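/- **Setting.** Write $\Delta=\tfrac14(\partial_{xx}+\partial_{yy})$ and $dA=\tfrac1\pi\,dx\,dy$. Let $Q(z)=q(|z|)$, $q:[0,\infty)\to\mathbb R$, be a lower semicontinuous radially symmetric function on $\mathbb C$ with $Q(z)-2\log|z|\to+\infty$ as $z\to\infty$. Let $\sigma$ be its equilibrium measure, i.e. the minimizer of $$I_Q[\mu]=\iint\log\frac1{|z-w|}\,d\mu(z)\,d\mu(w)+\int Q\,d\mu$$ over all compactly supported Borel probability measures on $\mathbb C$, and let $S=\operatorname{supp}\sigma$ (the droplet). Put $U^\sigma(z)=\int\log\frac1{|z-w|}\,d\sigma(w)$ and $\check Q=\gamma-2U^\sigma$, where $\gamma=\int(Q+2U^\sigma)\,d\sigma$ is Robin's constant. Assume that $Q$ is $C^2$-smooth in a neighbourhood of $S$, that $\Delta Q>0$ on $\partial S$, that $\check Q<Q$ on $\mathbb C\setminus S$, and that $$S=\bigcup_{j=0}^N\{a_j\le|z|\le b_j\},\qquad 0\le a_0<b_0<a_1<b_1<\cdots<a_N<b_N,\quad N\ge1.$$ Fix $k$ with $0\le k<N$, put $r_1=b_k$, $r_2=a_{k+1}$,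 $G=\{r_1<|z|<r_2\}$, and assume that $Q$ is $C^6$-smooth in a neighbourhood of $\partial G$. Let $\lambda(z)=\lambda(|z|)$ be a real-valued radially symmetric $C^6$-smooth function on $\mathbb C$ which vanishes in a neighbourhood of the closure of $(\mathbb C\setminus S)\setminus G$ (that is, near all other components of $\mathbb C\setminus S$), and let $s\in\mathbb R$. Put $\tilde Q_n=Q-\frac{s\lambda}n$ and let $$\tilde R_{n,s\lambda}(z)=\sum_{j=0}^{n-1}\frac{|\tilde p_j(z)|^2}{\|\tilde p_j\|^2_{L^2(\mathbb C,dA)}},\qquad \tilde p_j(z)=z^je^{-\frac n2\tilde Q_n(z)},$$ be the 1-point function in potential $\tilde Q_n$. Write $\Delta Q(r)$ for $\Delta Q$ on the circle $|z|=r$, and $\partial_r$ for the radial derivative. Let $\operatorname{erfc}t=\frac2{\sqrt\pi}\int_t^\infty e^{-u^2}\,du$, let $\theta(z;\tau)=\sum_{\ell\in\mathbb Z}e^{2\pi i\ell z+\pi i\ell^2\tau}$ be the Jacobi theta function, and let $(\log\theta)'=\theta'/\theta$, with the derivative taken in the first argument. **Theorem 1.10 ("$r_2$-case").** There are constants $A,B\in\mathbb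 R$ such that $\check Q(z)=A+B\log|z|$ for $r_1\le|z|\le r_2$. Fix $\alpha\in[0,2\pi)$. With this $B$ and $$z=e^{i\alpha}\Big(r_2+\frac t{\sqrt{2n\Delta Q(r_2)}}\Big),\qquad t\in\mathbb R,\ |t|\le\log n,$$ one has, as $n\to\infty$, uniformly in such $t$, $$\begin{aligned} \tilde R_{n,s\lambda}(z)={}&n\Delta Q(r_2)\frac{\operatorname{erfc}(-t)}2+\frac{\sqrt{n\Delta Q(r_2)}}{\sqrt{2\pi}\,r_2}e^{-t^2}\Bigg[-\frac s2\Big(r_2\lambda'(r_2)+\frac{\lambda(r_1)-\lambda(r_2)}{\log(r_2/r_1)}\Big)+\frac16(2-t^2)\\ &+r_2\frac{\partial_r\Delta Q(r_2)}{\Delta Q(r_2)}\Big(\frac12\sqrt\pi\,t\operatorname{erfc}(-t)e^{t^2}+\frac1{12}(2t^2+5)\Big)-\frac{\log\frac{\Delta Q(r_2)}{\Delta Q(r_1)}}{4\log(r_2/r_1)}\\ &-\frac1{2\log(r_2/r_1)}(\log\theta)'\Big(\frac B2n+\frac{\log\frac{\Delta Q(r_2)}{\Delta Q(r_1)}}{4\log(r_2/r_1)}+\frac{s(\lambda(r_1)-\lambda(r_2))}{2\log(r_2/r_1)};\frac{\pi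 i}{\log(r_2/r_1)}\Big)\Bigg]+\mathcal O(\log^4n). \end{aligned}$$ -/

import Mathlib

open MeasureTheory Filter Topology
open scoped ENNReal Real

noncomputable section

namespace CoulombGap

/-- The normalised area measure `dA = dx dy / π` on the complex plane. -/
def areaMeasure : Measure ℂ := ENNReal.ofReal π⁻¹ • volume

/-- The normalised Laplacian `ΔQ = ∂∂̄Q = (Q_xx + Q_yy) / 4`. -/
def lap (Q : ℂ → ℝ) (z : ℂ) : ℝ := (1 / 4) * Laplacian.laplacian Q z

/-- The radially symmetric function on the plane with profile `q`, i.e. `z ↦ q |z|`. -/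
def radial (q : ℝ → ℝ) (z : ℂ) : ℝ := q ‖z‖

/-- Positive part of the logarithmic kernel `log (1 / |z - w|)`, equal to `∞` on the diagonal. -/
def logKernelPos (z w : ℂ) : ℝ≥0∞ :=
  if z = w then ⊤ else ENNReal.ofReal (-Real.log ‖z - w‖)

/-- Negative part of the logarithmic kernel `log (1 / |z - w|)`, equal to `0` on the diagonal. -/
def logKernelNeg (z w : ℂ) : ℝ≥0∞ := ENNReal.ofReal (Real.log ‖z - w‖)

/-- Compactly supported Borel probability measures on the plane. -/
def IsCompactUnitMeasure (μ : Measure ℂ) : Prop :=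
  IsProbabilityMeasure μ ∧ ∃ K : Set ℂ, IsCompact K ∧ μ Kᶜ = 0

/-- The weighted logarithmic energy
`I_Q[μ] = ∬ log (1 / |z - w|) dμ(z) dμ(w) + ∫ Q dμ`, with values in `(-∞, ∞]`
(for compactly supported unit measures `μ` and lower semicontinuous `Q`,
the two subtracted terms are finite). -/
def energy (Q : ℂ → ℝ) (μ : Measure ℂ) : EReal :=
  (((∫⁻ z, ∫⁻ w, logKernelPos z w ∂μ ∂μ : ℝ≥0∞) : EReal)
      - ((∫⁻ z, ∫⁻ w, logKernelNeg z w ∂μ ∂μ : ℝ≥0∞) : EReal))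
    + (((∫⁻ z, ENNReal.ofReal (Q z) ∂μ : ℝ≥0∞) : EReal)
      - ((∫⁻ z, ENNReal.ofReal (-Q z) ∂μ : ℝ≥0∞) : EReal))

/-- `σ` minimises the weighted logarithmic energy among all compactly supported unit
Borel measures. The droplet of `Q` is `σ.support`. -/
def IsEquilibriumMeasure (Q : ℂ → ℝ) (σ : Measure ℂ) : Prop :=
  IsCompactUnitMeasure σ ∧ ∀ μ : Measure ℂ, IsCompactUnitMeasure μ → energy Q σ ≤ energy Q μ

/-- The logarithmic potential `U^μ(z) = ∫ log (1 / |z - w|) dμ(w)`. -/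
def logPotential (μ : Measure ℂ) (z : ℂ) : ℝ := ∫ w, -Real.log ‖z - w‖ ∂μ

/-- Robin's constant: the `σ`-average of `Q + 2 U^σ`, a function which is constant on the
support of the equilibrium measure `σ`. -/
def robinConstant (Q : ℂ → ℝ) (σ : Measure ℂ) : ℝ := ∫ z, (Q z + 2 * logPotential σ z) ∂σ

/-- The obstacle function `γ - 2 U^σ`, with `γ` Robin's constant. -/
def obstacle (Q : ℂ → ℝ) (σ : Measure ℂ) (z : ℂ) : ℝ :=
  robinConstant Q σ - 2 * logPotential σ z

/-- The weighted monomial `p_j(z) = z ^ j * exp (-n W(z) / 2)`. -/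
def weightedMonomial (W : ℂ → ℝ) (n j : ℕ) (z : ℂ) : ℂ :=
  z ^ j * (Real.exp (-(n * W z / 2)) : ℂ)

/-- The 1-point function `K_n(z, z) = ∑_{j < n} |p_j(z)|² / ‖p_j‖²` in a radially symmetric
potential `W`, where the norm is that of `L²(ℂ, dA)`: the `p_j` are then an orthogonal basis of
the space of weighted polynomials of degree less than `n`. -/
def onePoint (W : ℂ → ℝ) (n : ℕ) (z : ℂ) : ℝ :=
  ∑ j ∈ Finset.range n,
    ‖weightedMonomial W n j z‖ ^ 2 / ∫ w, ‖weightedMonomial W n j w‖ ^ 2 ∂areaMeasure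

/-- The perturbed potential `Q - s λ / n`. -/
def perturbed (Q lam : ℂ → ℝ) (s : ℝ) (n : ℕ) (z : ℂ) : ℝ := Q z - s * lam z / n

/-- The complementary error function. -/
def erfc (t : ℝ) : ℝ := 2 / √π * ∫ x in Set.Ioi t, Real.exp (-x ^ 2)

/-- The logarithmic derivative `(log θ)'(x; i T)` in the first variable of the Jacobi theta
function `θ(z; τ) = ∑_ℓ exp (2 π i ℓ z + π i ℓ² τ)`, at real `x` and `τ = i T`
(the quotient `θ' / θ` is then real). -/
def thetaLogDeriv (x T : ℝ) : ℝ :=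
  (logDeriv (fun z : ℂ => jacobiTheta₂ z (T * Complex.I)) (x : ℂ)).re

end CoulombGap

end

/-! The potential is radial, so in the coordinate `x = log |w|` every squared norm is a
one-dimensional integral. With `E x = q (exp x) - A - B x`, `μ x = s l (exp x)` and `m = j + 1 - n B
/ 2`, the `j`-th summand at `|z| = exp x₀` is the reciprocal of the integral of `exp (2m(x - x₀) -
n(E x - E x₀) + μ x - μ x₀)`, divided by `2 exp (2 x₀)` (`onePoint_eq_sum`).

Potential theory gives the shape of `E`. The circle average `-∫ log max(r, |w|) dσ` of the potential
is affine in `log r` across the gap, with slope minus the mass `B / 2` enclosed by the gap, and a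
minimum principle carries this over to the potential itself (`logPotential_gap`). Frostman's
inequality for circles then shows that `E` vanishes at `x₁ = log r₁` and `x₂ = log r₂` and is
positive elsewhere (`droplet_gap_structure`). Thus `E` has two nondegenerate wells of equal depth
(`exists_twoWell`).

For `x₀` near `x₂` the right well contributes a Gaussian integral with one cubic correction. It is
expanded about `x₀`, not about the saddle, so that the normalised displacement `X` is affine in `m`
with step `2 / √(n E''(x₀))`. Relative to the right well, the left well has weight `exp (-2L(m -
const))`, `L = x₂ - x₁`. Hence the reciprocal is a corrected Gaussian in `X` times a Fermi weight in
`m` (`TwoWell.term_estimate`). The Fermi weight switches on over boundedly many indices and the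
Gaussian varies over about `√n` of them, so the sum over `j` is a half-line integral plus a boundary
term, the Gaussian at the switch times the total deviation of the Fermi weight from a step
(`ExpDecay.lattice_sum`). Altogether the summation costs `O(1)` (`TwoWell.sum_asymptotics`).

This deviation is where theta enters. Logarithmic differentiation of the Jacobi triple product
identifies a sum of Fermi functions with the mean of a discrete Gaussian, and the modular
transformation of theta turns that mean into `(log θ)'` (`thetaLogDeriv_eq`).

Finally `x₀ = x₂ + log (1 + u)` with `u` of size `log n / √n`. Taylor expansion of the main term
loses `O(log⁴ n)` (`edgeO_main`), and `edge_main_identity` rewrites the outcome through `ΔQ = E'' /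
(4 r²)`. -/

/-! ### The finite Jacobi triple product -/

/-- The finite Euler product `∏_{i < n} (1 - q ^ (i + 1))`. -/
noncomputable def qPochhammer (q : ℝ) (n : ℕ) : ℝ := ∏ i ∈ Finset.range n, (1 - q ^ (i + 1))

lemma qPochhammer_pos {q : ℝ} (h0 : 0 < q) (h1 : q < 1) (n : ℕ) : 0 < qPochhammer q n :=
  Finset.prod_pos fun i _ => sub_pos.2 (pow_lt_one₀ h0.le h1 (by omega))

lemma qPochhammer_succ (q : ℝ) (n : ℕ) :
    qPochhammer q (n + 1) = qPochhammer q n * (1 - q ^ (n + 1)) :=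
  Finset.prod_range_succ _ _

lemma qPochhammer_antitone {q : ℝ} (h0 : 0 < q) (h1 : q < 1) : Antitone (qPochhammer q) := by
  refine antitone_nat_of_succ_le fun n => ?_
  rw [qPochhammer_succ]
  have := qPochhammer_pos h0 h1 n
  have h2 : 0 < q ^ (n + 1) := by positivity
  nlinarith

/-- The logarithms of the factors are summable because `∑ q ^ (i + 1)` converges, so the infinite
product is the exponential of a finite number, in particular positive. By monotonicity it bounds
every finite product from below, which later provides the domination for passing to the infinite
triple product. -/
lemma qPochhammer_tendsto {q : ℝ} (h0 : 0 < q) (h1 : q < 1) :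
    ∃ c > 0, Tendsto (qPochhammer q) atTop (𝓝 c) ∧ ∀ n, c ≤ qPochhammer q n := by
  have hs : Summable fun i : ℕ => q ^ (i + 1) :=
    (summable_nat_add_iff 1).2 (summable_geometric_of_lt_one h0.le h1)
  have hlog : Summable fun i : ℕ => Real.log (1 + -q ^ (i + 1)) :=
    Real.summable_log_one_add_of_summable hs.neg
  have hpos : ∀ i : ℕ, 0 < 1 - q ^ (i + 1) := fun i =>
    sub_pos.2 (pow_lt_one₀ h0.le h1 (by omega))
  have ht : Tendsto (qPochhammer q) atTop
      (𝓝 (Real.exp (∑' i : ℕ, Real.log (1 + -q ^ (i + 1))))) := by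
    have := (Real.continuous_exp.tendsto _).comp hlog.hasSum.tendsto_sum_nat
    refine this.congr fun n => ?_
    simp only [Function.comp, Real.exp_sum, qPochhammer]
    refine Finset.prod_congr rfl fun i _ => ?_
    rw [Real.exp_log (by simpa [sub_eq_add_neg] using hpos i), sub_eq_add_neg]
  exact ⟨_, Real.exp_pos _, ht, fun n => (qPochhammer_antitone h0 h1).le_of_tendsto ht n⟩

/-- The Gaussian binomial coefficient, as a quotient of finite Euler products. -/
noncomputable def gaussBinomial (q : ℝ) (N k : ℕ) : ℝ :=
  if k ≤ N then qPochhammer q N / (qPochhammer q k * qPochhammer q (N - k)) else 0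

lemma gaussBinomial_pascal {q : ℝ} (h0 : 0 < q) (h1 : q < 1) (N k : ℕ) (hk : k ≤ N) :
    gaussBinomial q (N + 1) (k + 1) =
      gaussBinomial q N (k + 1) + q ^ (N - k) * gaussBinomial q N k := by
  obtain ⟨d, rfl⟩ := Nat.exists_eq_add_of_le hk
  have hp := fun n => (qPochhammer_pos h0 h1 n).ne'
  have hq : ∀ n : ℕ, 1 - q ^ (n + 1) ≠ 0 := fun i =>
    (sub_pos.2 (pow_lt_one₀ h0.le h1 (by omega))).ne'
  rcases d with _ | d
  -- Here `k = N`, so the first coefficient on the right lies above the diagonal and takes the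
  -- default value 0.
  · simp only [gaussBinomial, add_zero, le_refl, if_true]
    have : qPochhammer q 0 = 1 := by simp [qPochhammer]
    simp [this, hp]
  · have e1 : k + (d + 1) + 1 - (k + 1) = d + 1 := by omega
    have e2 : k + (d + 1) - (k + 1) = d := by omega
    have e3 : k + (d + 1) - k = d + 1 := by omega
    simp only [gaussBinomial, e1, e2, e3, show k + 1 ≤ k + (d + 1) + 1 by omega,
      show k + 1 ≤ k + (d + 1) by omega, show k ≤ k + (d + 1) by omega, if_true]
    rw [qPochhammer_succ q (k + (d + 1)), qPochhammer_succ q k, qPochhammer_succ q d]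
    have := hp (k + (d + 1)); have := hp k; have := hp d; have := hq k; have := hq d
    field_simp
    ring

/-- The `q`-binomial theorem. -/
lemma prod_one_add_geometric {q : ℝ} (h0 : 0 < q) (h1 : q < 1) (x : ℝ) (N : ℕ) :
    ∏ k ∈ Finset.range N, (1 + q ^ k * x) =
      ∑ k ∈ Finset.range (N + 1), q ^ (k.choose 2) * gaussBinomial q N k * x ^ k := by
  induction N with
  | zero => simp [gaussBinomial, qPochhammer]
  | succ N ih =>
    rw [Finset.prod_range_succ, ih, Finset.sum_range_succ' _ (N + 1)]
    have hp := fun n => (qPochhammer_pos h0 h1 n).ne'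
    have hz : ∀ M, gaussBinomial q M 0 = 1 := fun M => by
      have := hp M
      simp [gaussBinomial, qPochhammer]
      simpa [qPochhammer] using div_self this
    have key : ∀ k ∈ Finset.range (N + 1),
        q ^ ((k + 1).choose 2) * gaussBinomial q (N + 1) (k + 1) * x ^ (k + 1) =
        q ^ ((k + 1).choose 2) * gaussBinomial q N (k + 1) * x ^ (k + 1) +
        (q ^ (k.choose 2) * gaussBinomial q N k * x ^ k) * (q ^ N * x) := by
      intro k hk
      have hk' : k ≤ N := Nat.lt_succ_iff.1 (Finset.mem_range.1 hk)
      rw [gaussBinomial_pascal h0 h1 N k hk']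
      have e : q ^ N = q ^ k * q ^ (N - k) := by rw [← pow_add]; congr 1; omega
      have e2 : (k + 1).choose 2 = k + k.choose 2 := by
        rw [Nat.choose_succ_succ' k 1, Nat.choose_one_right]
      rw [e, e2, pow_add]
      ring
    rw [Finset.sum_congr rfl key, Finset.sum_add_distrib, ← Finset.sum_mul]
    -- The zero default above the diagonal lets both sums of the recursion run over the same range.
    have hlast : gaussBinomial q N (N + 1) = 0 := by simp [gaussBinomial]
    have := Finset.sum_range_succ' (fun k => q ^ (k.choose 2) * gaussBinomial q N k * x ^ k)
      (N + 1)
    rw [Finset.sum_range_succ _ (N + 1)] at this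
    simp only [hlast, mul_zero, zero_mul, add_zero] at this
    rw [hz] at this ⊢
    linear_combination (1 : ℝ) * this

/-- Logarithmic derivative of the finite form of the Jacobi triple product. -/
lemma finite_triple_product_logDeriv {L : ℝ} (hL : 0 < L) (y : ℝ) (M : ℕ) :
    (∑ k ∈ Finset.range (2 * M), (1 / (1 + Real.exp (2 * L * ((k : ℝ) - M + 1 / 2 - y))))) *
      (∑ k ∈ Finset.range (2 * M + 1), gaussBinomial (Real.exp (-2 * L)) (2 * M) k *
        Real.exp (-L * ((k : ℝ) - M) ^ 2 + 2 * L * k * y)) =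
    ∑ k ∈ Finset.range (2 * M + 1), (k : ℝ) * (gaussBinomial (Real.exp (-2 * L)) (2 * M) k *
        Real.exp (-L * ((k : ℝ) - M) ^ 2 + 2 * L * k * y)) := by
  set q := Real.exp (-2 * L) with hq
  have h0 : 0 < q := Real.exp_pos _
  have h1 : q < 1 := by rw [hq, ← Real.exp_zero]; exact Real.exp_lt_exp.2 (by linarith)
  have hprod : ∀ y : ℝ, ∏ k ∈ Finset.range (2 * M),
      (1 + Real.exp (-2 * L * ((k : ℝ) - M + 1 / 2) + 2 * L * y)) =
      ∑ k ∈ Finset.range (2 * M + 1), Real.exp (L * (M : ℝ) ^ 2) * (gaussBinomial q (2 * M) k *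
        Real.exp (-L * ((k : ℝ) - M) ^ 2 + 2 * L * k * y)) := by
    intro y
    -- The choice `x = q ^ (1/2 - M) exp (2Ly)` places the factors at the half-integers between `-M`
    -- and `M`. Completing the square in the coefficients then brings out the constant `exp (L M²)`.
    have := prod_one_add_geometric h0 h1 (Real.exp (-2 * L * (1 / 2 - M) + 2 * L * y)) (2 * M)
    convert this using 1
    · refine Finset.prod_congr rfl fun k _ => ?_
      rw [hq, ← Real.exp_nat_mul, ← Real.exp_add]; ring_nf
    · refine Finset.sum_congr rfl fun k _ => ?_
      rw [hq, ← Real.exp_nat_mul, ← Real.exp_nat_mul, Nat.cast_choose_two, mul_left_comm,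
        mul_right_comm (Real.exp _), ← Real.exp_add, ← Real.exp_add, mul_comm]
      congr 2; ring
  have hd1 : HasDerivAt (fun y => ∏ k ∈ Finset.range (2 * M),
      (1 + Real.exp (-2 * L * ((k : ℝ) - M + 1 / 2) + 2 * L * y)))
      (2 * L * (∑ k ∈ Finset.range (2 * M),
        (1 / (1 + Real.exp (2 * L * ((k : ℝ) - M + 1 / 2 - y))))) *
        ∏ k ∈ Finset.range (2 * M),
          (1 + Real.exp (-2 * L * ((k : ℝ) - M + 1 / 2) + 2 * L * y))) y := by
    have := HasDerivAt.fun_finsetProd (u := Finset.range (2 * M)) (x := y)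
      (f := fun (k : ℕ) y => (1 + Real.exp (-2 * L * ((k : ℝ) - M + 1 / 2) + 2 * L * y)))
      (f' := fun k => Real.exp (-2 * L * ((k : ℝ) - M + 1 / 2) + 2 * L * y) * (2 * L))
      (fun k _ => by
        have := ((((hasDerivAt_id y).const_mul (2 * L)).const_add
          (-2 * L * ((k : ℝ) - M + 1 / 2))).exp).const_add 1
        simpa using this)
    refine this.congr_deriv ?_
    symm
    rw [Finset.mul_sum, Finset.sum_mul]
    refine Finset.sum_congr rfl fun k hk => ?_
    rw [← Finset.mul_prod_erase _ _ hk, smul_eq_mul]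
    have e : Real.exp (2 * L * ((k : ℝ) - M + 1 / 2 - y)) *
        Real.exp (-2 * L * ((k : ℝ) - M + 1 / 2) + 2 * L * y) = 1 := by
      rw [← Real.exp_add, ← Real.exp_zero]; congr 1; ring
    have p1 := Real.exp_pos (2 * L * ((k : ℝ) - M + 1 / 2 - y))
    have : 1 / (1 + Real.exp (2 * L * ((k : ℝ) - M + 1 / 2 - y))) *
        (1 + Real.exp (-2 * L * ((k : ℝ) - M + 1 / 2) + 2 * L * y)) =
        Real.exp (-2 * L * ((k : ℝ) - M + 1 / 2) + 2 * L * y) := by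
      generalize Real.exp (2 * L * ((k : ℝ) - M + 1 / 2 - y)) = u at e p1 ⊢
      generalize Real.exp (-2 * L * ((k : ℝ) - M + 1 / 2) + 2 * L * y) = v at e ⊢
      field_simp
      linear_combination -e
    linear_combination (2 * L * ∏ j ∈ (Finset.range (2 * M)).erase k,
      (1 + Real.exp (-2 * L * ((j : ℝ) - M + 1 / 2) + 2 * L * y))) * this
  have hd2 : HasDerivAt (fun y => ∑ k ∈ Finset.range (2 * M + 1), Real.exp (L * (M : ℝ) ^ 2) *
      (gaussBinomial q (2 * M) k * Real.exp (-L * ((k : ℝ) - M) ^ 2 + 2 * L * k * y)))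
      (∑ k ∈ Finset.range (2 * M + 1), Real.exp (L * (M : ℝ) ^ 2) *
      (gaussBinomial q (2 * M) k * (Real.exp (-L * ((k : ℝ) - M) ^ 2 + 2 * L * k * y) *
        (2 * L * k)))) y := by
    refine HasDerivAt.fun_sum fun k _ => ?_
    have := ((((hasDerivAt_id y).const_mul (2 * L * k)).const_add
          (-L * ((k : ℝ) - M) ^ 2)).exp).const_mul (gaussBinomial q (2 * M) k)
    have := this.const_mul (Real.exp (L * (M : ℝ) ^ 2))
    simpa using this
  -- The product and the sum are the same function of `y`, so their derivatives agree; rewriting the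
  -- product as the sum again leaves the common factor `2L exp (L M²)`.
  have hu := hd1.unique (by rw [funext hprod]; exact hd2)
  rw [hprod] at hu
  rw [← Finset.mul_sum, ← Finset.mul_sum] at hu
  have hE := Real.exp_pos (L * (M : ℝ) ^ 2)
  have : ∑ k ∈ Finset.range (2 * M + 1), gaussBinomial q (2 * M) k *
      (Real.exp (-L * ((k : ℝ) - M) ^ 2 + 2 * L * k * y) * (2 * L * k)) =
      2 * L * ∑ k ∈ Finset.range (2 * M + 1), (k : ℝ) * (gaussBinomial q (2 * M) k *
        Real.exp (-L * ((k : ℝ) - M) ^ 2 + 2 * L * k * y)) := by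
    rw [Finset.mul_sum]; refine Finset.sum_congr rfl fun k _ => ?_; ring
  rw [this] at hu
  have h2 : 2 * L * Real.exp (L * (M : ℝ) ^ 2) ≠ 0 := by positivity
  apply mul_left_cancel₀ h2
  linear_combination hu

/-! ### Sums of Fermi functions and the theta function -/

/-- The Fermi function minus the step `1 ≤ k`, on the half-integer lattice shifted by `y`. -/
noncomputable def fermiStep (L y : ℝ) (k : ℤ) : ℝ :=
  1 / (1 + Real.exp (-2 * L * ((k : ℝ) - 1 / 2 - y))) - if 1 ≤ k then 1 else 0

lemma summable_exp_neg_abs_int {a : ℝ} (ha : 0 < a) :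
    Summable fun k : ℤ => Real.exp (-a * |(k : ℝ)|) := by
  have h : Summable fun n : ℕ => Real.exp (-a * (n : ℝ)) := by
    have := summable_geometric_of_lt_one (Real.exp_pos (-a)).le
      (by rw [← Real.exp_zero]; exact Real.exp_lt_exp.2 (by linarith))
    refine this.congr fun n => ?_
    rw [← Real.exp_nat_mul]; congr 1; ring
  refine Summable.of_nat_of_neg ?_ ?_ <;> simpa using h

/-- The Fermi function approaches its limits 0 and 1 at the rate `exp (-2L|k|)`, so what remains
after subtracting the step is absolutely summable. -/
lemma abs_fermiStep_le {L : ℝ} (hL : 0 < L) (y : ℝ) (k : ℤ) :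
    |fermiStep L y k| ≤ Real.exp (2 * L * (1 / 2 + |y|)) * Real.exp (-(2 * L) * |(k : ℝ)|) := by
  have hy1 := le_abs_self y
  have hy2 := neg_abs_le y
  rw [← Real.exp_add]
  unfold fermiStep
  set u := Real.exp (-2 * L * ((k : ℝ) - 1 / 2 - y)) with hu
  have hu0 : 0 < u := Real.exp_pos _
  split_ifs with h
  · have hk : (1 : ℝ) ≤ k := by exact_mod_cast h
    have e : 1 / (1 + u) - 1 = -(u / (1 + u)) := by field_simp; ring
    rw [e, abs_neg, abs_of_pos (by positivity)]
    calc u / (1 + u) ≤ u := div_le_self hu0.le (by linarith)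
      _ ≤ _ := by
        rw [hu, abs_of_pos (show (0 : ℝ) < k by linarith)]
        exact Real.exp_le_exp.2 (by nlinarith)
  · have hk : (k : ℝ) ≤ 0 := by exact_mod_cast (by omega : k ≤ 0)
    rw [sub_zero, abs_of_pos (by positivity)]
    calc 1 / (1 + u) ≤ 1 / u := one_div_le_one_div_of_le hu0 (by linarith)
      _ = Real.exp (2 * L * ((k : ℝ) - 1 / 2 - y)) := by
        rw [hu, one_div, ← Real.exp_neg]; congr 1; ring
      _ ≤ _ := by
        rw [abs_of_nonpos hk]
        exact Real.exp_le_exp.2 (by nlinarith)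

lemma summable_fermiStep {L : ℝ} (hL : 0 < L) (y : ℝ) : Summable (fermiStep L y) :=
  .of_norm_bounded ((summable_exp_neg_abs_int (a := 2 * L) (by positivity)).mul_left _)
    (abs_fermiStep_le hL y)

/-- The shift `k ↦ k - M + 1` moves the sum to `-M < k ≤ M`, and `1 / (1 + exp u) = 1 - 1 / (1 + exp
(-u))` reverses the Fermi function. The term `M` counts the indices with `k ≤ 0`. -/
lemma fermiStep_sum_range {L : ℝ} (y : ℝ) (M : ℕ) :
    ∑ k ∈ Finset.range (2 * M), (1 / (1 + Real.exp (2 * L * ((k : ℝ) - M + 1 / 2 - y)))) =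
      M - ∑ k ∈ Finset.Ioc (-(M : ℤ)) M, fermiStep L y k := by
  have e1 : ∑ k ∈ Finset.range (2 * M), (1 / (1 + Real.exp (2 * L * ((k : ℝ) - M + 1 / 2 - y)))) =
      ∑ k ∈ Finset.Ioc (-(M : ℤ)) M, (1 / (1 + Real.exp (2 * L * ((k : ℝ) - 1 / 2 - y)))) := by
    refine Finset.sum_nbij' (fun k => (k : ℤ) - M + 1) (fun k => (k + M - 1).toNat) ?_ ?_ ?_ ?_ ?_
    · intro k hk; simp at hk ⊢; omega
    · intro k hk; simp at hk ⊢; omega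
    · intro k hk; simp at hk ⊢; omega
    · intro k hk; simp at hk ⊢; omega
    · intro k hk; push_cast; ring_nf
  have e2 : ∀ k : ℤ, 1 / (1 + Real.exp (2 * L * ((k : ℝ) - 1 / 2 - y))) =
      (if k ≤ 0 then 1 else 0) - fermiStep L y k := by
    intro k
    have : Real.exp (2 * L * ((k : ℝ) - 1 / 2 - y)) *
        Real.exp (-2 * L * ((k : ℝ) - 1 / 2 - y)) = 1 := by
      rw [← Real.exp_add, ← Real.exp_zero]; congr 1; ring
    have p1 := Real.exp_pos (2 * L * ((k : ℝ) - 1 / 2 - y))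
    have p2 := Real.exp_pos (-2 * L * ((k : ℝ) - 1 / 2 - y))
    unfold fermiStep
    generalize Real.exp (2 * L * ((k : ℝ) - 1 / 2 - y)) = u at *
    generalize Real.exp (-2 * L * ((k : ℝ) - 1 / 2 - y)) = v at *
    have : 1 / (1 + u) = 1 - 1 / (1 + v) := by
      field_simp; linear_combination -this
    rw [this]
    by_cases h : 1 ≤ k
    · simp [h, show ¬ k ≤ 0 by omega]
    · simp [h, show k ≤ 0 by omega]
  rw [e1, Finset.sum_congr rfl fun k _ => e2 k, Finset.sum_sub_distrib]
  congr 1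
  rw [← Finset.sum_filter]
  have : (Finset.Ioc (-(M : ℤ)) M).filter (fun k => k ≤ 0) = Finset.Ioc (-(M : ℤ)) 0 := by
    ext k; simp; omega
  rw [this]; simp

/-- The coefficient of `w ^ j` in the finite triple product, extended by zero. -/
noncomputable def tripleCoeff (q : ℝ) (M : ℕ) (j : ℤ) : ℝ :=
  if j ∈ Finset.Icc (-(M : ℤ)) M then gaussBinomial q (2 * M) (j + M).toNat else 0

/-- For fixed `j` all three Euler products tend to the same `c`, so the coefficient tends to `c / (c
* c)`, independently of `j`. The uniform bound holds because each product lies between `c` and 1. -/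
lemma tripleCoeff_tendsto {q : ℝ} (h0 : 0 < q) (h1 : q < 1) :
    ∃ c > 0, (∀ j, Tendsto (fun M => tripleCoeff q M j) atTop (𝓝 c⁻¹)) ∧
      ∀ M j, |tripleCoeff q M j| ≤ (c ^ 2)⁻¹ := by
  obtain ⟨c, hc, ht, hle⟩ := qPochhammer_tendsto h0 h1
  have h1' : ∀ n, qPochhammer q n ≤ 1 := fun n =>
    (qPochhammer_antitone h0 h1 (Nat.zero_le n)).trans (by simp [qPochhammer])
  refine ⟨c, hc, fun j => ?_, fun M j => ?_⟩
  · have a1 : Tendsto (fun M : ℕ => 2 * M) atTop atTop :=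
      tendsto_atTop_mono (fun n => show n ≤ 2 * n by omega) tendsto_id
    have a2 : Tendsto (fun M : ℕ => (j + M).toNat) atTop atTop :=
      tendsto_atTop_atTop.2 fun b => ⟨b + j.natAbs, fun a ha => by omega⟩
    have a3 : Tendsto (fun M : ℕ => 2 * M - (j + M).toNat) atTop atTop :=
      tendsto_atTop_atTop.2 fun b => ⟨b + j.natAbs, fun a ha => by omega⟩
    have := (ht.comp a1).div ((ht.comp a2).mul (ht.comp a3)) (by positivity)
    have e : c / (c * c) = c⁻¹ := by field_simp
    rw [e] at this
    refine this.congr' ?_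
    filter_upwards [eventually_ge_atTop j.natAbs] with M hM
    have hj : j ∈ Finset.Icc (-(M : ℤ)) M := by simp; omega
    simp only [tripleCoeff, hj, if_true, gaussBinomial, show (j + M).toNat ≤ 2 * M by
      simp at hj; omega, Function.comp, Pi.div_apply]
  · unfold tripleCoeff gaussBinomial
    have hp := fun n => (qPochhammer_pos h0 h1 n)
    split_ifs
    · have q1 := hp (2 * M); have q2 := hp (j + M).toNat; have q3 := hp (2 * M - (j + M).toNat)
      rw [abs_of_pos (by positivity), inv_eq_one_div, sq]
      exact div_le_div₀ zero_le_one (h1' _) (by positivity)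
        (mul_le_mul (hle _) (hle _) hc.le (by positivity))
    · simp; positivity
    · simp; positivity

lemma sum_tripleCoeff (q : ℝ) (M : ℕ) (f : ℤ → ℝ) :
    ∑ k ∈ Finset.range (2 * M + 1), gaussBinomial q (2 * M) k * f ((k : ℤ) - M) =
      ∑' j : ℤ, tripleCoeff q M j * f j := by
  rw [tsum_eq_sum (s := Finset.Icc (-(M : ℤ)) M)
    (fun j hj => by simp only [tripleCoeff, hj, if_false, zero_mul])]
  refine Finset.sum_nbij' (fun k => (k : ℤ) - M) (fun k => (k + M).toNat) ?_ ?_ ?_ ?_ ?_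
  · intro k hk; simp at hk ⊢; omega
  · intro k hk; simp at hk ⊢; omega
  · intro k hk; simp at hk ⊢
  · intro k hk; simp at hk ⊢; omega
  · intro k hk
    have : (k : ℤ) - M ∈ Finset.Icc (-(M : ℤ)) M := by simp at hk ⊢; omega
    simp only [tripleCoeff, this, if_true]
    congr 2; omega

lemma tsum_tripleCoeff_tendsto {q c : ℝ}
    (ht : ∀ j, Tendsto (fun M => tripleCoeff q M j) atTop (𝓝 c⁻¹))
    (hb : ∀ M j, |tripleCoeff q M j| ≤ (c ^ 2)⁻¹) {f : ℤ → ℝ} (hf : Summable f) :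
    Tendsto (fun M => ∑' j : ℤ, tripleCoeff q M j * f j) atTop (𝓝 (c⁻¹ * ∑' j, f j)) := by
  rw [← tsum_mul_left]
  refine tendsto_tsum_of_dominated_convergence (bound := fun j => (c ^ 2)⁻¹ * |f j|)
    (hf.abs.mul_left _) (fun j => (ht j).mul_const _) (Eventually.of_forall fun M j => ?_)
  rw [Real.norm_eq_abs, abs_mul]
  exact mul_le_mul_of_nonneg_right (hb M j) (abs_nonneg _)

/-- Logarithmic derivative of the Jacobi triple product: the first moment of the discrete
Gaussian weights `exp (-L j² + 2 L j y)` as a sum of Fermi functions. -/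
theorem tsum_discrete_gaussian_moment {L : ℝ} (hL : 0 < L) (y : ℝ)
    (hs0 : Summable fun j : ℤ => Real.exp (-L * (j : ℝ) ^ 2 + 2 * L * j * y))
    (hs1 : Summable fun j : ℤ => (j : ℝ) * Real.exp (-L * (j : ℝ) ^ 2 + 2 * L * j * y)) :
    ∑' j : ℤ, (j : ℝ) * Real.exp (-L * (j : ℝ) ^ 2 + 2 * L * j * y) =
      -(∑' k, fermiStep L y k) * ∑' j : ℤ, Real.exp (-L * (j : ℝ) ^ 2 + 2 * L * j * y) := by
  set q := Real.exp (-2 * L) with hq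
  have h0 : 0 < q := Real.exp_pos _
  have h1 : q < 1 := by rw [hq, ← Real.exp_zero]; exact Real.exp_lt_exp.2 (by linarith)
  obtain ⟨c, hc, ht, hb⟩ := tripleCoeff_tendsto h0 h1
  -- The finite identity, recentred at `j = k - M`. The recentring adds `M` times the zeroth moment,
  -- and this cancels the `M` of `fermiStep_sum_range`.
  have key : ∀ M : ℕ, -(∑ k ∈ Finset.Ioc (-(M : ℤ)) M, fermiStep L y k) *
      (∑' j : ℤ, tripleCoeff q M j * Real.exp (-L * (j : ℝ) ^ 2 + 2 * L * j * y)) =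
      ∑' j : ℤ, tripleCoeff q M j * ((j : ℝ) * Real.exp (-L * (j : ℝ) ^ 2 + 2 * L * j * y)) := by
    intro M
    have h := finite_triple_product_logDeriv hL y M
    rw [fermiStep_sum_range, ← hq] at h
    rw [← sum_tripleCoeff q M (fun j => Real.exp (-L * (j : ℝ) ^ 2 + 2 * L * j * y)),
      ← sum_tripleCoeff q M (fun j => (j : ℝ) * Real.exp (-L * (j : ℝ) ^ 2 + 2 * L * j * y))]
    have e : ∀ k : ℕ, Real.exp (-L * ((k : ℝ) - M) ^ 2 + 2 * L * k * y) =
        Real.exp (2 * L * M * y) * Real.exp (-L * (((k : ℤ) - M : ℤ) : ℝ) ^ 2 +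
          2 * L * (((k : ℤ) - M : ℤ) : ℝ) * y) := by
      intro k; rw [← Real.exp_add]; congr 1; push_cast; ring
    have hE := (Real.exp_pos (2 * L * M * y)).ne'
    apply mul_left_cancel₀ hE
    have e1 : ∑ k ∈ Finset.range (2 * M + 1), gaussBinomial q (2 * M) k *
        Real.exp (-L * ((k : ℝ) - M) ^ 2 + 2 * L * k * y) = Real.exp (2 * L * M * y) *
        ∑ k ∈ Finset.range (2 * M + 1), gaussBinomial q (2 * M) k *
        Real.exp (-L * (((k : ℤ) - M : ℤ) : ℝ) ^ 2 + 2 * L * (((k : ℤ) - M : ℤ) : ℝ) * y) := by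
      rw [Finset.mul_sum]; refine Finset.sum_congr rfl fun k _ => ?_; rw [e]; ring
    have e2 : ∑ k ∈ Finset.range (2 * M + 1), (k : ℝ) * (gaussBinomial q (2 * M) k *
        Real.exp (-L * ((k : ℝ) - M) ^ 2 + 2 * L * k * y)) = Real.exp (2 * L * M * y) *
        (∑ k ∈ Finset.range (2 * M + 1), gaussBinomial q (2 * M) k * ((((k : ℤ) - M : ℤ) : ℝ) *
        Real.exp (-L * (((k : ℤ) - M : ℤ) : ℝ) ^ 2 + 2 * L * (((k : ℤ) - M : ℤ) : ℝ) * y))) +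
        M * (Real.exp (2 * L * M * y) *
        ∑ k ∈ Finset.range (2 * M + 1), gaussBinomial q (2 * M) k *
        Real.exp (-L * (((k : ℤ) - M : ℤ) : ℝ) ^ 2 + 2 * L * (((k : ℤ) - M : ℤ) : ℝ) * y)) := by
      rw [Finset.mul_sum, Finset.mul_sum, Finset.mul_sum, ← Finset.sum_add_distrib]
      refine Finset.sum_congr rfl fun k _ => ?_; rw [e]; push_cast; ring
    rw [e1, e2] at h
    linear_combination h
  have l1 : Tendsto (fun M : ℕ => ∑ k ∈ Finset.Ioc (-(M : ℤ)) M, fermiStep L y k) atTop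
      (𝓝 (∑' k, fermiStep L y k)) := by
    refine (summable_fermiStep hL y).hasSum.comp ?_
    refine tendsto_atTop_finset_of_monotone (fun a b hab => ?_) fun x => ⟨x.natAbs + 1, ?_⟩
    · exact Finset.Ioc_subset_Ioc (by omega) (by omega)
    · rw [Finset.mem_Ioc]; omega
  have l2 := (l1.neg.mul (tsum_tripleCoeff_tendsto ht hb hs0))
  have l3 := tsum_tripleCoeff_tendsto ht hb hs1
  -- Both sides of the finite identity converge, and the limits share the nonzero factor `c⁻¹`.
  have := tendsto_nhds_unique (l2.congr key) l3
  have hc' : c⁻¹ ≠ 0 := by positivity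
  apply mul_left_cancel₀ hc'
  linear_combination -this

/-- The functional equation replaces `τ = iπ/L` by `-1/τ = iL/π`, where at the point `y/τ` the theta
series has the real positive terms `exp (-L j² + 2L j y)`. The factor `exp (-πi y²/τ) = exp (-L y²)`
contributes `-2Ly`, and the first moment of the discrete Gaussian contributes the Fermi sum. -/
theorem thetaLogDeriv_eq {L : ℝ} (hL : 0 < L) (y : ℝ) :
    CoulombGap.thetaLogDeriv y (π / L) = -2 * L * (y + ∑' k, fermiStep L y k) := by
  have hL' : (L : ℂ) ≠ 0 := by exact_mod_cast hL.ne'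
  have hpi : (π : ℂ) ≠ 0 := by exact_mod_cast Real.pi_ne_zero
  set τ : ℂ := ((π / L : ℝ) : ℂ) * Complex.I with hτ
  have hτim : 0 < τ.im := by simp [hτ]; positivity
  have hτ' : -1 / τ = ((L / π : ℝ) : ℂ) * Complex.I := by
    rw [hτ]; push_cast; field_simp; rw [Complex.I_sq]
  have hz' : (y : ℂ) / τ = -((y * L / π : ℝ) : ℂ) * Complex.I := by
    rw [hτ]; push_cast; field_simp; rw [Complex.I_sq]; ring
  have him : 0 < (-1 / τ).im := by rw [hτ']; simp; positivity
  have hterm : ∀ j : ℤ, jacobiTheta₂_term j (y / τ) (-1 / τ) =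
      ((Real.exp (-L * (j : ℝ) ^ 2 + 2 * L * j * y) : ℝ) : ℂ) := by
    intro j
    rw [jacobiTheta₂_term, hz', hτ']
    push_cast
    congr 1
    field_simp
    linear_combination (-2 * y * (j : ℂ) + (j : ℂ) ^ 2) * Complex.I_sq
  have s0 := hasSum_jacobiTheta₂_term (y / τ) him
  have s1 := hasSum_jacobiTheta₂'_term (y / τ) him
  simp only [jacobiTheta₂'_term] at s1
  simp only [hterm] at s0 s1
  have hs0 : Summable fun j : ℤ => Real.exp (-L * (j : ℝ) ^ 2 + 2 * L * j * y) :=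
    Complex.summable_ofReal.1 s0.summable
  have h2 : (2 * π * Complex.I : ℂ) ≠ 0 := by simp [hpi]
  have s1' : HasSum (fun j : ℤ => (((j : ℝ) *
      Real.exp (-L * (j : ℝ) ^ 2 + 2 * L * j * y) : ℝ) : ℂ))
      ((2 * π * Complex.I)⁻¹ * jacobiTheta₂' (y / τ) (-1 / τ)) := by
    refine (s1.mul_left (2 * π * Complex.I : ℂ)⁻¹).congr_fun ?_
    intro j; push_cast; field_simp
  have hs1 : Summable fun j : ℤ => (j : ℝ) * Real.exp (-L * (j : ℝ) ^ 2 + 2 * L * j * y) :=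
    Complex.summable_ofReal.1 s1'.summable
  have key := tsum_discrete_gaussian_moment hL y hs0 hs1
  set S0 := ∑' j : ℤ, Real.exp (-L * (j : ℝ) ^ 2 + 2 * L * j * y) with hS0
  have hS0pos : 0 < S0 := hs0.tsum_pos (fun j => (Real.exp_pos _).le) 0 (Real.exp_pos _)
  have t0 : jacobiTheta₂ (y / τ) (-1 / τ) = (S0 : ℂ) := by
    rw [← s0.tsum_eq, hS0, Complex.ofReal_tsum]
  have t1 : jacobiTheta₂' (y / τ) (-1 / τ) =
      2 * π * Complex.I * ((-(∑' k, fermiStep L y k) * S0 : ℝ) : ℂ) := by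
    rw [← key, Complex.ofReal_tsum, s1'.tsum_eq]; field_simp
  have hτ0 : τ ≠ 0 := fun h => by simp [h] at hτim
  have hA : 1 / (-Complex.I * τ) ^ (1 / 2 : ℂ) ≠ 0 := by
    refine one_div_ne_zero ?_
    rw [Ne, Complex.cpow_eq_zero_iff]
    push Not
    intro h; simp [hτ0] at h
  unfold CoulombGap.thetaLogDeriv
  rw [logDeriv_apply, (hasDerivAt_jacobiTheta₂_fst (y : ℂ) hτim).deriv,
    jacobiTheta₂'_functional_equation, jacobiTheta₂_functional_equation (y : ℂ) τ, t0, t1]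
  have hE := Complex.exp_ne_zero (-π * Complex.I * (y : ℂ) ^ 2 / τ)
  have hS0c : (S0 : ℂ) ≠ 0 := by exact_mod_cast hS0pos.ne'
  generalize Complex.exp (-π * Complex.I * (y : ℂ) ^ 2 / τ) = e at hE ⊢
  generalize 1 / (-Complex.I * τ) ^ (1 / 2 : ℂ) = a at hA ⊢
  have : a * e / τ * (2 * π * Complex.I * ((-(∑' k, fermiStep L y k) * S0 : ℝ) : ℂ) -
      2 * π * Complex.I * y * S0) / (a * e * S0) =
      ((-2 * L * (y + ∑' k, fermiStep L y k) : ℝ) : ℂ) := by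
    push_cast
    rw [hτ]
    push_cast
    field_simp
    ring
  rw [this, Complex.ofReal_re]

/-! ### Circle measures and mutual logarithmic energies -/

/-- Normalised arclength on the circle with centre `p` and radius `ε`. -/
noncomputable def circleMeasure (p : ℂ) (ε : ℝ) : Measure ℂ :=
  Measure.map (circleMap p ε)
    (ENNReal.ofReal (2 * π)⁻¹ • (volume.restrict (Set.Ioc 0 (2 * π))))

instance isProbabilityMeasure_circleMeasure (p : ℂ) (ε : ℝ) :
    IsProbabilityMeasure (circleMeasure p ε) := by
  constructor
  rw [circleMeasure, Measure.map_apply (continuous_circleMap p ε).measurable MeasurableSet.univ]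
  simp only [Set.preimage_univ, Measure.smul_apply, Measure.restrict_apply_univ,
    Real.volume_Ioc, sub_zero, smul_eq_mul]
  rw [← ENNReal.ofReal_mul (by positivity), inv_mul_cancel₀ (by positivity), ENNReal.ofReal_one]

lemma integral_circleMeasure {f : ℂ → ℝ} (hf : Measurable f) (p : ℂ) (ε : ℝ) :
    ∫ z, f z ∂circleMeasure p ε = Real.circleAverage f p ε := by
  rw [circleMeasure, integral_map (continuous_circleMap p ε).measurable.aemeasurable
    hf.aestronglyMeasurable, integral_smul_measure, Real.circleAverage_def,
    intervalIntegral.integral_of_le (by positivity), ENNReal.toReal_ofReal (by positivity)]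

lemma integrable_circleMeasure {f : ℂ → ℝ} (hf : Measurable f) {p : ℂ} {ε : ℝ}
    (hi : CircleIntegrable f p ε) : Integrable f (circleMeasure p ε) := by
  rw [circleMeasure, integrable_map_measure hf.aestronglyMeasurable
    (continuous_circleMap p ε).measurable.aemeasurable]
  refine Integrable.smul_measure ?_ ENNReal.ofReal_ne_top
  exact (intervalIntegrable_iff_integrableOn_Ioc_of_le (by positivity)).1 hi

lemma ae_circleMeasure_mem_sphere (p : ℂ) {ε : ℝ} (hε : 0 ≤ ε) :
    ∀ᵐ w ∂circleMeasure p ε, w ∈ Metric.sphere p ε := by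
  rw [circleMeasure, ae_map_iff (p := (· ∈ Metric.sphere p ε))
    (continuous_circleMap p ε).measurable.aemeasurable Metric.isClosed_sphere.measurableSet]
  exact Eventually.of_forall fun θ => circleMap_mem_sphere p hε θ

/-- The positive kernel is infinite on the diagonal, so circles must be known to carry no atoms. On
a half-open period `circleMap` meets each point at most once. -/
lemma ae_circleMeasure_ne (p : ℂ) {ε : ℝ} (hε : 0 < ε) (z : ℂ) :
    ∀ᵐ w ∂circleMeasure p ε, z ≠ w := by
  rw [circleMeasure, ae_map_iff (continuous_circleMap p ε).measurable.aemeasurable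
    (by simpa only [Set.compl_def, Set.mem_singleton_iff, eq_comm] using
      (measurableSet_singleton z).compl)]
  refine Measure.ae_smul_measure ?_ _
  rw [← Measure.restrict_congr_set Ico_ae_eq_Ioc, ae_restrict_iff' measurableSet_Ico, ae_iff]
  have : {a | ¬(a ∈ Set.Ico 0 (2 * π) → z ≠ circleMap p ε a)} =
      Set.Ico 0 (2 * π) ∩ circleMap p ε ⁻¹' {z} := by
    ext a; simp [eq_comm, and_assoc]
  rw [this]
  refine Set.Subsingleton.measure_zero (fun a ha b hb => ?_) _
  refine injOn_circleMap_of_abs_sub_le' (c := p) hε.ne' (by simp) ha.1 hb.1 ?_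
  rw [ha.2, hb.2]

lemma isCompactUnitMeasure_circleMeasure (p : ℂ) {ε : ℝ} (hε : 0 ≤ ε) :
    CoulombGap.IsCompactUnitMeasure (circleMeasure p ε) :=
  ⟨inferInstance, Metric.sphere p ε, isCompact_sphere p ε, by
    simpa [ae_iff, Set.compl_def] using ae_circleMeasure_mem_sphere p hε⟩

lemma measurable_logKernel : Measurable fun x : ℂ × ℂ => -Real.log ‖x.1 - x.2‖ := by
  fun_prop

lemma measurable_logKernelPos :
    Measurable fun x : ℂ × ℂ => CoulombGap.logKernelPos x.1 x.2 := by
  unfold CoulombGap.logKernelPos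
  refine Measurable.ite (measurableSet_eq_fun measurable_fst measurable_snd) measurable_const ?_
  fun_prop

lemma measurable_logKernelNeg :
    Measurable fun x : ℂ × ℂ => CoulombGap.logKernelNeg x.1 x.2 := by
  unfold CoulombGap.logKernelNeg
  fun_prop

/-- Mutual energy of the positive part of the logarithmic kernel. -/
noncomputable def mutualPos (μ ν : Measure ℂ) : ℝ≥0∞ :=
  ∫⁻ z, ∫⁻ w, CoulombGap.logKernelPos z w ∂ν ∂μ

/-- Mutual energy of the negative part of the logarithmic kernel. -/
noncomputable def mutualNeg (μ ν : Measure ℂ) : ℝ≥0∞ :=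
  ∫⁻ z, ∫⁻ w, CoulombGap.logKernelNeg z w ∂ν ∂μ

lemma mutualPos_comm (μ ν : Measure ℂ) [SFinite μ] [SFinite ν] :
    mutualPos μ ν = mutualPos ν μ := by
  unfold mutualPos
  rw [lintegral_lintegral_swap measurable_logKernelPos.aemeasurable]
  simp only [CoulombGap.logKernelPos, eq_comm, norm_sub_rev]

lemma mutualNeg_comm (μ ν : Measure ℂ) [SFinite μ] [SFinite ν] :
    mutualNeg μ ν = mutualNeg ν μ := by
  unfold mutualNeg
  rw [lintegral_lintegral_swap measurable_logKernelNeg.aemeasurable]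
  simp only [CoulombGap.logKernelNeg, norm_sub_rev]

/-- The positive kernel is infinite on the diagonal, so finite mutual energy leaves no mass there.
-/
lemma lintegral_diag_null {μ ν : Measure ℂ} [SFinite μ] [SFinite ν] (hp : mutualPos μ ν ≠ ⊤) :
    ∀ᵐ x ∂μ.prod ν, x.1 ≠ x.2 := by
  have h : ∫⁻ x, CoulombGap.logKernelPos x.1 x.2 ∂μ.prod ν ≠ ⊤ := by
    rwa [lintegral_prod _ measurable_logKernelPos.aemeasurable]
  filter_upwards [ae_lt_top measurable_logKernelPos h] with x hx hne
  simp [CoulombGap.logKernelPos, hne] at hx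

/-- The real kernel takes the junk value 0 on the diagonal, where the extended one is infinite. The
two agree almost everywhere because finite energy makes the diagonal null. -/
lemma integrable_logKernel {μ ν : Measure ℂ} [SFinite μ] [SFinite ν] (hp : mutualPos μ ν ≠ ⊤)
    (hn : mutualNeg μ ν ≠ ⊤) :
    Integrable (fun x : ℂ × ℂ => -Real.log ‖x.1 - x.2‖) (μ.prod ν) ∧
    (mutualPos μ ν).toReal - (mutualNeg μ ν).toReal =
      ∫ x, -Real.log ‖x.1 - x.2‖ ∂μ.prod ν := by
  have hd := lintegral_diag_null hp
  have e1 : mutualPos μ ν = ∫⁻ x, ENNReal.ofReal (-Real.log ‖x.1 - x.2‖) ∂μ.prod ν := by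
    rw [mutualPos, ← lintegral_prod (fun x => CoulombGap.logKernelPos x.1 x.2)
      measurable_logKernelPos.aemeasurable]
    refine lintegral_congr_ae ?_
    filter_upwards [hd] with x hx
    simp [CoulombGap.logKernelPos, hx]
  have e2 : mutualNeg μ ν = ∫⁻ x, ENNReal.ofReal (- -Real.log ‖x.1 - x.2‖) ∂μ.prod ν := by
    rw [mutualNeg, ← lintegral_prod (fun x => CoulombGap.logKernelNeg x.1 x.2)
      measurable_logKernelNeg.aemeasurable]
    simp [CoulombGap.logKernelNeg]
  have hi : Integrable (fun x : ℂ × ℂ => -Real.log ‖x.1 - x.2‖) (μ.prod ν) := by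
    refine ⟨measurable_logKernel.aestronglyMeasurable, ?_⟩
    rw [hasFiniteIntegral_iff_norm]
    calc ∫⁻ x, ENNReal.ofReal ‖-Real.log ‖x.1 - x.2‖‖ ∂μ.prod ν
        ≤ ∫⁻ x, (ENNReal.ofReal (-Real.log ‖x.1 - x.2‖) +
          ENNReal.ofReal (- -Real.log ‖x.1 - x.2‖)) ∂μ.prod ν := by
          refine lintegral_mono fun x => ?_
          rw [Real.norm_eq_abs]
          rcases abs_cases (-Real.log ‖x.1 - x.2‖) with h | h
          · rw [h.1]; exact le_self_add
          · rw [h.1]; exact le_add_self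
      _ = mutualPos μ ν + mutualNeg μ ν := by
          rw [lintegral_add_left (measurable_logKernel.ennreal_ofReal), e1, e2]
      _ < ⊤ := ENNReal.add_lt_top.2 ⟨hp.lt_top, hn.lt_top⟩
  exact ⟨hi, by rw [integral_eq_lintegral_pos_part_sub_lintegral_neg_part hi, e1, e2]⟩

lemma mutualNeg_ne_top {μ ν : Measure ℂ} (hμ : CoulombGap.IsCompactUnitMeasure μ)
    (hν : CoulombGap.IsCompactUnitMeasure ν) : mutualNeg μ ν ≠ ⊤ := by
  obtain ⟨hμ1, K, hK, hμK⟩ := hμ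
  obtain ⟨hν1, K', hK', hνK⟩ := hν
  obtain ⟨R, hR⟩ := hK.isBounded.exists_norm_le
  obtain ⟨R', hR'⟩ := hK'.isBounded.exists_norm_le
  have h1 : ∀ᵐ z ∂μ, z ∈ K := by rw [ae_iff]; exact hμK
  have h2 : ∀ᵐ z ∂ν, z ∈ K' := by rw [ae_iff]; exact hνK
  have : mutualNeg μ ν ≤ ∫⁻ z, ∫⁻ w, ENNReal.ofReal (R + R') ∂ν ∂μ := by
    refine lintegral_mono_ae (h1.mono fun z hz => lintegral_mono_ae (h2.mono fun w hw => ?_))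
    refine ENNReal.ofReal_le_ofReal ?_
    have := norm_sub_le z w
    have := hR z hz; have := hR' w hw
    have := Real.log_le_self (norm_nonneg (z - w))
    linarith
  refine ne_top_of_le_ne_top ?_ this
  simp

lemma circleAverage_logKernel (p : ℂ) {ε : ℝ} (hε : 0 < ε) (z : ℂ) :
    Real.circleAverage (fun w => -Real.log ‖z - w‖) p ε = -Real.log (max ε ‖z - p‖) := by
  have h := circleAverage_log_norm_sub_const_eq_log_radius_add_posLog (a := z) (c := p) hε.ne'
  have e : Real.circleAverage (fun w => -Real.log ‖z - w‖) p ε =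
      -Real.circleAverage (fun w => Real.log ‖w - z‖) p ε := by
    simp only [Real.circleAverage_def, intervalIntegral.integral_neg, smul_neg, norm_sub_rev z]
  rw [e, h, Real.posLog_eq_log_max_one (by positivity), ← Real.log_mul hε.ne' (by positivity),
    mul_max_of_nonneg _ _ hε.le, mul_one, mul_inv_cancel_left₀ hε.ne', norm_sub_rev]

lemma circleIntegrable_logKernel (p : ℂ) (ε : ℝ) (z : ℂ) :
    CircleIntegrable (fun w => -Real.log ‖z - w‖) p ε := by
  have := (circleIntegrable_log_norm_sub_const (a := z) (c := p) ε).neg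
  refine this.congr ?_
  intro x _
  simp [norm_sub_rev]

lemma integral_logKernel_circleMeasure (p : ℂ) {ε : ℝ} (hε : 0 < ε) (z : ℂ) :
    ∫ w, -Real.log ‖z - w‖ ∂circleMeasure p ε = -Real.log (max ε ‖z - p‖) := by
  rw [integral_circleMeasure (by fun_prop), circleAverage_logKernel p hε]

/-- On the circle the kernel is at least `-(‖z‖ + ‖p‖ + ε)`, so its positive part is dominated by
the kernel plus this constant, and the integral of the kernel over the circle is explicit. -/
lemma lintegral_logKernelPos_circleMeasure_le (p : ℂ) {ε : ℝ} (hε : 0 < ε) (z : ℂ) :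
    ∫⁻ w, CoulombGap.logKernelPos z w ∂circleMeasure p ε ≤
      ENNReal.ofReal (-Real.log ε + ‖z‖ + (‖p‖ + ε)) := by
  have hi := integrable_circleMeasure (f := fun w => -Real.log ‖z - w‖) (by fun_prop)
    (circleIntegrable_logKernel p ε z)
  have hmul := integral_logKernel_circleMeasure p hε z
  have h1 : ∫⁻ w, CoulombGap.logKernelPos z w ∂circleMeasure p ε =
      ∫⁻ w, ENNReal.ofReal (max (-Real.log ‖z - w‖) 0) ∂circleMeasure p ε := by
    refine lintegral_congr_ae ((ae_circleMeasure_ne p hε z).mono fun w hw => ?_)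
    simp [CoulombGap.logKernelPos, hw]
  rw [h1, ← ofReal_integral_eq_lintegral_ofReal hi.pos_part
    (Eventually.of_forall fun w => le_max_right _ _)]
  refine ENNReal.ofReal_le_ofReal ?_
  calc ∫ w, max (-Real.log ‖z - w‖) 0 ∂circleMeasure p ε
      ≤ ∫ w, (-Real.log ‖z - w‖ + (‖z‖ + (‖p‖ + ε))) ∂circleMeasure p ε := by
        refine integral_mono_ae hi.pos_part (hi.add (integrable_const _))
          ((ae_circleMeasure_mem_sphere p hε.le).mono fun w hw => ?_)
        have h2 : ‖w‖ ≤ ‖p‖ + ε := by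
          have : ‖w - p‖ = ε := by simpa [dist_eq_norm] using hw
          calc ‖w‖ = ‖p + (w - p)‖ := by ring_nf
            _ ≤ _ := by rw [← this]; exact norm_add_le _ _
        have h3 := norm_sub_le z w
        have h4 := Real.log_le_self (norm_nonneg (z - w))
        have h5 := norm_nonneg z
        have h6 := norm_nonneg p
        refine max_le ?_ ?_
        · linarith
        · linarith
    _ = -Real.log (max ε ‖z - p‖) + (‖z‖ + (‖p‖ + ε)) := by
        rw [integral_add hi (integrable_const _), hmul]; simp
    _ ≤ _ := by
        have := Real.log_le_log hε (le_max_left ε ‖z - p‖)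
        linarith

lemma mutualPos_circleMeasure_ne_top {μ : Measure ℂ} (hμ : CoulombGap.IsCompactUnitMeasure μ)
    (p : ℂ) {ε : ℝ} (hε : 0 < ε) : mutualPos μ (circleMeasure p ε) ≠ ⊤ := by
  obtain ⟨hμ1, K, hK, hμK⟩ := hμ
  obtain ⟨R, hR⟩ := hK.isBounded.exists_norm_le
  have h1 : ∀ᵐ z ∂μ, z ∈ K := by rw [ae_iff]; exact hμK
  have : mutualPos μ (circleMeasure p ε) ≤
      ∫⁻ z, ENNReal.ofReal (-Real.log ε + R + (‖p‖ + ε)) ∂μ := by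
    refine lintegral_mono_ae (h1.mono fun z hz => ?_)
    refine (lintegral_logKernelPos_circleMeasure_le p hε z).trans (ENNReal.ofReal_le_ofReal ?_)
    have := hR z hz
    linarith
  refine ne_top_of_le_ne_top ?_ this
  simp

/-- The mixed energy of a measure with a circle, in two ways. -/
lemma mutual_circleMeasure {μ : Measure ℂ} (hμ : CoulombGap.IsCompactUnitMeasure μ)
    (p : ℂ) {ε : ℝ} (hε : 0 < ε) :
    (mutualPos μ (circleMeasure p ε)).toReal - (mutualNeg μ (circleMeasure p ε)).toReal =
      ∫ z, -Real.log (max ε ‖z - p‖) ∂μ ∧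
    Integrable (CoulombGap.logPotential μ) (circleMeasure p ε) ∧
    ∫ z, CoulombGap.logPotential μ z ∂circleMeasure p ε =
      ∫ z, -Real.log (max ε ‖z - p‖) ∂μ := by
  have := hμ.1
  obtain ⟨hi, he⟩ := integrable_logKernel (mutualPos_circleMeasure_ne_top hμ p hε)
    (mutualNeg_ne_top hμ (isCompactUnitMeasure_circleMeasure p hε.le))
  have e1 : ∫ x, -Real.log ‖x.1 - x.2‖ ∂μ.prod (circleMeasure p ε) =
      ∫ z, -Real.log (max ε ‖z - p‖) ∂μ := by
    rw [integral_prod _ hi]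
    simp only [integral_logKernel_circleMeasure p hε]
  have e2 : ∀ z, CoulombGap.logPotential μ z = ∫ w, -Real.log ‖w - z‖ ∂μ := fun z => by
    simp only [CoulombGap.logPotential, norm_sub_rev]
  refine ⟨he.trans e1, ?_, ?_⟩
  · simp only [funext e2]
    exact hi.integral_prod_right
  · rw [← e1, integral_prod_symm _ hi]
    simp only [e2]

lemma energy_eq_coe {Q : ℂ → ℝ} {μ : Measure ℂ} (hp : mutualPos μ μ ≠ ⊤)
    (hn : mutualNeg μ μ ≠ ⊤) (hQp : ∫⁻ z, ENNReal.ofReal (Q z) ∂μ ≠ ⊤)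
    (hQn : ∫⁻ z, ENNReal.ofReal (-Q z) ∂μ ≠ ⊤) :
    CoulombGap.energy Q μ = (((mutualPos μ μ).toReal - (mutualNeg μ μ).toReal +
      ((∫⁻ z, ENNReal.ofReal (Q z) ∂μ).toReal -
        (∫⁻ z, ENNReal.ofReal (-Q z) ∂μ).toReal) : ℝ) : EReal) := by
  unfold CoulombGap.energy
  change ((mutualPos μ μ : EReal) - (mutualNeg μ μ : EReal)) + _ = _
  lift mutualPos μ μ to NNReal using hp with a
  lift mutualNeg μ μ to NNReal using hn with b
  lift ∫⁻ z, ENNReal.ofReal (Q z) ∂μ to NNReal using hQp with c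
  lift ∫⁻ z, ENNReal.ofReal (-Q z) ∂μ to NNReal using hQn with d
  simp only [ENNReal.coe_toReal]
  push_cast
  rfl

/-- With both subtracted terms finite, an infinite positive part would absorb everything else in the
extended reals. -/
lemma finite_of_energy_lt_top {Q : ℂ → ℝ} {μ : Measure ℂ}
    (hn : mutualNeg μ μ ≠ ⊤) (hQn : ∫⁻ z, ENNReal.ofReal (-Q z) ∂μ ≠ ⊤)
    (h : CoulombGap.energy Q μ < ⊤) :
    mutualPos μ μ ≠ ⊤ ∧ ∫⁻ z, ENNReal.ofReal (Q z) ∂μ ≠ ⊤ := by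
  unfold CoulombGap.energy at h
  change ((mutualPos μ μ : EReal) - (mutualNeg μ μ : EReal)) + _ < _ at h
  lift mutualNeg μ μ to NNReal using hn with b
  lift ∫⁻ z, ENNReal.ofReal (-Q z) ∂μ to NNReal using hQn with d
  generalize mutualPos μ μ = a at h ⊢
  generalize ∫⁻ z, ENNReal.ofReal (Q z) ∂μ = c at h ⊢
  have hsub : ∀ x : NNReal, ((⊤ : ℝ≥0∞) : EReal) - ((x : ℝ≥0∞) : EReal) = ⊤ := fun x => by
    exact EReal.top_sub_coe (x : ℝ)
  have hbot : ∀ (y : ℝ≥0∞) (x : NNReal), (y : EReal) - ((x : ℝ≥0∞) : EReal) ≠ ⊥ := by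
    intro y x
    induction y with
    | top => rw [hsub]; simp
    | coe y => exact EReal.coe_ne_bot ((y : ℝ) - x)
  constructor
  · rintro rfl
    rw [hsub, EReal.top_add_of_ne_bot (hbot _ _)] at h
    exact lt_irrefl _ h
  · rintro rfl
    rw [hsub, EReal.add_top_of_ne_bot (hbot _ _)] at h
    exact lt_irrefl _ h

lemma mutualPos_mix (σ τ : Measure ℂ) [SFinite σ] [SFinite τ] (a b : ℝ≥0∞) :
    mutualPos (a • σ + b • τ) (a • σ + b • τ) =
      a * a * mutualPos σ σ + 2 * (a * b * mutualPos σ τ) + b * b * mutualPos τ τ := by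
  have hm : ∀ ν : Measure ℂ, ∀ [SFinite ν], Measurable fun z =>
      ∫⁻ w, CoulombGap.logKernelPos z w ∂ν := fun ν _ =>
    measurable_logKernelPos.lintegral_prod_right'
  have hc := mutualPos_comm τ σ
  simp only [mutualPos] at hc ⊢
  simp only [lintegral_add_measure, lintegral_smul_measure, smul_eq_mul]
  rw [lintegral_add_left ((hm σ).const_mul a), lintegral_add_left ((hm σ).const_mul a),
    lintegral_const_mul _ (hm σ), lintegral_const_mul _ (hm τ), lintegral_const_mul _ (hm σ),
    lintegral_const_mul _ (hm τ), hc]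
  ring

lemma mutualNeg_mix (σ τ : Measure ℂ) [SFinite σ] [SFinite τ] (a b : ℝ≥0∞) :
    mutualNeg (a • σ + b • τ) (a • σ + b • τ) =
      a * a * mutualNeg σ σ + 2 * (a * b * mutualNeg σ τ) + b * b * mutualNeg τ τ := by
  have hm : ∀ ν : Measure ℂ, ∀ [SFinite ν], Measurable fun z =>
      ∫⁻ w, CoulombGap.logKernelNeg z w ∂ν := fun ν _ =>
    measurable_logKernelNeg.lintegral_prod_right'
  have hc := mutualNeg_comm τ σ
  simp only [mutualNeg] at hc ⊢
  simp only [lintegral_add_measure, lintegral_smul_measure, smul_eq_mul]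
  rw [lintegral_add_left ((hm σ).const_mul a), lintegral_add_left ((hm σ).const_mul a),
    lintegral_const_mul _ (hm σ), lintegral_const_mul _ (hm τ), lintegral_const_mul _ (hm σ),
    lintegral_const_mul _ (hm τ), hc]
  ring

lemma isCompactUnitMeasure_mix {σ τ : Measure ℂ} (hσ : CoulombGap.IsCompactUnitMeasure σ)
    (hτ : CoulombGap.IsCompactUnitMeasure τ) {t : ℝ} (h0 : 0 ≤ t) (h1 : t ≤ 1) :
    CoulombGap.IsCompactUnitMeasure (ENNReal.ofReal (1 - t) • σ + ENNReal.ofReal t • τ) := by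
  obtain ⟨hσ1, K, hK, hσK⟩ := hσ
  obtain ⟨hτ1, K', hK', hτK⟩ := hτ
  refine ⟨⟨?_⟩, K ∪ K', hK.union hK', ?_⟩
  · simp [← ENNReal.ofReal_add (sub_nonneg.2 h1) h0]
  · rw [Set.compl_union]
    simp [measure_mono_null Set.inter_subset_left hσK,
      measure_mono_null Set.inter_subset_right hτK]

lemma lintegral_ofReal_neg_ne_top {Q : ℂ → ℝ} (hQ : LowerSemicontinuous Q) {μ : Measure ℂ}
    (hμ : CoulombGap.IsCompactUnitMeasure μ) : ∫⁻ z, ENNReal.ofReal (-Q z) ∂μ ≠ ⊤ := by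
  obtain ⟨hμ1, K, hK, hμK⟩ := hμ
  have hK1 : ∀ᵐ z ∂μ, z ∈ K := by rw [ae_iff]; exact hμK
  have hne : K.Nonempty := by
    by_contra h
    rw [Set.not_nonempty_iff_eq_empty] at h
    simp [h] at hμK
  obtain ⟨z0, -, hmin⟩ := LowerSemicontinuousOn.exists_isMinOn hne hK
    (hQ.lowerSemicontinuousOn K)
  have : ∫⁻ z, ENNReal.ofReal (-Q z) ∂μ ≤ ∫⁻ _, ENNReal.ofReal (-Q z0) ∂μ :=
    lintegral_mono_ae (hK1.mono fun z hz => ENNReal.ofReal_le_ofReal (neg_le_neg (hmin hz)))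
  refine ne_top_of_le_ne_top ?_ this
  simp

lemma integrable_and_eq_of_finite {Q : ℂ → ℝ} (hQ : Measurable Q) {μ : Measure ℂ}
    (hp : ∫⁻ z, ENNReal.ofReal (Q z) ∂μ ≠ ⊤) (hn : ∫⁻ z, ENNReal.ofReal (-Q z) ∂μ ≠ ⊤) :
    Integrable Q μ ∧ (∫⁻ z, ENNReal.ofReal (Q z) ∂μ).toReal -
      (∫⁻ z, ENNReal.ofReal (-Q z) ∂μ).toReal = ∫ z, Q z ∂μ := by
  have hi : Integrable Q μ := by
    refine ⟨hQ.aestronglyMeasurable, ?_⟩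
    rw [hasFiniteIntegral_iff_norm]
    calc ∫⁻ x, ENNReal.ofReal ‖Q x‖ ∂μ
        ≤ ∫⁻ x, (ENNReal.ofReal (Q x) + ENNReal.ofReal (-Q x)) ∂μ := by
          refine lintegral_mono fun x => ?_
          rw [Real.norm_eq_abs]
          rcases abs_cases (Q x) with h | h
          · rw [h.1]; exact le_self_add
          · rw [h.1]; exact le_add_self
      _ = _ := lintegral_add_left hQ.ennreal_ofReal _
      _ < ⊤ := ENNReal.add_lt_top.2 ⟨hp.lt_top, hn.lt_top⟩
  exact ⟨hi, (integral_eq_lintegral_pos_part_sub_lintegral_neg_part hi).symm⟩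

lemma lintegral_ofReal_ne_top {Q : ℂ → ℝ} {μ : Measure ℂ} (hi : Integrable Q μ) :
    ∫⁻ z, ENNReal.ofReal (Q z) ∂μ ≠ ⊤ :=
  (hi.lintegral_lt_top).ne

/-! ### First variation at the equilibrium measure -/

/-- First-order optimality from a quadratic inequality on `(0, 1)`. -/
lemma first_variation_of_quadratic {a b c u v : ℝ}
    (h : ∀ t : ℝ, 0 < t → t < 1 → a + u ≤ (1 - t) * (1 - t) * a + 2 * ((1 - t) * t * b) +
      t * t * c + ((1 - t) * u + t * v)) : 2 * a + u ≤ 2 * b + v := by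
  have h2 : ∀ t : ℝ, 0 < t → t < 1 → 2 * a + u ≤ 2 * b + v + t * (a - 2 * b + c) := by
    intro t h0 h1
    have := h t h0 h1
    refine le_of_mul_le_mul_left ?_ h0
    nlinarith
  have hc : Tendsto (fun t : ℝ => 2 * b + v + t * (a - 2 * b + c)) (𝓝[>] 0)
      (𝓝 (2 * b + v + 0 * (a - 2 * b + c))) := by
    refine Tendsto.mono_left ?_ nhdsWithin_le_nhds
    exact Continuous.tendsto (by fun_prop) 0
  rw [zero_mul, add_zero] at hc
  refine ge_of_tendsto hc ?_
  filter_upwards [Ioo_mem_nhdsGT (zero_lt_one' ℝ)] with t ht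
  exact h2 t ht.1 ht.2

section Equilibrium

variable {Q : ℂ → ℝ} {σ : Measure ℂ}

/-- The first variation of the weighted energy at an equilibrium measure. -/
theorem equilibrium_first_variation (hQ : LowerSemicontinuous Q)
    (hσ : CoulombGap.IsEquilibriumMeasure Q σ) (hfin : CoulombGap.energy Q σ < ⊤)
    {τ : Measure ℂ} (hτ : CoulombGap.IsCompactUnitMeasure τ) (hQτ : Integrable Q τ)
    (hττ : mutualPos τ τ ≠ ⊤) (hστ : mutualPos σ τ ≠ ⊤) :
    2 * ((mutualPos σ σ).toReal - (mutualNeg σ σ).toReal) + ∫ z, Q z ∂σ ≤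
      2 * ((mutualPos σ τ).toReal - (mutualNeg σ τ).toReal) + ∫ z, Q z ∂τ := by
  have := hσ.1.1
  have := hτ.1
  have nσσ := mutualNeg_ne_top hσ.1 hσ.1
  have nστ := mutualNeg_ne_top hσ.1 hτ
  have nττ := mutualNeg_ne_top hτ hτ
  have qσn := lintegral_ofReal_neg_ne_top hQ hσ.1
  obtain ⟨pσσ, qσp⟩ := finite_of_energy_lt_top nσσ qσn hfin
  have qτp := lintegral_ofReal_ne_top hQτ
  have qτn := lintegral_ofReal_ne_top hQτ.neg
  simp only [Pi.neg_apply] at qτn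
  refine first_variation_of_quadratic
    (c := (mutualPos τ τ).toReal - (mutualNeg τ τ).toReal) fun t h0 h1 => ?_
  have ht : 0 < 1 - t := by linarith
  -- Comparison with `(1 - t) σ + t τ`. The mutual energies are bilinear, so the energy of the
  -- mixture is the quadratic polynomial in `t` that `first_variation_of_quadratic` expects.
  have hmin := hσ.2 _ (isCompactUnitMeasure_mix hσ.1 hτ h0.le h1.le)
  set a := ENNReal.ofReal (1 - t) with ha
  set b := ENNReal.ofReal t with hb
  have ha' : a ≠ ⊤ := ENNReal.ofReal_ne_top
  have hb' : b ≠ ⊤ := ENNReal.ofReal_ne_top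
  have haR : a.toReal = 1 - t := ENNReal.toReal_ofReal ht.le
  have hbR : b.toReal = t := ENNReal.toReal_ofReal h0.le
  have mp := mutualPos_mix σ τ a b
  have mn := mutualNeg_mix σ τ a b
  have qp : ∫⁻ z, ENNReal.ofReal (Q z) ∂(a • σ + b • τ) =
      a * ∫⁻ z, ENNReal.ofReal (Q z) ∂σ + b * ∫⁻ z, ENNReal.ofReal (Q z) ∂τ := by
    simp [lintegral_add_measure, lintegral_smul_measure]
  have qn : ∫⁻ z, ENNReal.ofReal (-Q z) ∂(a • σ + b • τ) =
      a * ∫⁻ z, ENNReal.ofReal (-Q z) ∂σ + b * ∫⁻ z, ENNReal.ofReal (-Q z) ∂τ := by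
    simp [lintegral_add_measure, lintegral_smul_measure]
  have fin3 : ∀ {x y z : ℝ≥0∞}, x ≠ ⊤ → y ≠ ⊤ → z ≠ ⊤ →
      a * a * x + 2 * (a * b * y) + b * b * z ≠ ⊤ := by
    intro x y z hx hy hz
    finiteness
  have val3 : ∀ {x y z : ℝ≥0∞}, x ≠ ⊤ → y ≠ ⊤ → z ≠ ⊤ →
      (a * a * x + 2 * (a * b * y) + b * b * z).toReal =
      (1 - t) * (1 - t) * x.toReal + 2 * ((1 - t) * t * y.toReal) + t * t * z.toReal := by
    intro x y z hx hy hz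
    rw [ENNReal.toReal_add (by finiteness) (by finiteness),
      ENNReal.toReal_add (by finiteness) (by finiteness)]
    simp [haR, hbR]
  have val2 : ∀ {x y : ℝ≥0∞}, x ≠ ⊤ → y ≠ ⊤ →
      (a * x + b * y).toReal = (1 - t) * x.toReal + t * y.toReal := by
    intro x y hx hy
    rw [ENNReal.toReal_add (by finiteness) (by finiteness)]
    simp [haR, hbR]
  rw [energy_eq_coe pσσ nσσ qσp qσn, energy_eq_coe (by rw [mp]; exact fin3 pσσ hστ hττ)
    (by rw [mn]; exact fin3 nσσ nστ nττ) (by rw [qp]; finiteness) (by rw [qn]; finiteness),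
    EReal.coe_le_coe_iff, mp, mn, qp, qn, val3 pσσ hστ hττ, val3 nσσ nστ nττ, val2 qσp qτp,
    val2 qσn qτn] at hmin
  rw [← (integrable_and_eq_of_finite hQ.measurable qτp qτn).2,
    ← (integrable_and_eq_of_finite hQ.measurable qσp qσn).2]
  linarith

variable (hQ : LowerSemicontinuous Q) (hσ : CoulombGap.IsEquilibriumMeasure Q σ)
  {r₀ c₀ : ℝ} (hr₀ : 0 < r₀) (hc₀ : ∀ z : ℂ, ‖z‖ = r₀ → Q z = c₀)
include hQ hσ hr₀ hc₀

omit hQ in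
-- One competitor of finite energy suffices, and arclength on a circle where `Q` is constant is one.
lemma equilibrium_energy_lt_top : CoulombGap.energy Q σ < ⊤ := by
  have hτ := isCompactUnitMeasure_circleMeasure 0 hr₀.le
  have hae : ∀ᵐ z ∂circleMeasure 0 r₀, Q z = c₀ :=
    (ae_circleMeasure_mem_sphere 0 hr₀.le).mono fun z hz => hc₀ z (by simpa using hz)
  have hi : Integrable Q (circleMeasure 0 r₀) :=
    (integrable_const c₀).congr (hae.mono fun z hz => hz.symm)
  have qn := lintegral_ofReal_ne_top hi.neg
  simp only [Pi.neg_apply] at qn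
  refine (hσ.2 _ hτ).trans_lt ?_
  rw [energy_eq_coe (mutualPos_circleMeasure_ne_top hτ 0 hr₀) (mutualNeg_ne_top hτ hτ)
    (lintegral_ofReal_ne_top hi) qn]
  exact EReal.coe_lt_top _

lemma equilibrium_finite :
    mutualPos σ σ ≠ ⊤ ∧ Integrable Q σ ∧ Integrable (CoulombGap.logPotential σ) σ ∧
    CoulombGap.robinConstant Q σ =
      2 * ((mutualPos σ σ).toReal - (mutualNeg σ σ).toReal) + ∫ z, Q z ∂σ := by
  have := hσ.1.1
  have nσσ := mutualNeg_ne_top hσ.1 hσ.1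
  have qσn := lintegral_ofReal_neg_ne_top hQ hσ.1
  obtain ⟨pσσ, qσp⟩ := finite_of_energy_lt_top nσσ qσn (equilibrium_energy_lt_top hσ hr₀ hc₀)
  obtain ⟨hi, he⟩ := integrable_logKernel pσσ nσσ
  have hiQ := (integrable_and_eq_of_finite hQ.measurable qσp qσn).1
  have hiU : Integrable (CoulombGap.logPotential σ) σ := hi.integral_prod_left
  refine ⟨pσσ, hiQ, hiU, ?_⟩
  rw [CoulombGap.robinConstant, integral_add hiQ (hiU.const_mul 2), integral_const_mul, he,
    integral_prod _ hi]
  simp only [CoulombGap.logPotential]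
  ring

/-- The Frostman inequality for circle averages. -/
lemma robinConstant_le_circleAverage {p : ℂ} {ε : ℝ} (hε : 0 < ε) (hQi : CircleIntegrable Q p ε) :
    CoulombGap.robinConstant Q σ ≤
      2 * ∫ z, -Real.log (max ε ‖z - p‖) ∂σ + Real.circleAverage Q p ε := by
  have hτ := isCompactUnitMeasure_circleMeasure p hε.le
  have h := equilibrium_first_variation hQ hσ (equilibrium_energy_lt_top hσ hr₀ hc₀) hτ
    (integrable_circleMeasure hQ.measurable hQi) (mutualPos_circleMeasure_ne_top hτ p hε)
    (mutualPos_circleMeasure_ne_top hσ.1 p hε)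
  rw [(equilibrium_finite hQ hσ hr₀ hc₀).2.2.2]
  rwa [(mutual_circleMeasure hσ.1 p hε).1, integral_circleMeasure hQ.measurable] at h

/-- An atom at `p` would give `{p} × {p}`, a subset of the diagonal, positive product mass,
contradicting finite energy. -/
lemma equilibrium_no_atoms (p : ℂ) : σ {p} = 0 := by
  have := hσ.1.1
  have h := lintegral_diag_null (equilibrium_finite hQ hσ hr₀ hc₀).1
  rw [ae_iff] at h
  have h2 : (σ.prod σ) ({p} ×ˢ {p}) = 0 := by
    refine measure_mono_null ?_ h
    rintro ⟨x, y⟩ ⟨hx, hy⟩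
    simp only [Set.mem_singleton_iff] at hx hy
    simp [hx, hy]
  rw [Measure.prod_prod] at h2
  simpa using h2

lemma equilibrium_ae_integrable :
    ∀ᵐ p ∂σ, Integrable (fun z => -Real.log ‖p - z‖) σ := by
  have := hσ.1.1
  exact (integrable_logKernel (equilibrium_finite hQ hσ hr₀ hc₀).1
    (mutualNeg_ne_top hσ.1 hσ.1)).1.prod_right_ae

end Equilibrium

/-! ### Truncated potentials -/

/-- The potential of `σ` averaged over the circle of radius `ε` about `p`. -/
noncomputable def truncPotential (σ : Measure ℂ) (ε : ℝ) (p : ℂ) : ℝ :=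
  ∫ z, -Real.log (max ε ‖z - p‖) ∂σ

lemma measurable_log_max (ε : ℝ) (p : ℂ) : Measurable fun z => -Real.log (max ε ‖z - p‖) :=
  (Real.measurable_log.comp (by fun_prop)).neg

section Trunc

variable {σ : Measure ℂ} (hσ : CoulombGap.IsCompactUnitMeasure σ)
include hσ

lemma truncPotential_bound {ε : ℝ} (hε : 0 < ε) (R : ℝ) :
    ∃ C, ∀ p : ℂ, ‖p‖ ≤ R → ∀ᵐ z ∂σ, ‖-Real.log (max ε ‖z - p‖)‖ ≤ C := by
  obtain ⟨hμ1, K, hK, hμK⟩ := hσ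
  obtain ⟨R', hR'⟩ := hK.isBounded.exists_norm_le
  have h1 : ∀ᵐ z ∂σ, z ∈ K := by rw [ae_iff]; exact hμK
  refine ⟨|Real.log ε| + (ε + (R' + R)), fun p hp => h1.mono fun z hz => ?_⟩
  have e1 : 0 ≤ R' + R := (norm_nonneg (z - p)).trans
    ((norm_sub_le z p).trans (add_le_add (hR' z hz) hp))
  have hm : max ε ‖z - p‖ ≤ ε + (R' + R) := by
    refine max_le (by linarith) ?_
    have := norm_sub_le z p
    have := hR' z hz
    linarith
  have hpos : 0 < max ε ‖z - p‖ := lt_max_of_lt_left hε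
  have l1 := Real.log_le_self hpos.le
  have l2 := Real.log_le_log hε (le_max_left ε ‖z - p‖)
  rw [norm_neg, Real.norm_eq_abs, abs_le]
  have := neg_abs_le (Real.log ε)
  have := abs_nonneg (Real.log ε)
  constructor <;> linarith

lemma truncPotential_integrable {ε : ℝ} (hε : 0 < ε) (p : ℂ) :
    Integrable (fun z => -Real.log (max ε ‖z - p‖)) σ := by
  have := hσ.1
  obtain ⟨C, hC⟩ := truncPotential_bound hσ hε ‖p‖
  exact Integrable.of_bound (measurable_log_max ε p).aestronglyMeasurable C (hC p le_rfl)

lemma truncPotential_continuous {ε : ℝ} (hε : 0 < ε) : Continuous (truncPotential σ ε) := by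
  have := hσ.1
  rw [continuous_iff_continuousAt]
  intro p
  obtain ⟨C, hC⟩ := truncPotential_bound hσ hε (‖p‖ + 1)
  refine continuousAt_of_dominated (bound := fun _ => C) (Eventually.of_forall fun x =>
    (measurable_log_max ε x).aestronglyMeasurable) ?_ (integrable_const _) (Eventually.of_forall fun z => ?_)
  · filter_upwards [Metric.ball_mem_nhds p one_pos] with x hx
    refine hC x ?_
    have : ‖x - p‖ < 1 := by simpa [dist_eq_norm] using hx
    calc ‖x‖ = ‖p + (x - p)‖ := by ring_nf
      _ ≤ ‖p‖ + ‖x - p‖ := norm_add_le _ _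
      _ ≤ _ := by linarith
  · refine ContinuousAt.neg (ContinuousAt.log (by fun_prop) ?_)
    exact (lt_max_of_lt_left hε).ne'

lemma circleAverage_logPotential (p : ℂ) {ε : ℝ} (hε : 0 < ε) :
    Real.circleAverage (CoulombGap.logPotential σ) p ε = truncPotential σ ε p := by
  have := hσ.1
  have h := (mutual_circleMeasure hσ p hε).2.2
  rwa [integral_circleMeasure] at h
  have : StronglyMeasurable fun z => ∫ w, -Real.log ‖z - w‖ ∂σ :=
    measurable_logKernel.stronglyMeasurable.integral_prod_right'
  exact this.measurable

/-- At a point which is not an atom, the truncated potentials increase to the potential; bounded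
truncated potentials force integrability of the logarithmic kernel. -/
lemma logPotential_of_truncPotential_le {p : ℂ} (hp : σ {p} = 0) {C : ℝ}
    (hC : ∀ ε > 0, truncPotential σ ε p ≤ C) :
    Integrable (fun z => -Real.log ‖p - z‖) σ := by
  have := hσ.1
  have hne : ∀ᵐ z ∂σ, z ≠ p := by rw [ae_iff]; simpa using hp
  have h1 := truncPotential_integrable hσ one_pos p
  have hpos : ∀ ε : ℝ, 0 < ε → ε ≤ 1 → ∀ z : ℂ, 0 ≤ Real.log (max 1 ‖z - p‖) -
      Real.log (max ε ‖z - p‖) := fun ε h0 hε z =>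
    sub_nonneg.2 (Real.log_le_log (lt_max_of_lt_left h0) (max_le_max_right _ hε))
  -- Fatou's lemma along `ε = 1 / (n + 1)`, applied to the nonnegative differences from the
  -- truncation at radius 1. The truncated kernel equals the full one as soon as `ε ≤ ‖z - p‖`,
  -- which happens eventually for `z ≠ p`.
  have key : ∫⁻ z, ENNReal.ofReal (Real.log (max 1 ‖z - p‖) - Real.log ‖z - p‖) ∂σ ≤
      ENNReal.ofReal (C - truncPotential σ 1 p) := by
    have hlim : ∀ᵐ z ∂σ, Tendsto (fun n : ℕ => ENNReal.ofReal (Real.log (max 1 ‖z - p‖) -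
        Real.log (max (1 / ((n : ℝ) + 1)) ‖z - p‖))) atTop
        (𝓝 (ENNReal.ofReal (Real.log (max 1 ‖z - p‖) - Real.log ‖z - p‖))) := by
      filter_upwards [hne] with z hz
      have hz' : 0 < ‖z - p‖ := norm_pos_iff.2 (sub_ne_zero.2 hz)
      refine tendsto_const_nhds.congr' ?_
      filter_upwards [(tendsto_one_div_add_atTop_nhds_zero_nat (𝕜 := ℝ)).eventually_le_const hz']
        with n hn
      rw [max_eq_right hn]
    have := lintegral_liminf_le (μ := σ) (f := fun (n : ℕ) z =>
      ENNReal.ofReal (Real.log (max 1 ‖z - p‖) - Real.log (max (1 / ((n : ℝ) + 1)) ‖z - p‖)))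
      (u := atTop) (fun n => by fun_prop)
    rw [lintegral_congr_ae (hlim.mono fun z hz => hz.liminf_eq)] at this
    refine this.trans ?_
    refine liminf_le_of_le (by isBoundedDefault) fun b hb => ?_
    obtain ⟨n, hn⟩ := hb.exists
    refine hn.trans ?_
    have hn0 : (0 : ℝ) < 1 / ((n : ℝ) + 1) := by positivity
    have hn1 : 1 / ((n : ℝ) + 1) ≤ 1 := by
      rw [div_le_one (by positivity)]; linarith [(Nat.cast_nonneg n : (0 : ℝ) ≤ n)]
    have h2 := truncPotential_integrable hσ hn0 p
    rw [← ofReal_integral_eq_lintegral_ofReal]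
    · refine ENNReal.ofReal_le_ofReal ?_
      have : ∀ z : ℂ, Real.log (max 1 ‖z - p‖) - Real.log (max (1 / ((n : ℝ) + 1)) ‖z - p‖) =
          -Real.log (max (1 / ((n : ℝ) + 1)) ‖z - p‖) - -Real.log (max 1 ‖z - p‖) :=
        fun z => by ring
      simp only [this]
      rw [integral_sub h2 h1]
      exact sub_le_sub_right (hC _ hn0) _
    · simpa using h2.sub h1 |>.congr (Eventually.of_forall fun z => by simp; ring)
    · exact Eventually.of_forall (hpos _ hn0 hn1)
  have hi : Integrable (fun z => Real.log (max 1 ‖z - p‖) - Real.log ‖z - p‖) σ := by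
    refine ⟨by fun_prop, ?_⟩
    rw [hasFiniteIntegral_iff_ofReal]
    · exact key.trans_lt ENNReal.ofReal_lt_top
    · filter_upwards [hne] with z hz
      exact sub_nonneg.2 (Real.log_le_log (norm_pos_iff.2 (sub_ne_zero.2 hz)) (le_max_right _ _))
  refine (hi.add h1).congr (Eventually.of_forall fun z => ?_)
  simp only [Pi.add_apply, norm_sub_rev p z]
  ring

lemma truncPotential_le_logPotential {p : ℂ} (hp : σ {p} = 0)
    (hi : Integrable (fun z => -Real.log ‖p - z‖) σ) {ε : ℝ} (hε : 0 < ε) :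
    truncPotential σ ε p ≤ CoulombGap.logPotential σ p := by
  have hne : ∀ᵐ z ∂σ, z ≠ p := by rw [ae_iff]; simpa using hp
  refine integral_mono_ae (truncPotential_integrable hσ hε p) hi (hne.mono fun z hz => ?_)
  have hz' : 0 < ‖z - p‖ := norm_pos_iff.2 (sub_ne_zero.2 hz)
  simp only [neg_le_neg_iff]
  rw [norm_sub_rev p z]
  exact Real.log_le_log hz' (le_max_right _ _)

lemma truncPotential_tendsto {p : ℂ} (hp : σ {p} = 0)
    (hi : Integrable (fun z => -Real.log ‖p - z‖) σ) :
    Tendsto (fun n : ℕ => truncPotential σ (1 / ((n : ℝ) + 1)) p) atTop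
      (𝓝 (CoulombGap.logPotential σ p)) := by
  have hne : ∀ᵐ z ∂σ, z ≠ p := by rw [ae_iff]; simpa using hp
  refine integral_tendsto_of_tendsto_of_monotone
    (fun n => truncPotential_integrable hσ (by positivity) p) hi
    (Eventually.of_forall fun z n m hnm => ?_) (hne.mono fun z hz => ?_)
  · have : 1 / ((m : ℝ) + 1) ≤ 1 / ((n : ℝ) + 1) := by
      have : (n : ℝ) ≤ m := by exact_mod_cast hnm
      exact one_div_le_one_div_of_le (by positivity) (by linarith)
    simp only [neg_le_neg_iff]
    exact Real.log_le_log (lt_max_of_lt_left (by positivity)) (max_le_max_right _ this)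
  · have hz' : 0 < ‖z - p‖ := norm_pos_iff.2 (sub_ne_zero.2 hz)
    refine tendsto_const_nhds.congr' ?_
    filter_upwards [(tendsto_one_div_add_atTop_nhds_zero_nat (𝕜 := ℝ)).eventually_le_const hz']
      with n hn
    rw [max_eq_right hn, norm_sub_rev]

end Trunc

/-! ### Frostman's theorem and the potential in a gap -/

section DropletPotential

variable {q : ℝ → ℝ} {σ : Measure ℂ} (hQ : LowerSemicontinuous (CoulombGap.radial q))
  (hσ : CoulombGap.IsEquilibriumMeasure (CoulombGap.radial q) σ)
include hQ hσ

lemma radial_no_atoms (p : ℂ) : σ {p} = 0 :=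
  equilibrium_no_atoms hQ hσ one_pos (c₀ := q 1) (fun z hz => by simp [CoulombGap.radial, hz]) p

/-- On a circle about the origin a radial field equals the constant `q r`, so the averaged Frostman
inequality becomes a statement about `q r` alone. No continuity of `q` at `r` is needed, and this
covers radii far from the droplet. -/
lemma frostman_radial {r : ℝ} (hr : 0 < r) :
    CoulombGap.robinConstant (CoulombGap.radial q) σ ≤ 2 * truncPotential σ r 0 + q r := by
  have hc : ∀ z : ℂ, ‖z‖ = r → CoulombGap.radial q z = q r := fun z hz => by
    simp [CoulombGap.radial, hz]
  have hci : CircleIntegrable (CoulombGap.radial q) 0 r := by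
    refine (circleIntegrable_const (q r) 0 r).congr fun θ _ => ?_
    exact (hc _ (by simp [abs_of_pos hr])).symm
  have h := robinConstant_le_circleAverage hQ hσ hr hc hr hci
  rwa [Real.circleAverage_const_on_circle (a := q r) (fun z hz => hc z (by
    simpa [abs_of_pos hr] using hz))] at h

/-- The Frostman inequality at a point of continuity of the external field. -/
lemma frostman_le_of_continuousAt {p : ℂ} (hc : ∀ᶠ z in 𝓝 p, ContinuousAt (CoulombGap.radial q) z)
    (hi : Integrable (fun z => -Real.log ‖p - z‖) σ) :
    CoulombGap.robinConstant (CoulombGap.radial q) σ ≤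
      2 * CoulombGap.logPotential σ p + CoulombGap.radial q p := by
  have hat := radial_no_atoms hQ hσ p
  refine le_of_forall_pos_le_add fun δ hδ => ?_
  have hc1 := hc.self_of_nhds
  obtain ⟨ρ, hρ, hball⟩ := Metric.eventually_nhds_iff_ball.1
    (hc.and (hc1.eventually (Iio_mem_nhds (lt_add_of_pos_right _ hδ))))
  have hlt : ∀ᶠ n : ℕ in atTop, 1 / ((n : ℝ) + 1) < ρ :=
    (tendsto_one_div_add_atTop_nhds_zero_nat (𝕜 := ℝ)).eventually_lt_const hρ
  obtain ⟨n, hn⟩ := hlt.exists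
  set ε := 1 / ((n : ℝ) + 1)
  have hε : 0 < ε := by positivity
  have hsph : ∀ z ∈ Metric.sphere p |ε|, z ∈ Metric.ball p ρ := fun z hz => by
    rw [abs_of_pos hε, Metric.mem_sphere] at hz
    rw [Metric.mem_ball, hz]; exact hn
  have hci : CircleIntegrable (CoulombGap.radial q) p ε := by
    refine ContinuousOn.circleIntegrable' fun z hz => ?_
    exact (hball z (hsph z hz)).1.continuousWithinAt
  have h := robinConstant_le_circleAverage hQ hσ one_pos (c₀ := q 1)
    (fun z hz => by simp [CoulombGap.radial, hz]) hε hci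
  -- Continuity near `p` bounds the field from above on a small circle, which lower semicontinuity
  -- alone would not do.
  have h2 : Real.circleAverage (CoulombGap.radial q) p ε ≤ CoulombGap.radial q p + δ :=
    Real.circleAverage_mono_on_of_le_circle hci fun z hz => (hball z (hsph z hz)).2.le
  have h3 : ∫ z, -Real.log (max ε ‖z - p‖) ∂σ ≤ CoulombGap.logPotential σ p :=
    truncPotential_le_logPotential hσ.1 hat hi hε
  linarith

variable (hC : ∀ z ∈ σ.support, ∀ᶠ w in 𝓝 z, ContinuousAt (CoulombGap.radial q) w)
include hC

/-- Frostman's theorem on the droplet. -/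
lemma frostman_eq {p : ℂ} (hp : p ∈ σ.support) :
    Integrable (fun z => -Real.log ‖p - z‖) σ ∧
    CoulombGap.robinConstant (CoulombGap.radial q) σ =
      2 * CoulombGap.logPotential σ p + CoulombGap.radial q p := by
  have := hσ.1.1
  set γ := CoulombGap.robinConstant (CoulombGap.radial q) σ with hγ
  have h1 : ∀ z : ℂ, ‖z‖ = 1 → CoulombGap.radial q z = q 1 := fun z hz => by
    simp [CoulombGap.radial, hz]
  obtain ⟨-, hiQ, hiU, -⟩ := equilibrium_finite hQ hσ one_pos h1
  have hsupp : ∀ᵐ z ∂σ, z ∈ σ.support := Measure.support_mem_ae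
  have hint := equilibrium_ae_integrable hQ hσ one_pos h1
  have hge : ∀ᵐ z ∂σ, 0 ≤ CoulombGap.radial q z + 2 * CoulombGap.logPotential σ z - γ := by
    filter_upwards [hsupp, hint] with z hz hz'
    have := frostman_le_of_continuousAt hQ hσ (hC z hz) hz'
    linarith
  have hi3 : Integrable (fun z => CoulombGap.radial q z + 2 * CoulombGap.logPotential σ z) σ :=
    hiQ.add (hiU.const_mul 2)
  -- By the definition of Robin's constant the nonnegative function `Q + 2U - γ` has `σ`-mean zero,
  -- hence vanishes `σ`-almost everywhere.
  have hzero : ∫ z, (CoulombGap.radial q z + 2 * CoulombGap.logPotential σ z - γ) ∂σ = 0 := by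
    rw [integral_sub hi3 (integrable_const _), hγ]
    simp [CoulombGap.robinConstant]
  have heq := (integral_eq_zero_iff_of_nonneg_ae hge (hi3.sub (integrable_const _))).1 hzero
  have hboth : ∀ᵐ z ∂σ, z ∈ σ.support ∧ Integrable (fun w => -Real.log ‖z - w‖) σ ∧
      CoulombGap.logPotential σ z = (γ - CoulombGap.radial q z) / 2 := by
    filter_upwards [hsupp, hint, heq] with z h1 h2 h3
    refine ⟨h1, h2, ?_⟩
    simp only [Pi.zero_apply] at h3
    linarith
  -- From almost every point to every point of the support: if a truncated potential were too large
  -- at `p`, then by continuity it would be so on a neighbourhood, which has positive `σ`-measure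
  -- and hence contains a point where the Frostman equality holds. There the truncation would exceed
  -- the potential.
  have htr : ∀ ε > 0, truncPotential σ ε p ≤ (γ - CoulombGap.radial q p) / 2 := by
    intro ε hε
    refine le_of_not_gt fun hlt => ?_
    have hcont : ContinuousAt (fun z => truncPotential σ ε z - (γ - CoulombGap.radial q z) / 2) p :=
      (truncPotential_continuous hσ.1 hε).continuousAt.sub
        ((continuousAt_const.sub (hC p hp).self_of_nhds).div_const 2)
    have hev := hcont.eventually (Ioi_mem_nhds (sub_pos.2 hlt))
    have hpos := (Measure.mem_support_iff_forall p).1 hp _ hev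
    obtain ⟨z, hz1, -, hz2, hz3⟩ := ((frequently_ae_mem_iff.2 hpos.ne').and_eventually hboth).exists
    have := truncPotential_le_logPotential hσ.1 (radial_no_atoms hQ hσ z) hz2 hε
    have hz1' : 0 < truncPotential σ ε z - (γ - CoulombGap.radial q z) / 2 := hz1
    linarith
  -- The bound is uniform in `ε`, so it gives integrability of the kernel at `p` and, as `ε → 0`,
  -- the inequality opposite to Frostman's.
  have hi := logPotential_of_truncPotential_le hσ.1 (radial_no_atoms hQ hσ p) htr
  refine ⟨hi, le_antisymm (frostman_le_of_continuousAt hQ hσ (hC p hp) hi) ?_⟩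
  have := le_of_tendsto (truncPotential_tendsto hσ.1 (radial_no_atoms hQ hσ p) hi)
    (Eventually.of_forall fun n => htr _ (by positivity))
  linarith

omit hQ hσ hC in
/-- Off the droplet the potential agrees with its truncations. -/
lemma logPotential_eq_truncPotential {p : ℂ} {ε : ℝ}
    (hd : ∀ z ∈ σ.support, ε ≤ ‖z - p‖) :
    CoulombGap.logPotential σ p = truncPotential σ ε p := by
  refine integral_congr_ae ?_
  filter_upwards [(Measure.support_mem_ae : σ.support ∈ ae σ)] with z hz
  rw [max_eq_right (hd z hz), norm_sub_rev]

omit hQ hC in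
lemma integrable_logKernel_off_support {p : ℂ} {ε : ℝ} (hε : 0 < ε)
    (hd : ∀ z ∈ σ.support, ε ≤ ‖z - p‖) : Integrable (fun z => -Real.log ‖p - z‖) σ := by
  refine (truncPotential_integrable hσ.1 hε p).congr ?_
  filter_upwards [(Measure.support_mem_ae : σ.support ∈ ae σ)] with z hz
  rw [max_eq_right (hd z hz), norm_sub_rev]

omit hQ hσ hC in
lemma exists_dist_support {p : ℂ} (hp : p ∉ σ.support) :
    ∃ ε > 0, ∀ y, ‖y - p‖ < ε → ∀ z ∈ σ.support, ε ≤ ‖z - y‖ := by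
  obtain ⟨δ, hδ, hb⟩ := Metric.isOpen_iff.1 Measure.isOpen_compl_support p hp
  refine ⟨δ / 2, by positivity, fun y hy z hz => ?_⟩
  by_contra! h
  refine hb ?_ hz
  rw [Metric.mem_ball, dist_eq_norm]
  calc ‖z - p‖ = ‖(z - y) + (y - p)‖ := by ring_nf
    _ ≤ ‖z - y‖ + ‖y - p‖ := norm_add_le _ _
    _ < δ := by linarith

omit hQ hC in
lemma logPotential_continuousAt {p : ℂ} (hp : p ∉ σ.support) :
    ContinuousAt (CoulombGap.logPotential σ) p := by
  obtain ⟨ε, hε, hd⟩ := exists_dist_support hp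
  refine ((truncPotential_continuous hσ.1 hε).continuousAt (x := p)).congr ?_
  filter_upwards [Metric.ball_mem_nhds p hε] with y hy
  exact (logPotential_eq_truncPotential (hd y (by simpa [dist_eq_norm] using hy))).symm

lemma integrable_logKernel_everywhere (p : ℂ) : Integrable (fun z => -Real.log ‖p - z‖) σ := by
  by_cases hp : p ∈ σ.support
  · exact (frostman_eq hQ hσ hC hp).1
  · obtain ⟨ε, hε, hd⟩ := exists_dist_support hp
    exact integrable_logKernel_off_support hσ hε (hd p (by simpa using hε))

/-- The potential of the equilibrium measure is lower semicontinuous. -/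
lemma logPotential_lowerSemicontinuous : LowerSemicontinuous (CoulombGap.logPotential σ) := by
  intro p y hy
  -- The potential is a limit of smaller continuous functions: a truncation that already exceeds `y`
  -- at `p` exceeds it nearby.
  have ht := truncPotential_tendsto hσ.1 (radial_no_atoms hQ hσ p)
    (integrable_logKernel_everywhere hQ hσ hC p)
  obtain ⟨n, hn⟩ := (ht.eventually (Ioi_mem_nhds hy)).exists
  have hε : (0 : ℝ) < 1 / ((n : ℝ) + 1) := by positivity
  filter_upwards [(truncPotential_continuous hσ.1 hε).continuousAt.eventually
    (Ioi_mem_nhds hn)] with z hz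
  exact lt_of_lt_of_le hz (truncPotential_le_logPotential hσ.1 (radial_no_atoms hQ hσ z)
    (integrable_logKernel_everywhere hQ hσ hC z) hε)

/-- On a circle contained in the droplet the potential is constant. -/
lemma logPotential_eq_of_circle_subset {r : ℝ} (hr : 0 < r)
    (hS : ∀ z : ℂ, ‖z‖ = r → z ∈ σ.support) {z : ℂ} (hz : ‖z‖ = r) :
    CoulombGap.logPotential σ z = truncPotential σ r 0 := by
  rw [← circleAverage_logPotential hσ.1 0 hr]
  symm
  refine Real.circleAverage_const_on_circle fun w hw => ?_
  have hw' : ‖w‖ = r := by simpa [abs_of_pos hr] using hw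
  have h1 := (frostman_eq hQ hσ hC (hS z hz)).2
  have h2 := (frostman_eq hQ hσ hC (hS w hw')).2
  simp only [CoulombGap.radial, hz, hw'] at h1 h2
  linarith

/-- A logarithmic potential with logarithmic circle averages over a gap is itself logarithmic. -/
theorem logPotential_gap {r₁ r₂ a b : ℝ} (h1 : 0 < r₁) (h12 : r₁ < r₂)
    (hS1 : ∀ z : ℂ, ‖z‖ = r₁ → z ∈ σ.support) (hS2 : ∀ z : ℂ, ‖z‖ = r₂ → z ∈ σ.support)
    (hgap : ∀ z : ℂ, r₁ < ‖z‖ → ‖z‖ < r₂ → z ∉ σ.support)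
    (hP : ∀ r, r₁ ≤ r → r ≤ r₂ → truncPotential σ r 0 = a + b * Real.log r)
    {z : ℂ} (hz1 : r₁ ≤ ‖z‖) (hz2 : ‖z‖ ≤ r₂) :
    CoulombGap.logPotential σ z = a + b * Real.log ‖z‖ := by
  -- The deviation from the logarithm vanishes on both boundary circles and has the mean value
  -- property inside. The potential is not known to be continuous up to the boundary, only lower
  -- semicontinuous, which is enough for a minimum to exist but gives no maximum principle.
  set u : ℂ → ℝ := fun z => CoulombGap.logPotential σ z - (a + b * Real.log ‖z‖) with hu
  have hub : ∀ z : ℂ, ‖z‖ = r₁ ∨ ‖z‖ = r₂ → u z = 0 := by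
    rintro z (hz | hz)
    · simp only [hu]
      rw [logPotential_eq_of_circle_subset hQ hσ hC h1 hS1 hz, hP r₁ le_rfl h12.le, hz, sub_self]
    · simp only [hu]
      rw [logPotential_eq_of_circle_subset hQ hσ hC (h1.trans h12) hS2 hz, hP r₂ h12.le le_rfl,
        hz, sub_self]
  have hucont : ∀ z : ℂ, r₁ < ‖z‖ → ‖z‖ < r₂ → ContinuousAt u z := by
    intro z hz1 hz2
    refine (logPotential_continuousAt hσ (hgap z hz1 hz2)).sub
      (continuousAt_const.add (continuousAt_const.mul ?_))
    exact continuousAt_id.norm.log (by simpa using (h1.trans hz1).ne')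
  set G : Set ℂ := {z | r₁ ≤ ‖z‖ ∧ ‖z‖ ≤ r₂} with hG
  have hGc : IsCompact G := by
    refine (isCompact_closedBall (0 : ℂ) r₂).of_isClosed_subset ?_ fun z hz => by simpa using hz.2
    exact (isClosed_le continuous_const continuous_norm).inter
      (isClosed_le continuous_norm continuous_const)
  have hulsc : LowerSemicontinuousOn u G := by
    have e : u = fun z => CoulombGap.logPotential σ z + (-(a + b * Real.log ‖z‖)) := by
      ext z; simp only [hu]; ring
    rw [e]
    refine LowerSemicontinuousOn.add
      ((logPotential_lowerSemicontinuous hQ hσ hC).lowerSemicontinuousOn G)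
      (ContinuousOn.lowerSemicontinuousOn ?_)
    refine (continuousOn_const.add (continuousOn_const.mul ?_)).neg
    exact continuous_norm.continuousOn.log fun z hz => (h1.trans_le hz.1).ne'
  -- the minimum principle
  have hnonneg : ∀ z ∈ G, 0 ≤ u z := by
    obtain ⟨z0, hz0, hmin⟩ := LowerSemicontinuousOn.exists_isMinOn (⟨z, hz1, hz2⟩ : G.Nonempty) hGc hulsc
    by_contra! hcon
    obtain ⟨z1, hz1G, hz1neg⟩ := hcon
    have hm : u z0 < 0 := (hmin hz1G).trans_lt hz1neg
    -- Among the minimisers take one, `p`, nearest to the origin. The mean over a small circle about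
    -- `p` equals the minimum, so `u` is minimal on the whole circle, including a point closer to
    -- the origin than `p`.
    set Z : Set ℂ := {z ∈ G | u z ≤ u z0} with hZ
    have hZc : IsCompact Z := by
      refine hGc.of_isClosed_subset ?_ fun z hz => hz.1
      have := (lowerSemicontinuousOn_iff_preimage_Iic.1 hulsc) (u z0)
      obtain ⟨v, hv, hveq⟩ := this
      have : Z = G ∩ v := by
        rw [← hveq]; ext w; simp [hZ]
      rw [this]
      exact hGc.isClosed.inter hv
    obtain ⟨p, hpZ, hpmin⟩ := hZc.exists_isMinOn ⟨z0, hz0, le_rfl⟩ continuous_norm.continuousOn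
    have hpu : u p = u z0 := le_antisymm hpZ.2 (hmin hpZ.1)
    have hp1 : r₁ < ‖p‖ := lt_of_le_of_ne hpZ.1.1 fun h => by
      have := hub p (Or.inl h.symm); linarith
    have hp2 : ‖p‖ < r₂ := lt_of_le_of_ne hpZ.1.2 fun h => by
      have := hub p (Or.inr h); linarith
    have hp0 : 0 < ‖p‖ := h1.trans hp1
    obtain ⟨ε0, hε0, hd0⟩ := exists_dist_support (hgap p hp1 hp2)
    set ε := min ε0 (min ((‖p‖ - r₁) / 2) ((r₂ - ‖p‖) / 2)) with hεdef
    have hε : 0 < ε := by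
      refine lt_min hε0 (lt_min ?_ ?_) <;> linarith
    have hε1 : ε ≤ (‖p‖ - r₁) / 2 := (min_le_right _ _).trans (min_le_left _ _)
    have hε2 : ε ≤ (r₂ - ‖p‖) / 2 := (min_le_right _ _).trans (min_le_right _ _)
    have hcirc : ∀ w : ℂ, ‖w - p‖ = ε → r₁ < ‖w‖ ∧ ‖w‖ < r₂ := by
      intro w hw
      have e1 : ‖w‖ ≤ ‖p‖ + ε := by
        rw [← hw]; calc ‖w‖ = ‖p + (w - p)‖ := by ring_nf
          _ ≤ _ := norm_add_le _ _
      have e2 : ‖p‖ ≤ ‖w‖ + ε := by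
        rw [← hw, norm_sub_rev]; calc ‖p‖ = ‖w + (p - w)‖ := by ring_nf
          _ ≤ _ := norm_add_le _ _
      constructor <;> linarith
    have hmem : ∀ θ : ℝ, ‖circleMap p ε θ - p‖ = ε := fun θ => by
      simp [circleMap, abs_of_pos hε]
    have hiU : CircleIntegrable (CoulombGap.logPotential σ) p ε := by
      refine ContinuousOn.circleIntegrable' fun w hw => ?_
      have hw' := hcirc w (by simpa [dist_eq_norm, abs_of_pos hε] using hw)
      exact (logPotential_continuousAt hσ (hgap w hw'.1 hw'.2)).continuousWithinAt
    have hmeanU : Real.circleAverage (CoulombGap.logPotential σ) p ε =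
        CoulombGap.logPotential σ p := by
      rw [circleAverage_logPotential hσ.1 p hε]
      refine (logPotential_eq_truncPotential fun w hw => ?_).symm
      exact (min_le_left _ _).trans (hd0 p (by simpa using hε0) w hw)
    have hmeanL : Real.circleAverage (fun w => Real.log ‖w‖) p ε = Real.log ‖p‖ := by
      have := circleAverage_logKernel p hε 0
      simp only [zero_sub, norm_neg] at this
      rw [max_eq_right (by linarith)] at this
      simp only [Real.circleAverage_def, intervalIntegral.integral_neg, smul_neg] at this ⊢
      linarith
    have hiL : CircleIntegrable (fun w : ℂ => Real.log ‖w‖) p ε := by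
      refine ContinuousOn.circleIntegrable' fun w hw => ?_
      have hw' := hcirc w (by simpa [dist_eq_norm, abs_of_pos hε] using hw)
      exact (continuousAt_id.norm.log (by simpa using (h1.trans hw'.1).ne')).continuousWithinAt
    have hmeanu : Real.circleAverage u p ε = u p := by
      have hib : CircleIntegrable (fun w : ℂ => b * Real.log ‖w‖) p ε :=
        hiL.const_fun_smul (a := b)
      have hiab : CircleIntegrable (fun w : ℂ => a + b * Real.log ‖w‖) p ε :=
        (circleIntegrable_const a p ε).add hib
      simp only [hu]
      rw [Real.circleAverage_fun_sub hiU hiab, hmeanU,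
        Real.circleAverage_fun_add (circleIntegrable_const a p ε) hib, Real.circleAverage_const]
      have := Real.circleAverage_fun_smul (a := b) (f := fun w : ℂ => Real.log ‖w‖) (c := p)
        (R := ε)
      simp only [smul_eq_mul] at this
      rw [this, hmeanL]
    have hcu : Continuous fun θ : ℝ => u (circleMap p ε θ) - u p := by
      refine Continuous.sub ?_ continuous_const
      rw [continuous_iff_continuousAt]
      intro θ
      have hw := hcirc _ (hmem θ)
      exact (hucont _ hw.1 hw.2).comp (continuous_circleMap p ε).continuousAt
    have hcge : ∀ θ : ℝ, 0 ≤ u (circleMap p ε θ) - u p := fun θ => by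
      have hw := hcirc _ (hmem θ)
      have := hmin (a := circleMap p ε θ) ⟨hw.1.le, hw.2.le⟩
      simp only [Set.mem_ofPred_eq] at this
      linarith
    have hint0 : ∫ θ in (0 : ℝ)..2 * π, (u (circleMap p ε θ) - u p) = 0 := by
      have hcu' : Continuous fun θ : ℝ => u (circleMap p ε θ) := by
        refine (hcu.add (continuous_const (y := u p))).congr fun θ => ?_
        simp
      rw [intervalIntegral.integral_sub (hcu'.intervalIntegrable _ _) (by simp)]
      have := hmeanu
      rw [Real.circleAverage_def, smul_eq_mul, inv_mul_eq_iff_eq_mul₀ (by positivity)] at this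
      rw [this]; simp
    -- the point of the circle closest to the origin
    have harg : ∃ θ ∈ Set.Icc 0 (2 * π), circleMap p ε θ = p - (ε / ‖p‖ : ℝ) * p := by
      have : p - (ε / ‖p‖ : ℝ) * p ∈ Metric.sphere p |ε| := by
        rw [Metric.mem_sphere, dist_eq_norm, sub_sub_cancel_left, norm_neg, norm_mul,
          Complex.norm_real, Real.norm_eq_abs, abs_div, abs_norm, div_mul_cancel₀ _ hp0.ne']
      rw [← image_circleMap_Ioc] at this
      obtain ⟨θ, hθ, he⟩ := this
      exact ⟨θ, Set.Ioc_subset_Icc_self hθ, he⟩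
    obtain ⟨θ, hθ, hθe⟩ := harg
    have hval : u (circleMap p ε θ) = u p := by
      by_contra hne
      have hlt : 0 < u (circleMap p ε θ) - u p :=
        lt_of_le_of_ne (hcge θ) fun h => hne (by linarith)
      have := intervalIntegral.integral_pos (by positivity) hcu.continuousOn
        (fun x _ => hcge x) ⟨θ, hθ, hlt⟩
      linarith
    have hw := hcirc _ (hmem θ)
    have hwZ : circleMap p ε θ ∈ Z := ⟨⟨hw.1.le, hw.2.le⟩, by rw [hval, hpu]⟩
    have hle := hpmin hwZ
    simp only [Set.mem_ofPred_eq] at hle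
    rw [hθe] at hle
    have e3 : p - (ε / ‖p‖ : ℝ) * p = ((1 - ε / ‖p‖ : ℝ) : ℂ) * p := by push_cast; ring
    have hε3 : ε / ‖p‖ < 1 := by rw [div_lt_one hp0]; linarith
    rw [e3, norm_mul, Complex.norm_real, Real.norm_eq_abs, abs_of_pos (by linarith)] at hle
    have : 0 < ε / ‖p‖ := by positivity
    nlinarith
  rcases hz1.eq_or_lt with h | hlt1
  · have := hub z (Or.inl h.symm); simp only [hu] at this; linarith
  rcases hz2.eq_or_lt with h | hlt2
  · have := hub z (Or.inr h); simp only [hu] at this; linarith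
  -- the circle through `z`
  set r := ‖z‖ with hr
  have hr0 : 0 < r := h1.trans hlt1
  have hmem : ∀ θ : ℝ, ‖circleMap 0 r θ‖ = r := fun θ => by simp [abs_of_pos hr0]
  have hcU : Continuous fun θ : ℝ => CoulombGap.logPotential σ (circleMap 0 r θ) := by
    rw [continuous_iff_continuousAt]
    intro θ
    exact (logPotential_continuousAt hσ (hgap _ (by rw [hmem]; exact hlt1)
      (by rw [hmem]; exact hlt2))).comp (continuous_circleMap 0 r).continuousAt
  have hu' : ∀ θ, u (circleMap 0 r θ) =
      CoulombGap.logPotential σ (circleMap 0 r θ) - (a + b * Real.log r) := fun θ => by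
    simp only [hu, hmem]
  have hcu : Continuous fun θ : ℝ => u (circleMap 0 r θ) := by
    simp only [hu']; exact hcU.sub continuous_const
  -- The circle average of the potential is the truncated potential, which is `a + b log r` by
  -- hypothesis. Hence `u`, already nonnegative and continuous on the circle, has mean zero there
  -- and vanishes; this replaces the maximum principle.
  have hint0 : ∫ θ in (0 : ℝ)..2 * π, u (circleMap 0 r θ) = 0 := by
    simp only [hu']
    rw [intervalIntegral.integral_sub (hcU.intervalIntegrable _ _) (by simp)]
    have := circleAverage_logPotential hσ.1 0 hr0
    rw [hP r hlt1.le hlt2.le, Real.circleAverage_def, smul_eq_mul,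
      inv_mul_eq_iff_eq_mul₀ (by positivity)] at this
    rw [this]; simp; ring
  have hzc : z ∈ Metric.sphere (0 : ℂ) |r| := by simp [hr]
  rw [← image_circleMap_Ioc] at hzc
  obtain ⟨θ, hθ, he⟩ := hzc
  have hge : ∀ θ, 0 ≤ u (circleMap 0 r θ) := fun θ =>
    hnonneg _ ⟨by rw [hmem]; exact hz1, by rw [hmem]; exact hz2⟩
  by_contra hne
  have hlt : 0 < u (circleMap 0 r θ) := by
    refine lt_of_le_of_ne (hge θ) fun h => hne ?_
    rw [he] at h
    simp only [hu] at h
    linarith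
  have := intervalIntegral.integral_pos (by positivity) hcu.continuousOn (fun x _ => hge x)
    ⟨θ, Set.Ioc_subset_Icc_self hθ, hlt⟩
  linarith

end DropletPotential

/-! ### The external field near the gap -/

lemma annuli_ordered {N : ℕ} {a b : ℕ → ℝ} (hab : ∀ j ≤ N, a j < b j)
    (hba : ∀ j < N, b j < a (j + 1)) {i j : ℕ} (hij : i ≤ j) (hj : j ≤ N) :
    b i ≤ b j ∧ a i ≤ a j := by
  induction j, hij using Nat.le_induction with
  | base => exact ⟨le_rfl, le_rfl⟩
  | succ m hm ih =>
    have h1 := ih (by omega)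
    have h2 := hab m (by omega)
    have h3 := hba m (by omega)
    have h4 := hab (m + 1) hj
    exact ⟨by linarith, by linarith⟩

/-- Supplies mass arbitrarily close to the edges of the gap, the source of every strict inequality
below. -/
lemma measure_annulus_pos {σ : Measure ℂ} {c d ρ : ℝ} (hc : c < ρ) (hd : ρ < d)
    (h : (ρ : ℂ) ∈ σ.support) (hρ : 0 ≤ ρ) : 0 < σ {z : ℂ | c < ‖z‖ ∧ ‖z‖ < d} := by
  refine (Measure.mem_support_iff_forall _).1 h _ (IsOpen.mem_nhds ?_ ?_)
  · exact (isOpen_lt continuous_const continuous_norm).inter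
      (isOpen_lt continuous_norm continuous_const)
  · simpa [abs_of_nonneg hρ] using ⟨hc, hd⟩

/-- Structure of a radially symmetric field near a spectral gap: the obstacle function is an
affine function of `log |z|` on the gap, and the field lies strictly above this affine function
except at the two edges. -/
theorem droplet_gap_structure {q : ℝ → ℝ} {σ : Measure ℂ}
    (hQ : LowerSemicontinuous (CoulombGap.radial q))
    (hσ : CoulombGap.IsEquilibriumMeasure (CoulombGap.radial q) σ)
    (hC2 : ∀ z ∈ σ.support, ContDiffAt ℝ 2 (CoulombGap.radial q) z)
    (hstrict : ∀ z ∉ σ.support,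
      CoulombGap.obstacle (CoulombGap.radial q) σ z < CoulombGap.radial q z)
    {N : ℕ} {a b : ℕ → ℝ} (ha0 : 0 ≤ a 0) (hab : ∀ j ≤ N, a j < b j)
    (hba : ∀ j < N, b j < a (j + 1))
    (hS : σ.support = ⋃ j ∈ Finset.range (N + 1), {z : ℂ | a j ≤ ‖z‖ ∧ ‖z‖ ≤ b j})
    {k : ℕ} (hk : k < N) :
    ∃ A B : ℝ, 0 < B ∧ B < 2 ∧
      (∀ z : ℂ, b k ≤ ‖z‖ → ‖z‖ ≤ a (k + 1) →
        CoulombGap.obstacle (CoulombGap.radial q) σ z = A + B * Real.log ‖z‖) ∧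
      q (b k) = A + B * Real.log (b k) ∧
      q (a (k + 1)) = A + B * Real.log (a (k + 1)) ∧
      ∀ r > 0, r ≠ b k → r ≠ a (k + 1) → A + B * Real.log r < q r := by
  have := hσ.1.1
  have hC : ∀ z ∈ σ.support, ∀ᶠ w in 𝓝 z, ContinuousAt (CoulombGap.radial q) w := fun z hz =>
    ((hC2 z hz).eventually (by simp)).mono fun w hw => hw.continuousAt
  set r₁ := b k with hr₁
  set r₂ := a (k + 1) with hr₂
  have hak : 0 ≤ a k := ha0.trans (annuli_ordered hab hba (Nat.zero_le k) hk.le).2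
  have h1 : 0 < r₁ := hak.trans_lt (hab k hk.le)
  have h12 : r₁ < r₂ := hba k hk
  have h2 : 0 < r₂ := h1.trans h12
  have hb2 : r₂ < b (k + 1) := hab (k + 1) hk
  have hmem : ∀ z : ℂ, z ∈ σ.support ↔ ∃ j ≤ N, a j ≤ ‖z‖ ∧ ‖z‖ ≤ b j := by
    intro z; rw [hS]; simp [and_left_comm]
  have hgap' : ∀ z ∈ σ.support, ‖z‖ ≤ r₁ ∨ r₂ ≤ ‖z‖ := by
    intro z hz
    obtain ⟨j, hj, hj1, hj2⟩ := (hmem z).1 hz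
    rcases Nat.lt_or_ge k j with h | h
    · exact Or.inr ((annuli_ordered hab hba (Nat.succ_le_of_lt h) hj).2.trans hj1)
    · exact Or.inl (hj2.trans (annuli_ordered hab hba h hk.le).1)
  have hgap : ∀ z : ℂ, r₁ < ‖z‖ → ‖z‖ < r₂ → z ∉ σ.support := fun z hz1 hz2 hz => by
    rcases hgap' z hz with h | h <;> linarith
  have hS1 : ∀ z : ℂ, ‖z‖ = r₁ → z ∈ σ.support := fun z hz =>
    (hmem z).2 ⟨k, hk.le, hz ▸ (hab k hk.le).le, hz.le⟩
  have hS2 : ∀ z : ℂ, ‖z‖ = r₂ → z ∈ σ.support := fun z hz =>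
    (hmem z).2 ⟨k + 1, hk, hz.ge, hz.le.trans hb2.le⟩
  have hsupp : ∀ᵐ z ∂σ, z ∈ σ.support := Measure.support_mem_ae
  set γ := CoulombGap.robinConstant (CoulombGap.radial q) σ with hγ
  -- the comparison function
  set C₁ : Set ℂ := {z | ‖z‖ ≤ r₁} with hC₁
  have hC₁m : MeasurableSet C₁ := (isClosed_le continuous_norm continuous_const).measurableSet
  -- The inner `max r₁` changes nothing outside the disc `C₁`; it keeps the logarithm bounded below,
  -- which makes integrability immediate.
  set ℓ : ℝ → ℂ → ℝ := fun r z => C₁.indicator (fun _ => Real.log r) z +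
    C₁ᶜ.indicator (fun z => Real.log (max r₁ ‖z - 0‖)) z with hℓ
  have hℓ1 : ∀ r z, ‖z‖ ≤ r₁ → ℓ r z = Real.log r := fun r z hz => by
    have : z ∈ C₁ := hz
    simp [hℓ, this]
  have hℓ2 : ∀ r z, r₁ < ‖z‖ → ℓ r z = Real.log ‖z‖ := fun r z hz => by
    have : z ∉ C₁ := by simpa [hC₁] using hz
    simp [hℓ, this, max_eq_right hz.le]
  have hli : ∀ r > 0, Integrable (fun z => Real.log (max r ‖z - 0‖)) σ := fun r hr => by
    simpa using (truncPotential_integrable hσ.1 hr 0).neg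
  have hi1 : ∀ r : ℝ, Integrable (C₁.indicator (fun _ : ℂ => Real.log r)) σ := fun r =>
    (integrable_const _).indicator hC₁m
  have hi2 : Integrable (C₁ᶜ.indicator (fun z => Real.log (max r₁ ‖z - 0‖))) σ :=
    (hli r₁ h1).indicator hC₁m.compl
  have hℓi : ∀ r, Integrable (ℓ r) σ := fun r => (hi1 r).add hi2
  set β := σ.real C₁ with hβ
  set α := ∫ z, C₁ᶜ.indicator (fun z => Real.log (max r₁ ‖z - 0‖)) z ∂σ with hα
  have hℓint : ∀ r, ∫ z, ℓ r z ∂σ = β * Real.log r + α := fun r => by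
    simp only [hℓ]
    rw [integral_add (hi1 r) hi2, integral_indicator hC₁m]
    simp only [integral_const, smul_eq_mul, measureReal_restrict_apply_univ, hβ, hα]
  have htp : ∀ r, truncPotential σ r 0 = -∫ z, Real.log (max r ‖z - 0‖) ∂σ := fun r =>
    integral_neg _
  have hle : ∀ r > 0, ∀ z : ℂ, ℓ r z ≤ Real.log (max r ‖z - 0‖) := fun r hr z => by
    rw [sub_zero]
    rcases le_or_gt ‖z‖ r₁ with h | h
    · rw [hℓ1 r z h]; exact Real.log_le_log hr (le_max_left _ _)
    · rw [hℓ2 r z h]; exact Real.log_le_log (h1.trans h) (le_max_right _ _)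
  -- For `r` in the gap no support point has modulus strictly between `r₁` and `r₂`, so `max r ‖z‖`
  -- is `r` on the inner part of the droplet and `‖z‖` on the outer part, exactly as in `ℓ`.
  have hP : ∀ r, r₁ ≤ r → r ≤ r₂ → truncPotential σ r 0 = -α + -β * Real.log r := by
    intro r hr1 hr2
    have : ∫ z, Real.log (max r ‖z - 0‖) ∂σ = ∫ z, ℓ r z ∂σ := by
      refine integral_congr_ae (hsupp.mono fun z hz => ?_)
      simp only [sub_zero]
      rcases hgap' z hz with h | h
      · rw [hℓ1 r z h, max_eq_left (h.trans hr1)]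
      · rw [hℓ2 r z (h12.trans_le h), max_eq_right (hr2.trans h)]
    rw [htp, this, hℓint]; ring
  -- For any radius `ℓ r` lies below `log (max r ‖z‖)`, so the truncated potential lies below the
  -- affine function continued from the gap, strictly once the two differ on a set of positive mass.
  have hPlt : ∀ r > 0, 0 < σ {z : ℂ | ℓ r z < Real.log (max r ‖z - 0‖)} →
      truncPotential σ r 0 < -α + -β * Real.log r := by
    intro r hr hpos
    have hd : 0 < ∫ z, (Real.log (max r ‖z - 0‖) - ℓ r z) ∂σ := by
      rw [integral_pos_iff_support_of_nonneg_ae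
        (Eventually.of_forall fun z => sub_nonneg.2 (hle r hr z)) ((hli r hr).sub (hℓi r))]
      refine hpos.trans_le (measure_mono fun z hz => ?_)
      exact (sub_pos.2 hz).ne'
    rw [integral_sub (hli r hr) (hℓi r), hℓint] at hd
    rw [htp]; linarith
  have hpos1 : ∀ c < r₁, 0 < σ {z : ℂ | c < ‖z‖ ∧ ‖z‖ < r₁} := fun c hc => by
    have ⟨ρ, hρ1, hρ2⟩ := exists_between (max_lt hc (hab k hk.le))
    have h3 := (le_max_left c (a k)).trans_lt hρ1
    have h4 := (le_max_right c (a k)).trans_lt hρ1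
    have hρ0 : 0 ≤ ρ := hak.trans h4.le
    refine measure_annulus_pos h3 hρ2 ((hmem _).2 ⟨k, hk.le, ?_⟩) hρ0
    simpa [abs_of_nonneg hρ0] using ⟨h4.le, hρ2.le⟩
  have hpos2 : ∀ d > r₂, 0 < σ {z : ℂ | r₂ < ‖z‖ ∧ ‖z‖ < d} := fun d hd => by
    have ⟨ρ, hρ1, hρ2⟩ := exists_between (lt_min hd hb2)
    have h3 := hρ2.trans_le (min_le_left _ _)
    have h4 := hρ2.trans_le (min_le_right _ _)
    have hρ0 : 0 ≤ ρ := h2.le.trans hρ1.le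
    refine measure_annulus_pos hρ1 h3 ((hmem _).2 ⟨k + 1, hk, ?_⟩) hρ0
    simpa [abs_of_nonneg hρ0] using ⟨hρ1.le, h4.le⟩
  -- `β` is the mass of the closed disc bounded by the inner edge. Both sides of the gap carry mass,
  -- so it lies strictly between 0 and 1, and `B = 2β`.
  have hβ0 : 0 < β := by
    exact ENNReal.toReal_pos ((hpos1 (r₁ - 1) (by linarith)).trans_le
      (measure_mono fun z hz => hz.2.le)).ne' (measure_ne_top _ _)
  have hβ1 : β < 1 := by
    have h3 : 0 < σ.real C₁ᶜ := by
      refine ENNReal.toReal_pos ((hpos2 (r₂ + 1) (by linarith)).trans_le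
        (measure_mono fun z hz => ?_)).ne' (measure_ne_top _ _)
      simpa [hC₁] using h12.trans hz.1
    have := probReal_compl_eq_one_sub (μ := σ) hC₁m
    rw [this] at h3
    linarith
  have hU : ∀ z : ℂ, r₁ ≤ ‖z‖ → ‖z‖ ≤ r₂ →
      CoulombGap.logPotential σ z = -α + -β * Real.log ‖z‖ := fun z hz1 hz2 =>
    logPotential_gap hQ hσ hC h1 h12 hS1 hS2 hgap hP hz1 hz2
  have hobs : ∀ z : ℂ, r₁ ≤ ‖z‖ → ‖z‖ ≤ r₂ →
      CoulombGap.obstacle (CoulombGap.radial q) σ z =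
        (γ + 2 * α) + (2 * β) * Real.log ‖z‖ := fun z hz1 hz2 => by
    rw [CoulombGap.obstacle, hU z hz1 hz2, ← hγ]; ring
  have hnorm : ∀ r : ℝ, 0 < r → ‖(r : ℂ)‖ = r := fun r hr => by simp [abs_of_pos hr]
  have hval : ∀ r : ℝ, 0 < r → (r : ℂ) ∈ σ.support → r₁ ≤ r → r ≤ r₂ →
      q r = (γ + 2 * α) + (2 * β) * Real.log r := by
    intro r hr hrS hr1 hr2
    have h3 := (frostman_eq hQ hσ hC hrS).2
    rw [hU _ (by rw [hnorm r hr]; exact hr1) (by rw [hnorm r hr]; exact hr2), hnorm r hr] at h3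
    simp only [CoulombGap.radial, hnorm r hr, ← hγ] at h3
    linarith
  refine ⟨γ + 2 * α, 2 * β, by linarith, by linarith, hobs,
    hval r₁ h1 (hS1 _ (hnorm _ h1)) le_rfl h12.le, hval r₂ h2 (hS2 _ (hnorm _ h2)) h12.le le_rfl,
    fun r hr hne1 hne2 => ?_⟩
  -- Frostman gives `q r ≥ γ - 2 truncPotential`. Outside the closed gap the truncated potential is
  -- strictly below its affine continuation, because an annulus at the nearer edge is charged.
  -- Inside the gap the strict inequality is the hypothesis on the obstacle function.
  have hfr := frostman_radial hQ hσ hr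
  rw [← hγ] at hfr
  rcases lt_or_gt_of_ne hne1 with hlt | hgt
  · have := hPlt r hr ((hpos1 r hlt).trans_le (measure_mono fun z hz => ?_))
    · linarith
    · simp only [Set.mem_ofPred_eq, sub_zero]
      rw [hℓ1 r z hz.2.le]
      exact Real.log_lt_log hr (hz.1.trans_le (le_max_right _ _))
  rcases lt_or_gt_of_ne hne2 with hlt2 | hgt2
  · have h3 := hstrict r (hgap _ (by rwa [hnorm r hr]) (by rwa [hnorm r hr]))
    rw [hobs _ (by rw [hnorm r hr]; exact hgt.le) (by rw [hnorm r hr]; exact hlt2.le),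
      hnorm r hr] at h3
    simpa [CoulombGap.radial, abs_of_pos hr] using h3
  · have := hPlt r hr ((hpos2 r hgt2).trans_le (measure_mono fun z hz => ?_))
    · linarith
    · simp only [Set.mem_ofPred_eq, sub_zero]
      rw [hℓ2 r z (h12.trans hz.1)]
      exact Real.log_lt_log (h2.trans hz.1) (hz.2.trans_le (le_max_left _ _))

/-! ### Gaussian moments and Taylor estimates -/

lemma exists_poly_le_exp (k : ℕ) {θ : ℝ} (hθ : 0 < θ) :
    ∃ C > 0, ∀ T : ℝ, 0 ≤ T → T ^ k ≤ C * Real.exp (θ * T) := by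
  refine ⟨(k.factorial : ℝ) / θ ^ k, by positivity, fun T hT => ?_⟩
  have := Real.pow_div_factorial_le_exp (θ * T) (by positivity) k
  rw [div_le_iff₀ (by positivity), mul_pow] at this
  rw [div_mul_eq_mul_div, le_div_iff₀ (by positivity)]
  linarith

lemma integrable_pow_mul_gaussian (k : ℕ) (α : ℝ) {b : ℝ} (hb : 0 < b) :
    Integrable fun y : ℝ => y ^ k * Real.exp (α * y - b * y ^ 2) := by
  have h := (integrable_exp_neg_mul_sq (half_pos hb)).const_mul
    ((k.factorial : ℝ) * Real.exp ((1 + |α|) ^ 2 / (2 * b)))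
  refine h.mono' (by fun_prop) (Eventually.of_forall fun y => ?_)
  rw [norm_mul, norm_pow, Real.norm_eq_abs, Real.norm_eq_abs, Real.abs_exp]
  have h1 := Real.pow_div_factorial_le_exp |y| (abs_nonneg y) k
  rw [div_le_iff₀ (by positivity)] at h1
  have h2 : |y| + (α * y - b * y ^ 2) ≤ (1 + |α|) ^ 2 / (2 * b) + -(b / 2) * y ^ 2 := by
    have e1 : α * y ≤ |α| * |y| := by rw [← abs_mul]; exact le_abs_self _
    have e2 : (1 + |α|) * |y| ≤ (1 + |α|) ^ 2 / (2 * b) + b / 2 * y ^ 2 := by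
      rw [← sub_nonneg]
      have : (1 + |α|) ^ 2 / (2 * b) + b / 2 * y ^ 2 - (1 + |α|) * |y| =
          ((1 + |α|) - b * |y|) ^ 2 / (2 * b) := by
        rw [← sq_abs y]; field_simp; ring
      rw [this]; positivity
    linarith
  calc |y| ^ k * Real.exp (α * y - b * y ^ 2)
      ≤ (Real.exp |y| * k.factorial) * Real.exp (α * y - b * y ^ 2) := by gcongr
    _ = k.factorial * Real.exp (|y| + (α * y - b * y ^ 2)) := by rw [Real.exp_add]; ring
    _ ≤ k.factorial * Real.exp ((1 + |α|) ^ 2 / (2 * b) + -(b / 2) * y ^ 2) := by gcongr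
    _ = _ := by rw [Real.exp_add]; ring

lemma integral_gaussian_linear (α : ℝ) {b : ℝ} (hb : 0 < b) :
    ∫ y : ℝ, Real.exp (α * y - b * y ^ 2) = √(π / b) * Real.exp (α ^ 2 / (4 * b)) := by
  have e : ∀ y : ℝ, Real.exp (α * y - b * y ^ 2) =
      Real.exp (-b * (y - α / (2 * b)) ^ 2) * Real.exp (α ^ 2 / (4 * b)) := by
    intro y; rw [← Real.exp_add]; congr 1; field_simp; ring
  simp only [e]
  rw [integral_mul_const, integral_sub_right_eq_self (fun y => Real.exp (-b * y ^ 2)),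
    integral_gaussian]

/-- The derivative of `y ^ k * exp (α y - b y²)` integrates to zero. At `k = 0` the truncated
exponent `k - 1` is harmless, since its coefficient vanishes. -/
lemma gaussian_moment_rec (k : ℕ) (α : ℝ) {b : ℝ} (hb : 0 < b) :
    2 * b * ∫ y : ℝ, y ^ (k + 1) * Real.exp (α * y - b * y ^ 2) =
      α * (∫ y : ℝ, y ^ k * Real.exp (α * y - b * y ^ 2)) +
      k * ∫ y : ℝ, y ^ (k - 1) * Real.exp (α * y - b * y ^ 2) := by
  have i0 := integrable_pow_mul_gaussian (k - 1) α hb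
  have i1 := integrable_pow_mul_gaussian k α hb
  have i2 := integrable_pow_mul_gaussian (k + 1) α hb
  have hd : ∀ y : ℝ, HasDerivAt (fun y : ℝ => y ^ k * Real.exp (α * y - b * y ^ 2))
      (k * (y ^ (k - 1) * Real.exp (α * y - b * y ^ 2)) +
        (α * (y ^ k * Real.exp (α * y - b * y ^ 2)) -
        2 * b * (y ^ (k + 1) * Real.exp (α * y - b * y ^ 2)))) y := by
    intro y
    have h1 : HasDerivAt (fun y : ℝ => α * y - b * y ^ 2) (α - b * (2 * y)) y := by
      simpa using ((hasDerivAt_id y).const_mul α).fun_sub ((hasDerivAt_pow 2 y).const_mul b)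
    refine ((hasDerivAt_pow k y).mul h1.exp).congr_deriv ?_
    ring
  have hz := integral_eq_zero_of_hasDerivAt_of_integrable hd
    ((i0.const_mul (k : ℝ)).add ((i1.const_mul α).sub (i2.const_mul (2 * b)))) i1
  have i3 : Integrable fun y : ℝ => α * (y ^ k * Real.exp (α * y - b * y ^ 2)) -
      2 * b * (y ^ (k + 1) * Real.exp (α * y - b * y ^ 2)) :=
    (i1.const_mul α).sub (i2.const_mul (2 * b))
  rw [integral_add (i0.const_mul (k : ℝ)) i3, integral_sub (i1.const_mul α) (i2.const_mul (2 * b)), integral_const_mul, integral_const_mul,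
    integral_const_mul] at hz
  linarith

lemma gaussian_third_moment (α : ℝ) {b : ℝ} (hb : 0 < b) :
    ∫ y : ℝ, y ^ 3 * Real.exp (α * y - b * y ^ 2) =
      ((α / (2 * b)) ^ 3 + 3 * (α / (2 * b)) / (2 * b)) *
        ∫ y : ℝ, Real.exp (α * y - b * y ^ 2) := by
  have h0 := gaussian_moment_rec 0 α hb
  have h1 := gaussian_moment_rec 1 α hb
  have h2 := gaussian_moment_rec 2 α hb
  norm_num at h0 h1 h2
  set I0 := ∫ y : ℝ, Real.exp (α * y - b * y ^ 2)
  set I1 := ∫ y : ℝ, y * Real.exp (α * y - b * y ^ 2)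
  set I2 := ∫ y : ℝ, y ^ 2 * Real.exp (α * y - b * y ^ 2)
  set I3 := ∫ y : ℝ, y ^ 3 * Real.exp (α * y - b * y ^ 2)
  have e1 : I1 = α * I0 / (2 * b) := by field_simp; linarith
  have e2 : I2 = (α * I1 + I0) / (2 * b) := by field_simp; linarith
  have e3 : I3 = (α * I2 + 2 * I1) / (2 * b) := by field_simp; linarith
  rw [e3, e2, e1]; field_simp; ring

/-- If the derivative of `h` is `O(|y|^k)` near `0` and `h 0 = 0`, then `h = O(|y|^(k+1))`. -/
lemma abs_le_pow_succ_of_hasDerivAt {h h' : ℝ → ℝ} {η C : ℝ} {k : ℕ} (h0 : h 0 = 0)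
    (hd : ∀ y, |y| ≤ η → HasDerivAt h (h' y) y) (hb : ∀ y, |y| ≤ η → |h' y| ≤ C * |y| ^ k)
    {y : ℝ} (hy : |y| ≤ η) : |h y| ≤ C * |y| ^ (k + 1) := by
  have hC : 0 ≤ C * |y| ^ k := (abs_nonneg _).trans (hb y hy)
  have hseg : ∀ x ∈ Set.uIcc 0 y, |x| ≤ |y| := fun x hx => by
    simpa using Set.abs_sub_left_of_mem_uIcc hx
  rcases eq_or_ne y 0 with rfl | hy0
  · simp [h0]
  have hC' : 0 ≤ C := by
    by_contra! hneg
    have : 0 < |y| ^ k := by positivity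
    nlinarith
  have := Convex.norm_image_sub_le_of_norm_hasDerivWithin_le (f := h) (f' := h')
    (s := Set.uIcc 0 y) (x := 0) (y := y) (C := C * |y| ^ k)
    (fun x hx => (hd x ((hseg x hx).trans hy)).hasDerivWithinAt)
    (fun x hx => (hb x ((hseg x hx).trans hy)).trans
      (mul_le_mul_of_nonneg_left (pow_le_pow_left₀ (abs_nonneg x) (hseg x hx) k) hC'))
    (convex_uIcc 0 y) Set.left_mem_uIcc Set.right_mem_uIcc
  rw [h0, sub_zero, sub_zero, Real.norm_eq_abs, Real.norm_eq_abs] at this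
  rw [pow_succ, ← mul_assoc]; exact this

/-- `f` has derivatives `f₁, …, f₄` on `[c - ρ, c + ρ]`, all bounded by `M`. -/
structure SmoothNear (f f₁ f₂ f₃ f₄ : ℝ → ℝ) (c ρ M : ℝ) : Prop where
  d0 : ∀ x, |x - c| ≤ ρ → HasDerivAt f (f₁ x) x
  d1 : ∀ x, |x - c| ≤ ρ → HasDerivAt f₁ (f₂ x) x
  d2 : ∀ x, |x - c| ≤ ρ → HasDerivAt f₂ (f₃ x) x
  d3 : ∀ x, |x - c| ≤ ρ → HasDerivAt f₃ (f₄ x) x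
  b1 : ∀ x, |x - c| ≤ ρ → |f₁ x| ≤ M
  b2 : ∀ x, |x - c| ≤ ρ → |f₂ x| ≤ M
  b3 : ∀ x, |x - c| ≤ ρ → |f₃ x| ≤ M
  b4 : ∀ x, |x - c| ≤ ρ → |f₄ x| ≤ M

namespace SmoothNear

variable {f f₁ f₂ f₃ f₄ : ℝ → ℝ} {c ρ M : ℝ} (h : SmoothNear f f₁ f₂ f₃ f₄ c ρ M)
include h

omit h in
lemma taylor_aux {x₀ η y : ℝ} (hx : |x₀ - c| + η ≤ ρ) (hy : |y| ≤ η) : |x₀ + y - c| ≤ ρ := by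
  calc |x₀ + y - c| = |(x₀ - c) + y| := by ring_nf
    _ ≤ |x₀ - c| + |y| := abs_add_le _ _
    _ ≤ ρ := by linarith

omit h in
lemma hasDerivAt_shift {g g' : ℝ → ℝ} {x₀ y : ℝ} (hg : HasDerivAt g (g' (x₀ + y)) (x₀ + y)) :
    HasDerivAt (fun y => g (x₀ + y)) (g' (x₀ + y)) y := by
  simpa using hg.comp_const_add x₀ y

/-- The Taylor estimates descend from the highest derivative: each remainder vanishes at 0 and has
the previous remainder as its derivative. The factorials in the denominators are given away. -/
lemma taylor_f₃ {x₀ η y : ℝ} (hx : |x₀ - c| + η ≤ ρ) (hy : |y| ≤ η) :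
    |f₃ (x₀ + y) - f₃ x₀| ≤ M * |y| ^ 1 :=
  abs_le_pow_succ_of_hasDerivAt (h := fun y => f₃ (x₀ + y) - f₃ x₀) (h' := fun y => f₄ (x₀ + y))
    (k := 0) (η := η) (by simp)
    (fun y hy => (hasDerivAt_shift (h.d3 _ (taylor_aux hx hy))).sub_const _)
    (fun y hy => by simpa using h.b4 _ (taylor_aux hx hy)) hy

lemma taylor_f₂ {x₀ η y : ℝ} (hx : |x₀ - c| + η ≤ ρ) (hy : |y| ≤ η) :
    |f₂ (x₀ + y) - f₂ x₀ - f₃ x₀ * y| ≤ M * |y| ^ 2 :=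
  abs_le_pow_succ_of_hasDerivAt (h := fun y => f₂ (x₀ + y) - f₂ x₀ - f₃ x₀ * y)
    (h' := fun y => f₃ (x₀ + y) - f₃ x₀) (k := 1) (η := η) (by simp)
    (fun y hy => by
      have := (hasDerivAt_shift (h.d2 _ (taylor_aux hx hy))).sub_const (f₂ x₀)
      simpa using this.fun_sub ((hasDerivAt_id y).const_mul (f₃ x₀)))
    (fun y hy => h.taylor_f₃ hx hy) hy

lemma taylor_f₁ {x₀ η y : ℝ} (hx : |x₀ - c| + η ≤ ρ) (hy : |y| ≤ η) :
    |f₁ (x₀ + y) - f₁ x₀ - f₂ x₀ * y - f₃ x₀ * y ^ 2 / 2| ≤ M * |y| ^ 3 :=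
  abs_le_pow_succ_of_hasDerivAt
    (h := fun y => f₁ (x₀ + y) - f₁ x₀ - f₂ x₀ * y - f₃ x₀ * y ^ 2 / 2)
    (h' := fun y => f₂ (x₀ + y) - f₂ x₀ - f₃ x₀ * y) (k := 2) (η := η) (by simp)
    (fun y hy => by
      have := (hasDerivAt_shift (h.d1 _ (taylor_aux hx hy))).sub_const (f₁ x₀)
      refine ((this.sub ((hasDerivAt_id y).const_mul (f₂ x₀))).sub
        (((hasDerivAt_pow 2 y).const_mul (f₃ x₀)).div_const 2)).congr_deriv ?_
      simp; ring)
    (fun y hy => h.taylor_f₂ hx hy) hy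

lemma taylor_f {x₀ η y : ℝ} (hx : |x₀ - c| + η ≤ ρ) (hy : |y| ≤ η) :
    |f (x₀ + y) - f x₀ - f₁ x₀ * y - f₂ x₀ * y ^ 2 / 2 - f₃ x₀ * y ^ 3 / 6| ≤ M * |y| ^ 4 :=
  abs_le_pow_succ_of_hasDerivAt
    (h := fun y => f (x₀ + y) - f x₀ - f₁ x₀ * y - f₂ x₀ * y ^ 2 / 2 - f₃ x₀ * y ^ 3 / 6)
    (h' := fun y => f₁ (x₀ + y) - f₁ x₀ - f₂ x₀ * y - f₃ x₀ * y ^ 2 / 2)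
    (k := 3) (η := η) (by simp)
    (fun y hy => by
      have := (hasDerivAt_shift (h.d0 _ (taylor_aux hx hy))).sub_const (f x₀)
      refine (((this.sub ((hasDerivAt_id y).const_mul (f₁ x₀))).sub
        (((hasDerivAt_pow 2 y).const_mul (f₂ x₀)).div_const 2)).sub
        (((hasDerivAt_pow 3 y).const_mul (f₃ x₀)).div_const 6)).congr_deriv ?_
      simp; ring)
    (fun y hy => h.taylor_f₁ hx hy) hy

lemma taylor_one {x₀ η y : ℝ} (hx : |x₀ - c| + η ≤ ρ) (hy : |y| ≤ η) :
    |f (x₀ + y) - f x₀ - f₁ x₀ * y| ≤ M * |y| ^ 2 :=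
  abs_le_pow_succ_of_hasDerivAt (h := fun y => f (x₀ + y) - f x₀ - f₁ x₀ * y)
    (h' := fun y => f₁ (x₀ + y) - f₁ x₀) (k := 1) (η := η) (by simp)
    (fun y hy => by
      have := (hasDerivAt_shift (h.d0 _ (taylor_aux hx hy))).sub_const (f x₀)
      simpa using this.fun_sub ((hasDerivAt_id y).const_mul (f₁ x₀)))
    (fun y hy => abs_le_pow_succ_of_hasDerivAt (h := fun y => f₁ (x₀ + y) - f₁ x₀)
      (h' := fun y => f₂ (x₀ + y)) (k := 0) (η := η) (by simp)
      (fun y hy => (hasDerivAt_shift (h.d1 _ (taylor_aux hx hy))).sub_const _)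
      (fun y hy => by simpa using h.b2 _ (taylor_aux hx hy)) hy) hy

end SmoothNear

/-- A `C⁶` function has bounded derivatives near the point. -/
lemma ContDiffAt.exists_smoothNear {f : ℝ → ℝ} {c : ℝ} (hf : ContDiffAt ℝ 6 f c) :
    ∃ ρ > 0, ∃ M > 0, SmoothNear f (deriv f) (deriv (deriv f)) (deriv (deriv (deriv f)))
      (deriv (deriv (deriv (deriv f)))) c ρ M := by
  have step : ∀ {g : ℝ → ℝ} {n m : WithTop ℕ∞}, ContDiffAt ℝ n g c → n ≠ 0 → n ≠ (⊤ : ℕ∞) →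
      m + 1 ≤ n → ContDiffAt ℝ m (deriv g) c ∧ ∀ᶠ x in 𝓝 c, HasDerivAt g (deriv g x) x := by
    intro g n m hg hn0 hn hmn
    refine ⟨?_, ?_⟩
    · have := (hg.fderiv_right hmn).clm_apply (contDiffAt_const (c := (1 : ℝ)))
      simpa only [fderiv_apply_one_eq_deriv] using this
    · exact (hg.eventually hn).mono fun x hx => (hx.differentiableAt hn0).hasDerivAt
  obtain ⟨c1, e0⟩ := step (m := 5) hf (by simp) (by simp) (by norm_num)
  obtain ⟨c2, e1⟩ := step (m := 4) c1 (by simp) (by simp) (by norm_num)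
  obtain ⟨c3, e2⟩ := step (m := 3) c2 (by simp) (by simp) (by norm_num)
  obtain ⟨c4, e3⟩ := step (m := 2) c3 (by simp) (by simp) (by norm_num)
  have bd : ∀ {g : ℝ → ℝ} {n : WithTop ℕ∞}, ContDiffAt ℝ n g c → ∀ᶠ x in 𝓝 c,
      |g x| < |g c| + 1 := fun hg =>
    hg.continuousAt.abs.eventually (Iio_mem_nhds (lt_add_one _))
  set M := |deriv f c| + |deriv (deriv f) c| + |deriv (deriv (deriv f)) c| +
    |deriv (deriv (deriv (deriv f))) c| + 1 with hM
  obtain ⟨ρ, hρ, hball⟩ := Metric.eventually_nhds_iff_ball.1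
    (((e0.and e1).and (e2.and e3)).and (((bd c1).and (bd c2)).and ((bd c3).and (bd c4))))
  have hmem : ∀ x, |x - c| ≤ ρ / 2 → x ∈ Metric.ball c ρ := fun x hx => by
    rw [Metric.mem_ball, Real.dist_eq]; linarith
  have p1 := abs_nonneg (deriv f c)
  have p2 := abs_nonneg (deriv (deriv f) c)
  have p3 := abs_nonneg (deriv (deriv (deriv f)) c)
  have p4 := abs_nonneg (deriv (deriv (deriv (deriv f))) c)
  refine ⟨ρ / 2, by positivity, M, by positivity, fun x hx => ?_, fun x hx => ?_, fun x hx => ?_,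
    fun x hx => ?_, fun x hx => ?_, fun x hx => ?_, fun x hx => ?_, fun x hx => ?_⟩ <;>
  obtain ⟨⟨⟨q0, q1⟩, q2, q3⟩, ⟨r1, r2⟩, r3, r4⟩ := hball x (hmem x hx)
  · exact q0
  · exact q1
  · exact q2
  · exact q3
  all_goals linarith

lemma abs_exp_sub_one_sub_self_le (w : ℝ) :
    |Real.exp w - 1 - w| ≤ w ^ 2 * Real.exp |w| := by
  have h := Complex.norm_exp_sub_sum_le_norm_mul_exp (w : ℂ) 2
  simp only [Finset.sum_range_succ, Finset.sum_range_zero, pow_zero, Nat.factorial, zero_add,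
    pow_one, Nat.cast_one, div_one, Nat.mul_one, Complex.norm_real, Real.norm_eq_abs,
    sq_abs] at h
  have e : Complex.exp (w : ℂ) - (1 + (w : ℂ)) = ((Real.exp w - 1 - w : ℝ) : ℂ) := by
    push_cast; ring
  rwa [e, Complex.norm_real, Real.norm_eq_abs] at h

/-! ### Laplace's method at one well -/

/-- The part of the exponent beyond second order at `x₀`. -/
noncomputable def phaseRemainder (E E₁ E₂ μ μ₁ : ℝ → ℝ) (n x₀ y : ℝ) : ℝ :=
  -n * (E (x₀ + y) - E x₀ - E₁ x₀ * y - E₂ x₀ * y ^ 2 / 2) + (μ (x₀ + y) - μ x₀ - μ₁ x₀ * y)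

section Laplace

variable {E E₁ E₂ E₃ E₄ μ μ₁ μ₂ μ₃ μ₄ : ℝ → ℝ} {c ρ M κ₀ : ℝ}
  (hE : SmoothNear E E₁ E₂ E₃ E₄ c ρ M) (hμ : SmoothNear μ μ₁ μ₂ μ₃ μ₄ c ρ M)
  (hρ : 0 < ρ) (hM : 0 < M)
include hE hμ hρ hM

/-- The first bound isolates the cubic term for expanding the exponential; the second is crude and
only serves to control `w ^ 2 * exp |w|`. Since `μ` carries no factor `n`, it is expanded to first
order only. -/
lemma phaseRemainder_bounds {η : ℝ} (hη1 : 4 * η ≤ ρ) (hη2 : 3 * η ≤ 1) {n : ℝ} (hn : 1 ≤ n)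
    {x₀ y : ℝ} (hx : |x₀ - c| ≤ η) (hy : |y| ≤ 3 * η) :
    |phaseRemainder E E₁ E₂ μ μ₁ n x₀ y - -(n * E₃ x₀ * y ^ 3 / 6)| ≤ M * (n * y ^ 4 + y ^ 2) ∧
    |phaseRemainder E E₁ E₂ μ μ₁ n x₀ y| ≤ 2 * M * n * |y| ^ 3 + M * y ^ 2 := by
  have hx' : |x₀ - c| + 3 * η ≤ ρ := by linarith
  have t1 := hE.taylor_f hx' hy
  have t2 := hμ.taylor_one hx' hy
  have hη0 : 0 ≤ η := (abs_nonneg _).trans hx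
  have t3 := hE.b3 x₀ (by linarith)
  have hy1 : |y| ≤ 1 := hy.trans hη2
  have e2 : |y| ^ 2 = y ^ 2 := sq_abs y
  have e4 : |y| ^ 4 = y ^ 4 := by rw [show (4 : ℕ) = 2 * 2 from rfl, pow_mul, pow_mul, e2]
  have main : |phaseRemainder E E₁ E₂ μ μ₁ n x₀ y - -(n * E₃ x₀ * y ^ 3 / 6)| ≤
      M * (n * y ^ 4 + y ^ 2) := by
    have : phaseRemainder E E₁ E₂ μ μ₁ n x₀ y - -(n * E₃ x₀ * y ^ 3 / 6) =
        -n * (E (x₀ + y) - E x₀ - E₁ x₀ * y - E₂ x₀ * y ^ 2 / 2 - E₃ x₀ * y ^ 3 / 6) +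
        (μ (x₀ + y) - μ x₀ - μ₁ x₀ * y) := by unfold phaseRemainder; ring
    rw [this]
    refine (abs_add_le _ _).trans ?_
    rw [abs_mul, abs_neg, abs_of_pos (by linarith : (0 : ℝ) < n)]
    have := mul_le_mul_of_nonneg_left t1 (by linarith : (0 : ℝ) ≤ n)
    rw [e4] at this
    rw [e2] at t2
    linarith
  refine ⟨main, ?_⟩
  have h1 : |n * E₃ x₀ * y ^ 3 / 6| ≤ M * n * |y| ^ 3 := by
    rw [abs_div, abs_mul, abs_mul, abs_pow, abs_of_pos (by linarith : (0 : ℝ) < n),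
      abs_of_pos (by norm_num : (0 : ℝ) < 6)]
    have hp : 0 ≤ n * |y| ^ 3 := by positivity
    have := mul_le_mul_of_nonneg_right t3 hp
    have h5 : 0 ≤ |E₃ x₀| * (n * |y| ^ 3) := by positivity
    linarith
  have h2 : y ^ 4 ≤ |y| ^ 3 := by
    rw [← e4]; exact pow_le_pow_of_le_one (abs_nonneg y) hy1 (by norm_num)
  have h3 : M * (n * y ^ 4) ≤ M * n * |y| ^ 3 := by
    rw [mul_assoc]; gcongr
  have h4 := abs_sub_abs_le_abs_sub (phaseRemainder E E₁ E₂ μ μ₁ n x₀ y)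
    (-(n * E₃ x₀ * y ^ 3 / 6))
  rw [abs_neg] at h4
  linarith

set_option maxHeartbeats 800000 in
-- In terms of `T = n y²` every error is a polynomial in `T` divided by `n`, and `exp (θ T)` absorbs
-- polynomials. The comparison holds on the whole line, so it can be integrated against a full
-- Gaussian.
lemma laplace_pointwise {θ : ℝ} (hθ : 0 < θ) :
    ∃ η₀ > 0, 4 * η₀ ≤ ρ ∧ ∀ η, 0 < η → η ≤ η₀ → ∃ C > 0, ∀ n : ℝ, 1 ≤ n → ∀ x₀ : ℝ,
      |x₀ - c| ≤ η → ∀ y : ℝ,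
      |(if |x₀ + y - c| ≤ 2 * η then Real.exp (phaseRemainder E E₁ E₂ μ μ₁ n x₀ y) else 0) -
        (1 - n * E₃ x₀ * y ^ 3 / 6)| ≤ C / n * Real.exp (θ * (n * y ^ 2)) := by
  obtain ⟨C1, hC1, p1⟩ := exists_poly_le_exp 1 (half_pos hθ)
  obtain ⟨C2, hC2, p2⟩ := exists_poly_le_exp 2 (half_pos hθ)
  obtain ⟨C3, hC3, p3⟩ := exists_poly_le_exp 3 (half_pos hθ)
  -- `ρ / 4` keeps `x₀ + y` inside the interval of smoothness, `1 / 3` forces `|y| ≤ 1`, and `θ /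
  -- (12 M)` makes `2 M n |y|³` at most `θ T / 2`.
  refine ⟨min (ρ / 4) (min (1 / 3) (θ / (12 * M))), by positivity, ?_, fun η hη hηle => ?_⟩
  · have := min_le_left (ρ / 4) (min (1 / 3) (θ / (12 * M))); linarith
  have hη1 : 4 * η ≤ ρ := by
    have := hηle.trans (min_le_left _ _); linarith
  have hη2 : 3 * η ≤ 1 := by
    have := hηle.trans ((min_le_right _ _).trans (min_le_left _ _)); linarith
  have hη3 : 12 * M * η ≤ θ := by
    have := hηle.trans ((min_le_right _ _).trans (min_le_right _ _))
    rw [le_div_iff₀ (by positivity)] at this; linarith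
  refine ⟨(8 * M ^ 2 * C3 + 2 * M ^ 2 * C2) * Real.exp M + M * (C2 + C1) + (C1 / η ^ 2 +
    M * (C2 / η)), by positivity, fun n hn x₀ hx y => ?_⟩
  have hn0 : 0 < n := by linarith
  set T := n * y ^ 2 with hT
  have hT0 : 0 ≤ T := by positivity
  set e := Real.exp (θ / 2 * T) with he
  have hee : Real.exp (θ * T) = e * e := by rw [he, ← Real.exp_add]; congr 1; ring
  have he1 : 1 ≤ e := Real.one_le_exp (by positivity)
  have he0 : 0 < e := by linarith
  have q1 := p1 T hT0
  have q2 := p2 T hT0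
  have q3 := p3 T hT0
  rw [pow_one] at q1
  rw [← he] at q1 q2 q3
  rw [hee]
  rw [div_mul_eq_mul_div, le_div_iff₀ hn0]
  split_ifs with hreg
  · have hy : |y| ≤ 3 * η := by
      calc |y| = |(x₀ + y - c) - (x₀ - c)| := by ring_nf
        _ ≤ |x₀ + y - c| + |x₀ - c| := abs_sub _ _
        _ ≤ _ := by linarith
    obtain ⟨b1, b2⟩ := phaseRemainder_bounds hE hμ hρ hM hη1 hη2 hn hx hy
    set w := phaseRemainder E E₁ E₂ μ μ₁ n x₀ y with hw
    have hy1 : |y| ≤ 1 := hy.trans hη2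
    have hysq : y ^ 2 ≤ 1 := by rw [← sq_abs]; exact pow_le_one₀ (abs_nonneg _) hy1
    have hexp : Real.exp |w| ≤ e * Real.exp M := by
      rw [he, ← Real.exp_add]
      refine Real.exp_le_exp.2 (b2.trans ?_)
      have e3 : |y| ^ 3 = |y| * y ^ 2 := by rw [← sq_abs]; ring
      have h1 : 2 * M * n * |y| ^ 3 ≤ θ / 2 * T := by
        rw [e3, hT]
        have h2 : 2 * M * |y| ≤ θ / 2 := by nlinarith
        have h3 : 0 ≤ n * y ^ 2 := hT0
        have := mul_le_mul_of_nonneg_right h2 h3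
        linarith
      have h2 : M * y ^ 2 ≤ M := by nlinarith
      linarith
    have hwsq : n * w ^ 2 ≤ 8 * M ^ 2 * T ^ 3 + 2 * M ^ 2 * T ^ 2 := by
      have h1 : w ^ 2 ≤ (2 * M * n * |y| ^ 3 + M * y ^ 2) ^ 2 := by
        rw [← sq_abs w]; exact pow_le_pow_left₀ (abs_nonneg _) b2 2
      have h2 : (2 * M * n * |y| ^ 3 + M * y ^ 2) ^ 2 ≤
          2 * (2 * M * n * |y| ^ 3) ^ 2 + 2 * (M * y ^ 2) ^ 2 := by
        nlinarith [sq_nonneg (2 * M * n * |y| ^ 3 - M * y ^ 2)]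
      have e6 : (2 * M * n * |y| ^ 3) ^ 2 = 4 * M ^ 2 * n ^ 2 * (y ^ 2) ^ 3 := by
        rw [← sq_abs y]; ring
      have h3 : n * (2 * (2 * M * n * |y| ^ 3) ^ 2 + 2 * (M * y ^ 2) ^ 2) ≤
          8 * M ^ 2 * T ^ 3 + 2 * M ^ 2 * T ^ 2 := by
        rw [e6, hT]
        have h5 : n * (y ^ 2) ^ 2 ≤ (n * y ^ 2) ^ 2 := by
          have : 0 ≤ n * (y ^ 2) ^ 2 * (n - 1) :=
            mul_nonneg (by positivity) (by linarith)
          linarith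
        calc n * (2 * (4 * M ^ 2 * n ^ 2 * (y ^ 2) ^ 3) + 2 * (M * y ^ 2) ^ 2) =
            8 * M ^ 2 * (n * y ^ 2) ^ 3 + 2 * M ^ 2 * (n * (y ^ 2) ^ 2) := by ring
          _ ≤ _ := by gcongr
      exact (mul_le_mul_of_nonneg_left (h1.trans h2) hn0.le).trans h3
    have hr : n * |w - -(n * E₃ x₀ * y ^ 3 / 6)| ≤ M * (T ^ 2 + T) := by
      calc n * |w - -(n * E₃ x₀ * y ^ 3 / 6)| ≤ n * (M * (n * y ^ 4 + y ^ 2)) := by gcongr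
        _ = _ := by rw [hT]; ring
    have hdec : |Real.exp w - (1 - n * E₃ x₀ * y ^ 3 / 6)| ≤
        w ^ 2 * Real.exp |w| + |w - -(n * E₃ x₀ * y ^ 3 / 6)| := by
      have := abs_exp_sub_one_sub_self_le w
      calc |Real.exp w - (1 - n * E₃ x₀ * y ^ 3 / 6)| =
          |(Real.exp w - 1 - w) + (w - -(n * E₃ x₀ * y ^ 3 / 6))| := by ring_nf
        _ ≤ _ := (abs_add_le _ _).trans (by linarith)
    have k1 : n * (w ^ 2 * Real.exp |w|) ≤
        (8 * M ^ 2 * C3 + 2 * M ^ 2 * C2) * Real.exp M * (e * e) := by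
      calc n * (w ^ 2 * Real.exp |w|) = (n * w ^ 2) * Real.exp |w| := by ring
        _ ≤ (8 * M ^ 2 * T ^ 3 + 2 * M ^ 2 * T ^ 2) * (e * Real.exp M) := by gcongr
        _ ≤ (8 * M ^ 2 * (C3 * e) + 2 * M ^ 2 * (C2 * e)) * (e * Real.exp M) := by gcongr
        _ = _ := by ring
    have k2 : M * (T ^ 2 + T) ≤ M * (C2 + C1) * (e * e) := by
      calc M * (T ^ 2 + T) ≤ M * (C2 * e + C1 * e) := by gcongr
        _ = M * (C2 + C1) * e * 1 := by ring
        _ ≤ M * (C2 + C1) * e * e := by gcongr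
        _ = _ := by ring
    have k3 : 0 ≤ (C1 / η ^ 2 + M * (C2 / η)) * (e * e) := by positivity
    calc _ ≤ (w ^ 2 * Real.exp |w| + |w - -(n * E₃ x₀ * y ^ 3 / 6)|) * n := by gcongr
      _ = n * (w ^ 2 * Real.exp |w|) + n * |w - -(n * E₃ x₀ * y ^ 3 / 6)| := by ring
      _ ≤ (8 * M ^ 2 * C3 + 2 * M ^ 2 * C2) * Real.exp M * (e * e) +
          M * (C2 + C1) * (e * e) + (C1 / η ^ 2 + M * (C2 / η)) * (e * e) :=
        (add_le_add k1 (hr.trans k2)).trans (le_add_of_nonneg_right k3)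
      _ = _ := by ring
  -- Outside the window the approximant itself is the error. Here `|y| ≥ η`, so `n ≤ T / η²`
  -- produces the missing factor `1 / n`.
  · have hy : η ≤ |y| := by
      push Not at hreg
      have : |x₀ + y - c| ≤ |y| + |x₀ - c| := by
        calc |x₀ + y - c| = |y + (x₀ - c)| := by ring_nf
          _ ≤ _ := abs_add_le _ _
      linarith
    have t3 := hE.b3 x₀ (by linarith)
    have hb : |0 - (1 - n * E₃ x₀ * y ^ 3 / 6)| ≤ 1 + M * n * |y| ^ 3 := by
      have h1 : |n * E₃ x₀ * y ^ 3 / 6| ≤ M * n * |y| ^ 3 := by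
        rw [abs_div, abs_mul, abs_mul, abs_pow, abs_of_pos hn0,
          abs_of_pos (by norm_num : (0 : ℝ) < 6)]
        have hp : 0 ≤ n * |y| ^ 3 := by positivity
        have := mul_le_mul_of_nonneg_right t3 hp
        have h5 : 0 ≤ |E₃ x₀| * (n * |y| ^ 3) := by positivity
        linarith only [this, h5]
      rw [zero_sub, abs_neg]
      refine (abs_sub _ _).trans ?_
      rw [abs_one]; linarith
    have hsq : η ^ 2 ≤ y ^ 2 := by rw [← sq_abs y]; gcongr
    have h1 : n ≤ T / η ^ 2 := by
      rw [le_div_iff₀ (by positivity), hT]; gcongr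
    have h2 : n * (n * |y| ^ 3) ≤ T ^ 2 / η := by
      rw [le_div_iff₀ hη, hT]
      have e4 : (n * y ^ 2) ^ 2 = n * (n * |y| ^ 3) * |y| := by rw [← sq_abs y]; ring
      rw [e4]; gcongr
    have k0 : 0 ≤ ((8 * M ^ 2 * C3 + 2 * M ^ 2 * C2) * Real.exp M + M * (C2 + C1)) * (e * e) := by
      positivity
    have k1 : T / η ^ 2 ≤ C1 / η ^ 2 * (e * e) := by
      rw [div_mul_eq_mul_div]
      refine div_le_div_of_nonneg_right ?_ (by positivity)
      calc T ≤ C1 * e * 1 := by linarith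
        _ ≤ C1 * e * e := by gcongr
        _ = _ := by ring
    have k2 : M * (T ^ 2 / η) ≤ M * (C2 / η) * (e * e) := by
      rw [mul_assoc, div_mul_eq_mul_div]
      refine mul_le_mul_of_nonneg_left (div_le_div_of_nonneg_right ?_ hη.le) hM.le
      calc T ^ 2 ≤ C2 * e * 1 := by linarith
        _ ≤ C2 * e * e := by gcongr
        _ = _ := by ring
    calc |0 - (1 - n * E₃ x₀ * y ^ 3 / 6)| * n ≤ (1 + M * n * |y| ^ 3) * n := by gcongr
      _ = n + M * (n * (n * |y| ^ 3)) := by ring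
      _ ≤ T / η ^ 2 + M * (T ^ 2 / η) := by gcongr
      _ ≤ ((8 * M ^ 2 * C3 + 2 * M ^ 2 * C2) * Real.exp M + M * (C2 + C1)) * (e * e) +
          (C1 / η ^ 2 * (e * e) + M * (C2 / η) * (e * e)) :=
        (add_le_add k1 k2).trans (le_add_of_nonneg_left k0)
      _ = _ := by ring

end Laplace

/-- The normalised distance of the saddle from `x₀`. -/
noncomputable def saddleX (E₁ E₂ μ₁ : ℝ → ℝ) (n x₀ m : ℝ) : ℝ :=
  (2 * m - n * E₁ x₀ + μ₁ x₀) / √(n * E₂ x₀)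

/-- The normalised third cumulant of the phase at `x₀`. -/
noncomputable def phaseSkew (E₂ E₃ : ℝ → ℝ) (n x₀ : ℝ) : ℝ :=
  E₃ x₀ / (6 * E₂ x₀ * √(n * E₂ x₀))

/-- The Laplace integrand. -/
noncomputable def laplaceIntegrand (E μ : ℝ → ℝ) (n m x₀ x : ℝ) : ℝ :=
  Real.exp (2 * m * (x - x₀) - n * (E x - E x₀) + (μ x - μ x₀))

/-- The prefactor of the Laplace approximation. -/
noncomputable def gaussWeight (E₂ : ℝ → ℝ) (n x₀ X : ℝ) : ℝ :=
  √(2 * π / (n * E₂ x₀)) * Real.exp (X ^ 2 / 2)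

section LaplaceIntegral

variable {E E₁ E₂ E₃ E₄ μ μ₁ μ₂ μ₃ μ₄ : ℝ → ℝ} {c ρ M κ₀ : ℝ}
  (hE : SmoothNear E E₁ E₂ E₃ E₄ c ρ M) (hμ : SmoothNear μ μ₁ μ₂ μ₃ μ₄ c ρ M)
include hE hμ

lemma laplaceIntegrand_integrableOn {η : ℝ} (hη : 2 * η ≤ ρ) (n m x₀ : ℝ) :
    IntegrableOn (laplaceIntegrand E μ n m x₀) {x | |x - c| ≤ 2 * η} := by
  have hset : {x : ℝ | |x - c| ≤ 2 * η} = Metric.closedBall c (2 * η) := by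
    ext x; simp [Real.dist_eq]
  rw [hset]
  refine ContinuousOn.integrableOn_compact (isCompact_closedBall _ _) fun x hx => ?_
  have hx' : |x - c| ≤ ρ := by
    have : |x - c| ≤ 2 * η := by simpa [Real.dist_eq] using hx
    linarith
  have c1 := (hE.d0 x hx').continuousAt
  have c2 := (hμ.d0 x hx').continuousAt
  unfold laplaceIntegrand
  exact ContinuousAt.continuousWithinAt (by fun_prop)

/-- After translation by `x₀` the quadratic part is a Gaussian with `2b = n κ` and linear
coefficient `X √(n κ)`, and the cubic term is its third moment. The pointwise error merely widens
the Gaussian slightly, which costs the factor `exp (θ X²)`. -/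
lemma laplace_integral (hρ : 0 < ρ) (hM : 0 < M) (hκ₀ : 0 < κ₀)
    (hκ : ∀ x, |x - c| ≤ ρ → κ₀ ≤ E₂ x) {θ : ℝ} (hθ : 0 < θ) :
    ∃ η₀ > 0, 4 * η₀ ≤ ρ ∧ ∀ η, 0 < η → η ≤ η₀ → ∃ C > 0, ∀ n : ℝ, 1 ≤ n → ∀ x₀ : ℝ,
      |x₀ - c| ≤ η → ∀ m : ℝ,
      |(∫ x in {x | |x - c| ≤ 2 * η}, laplaceIntegrand E μ n m x₀ x) -
        gaussWeight E₂ n x₀ (saddleX E₁ E₂ μ₁ n x₀ m) * (1 - phaseSkew E₂ E₃ n x₀ *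
          (saddleX E₁ E₂ μ₁ n x₀ m ^ 3 + 3 * saddleX E₁ E₂ μ₁ n x₀ m))| ≤
      C / n * (gaussWeight E₂ n x₀ (saddleX E₁ E₂ μ₁ n x₀ m) *
        Real.exp (θ * saddleX E₁ E₂ μ₁ n x₀ m ^ 2)) := by
  -- For `t ≤ 1 / 2` one has `(1 + 2t)(1 - t) ≥ 1`, hence `X² / (2(1 - t)) ≤ X² / 2 + θ X²` after
  -- the Gaussian has been widened by `1 - t`.
  set t := min (1 / 2) θ with ht
  have ht0 : 0 < t := by positivity
  have ht1 : t ≤ 1 / 2 := min_le_left _ _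
  have htθ : t ≤ θ := min_le_right _ _
  obtain ⟨η₀, hη₀, hηρ, hmain⟩ := laplace_pointwise hE hμ hρ hM
    (θ := κ₀ * t / 2) (by positivity)
  refine ⟨η₀, hη₀, hηρ, fun η hη hηle => ?_⟩
  obtain ⟨C, hC, hpt⟩ := hmain η hη hηle
  refine ⟨2 * C, by positivity, fun n hn x₀ hx m => ?_⟩
  have hn0 : 0 < n := by linarith
  set κ := E₂ x₀ with hκdef
  have hκx : κ₀ ≤ κ := hκ x₀ (by linarith)
  have hκ0 : 0 < κ := by linarith
  set X := saddleX E₁ E₂ μ₁ n x₀ m with hX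
  set α := 2 * m - n * E₁ x₀ + μ₁ x₀ with hα
  set S := √(n * κ) with hS
  have hS0 : 0 < S := Real.sqrt_pos.2 (by positivity)
  have hSS : S ^ 2 = n * κ := Real.sq_sqrt (by positivity)
  have hαX : α = X * S := by rw [hX, saddleX, div_mul_cancel₀ _ hS0.ne']
  set b := n * κ / 2 with hb
  have hb0 : 0 < b := by positivity
  have hbS : 2 * b = S ^ 2 := by rw [hSS, hb]; ring
  set b' := b - κ₀ * t / 2 * n with hb'
  have hb'b : b * (1 - t) ≤ b' := by
    have h2 : n * t * κ₀ ≤ n * t * κ := by gcongr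
    rw [hb', hb]; linarith
  have hb'0 : 0 < b' := lt_of_lt_of_le (mul_pos hb0 (by linarith)) hb'b
  -- change of variables
  have hset : MeasurableSet {x : ℝ | |x - c| ≤ 2 * η} :=
    measurableSet_le (by fun_prop) measurable_const
  set F : ℝ → ℝ := fun y => Real.exp (α * y - b * y ^ 2) *
    (if |x₀ + y - c| ≤ 2 * η then Real.exp (phaseRemainder E E₁ E₂ μ μ₁ n x₀ y) else 0) with hF
  have hFeq : ∀ y, F y = ({x | |x - c| ≤ 2 * η} : Set ℝ).indicator
      (laplaceIntegrand E μ n m x₀) (x₀ + y) := by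
    intro y
    simp only [hF, Set.indicator, Set.mem_ofPred_eq]
    split_ifs
    · rw [laplaceIntegrand, ← Real.exp_add]
      congr 1
      rw [phaseRemainder, hα, hb, hκdef]; ring
    · simp
  have hHF : ∫ x in {x | |x - c| ≤ 2 * η}, laplaceIntegrand E μ n m x₀ x = ∫ y, F y := by
    rw [← integral_indicator hset, ← integral_add_left_eq_self _ x₀]
    simp only [hFeq]
  have hFi : Integrable F := by
    have h1 := (laplaceIntegrand_integrableOn hE hμ (η := η) (by linarith) n m
      x₀).integrable_indicator hset
    have h2 := h1.comp_add_left x₀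
    exact h2.congr (Eventually.of_forall fun y => (hFeq y).symm)
  set G : ℝ → ℝ := fun y => Real.exp (α * y - b * y ^ 2) -
    n * E₃ x₀ / 6 * (y ^ 3 * Real.exp (α * y - b * y ^ 2)) with hG
  have i0 : Integrable fun y : ℝ => Real.exp (α * y - b * y ^ 2) := by
    simpa using integrable_pow_mul_gaussian 0 α hb0
  have i3 := (integrable_pow_mul_gaussian 3 α hb0).const_mul (n * E₃ x₀ / 6)
  have hGi : Integrable G := i0.sub i3
  have hJ0 : ∫ y : ℝ, Real.exp (α * y - b * y ^ 2) = gaussWeight E₂ n x₀ X := by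
    rw [integral_gaussian_linear α hb0, gaussWeight, ← hκdef]
    congr 2
    · rw [hb]; field_simp
    · rw [hαX, mul_pow, hSS, hb]; field_simp; ring
  set J := gaussWeight E₂ n x₀ X with hJ
  have hJpos : 0 ≤ J := by rw [hJ, gaussWeight]; positivity
  have hGint : ∫ y, G y = J * (1 - phaseSkew E₂ E₃ n x₀ * (X ^ 3 + 3 * X)) := by
    simp only [hG]
    rw [integral_sub i0 i3, integral_const_mul, gaussian_third_moment α hb0, hJ0, hbS, hαX,
      phaseSkew, ← hκdef, ← hS]
    have : n = S ^ 2 / κ := by rw [hSS]; field_simp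
    rw [this]
    field_simp
  have hbound : ∀ y, |F y - G y| ≤ C / n * Real.exp (α * y - b' * y ^ 2) := by
    intro y
    have h1 := hpt n hn x₀ hx y
    have e1 : F y - G y = Real.exp (α * y - b * y ^ 2) *
      ((if |x₀ + y - c| ≤ 2 * η then Real.exp (phaseRemainder E E₁ E₂ μ μ₁ n x₀ y) else 0) -
        (1 - n * E₃ x₀ * y ^ 3 / 6)) := by simp only [hF, hG]; ring
    rw [e1, abs_mul, Real.abs_exp]
    refine (mul_le_mul_of_nonneg_left h1 (Real.exp_pos _).le).trans (le_of_eq ?_)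
    rw [mul_left_comm, ← Real.exp_add]
    congr 2
    rw [hb']; ring
  have ib' : Integrable fun y : ℝ => Real.exp (α * y - b' * y ^ 2) := by
    simpa using integrable_pow_mul_gaussian 0 α hb'0
  rw [hHF, ← hGint, ← integral_sub hFi hGi]
  calc |∫ y, (F y - G y)| ≤ ∫ y, |F y - G y| := abs_integral_le_integral_abs
    _ ≤ ∫ y, C / n * Real.exp (α * y - b' * y ^ 2) :=
        integral_mono (hFi.sub hGi).abs (ib'.const_mul _) hbound
    _ = C / n * (√(π / b') * Real.exp (α ^ 2 / (4 * b'))) := by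
        rw [integral_const_mul, integral_gaussian_linear α hb'0]
    _ ≤ C / n * (2 * √(2 * π / (n * κ)) * Real.exp (X ^ 2 / 2 + θ * X ^ 2)) := by
        have hle1 : √(π / b') ≤ 2 * √(2 * π / (n * κ)) := by
          have : (2 : ℝ) * √(2 * π / (n * κ)) = √(4 * (2 * π / (n * κ))) := by
            rw [Real.sqrt_mul (by norm_num), show (4 : ℝ) = 2 ^ 2 by norm_num,
              Real.sqrt_sq (by norm_num)]
          rw [this]
          refine Real.sqrt_le_sqrt ?_
          have h2 : b / 2 ≤ b' := by nlinarith
          calc π / b' ≤ π / (b / 2) := by gcongr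
            _ ≤ 4 * (2 * π / (n * κ)) := by
              rw [hb]; rw [div_le_iff₀ (by positivity)]; field_simp; norm_num
        have hle2 : α ^ 2 / (4 * b') ≤ X ^ 2 / 2 + θ * X ^ 2 := by
          rw [div_le_iff₀ (by positivity), hαX, mul_pow, ← hbS]
          have h1 : (1 : ℝ) ≤ (1 + 2 * t) * (1 - t) := by nlinarith
          have hX2 : 0 ≤ X ^ 2 := sq_nonneg X
          have h2 : X ^ 2 * (2 * b) ≤ (X ^ 2 / 2 + t * X ^ 2) * (4 * (b * (1 - t))) := by
            have : (X ^ 2 / 2 + t * X ^ 2) * (4 * (b * (1 - t))) =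
              X ^ 2 * (2 * b) * ((1 + 2 * t) * (1 - t)) := by ring
            rw [this]
            exact le_mul_of_one_le_right (by positivity) h1
          have h3 : X ^ 2 / 2 + t * X ^ 2 ≤ X ^ 2 / 2 + θ * X ^ 2 := by gcongr
          have h4 : 4 * (b * (1 - t)) ≤ 4 * b' := by gcongr
          have h5 : 0 ≤ 4 * (b * (1 - t)) :=
            mul_nonneg (by norm_num) (mul_nonneg hb0.le (by linarith))
          exact h2.trans (mul_le_mul h3 h4 h5 (by positivity))
        gcongr
    _ = 2 * C / n * (J * Real.exp (θ * X ^ 2)) := by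
        rw [hJ, gaussWeight, ← hκdef, Real.exp_add]; ring

set_option maxHeartbeats 800000 in
/-- Reciprocals of localised Laplace integrals. -/
lemma laplace_reciprocal (hρ : 0 < ρ) (hM : 0 < M) (hκ₀ : 0 < κ₀)
    (hκ : ∀ x, |x - c| ≤ ρ → κ₀ ≤ E₂ x) {θ : ℝ} (hθ : 0 < θ) (hθ8 : θ ≤ 1 / 8) :
    ∃ η₀ > 0, 4 * η₀ ≤ ρ ∧ ∀ η, 0 < η → η ≤ η₀ → ∃ C > 0, ∃ n₀ : ℝ, 1 ≤ n₀ ∧ ∀ n : ℝ, n₀ ≤ n →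
      ∀ x₀ : ℝ, |x₀ - c| ≤ η → ∀ m : ℝ,
      4 * θ * saddleX E₁ E₂ μ₁ n x₀ m ^ 2 ≤ Real.log n →
      gaussWeight E₂ n x₀ (saddleX E₁ E₂ μ₁ n x₀ m) / 2 ≤
        (∫ x in {x | |x - c| ≤ 2 * η}, laplaceIntegrand E μ n m x₀ x) ∧
      |(∫ x in {x | |x - c| ≤ 2 * η}, laplaceIntegrand E μ n m x₀ x)⁻¹ -
        (gaussWeight E₂ n x₀ (saddleX E₁ E₂ μ₁ n x₀ m))⁻¹ * (1 + phaseSkew E₂ E₃ n x₀ *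
          (saddleX E₁ E₂ μ₁ n x₀ m ^ 3 + 3 * saddleX E₁ E₂ μ₁ n x₀ m))| ≤
      C / n * ((gaussWeight E₂ n x₀ (saddleX E₁ E₂ μ₁ n x₀ m))⁻¹ *
        Real.exp (2 * θ * saddleX E₁ E₂ μ₁ n x₀ m ^ 2)) := by
  obtain ⟨η₀, hη₀, hηρ, hmain⟩ := laplace_integral hE hμ hρ hM hκ₀ hκ hθ
  refine ⟨η₀, hη₀, hηρ, fun η hη hηle => ?_⟩
  obtain ⟨C, hC, hlap⟩ := hmain η hη hηle
  -- a bound for the cubic correction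
  obtain ⟨D1, hD1, q1⟩ := exists_poly_le_exp 1 hθ
  obtain ⟨D3, hD3, q3⟩ := exists_poly_le_exp 3 hθ
  set D := M / (6 * κ₀ * √κ₀) with hD
  have hD0 : 0 < D := by positivity
  set P := D ^ 2 * (2 * D3 + 18 * D1) with hP
  have hP0 : 0 < P := by positivity
  have hskew : ∀ n : ℝ, 1 ≤ n → ∀ x₀, |x₀ - c| ≤ η → ∀ X : ℝ,
      n * (phaseSkew E₂ E₃ n x₀ * (X ^ 3 + 3 * X)) ^ 2 ≤ P * Real.exp (θ * X ^ 2) := by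
    intro n hn x₀ hx X
    have hn0 : 0 < n := by linarith
    have hκx := hκ x₀ (by linarith)
    have hκ0 : 0 < E₂ x₀ := by linarith
    have h3 := hE.b3 x₀ (by linarith)
    have hs : n * phaseSkew E₂ E₃ n x₀ ^ 2 ≤ D ^ 2 := by
      have e1 : n * phaseSkew E₂ E₃ n x₀ ^ 2 = |E₃ x₀| ^ 2 / (36 * E₂ x₀ ^ 2 * E₂ x₀) := by
        rw [phaseSkew, div_pow, mul_pow, Real.sq_sqrt (by positivity), sq_abs]
        field_simp; norm_num
      have e2 : D ^ 2 = M ^ 2 / (36 * κ₀ ^ 2 * κ₀) := by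
        rw [hD, div_pow, mul_pow, Real.sq_sqrt hκ₀.le]; ring
      rw [e1, e2]
      gcongr
    have hX : (X ^ 3 + 3 * X) ^ 2 ≤ 2 * (X ^ 2) ^ 3 + 18 * X ^ 2 := by
      nlinarith [sq_nonneg (X ^ 3 - 3 * X)]
    have r1 := q1 (X ^ 2) (sq_nonneg X)
    have r3 := q3 (X ^ 2) (sq_nonneg X)
    rw [pow_one] at r1
    calc n * (phaseSkew E₂ E₃ n x₀ * (X ^ 3 + 3 * X)) ^ 2 =
        n * phaseSkew E₂ E₃ n x₀ ^ 2 * (X ^ 3 + 3 * X) ^ 2 := by ring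
      _ ≤ D ^ 2 * (2 * (X ^ 2) ^ 3 + 18 * X ^ 2) := by gcongr
      _ ≤ D ^ 2 * (2 * (D3 * Real.exp (θ * X ^ 2)) + 18 * (D1 * Real.exp (θ * X ^ 2))) := by
          gcongr
      _ = _ := by rw [hP]; ring
  -- Chosen so that `B exp (2θX²) ≤ n` makes the relative error at most `1/16` and the cubic
  -- correction at most `1/4`. The integral then stays above half of its Gaussian value and can be
  -- inverted.
  set B := 16 * (P + C + 1) ^ 2 with hB
  refine ⟨4 * (P + C) + 4 * C, by positivity, max 1 (B ^ 2), le_max_left _ _,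
    fun n hn x₀ hx m hm => ?_⟩
  have hn1 : 1 ≤ n := (le_max_left _ _).trans hn
  have hn0 : 0 < n := by linarith
  have hnB : B ^ 2 ≤ n := (le_max_right _ _).trans hn
  have h1 := hlap n hn1 x₀ hx m
  set X := saddleX E₁ E₂ μ₁ n x₀ m with hX
  set J := gaussWeight E₂ n x₀ X with hJ
  set p := phaseSkew E₂ E₃ n x₀ * (X ^ 3 + 3 * X) with hp
  set H := ∫ x in {x | |x - c| ≤ 2 * η}, laplaceIntegrand E μ n m x₀ x with hH
  have hκx := hκ x₀ (by linarith)
  have hκ0 : 0 < E₂ x₀ := by linarith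
  have hJ0 : 0 < J := by rw [hJ, gaussWeight]; positivity
  have hp2 := hskew n hn1 x₀ hx X
  rw [← hp] at hp2
  set e := Real.exp (θ * X ^ 2) with he
  have he1 : 1 ≤ e := Real.one_le_exp (by positivity)
  have hee : Real.exp (2 * θ * X ^ 2) = e * e := by rw [he, ← Real.exp_add]; congr 1; ring
  have hen : e ^ 4 ≤ n := by
    rw [he, ← Real.exp_nat_mul]
    calc Real.exp ((4 : ℕ) * (θ * X ^ 2)) ≤ Real.exp (Real.log n) := by
          refine Real.exp_le_exp.2 ?_; push_cast; linarith
      _ = n := Real.exp_log hn0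
  -- `B e² ≤ n` since both `B²` and `e⁴` are at most `n`
  have hBe : B * (e * e) ≤ n := by
    have : (B * (e * e)) ^ 2 ≤ n ^ 2 := by
      calc (B * (e * e)) ^ 2 = B ^ 2 * e ^ 4 := by ring
        _ ≤ n * n := by gcongr
        _ = n ^ 2 := by ring
    exact le_of_sq_le_sq this hn0.le
  -- With `y = 1 - p + r` one has `1 - (1 + p) y = p² - r - p r`, so inverting costs `p²` and `r`,
  -- both of order `exp (θX²) / n`.
  set y := H / J with hy
  set r := y - (1 - p) with hr
  have hrb : n * |r| ≤ C * e := by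
    have : |H - J * (1 - p)| = J * |r| := by
      rw [hr, hy, ← abs_of_pos hJ0, ← abs_mul, abs_of_pos hJ0]
      congr 1; field_simp
    rw [this, div_mul_eq_mul_div, le_div_iff₀ hn0] at h1
    have h2 : J * (n * |r|) ≤ J * (C * e) := by linarith
    exact le_of_mul_le_mul_left h2 hJ0
  have hCB : 16 * (C + P) ≤ B := by
    have h2 : 0 ≤ (P + C) ^ 2 := by positivity
    have h3 : B = 16 * (P + C) ^ 2 + 32 * (P + C) + 16 := by rw [hB]; ring
    linarith
  have hr4 : |r| ≤ 1 / 16 := by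
    have h5 : 16 * (C * e) ≤ B * (e * e) := by
      calc 16 * (C * e) = 16 * C * (e * 1) := by ring
        _ ≤ 16 * (C + P) * (e * e) := by
          gcongr
          linarith
        _ ≤ B * (e * e) := by gcongr
    have h6 : n * (16 * |r|) ≤ n * 1 := by linarith
    have := le_of_mul_le_mul_left h6 hn0
    linarith
  have hp4 : |p| ≤ 1 / 4 := by
    have h5 : 16 * (P * e) ≤ B * (e * e) := by
      calc 16 * (P * e) = 16 * P * (e * 1) := by ring
        _ ≤ 16 * (C + P) * (e * e) := by
          gcongr
          linarith
        _ ≤ B * (e * e) := by gcongr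
    have h6 : n * (16 * p ^ 2) ≤ n * 1 := by linarith
    have h7 := le_of_mul_le_mul_left h6 hn0
    refine abs_le_of_sq_le_sq ?_ (by norm_num)
    linarith
  have hy2 : 1 / 2 ≤ y := by
    have e1 : y = 1 - p + r := by rw [hr]; ring
    have := neg_abs_le r
    have := le_abs_self p
    rw [e1]; linarith
  have hHJ : H = J * y := by rw [hy]; field_simp
  refine ⟨by rw [hHJ, div_eq_mul_one_div]; gcongr, ?_⟩
  have hy0 : 0 < y := by linarith
  have e2 : H⁻¹ - J⁻¹ * (1 + p) = J⁻¹ * ((p ^ 2 - r - p * r) / y) := by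
    have e1 : y = 1 - p + r := by rw [hr]; ring
    rw [hHJ]
    have : p ^ 2 - r - p * r = 1 - (1 + p) * y := by rw [e1]; ring
    rw [this]; field_simp
  rw [e2, abs_mul, abs_of_pos (inv_pos.2 hJ0), hee, abs_div, abs_of_pos hy0]
  have h8 : |p ^ 2 - r - p * r| ≤ p ^ 2 + 2 * |r| := by
    have h9 : |p * r| ≤ |r| := by
      rw [abs_mul]; exact mul_le_of_le_one_left (abs_nonneg r) (by linarith)
    calc |p ^ 2 - r - p * r| ≤ |p ^ 2 - r| + |p * r| := abs_sub _ _
      _ ≤ |p ^ 2| + |r| + |p * r| := by gcongr; exact abs_sub _ _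
      _ ≤ _ := by rw [abs_of_nonneg (sq_nonneg p)]; linarith
  have h10 : |p ^ 2 - r - p * r| / y ≤ 2 * (p ^ 2 + 2 * |r|) := by
    rw [div_le_iff₀ hy0]
    have h9 : 0 ≤ p ^ 2 + 2 * |r| := by positivity
    calc _ ≤ 2 * (p ^ 2 + 2 * |r|) * (1 / 2) := by linarith
      _ ≤ _ := by gcongr
  have h11 : 2 * (p ^ 2 + 2 * |r|) ≤ (4 * (P + C) + 4 * C) / n * (e * e) := by
    rw [div_mul_eq_mul_div, le_div_iff₀ hn0]
    have h12 : e ≤ e * e := le_mul_of_one_le_left (by positivity) he1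
    have h13 : P * e ≤ P * (e * e) := by gcongr
    have h14 : C * e ≤ C * (e * e) := by gcongr
    have h15 : 0 ≤ P * (e * e) := by positivity
    have h16 : 0 ≤ C * (e * e) := by positivity
    linarith
  calc J⁻¹ * (|p ^ 2 - r - p * r| / y) ≤ J⁻¹ * ((4 * (P + C) + 4 * C) / n * (e * e)) := by
        gcongr; exact h10.trans h11
    _ = _ := by ring

end LaplaceIntegral

/-! ### Lattice sums and the trapezoidal rule -/

/-- Exponential sums over a shifted lattice. -/
lemma tsum_exp_neg_lattice {h : ℝ} (hh : 0 < h) (b : ℝ) :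
    Summable (fun k : ℤ => Real.exp (-|b + h * k|)) ∧
      ∑' k : ℤ, Real.exp (-|b + h * k|) ≤ 2 * Real.exp (h / 2) / (1 - Real.exp (-h)) := by
  have hr1 : Real.exp (-h) < 1 := by rw [Real.exp_lt_one_iff]; linarith
  have hg : HasSum (fun n : ℕ => Real.exp (-h) ^ n) (1 - Real.exp (-h))⁻¹ :=
    hasSum_geometric_of_lt_one (Real.exp_pos _).le hr1
  have h0 : 0 < 1 - Real.exp (-h) := by linarith
  have hpow : ∀ n : ℕ, Real.exp (-h) ^ n = Real.exp (-(h * n)) := fun n => by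
    rw [← Real.exp_nat_mul]; congr 1; ring
  have hsum : HasSum (fun k : ℤ => Real.exp (-(h * |(k : ℝ)|)))
      ((1 - Real.exp (-h))⁻¹ + Real.exp (-h) * (1 - Real.exp (-h))⁻¹) := by
    refine HasSum.of_nat_of_neg_add_one ?_ ?_
    · have e : (fun n : ℕ => Real.exp (-h) ^ n) =
          fun n : ℕ => Real.exp (-(h * |((n : ℤ) : ℝ)|)) := by
        funext n; rw [hpow]; simp
      rwa [← e]
    · have e : (fun n : ℕ => Real.exp (-h) * Real.exp (-h) ^ n) =
          fun n : ℕ => Real.exp (-(h * |((-((n : ℤ) + 1) : ℤ) : ℝ)|)) := by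
        funext n
        rw [hpow, ← Real.exp_add]
        push_cast
        rw [abs_neg, abs_of_nonneg (by positivity)]
        congr 1; ring
      rw [← e]
      exact hg.mul_left _
  -- Reindexing by the integer nearest to `b / h` removes the shift at the price of at most `h / 2`
  -- in the exponent.
  have hsum' := ((Equiv.addRight (round (b / h))).hasSum_iff.2 hsum).mul_left (Real.exp (h / 2))
  have hle : ∀ k : ℤ, Real.exp (-|b + h * k|) ≤ Real.exp (h / 2) *
      ((fun k : ℤ => Real.exp (-(h * |(k : ℝ)|))) ∘ Equiv.addRight (round (b / h))) k := by
    intro k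
    simp only [Function.comp, Equiv.coe_addRight, ← Real.exp_add]
    refine Real.exp_le_exp.2 ?_
    have h1 := abs_sub_round (b / h)
    have h2 : b + h * k = h * ((k + round (b / h) : ℤ) : ℝ) + h * (b / h - round (b / h)) := by
      push_cast; field_simp; ring
    have h3 : |h * ((k + round (b / h) : ℤ) : ℝ)| ≤
        |b + h * k| + |h * (b / h - round (b / h))| := by
      rw [h2]
      set u := h * ((k + round (b / h) : ℤ) : ℝ)
      set w := h * (b / h - round (b / h))
      calc |u| = |(u + w) - w| := by ring_nf
        _ ≤ |u + w| + |w| := abs_sub _ _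
    rw [abs_mul, abs_mul, abs_of_pos hh] at h3
    have h4 : h * |b / h - round (b / h)| ≤ h * (1 / 2) := by gcongr
    linarith
  have hs : Summable (fun k : ℤ => Real.exp (-|b + h * k|)) :=
    Summable.of_nonneg_of_le (fun _ => (Real.exp_pos _).le) hle hsum'.summable
  refine ⟨hs, (hs.tsum_le_tsum hle hsum'.summable).trans ?_⟩
  rw [hsum'.tsum_eq]
  have h5 : 0 < (1 - Real.exp (-h))⁻¹ := inv_pos.2 h0
  have h6 : Real.exp (-h) * (1 - Real.exp (-h))⁻¹ ≤ (1 - Real.exp (-h))⁻¹ :=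
    mul_le_of_le_one_left h5.le hr1.le
  calc _ ≤ Real.exp (h / 2) * ((1 - Real.exp (-h))⁻¹ + (1 - Real.exp (-h))⁻¹) := by gcongr
    _ = _ := by ring

lemma tsum_exp_neg_lattice_le {h : ℝ} (hh : 0 < h) (hh1 : h ≤ 1) (b : ℝ) :
    ∑' k : ℤ, Real.exp (-|b + h * k|) ≤ 8 / h := by
  refine (tsum_exp_neg_lattice hh b).2.trans ?_
  have h1 : Real.exp (h / 2) ≤ 2 := by
    calc Real.exp (h / 2) ≤ Real.exp (1 / 2) := Real.exp_le_exp.2 (by linarith)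
      _ ≤ 2 := by
        have := Real.exp_one_lt_d9
        rw [Real.exp_half]
        exact Real.sqrt_le_iff.2 ⟨by norm_num, by linarith⟩
  have h2 : h / 2 ≤ 1 - Real.exp (-h) := by
    have h3 := Real.add_one_le_exp h
    have h4 : Real.exp (-h) ≤ (1 + h)⁻¹ := by
      rw [Real.exp_neg]; exact inv_anti₀ (by linarith) (by linarith)
    have h5 : (1 + h)⁻¹ ≤ 1 - h / 2 := by
      rw [inv_le_iff_one_le_mul₀ (by linarith)]; nlinarith
    linarith
  calc 2 * Real.exp (h / 2) / (1 - Real.exp (-h)) ≤ 2 * 2 / (h / 2) := by gcongr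
    _ = 8 / h := by field_simp; norm_num

/-- One cell of the trapezoidal rule. -/
lemma trapezoid_cell {φ φ₁ φ₂ : ℝ → ℝ} (h1 : ∀ x, HasDerivAt φ (φ₁ x) x)
    (h2 : ∀ x, HasDerivAt φ₁ (φ₂ x) x) {x h ζ : ℝ} (hh : 0 ≤ h)
    (hb : ∀ y, |y| ≤ h → |φ₂ (x + y)| ≤ ζ) :
    |(∫ u in x..(x + h), φ u) - h * (φ x + φ (x + h)) / 2| ≤ ζ / 2 * h ^ 3 := by
  have hφ : Continuous φ := continuous_iff_continuousAt.2 fun y => (h1 y).continuousAt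
  have s1 : ∀ y, HasDerivAt (fun y => φ (x + y)) (φ₁ (x + y)) y := fun y => by
    simpa using (h1 (x + y)).comp_const_add x y
  have s2 : ∀ y, HasDerivAt (fun y => φ₁ (x + y)) (φ₂ (x + y)) y := fun y => by
    simpa using (h2 (x + y)).comp_const_add x y
  have s0 : ∀ y, HasDerivAt (fun y => ∫ u in x..(x + y), φ u) (φ (x + y)) y := fun y => by
    have := intervalIntegral.integral_hasDerivAt_right (a := x) (b := x + y)
      (hφ.intervalIntegrable _ _) (hφ.stronglyMeasurableAtFilter _ _) hφ.continuousAt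
    simpa using this.comp_const_add x y
  -- Differentiated twice in the width of the cell, the error of the rule becomes `-y φ₂ / 2`. Two
  -- integrations from 0 give the cube.
  have key := abs_le_pow_succ_of_hasDerivAt
    (h := fun y => (∫ u in x..(x + y), φ u) - y * (φ x + φ (x + y)) / 2)
    (h' := fun y => (φ (x + y) - φ x - y * φ₁ (x + y)) / 2) (η := h) (C := ζ / 2) (k := 2)
    (by simp)
    (fun y _ => by
      refine ((s0 y).sub (((hasDerivAt_id y).mul ((s1 y).const_add (φ x))).div_const 2)).congr_deriv
        ?_
      simp; ring)
    (fun y hy => ?_) (y := h) (by rw [abs_of_nonneg hh])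
  · rwa [abs_of_nonneg hh] at key
  · have := abs_le_pow_succ_of_hasDerivAt
      (h := fun y => (φ (x + y) - φ x - y * φ₁ (x + y)) / 2)
      (h' := fun y => -(y * φ₂ (x + y)) / 2) (η := h) (C := ζ / 2) (k := 1) (by simp)
      (fun y _ => by
        refine ((((s1 y).sub_const (φ x)).sub ((hasDerivAt_id y).mul (s2 y))).div_const
          2).congr_deriv ?_
        simp)
      (fun y hy => by
        rw [abs_div, abs_neg, abs_mul, abs_two, pow_one]
        have := hb y hy
        have h5 : |y| * |φ₂ (x + y)| ≤ |y| * ζ := by gcongr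
        linarith) hy
    exact this

/-- `φ` and its first two derivatives decay exponentially. -/
structure ExpDecay (φ φ₁ φ₂ : ℝ → ℝ) (D : ℝ) : Prop where
  d0 : ∀ x, HasDerivAt φ (φ₁ x) x
  d1 : ∀ x, HasDerivAt φ₁ (φ₂ x) x
  b0 : ∀ x, |φ x| ≤ D * Real.exp (-|x|)
  b1 : ∀ x, |φ₁ x| ≤ D * Real.exp (-|x|)
  b2 : ∀ x, |φ₂ x| ≤ D * Real.exp (-|x|)

namespace ExpDecay

variable {φ φ₁ φ₂ : ℝ → ℝ} {D : ℝ} (hφ : ExpDecay φ φ₁ φ₂ D)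
include hφ

lemma continuous : Continuous φ :=
  continuous_iff_continuousAt.2 fun y => (hφ.d0 y).continuousAt

lemma nonneg : 0 ≤ D := by
  have := (abs_nonneg _).trans (hφ.b0 0)
  simpa using this

lemma lipschitz (x y : ℝ) : |φ y - φ x| ≤ D * |y - x| := by
  have := Convex.norm_image_sub_le_of_norm_hasDerivWithin_le (f := φ) (f' := φ₁)
    (s := Set.univ) (x := x) (y := y) (C := D) (fun x _ => (hφ.d0 x).hasDerivWithinAt)
    (fun x _ => (hφ.b1 x).trans (mul_le_of_le_one_right hφ.nonneg
      (Real.exp_le_one_iff.2 (by simp)))) convex_univ (Set.mem_univ _) (Set.mem_univ _)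
  simpa using this

lemma integrable : Integrable φ := by
  refine (integrable_inv_one_add_sq.const_mul (2 * D)).mono' hφ.continuous.aestronglyMeasurable
    (Eventually.of_forall fun x => (hφ.b0 x).trans ?_)
  rw [mul_comm 2 D, mul_assoc]
  refine mul_le_mul_of_nonneg_left ?_ hφ.nonneg
  have h1 := Real.quadratic_le_exp_of_nonneg (abs_nonneg x)
  rw [sq_abs] at h1
  have h2 := abs_nonneg x
  rw [Real.exp_neg, ← div_eq_mul_inv, inv_le_comm₀ (Real.exp_pos _) (by positivity), inv_div]
  linarith

lemma summable_lattice {h : ℝ} (hh : 0 < h) (x : ℝ) :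
    Summable (fun i : ℕ => φ (x + h * i)) := by
  refine Summable.of_norm_bounded
    (((tsum_exp_neg_lattice hh x).1.comp_injective Nat.cast_injective).mul_left D) fun i => ?_
  simpa using hφ.b0 (x + h * i)

/-- The trapezoidal rule on a half-line. -/
lemma trapezoid {h : ℝ} (hh : 0 < h) (hh1 : h ≤ 1) (x : ℝ) :
    |h * ∑' i : ℕ, φ (x + h * i) - (∫ u in Set.Ioi x, φ u) - h * φ x / 2| ≤ 16 * D * h ^ 2 := by
  have hfin : ∀ n : ℕ, |h * ∑ i ∈ Finset.range n, φ (x + h * i) - (∫ u in x..(x + h * n), φ u) -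
      h * (φ x - φ (x + h * n)) / 2| ≤ 16 * D * h ^ 2 := by
    intro n
    have hcell : ∀ i : ℕ, |(∫ u in (x + h * i)..(x + h * (i + 1 : ℕ)), φ u) -
        h * (φ (x + h * i) + φ (x + h * (i + 1 : ℕ))) / 2| ≤
        D * Real.exp h / 2 * h ^ 3 * Real.exp (-|x + h * i|) := by
      intro i
      have := trapezoid_cell hφ.d0 hφ.d1 (x := x + h * i) (h := h)
        (ζ := D * (Real.exp h * Real.exp (-|x + h * i|))) hh.le fun y hy => by
          refine (hφ.b2 _).trans (mul_le_mul_of_nonneg_left ?_ hφ.nonneg)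
          rw [← Real.exp_add]
          refine Real.exp_le_exp.2 ?_
          have := abs_sub (x + h * i + y) y
          rw [add_sub_cancel_right] at this
          linarith
      have e1 : x + h * i + h = x + h * (i + 1 : ℕ) := by push_cast; ring
      rw [e1] at this
      exact this.trans (le_of_eq (by ring))
    have hint : ∫ u in x..(x + h * n), φ u =
        ∑ i ∈ Finset.range n, ∫ u in (x + h * i)..(x + h * (i + 1 : ℕ)), φ u := by
      have := intervalIntegral.sum_integral_adjacent_intervals (μ := volume) (f := φ)
        (a := fun i : ℕ => x + h * i) (n := n)
        (fun i _ => hφ.continuous.intervalIntegrable _ _)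
      simpa using this.symm
    have hsum : ∀ n : ℕ, h * ∑ i ∈ Finset.range n, φ (x + h * i) - h * (φ x - φ (x + h * n)) / 2 =
        ∑ i ∈ Finset.range n, h * (φ (x + h * i) + φ (x + h * (i + 1 : ℕ))) / 2 := by
      intro n
      induction n with
      | zero => simp
      | succ n ih =>
        rw [Finset.sum_range_succ, Finset.sum_range_succ, ← ih]
        ring
    have e2 : h * ∑ i ∈ Finset.range n, φ (x + h * i) - (∫ u in x..(x + h * n), φ u) -
        h * (φ x - φ (x + h * n)) / 2 =
        -∑ i ∈ Finset.range n, ((∫ u in (x + h * i)..(x + h * (i + 1 : ℕ)), φ u) -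
        h * (φ (x + h * i) + φ (x + h * (i + 1 : ℕ))) / 2) := by
      rw [Finset.sum_sub_distrib, ← hint, ← hsum n]; ring
    rw [e2, abs_neg]
    refine (Finset.abs_sum_le_sum_abs _ _).trans ((Finset.sum_le_sum fun i _ => hcell i).trans ?_)
    rw [← Finset.mul_sum]
    have hs := (tsum_exp_neg_lattice hh x).1
    -- The decay of `φ₂` turns the sum of the cell errors into a lattice sum of size `8 / h`, so one
    -- power of `h` is lost from `h³`, uniformly in the number of cells.
    have h3 : ∑ i ∈ Finset.range n, Real.exp (-|x + h * i|) ≤ 8 / h := by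
      refine le_trans ?_ (tsum_exp_neg_lattice_le hh hh1 x)
      have h4 := (hs.comp_injective Nat.cast_injective).sum_le_tsum (Finset.range n)
        (fun i _ => (Real.exp_pos _).le)
      have h5 := tsum_comp_le_tsum_of_inj hs (fun i => (Real.exp_pos _).le)
        (Nat.cast_injective (R := ℤ))
      refine le_trans ?_ h5
      simpa [Function.comp_def] using h4
    have h6 : Real.exp h ≤ 4 := by
      have := Real.exp_one_lt_d9
      have : Real.exp h ≤ Real.exp 1 := Real.exp_le_exp.2 hh1
      linarith
    have hD := hφ.nonneg
    calc D * Real.exp h / 2 * h ^ 3 * ∑ i ∈ Finset.range n, Real.exp (-|x + h * i|) ≤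
        D * 4 / 2 * h ^ 3 * (8 / h) := by gcongr
      _ = 16 * D * h ^ 2 := by field_simp; ring
  have hcast : Tendsto (fun n : ℕ => x + h * (n : ℝ)) atTop atTop :=
    tendsto_atTop_add_const_left _ _ (tendsto_natCast_atTop_atTop.const_mul_atTop hh)
  have t1 := (hφ.summable_lattice hh x).hasSum.tendsto_sum_nat
  have t2 := intervalIntegral_tendsto_integral_Ioi x hφ.integrable.integrableOn hcast
  have t3 : Tendsto (fun n : ℕ => φ (x + h * n)) atTop (𝓝 0) :=
    (hφ.summable_lattice hh x).tendsto_atTop_zero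
  have t := (((t1.const_mul h).sub t2).sub (((t3.const_sub (φ x)).const_mul h).div_const 2)).abs
  rw [sub_zero] at t
  exact le_of_tendsto' t hfin

end ExpDecay

/-! ### Lattice sums with a Fermi weight -/

/-- The Fermi weight `1 / (1 + exp (-2L(k - 1/2 - y)))`. -/
noncomputable def fermiWeight (L y : ℝ) (k : ℤ) : ℝ :=
  1 / (1 + Real.exp (-2 * L * ((k : ℝ) - 1 / 2 - y)))

lemma fermiWeight_nonneg (L y : ℝ) (k : ℤ) : 0 ≤ fermiWeight L y k := by
  unfold fermiWeight; positivity

lemma fermiWeight_le_one (L y : ℝ) (k : ℤ) : fermiWeight L y k ≤ 1 := by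
  unfold fermiWeight
  exact div_le_one_of_le₀ (by linarith [Real.exp_pos (-2 * L * ((k : ℝ) - 1 / 2 - y))])
    (by positivity)

lemma fermiWeight_le_exp (L y : ℝ) (k : ℤ) :
    fermiWeight L y k ≤ Real.exp (2 * L * ((k : ℝ) - 1 / 2 - y)) := by
  unfold fermiWeight
  have h : Real.exp (2 * L * ((k : ℝ) - 1 / 2 - y)) =
      (Real.exp (-2 * L * ((k : ℝ) - 1 / 2 - y)))⁻¹ := by
    rw [← Real.exp_neg]; congr 1; ring
  rw [h, ← one_div (Real.exp _)]
  gcongr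
  linarith

lemma one_sub_fermiWeight_le_exp (L y : ℝ) (k : ℤ) :
    1 - fermiWeight L y k ≤ Real.exp (-2 * L * ((k : ℝ) - 1 / 2 - y)) := by
  unfold fermiWeight
  set e := Real.exp (-2 * L * ((k : ℝ) - 1 / 2 - y))
  have he : 0 < e := Real.exp_pos _
  have : 1 - 1 / (1 + e) = e / (1 + e) := by field_simp; ring
  rw [this]
  exact div_le_self he.le (by linarith)

/-- `fermiStep` has its step fixed at 1, while the weights in use switch on near a moving index `K`.
Relocating the step changes the sum by `K - 1`. -/
lemma hasSum_step_sub_step (K : ℤ) :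
    HasSum (fun k : ℤ => ((if 1 ≤ k then (1 : ℝ) else 0) - if K ≤ k then 1 else 0)) (K - 1) := by
  have hone : ∀ K : ℤ, HasSum (fun k : ℤ => if k = K then (1 : ℝ) else 0) 1 := fun K =>
    hasSum_ite_eq K 1
  induction K using Int.inductionOn' (b := 1) with
  | zero => simp [hasSum_zero]
  | succ K _ ih =>
    have := ih.add (hone K)
    convert this using 1
    · funext k
      split_ifs <;> first | omega | norm_num
    · push_cast; ring
  | pred K _ ih =>
    have h1 : HasSum (fun k : ℤ => if k = K - 1 then (-1 : ℝ) else 0) (-1) :=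
      hasSum_ite_eq (K - 1) (-1)
    have := ih.add h1
    convert this using 1
    · funext k
      split_ifs <;> first | omega | norm_num
    · push_cast; ring

/-- Bound for the difference between the Fermi weight and a step at `⌈ν⌉`. -/
lemma abs_fermiWeight_sub_step_le {L : ℝ} (hL : 0 < L) (ν ξ : ℝ) (k : ℤ) :
    |fermiWeight L (ν + ξ) k - if ⌈ν⌉ ≤ k then 1 else 0| ≤
      Real.exp (L * (1 + 2 * |ξ|)) * Real.exp (-(2 * L * |(k : ℝ) - ν|)) := by
  rw [← Real.exp_add]
  have h1 := mul_le_mul_of_nonneg_left (le_abs_self ξ) hL.le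
  have h2 := mul_le_mul_of_nonneg_left (neg_abs_le ξ) hL.le
  split_ifs with hk
  · have hk' : ν ≤ k := Int.ceil_le.1 hk
    rw [abs_sub_comm, abs_of_nonneg (sub_nonneg.2 (fermiWeight_le_one _ _ _))]
    refine (one_sub_fermiWeight_le_exp _ _ _).trans (Real.exp_le_exp.2 ?_)
    rw [abs_of_nonneg (by linarith : 0 ≤ (k : ℝ) - ν)]
    linarith
  · have hk' : (k : ℝ) < ν := by
      by_contra! h
      exact hk (Int.ceil_le.2 h)
    rw [sub_zero, abs_of_nonneg (fermiWeight_nonneg _ _ _)]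
    refine (fermiWeight_le_exp _ _ _).trans (Real.exp_le_exp.2 ?_)
    rw [abs_of_nonpos (by linarith : (k : ℝ) - ν ≤ 0)]
    linarith

lemma hasSum_fermiWeight_sub_step {L : ℝ} (hL : 0 < L) (y : ℝ) (K : ℤ) :
    HasSum (fun k : ℤ => fermiWeight L y k - if K ≤ k then (1 : ℝ) else 0)
      ((∑' k, fermiStep L y k) + (K - 1)) := by
  convert (summable_fermiStep hL y).hasSum.add (hasSum_step_sub_step K) using 2 with k
  simp only [fermiStep, fermiWeight]; ring

/-- The weight differs from a step at `K = ⌈ν⌉` only near `k = ν`, where `φ` may be frozen at `x`;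
this gives `h φ(x) (F + K - 1)`, with `F` the Fermi sum. The step part is a half-line trapezoidal
sum from `x + h(K - ν)`, whose end correction is `h φ / 2`, and moving its endpoint to `x` gives `-h
(K - ν) φ(x)`. The dependence on `K` cancels, leaving `F + ν - 1/2`. -/
lemma ExpDecay.lattice_sum {L : ℝ} (hL : 0 < L) (D ξ : ℝ) :
    ∃ C > 0, ∀ φ φ₁ φ₂ : ℝ → ℝ, ExpDecay φ φ₁ φ₂ D → ∀ h : ℝ, 0 < h → h ≤ 1 → ∀ x ν : ℝ,
      |h * ∑' k : ℤ, φ (x + h * (k - ν)) * fermiWeight L (ν + ξ) k - (∫ u in Set.Ioi x, φ u) -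
        h * φ x * ((∑' k, fermiStep L (ν + ξ) k) + ν - 1 / 2)| ≤ C * h ^ 2 := by
  set C₁ := Real.exp (L * (1 + 2 * |ξ|)) with hC₁
  set C₂ := C₁ / L * (2 * Real.exp (L / 2) / (1 - Real.exp (-L))) with hC₂
  have hL1 : 0 < 1 - Real.exp (-L) := by
    have : Real.exp (-L) < 1 := by rw [Real.exp_lt_one_iff]; linarith
    linarith
  refine ⟨|D| * C₂ + 18 * |D| + 1, by positivity, fun φ φ₁ φ₂ hφ h hh hh1 x ν => ?_⟩
  have hD := hφ.nonneg
  rw [abs_of_nonneg hD]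
  set K := ⌈ν⌉ with hK
  have hK1 : ν ≤ K := Int.le_ceil ν
  have hK2 : (K : ℝ) < ν + 1 := Int.ceil_lt_add_one ν
  set s : ℤ → ℝ := fun k => fermiWeight L (ν + ξ) k - if K ≤ k then 1 else 0 with hs
  have hsb : ∀ k, |s k| ≤ C₁ * Real.exp (-(2 * L * |(k : ℝ) - ν|)) :=
    abs_fermiWeight_sub_step_le hL ν ξ
  have hsum := hasSum_fermiWeight_sub_step hL (ν + ξ) K
  set F := ∑' k, fermiStep L (ν + ξ) k with hF
  -- error of freezing `φ` in the weighted sum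
  have hlat := tsum_exp_neg_lattice hL (-(L * ν))
  have hfb : ∀ k : ℤ, ‖(φ (x + h * (k - ν)) - φ x) * s k‖ ≤
      D * h * (C₁ / L) * Real.exp (-|-(L * ν) + L * k|) := by
    intro k
    have h1 := hφ.lipschitz x (x + h * (k - ν))
    rw [add_sub_cancel_left, abs_mul, abs_of_pos hh] at h1
    rw [norm_mul, Real.norm_eq_abs, Real.norm_eq_abs]
    have h2 : |-(L * ν) + L * k| = L * |(k : ℝ) - ν| := by
      rw [show -(L * ν) + L * k = L * (k - ν) by ring, abs_mul, abs_of_pos hL]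
    rw [h2]
    set T := |(k : ℝ) - ν|
    have h3 : L * T ≤ Real.exp (L * T) := by linarith [Real.add_one_le_exp (L * T)]
    have h4 : T ≤ Real.exp (L * T) / L := by rw [le_div_iff₀ hL]; linarith
    calc |φ (x + h * (k - ν)) - φ x| * |s k| ≤
        (D * (h * (Real.exp (L * T) / L))) * (C₁ * Real.exp (-(2 * L * T))) := by
          refine mul_le_mul (h1.trans ?_) (hsb k) (abs_nonneg _) (by positivity)
          gcongr
      _ = D * h * (C₁ / L) * (Real.exp (L * T) * Real.exp (-(2 * L * T))) := by ring
      _ = _ := by rw [← Real.exp_add]; congr 2; ring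
  have hfs : Summable fun k : ℤ => (φ (x + h * (k - ν)) - φ x) * s k :=
    Summable.of_norm_bounded (hlat.1.mul_left _) hfb
  have hfreeze : |∑' k : ℤ, (φ (x + h * (k - ν)) - φ x) * s k| ≤ D * h * C₂ := by
    refine (tsum_of_norm_bounded (hlat.1.mul_left (D * h * (C₁ / L))).hasSum hfb).trans ?_
    rw [tsum_mul_left, hC₂, mul_assoc (D * h)]
    have := hlat.2
    gcongr
  -- the step sum
  have hstep : HasSum (fun k : ℤ => φ (x + h * (k - ν)) * if K ≤ k then (1 : ℝ) else 0)
      (∑' i : ℕ, φ (x + h * (K - ν) + h * i)) := by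
    have hinj : Function.Injective fun i : ℕ => K + (i : ℤ) := fun i j hij => by
      simpa using hij
    refine (hinj.hasSum_iff fun k hk => ?_).1 ?_
    · rw [if_neg, mul_zero]
      intro hle
      exact hk ⟨(k - K).toNat, by simp [Int.toNat_of_nonneg (sub_nonneg.2 hle)]⟩
    · have := (hφ.summable_lattice hh (x + h * (K - ν))).hasSum
      refine this.congr_fun fun i => ?_
      simp
      ring_nf
  have htot : HasSum (fun k : ℤ => φ (x + h * (k - ν)) * fermiWeight L (ν + ξ) k)
      ((∑' k : ℤ, (φ (x + h * (k - ν)) - φ x) * s k) + φ x * (F + (K - 1)) +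
        ∑' i : ℕ, φ (x + h * (K - ν) + h * i)) := by
    refine ((hfs.hasSum.add (hsum.mul_left (φ x))).add hstep).congr_fun fun k => ?_
    simp only [hs]; ring
  rw [htot.tsum_eq]
  set W := ∑' k : ℤ, (φ (x + h * (k - ν)) - φ x) * s k with hW
  set x' := x + h * (K - ν) with hx'
  have htrap := hφ.trapezoid hh hh1 x'
  set V := ∑' i : ℕ, φ (x' + h * i) with hV
  have hx1 : 0 ≤ x' - x := by rw [hx']; simp; exact mul_nonneg hh.le (by linarith)
  have hx2 : x' - x ≤ h := by
    rw [hx', add_sub_cancel_left]; exact mul_le_of_le_one_right hh.le (by linarith)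
  have hlip := hφ.lipschitz x x'
  rw [abs_of_nonneg hx1] at hlip
  have hsplit : ∫ u in Set.Ioi x, φ u = (∫ u in x..x', φ u) + ∫ u in Set.Ioi x', φ u :=
    (intervalIntegral.integral_interval_add_Ioi hφ.integrable.integrableOn
      hφ.integrable.integrableOn).symm
  have hcell : |(∫ u in x..x', φ u) - (x' - x) * φ x| ≤ D * h ^ 2 := by
    have e1 : (∫ u in x..x', φ u) - (x' - x) * φ x = ∫ u in x..x', (φ u - φ x) := by
      rw [intervalIntegral.integral_sub (hφ.continuous.intervalIntegrable _ _) (by simp)]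
      simp
    rw [e1]
    have := intervalIntegral.norm_integral_le_of_norm_le_const (a := x) (b := x') (C := D * h)
      (f := fun u => φ u - φ x) fun u hu => by
        rw [Set.uIoc_of_le (by linarith)] at hu
        refine (hφ.lipschitz x u).trans ?_
        rw [abs_of_nonneg (by linarith [hu.1])]
        have := hu.2
        gcongr
        linarith
    rw [Real.norm_eq_abs, abs_of_nonneg hx1] at this
    refine this.trans ?_
    calc D * h * (x' - x) ≤ D * h * h := by gcongr
      _ = _ := by ring
  have hxe : x' - x = h * (K - ν) := by rw [hx']; ring
  have e3 : h * (W + φ x * (F + (K - 1)) + V) - (∫ u in Set.Ioi x, φ u) -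
      h * φ x * (F + ν - 1 / 2) =
      h * W + (h * V - (∫ u in Set.Ioi x', φ u) - h * φ x' / 2) + h / 2 * (φ x' - φ x) -
        ((∫ u in x..x', φ u) - (x' - x) * φ x) := by
    rw [hsplit, hxe]; ring
  rw [e3]
  have b1 : |h * W| ≤ D * C₂ * h ^ 2 := by
    rw [abs_mul, abs_of_pos hh]
    calc h * |W| ≤ h * (D * h * C₂) := by gcongr
      _ = _ := by ring
  have b2 : |h / 2 * (φ x' - φ x)| ≤ D * h ^ 2 := by
    rw [abs_mul, abs_of_pos (by positivity)]
    calc h / 2 * |φ x' - φ x| ≤ h / 2 * (D * h) := by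
          gcongr; exact hlip.trans (by gcongr)
      _ ≤ D * h ^ 2 := by
        have : 0 ≤ D * h ^ 2 := by positivity
        linarith
  calc _ ≤ |h * W| + |h * V - (∫ u in Set.Ioi x', φ u) - h * φ x' / 2| +
        |h / 2 * (φ x' - φ x)| + |(∫ u in x..x', φ u) - (x' - x) * φ x| :=
        (abs_sub _ _).trans (by gcongr; exact (abs_add_le _ _).trans (by
          gcongr; exact abs_add_le _ _))
    _ ≤ D * C₂ * h ^ 2 + 16 * D * h ^ 2 + D * h ^ 2 + D * h ^ 2 := by gcongr
    _ ≤ _ := by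
      have : 0 ≤ h ^ 2 := by positivity
      linarith

lemma ExpDecay.summable_fermi {φ φ₁ φ₂ : ℝ → ℝ} {D : ℝ} (hφ : ExpDecay φ φ₁ φ₂ D) {h : ℝ}
    (hh : 0 < h) (x ν L y : ℝ) :
    Summable fun k : ℤ => φ (x + h * (k - ν)) * fermiWeight L y k := by
  refine Summable.of_norm_bounded ((tsum_exp_neg_lattice hh (x - h * ν)).1.mul_left D) fun k => ?_
  rw [norm_mul, Real.norm_eq_abs, Real.norm_eq_abs, abs_of_nonneg (fermiWeight_nonneg _ _ _)]
  refine (mul_le_of_le_one_right (abs_nonneg _) (fermiWeight_le_one _ _ _)).trans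
    ((hφ.b0 _).trans (le_of_eq ?_))
  congr 3; ring_nf

/-! ### The corrected Gaussian -/

lemma exists_pow_mul_gaussian_le (k : ℕ) :
    ∃ C > 0, ∀ X : ℝ, |X| ^ k * Real.exp (-X ^ 2 / 2) ≤ C * Real.exp (-|X|) := by
  obtain ⟨C, hC, h⟩ := exists_poly_le_exp k one_pos
  refine ⟨C * Real.exp 2, by positivity, fun X => ?_⟩
  calc |X| ^ k * Real.exp (-X ^ 2 / 2) ≤ C * Real.exp (1 * |X|) * Real.exp (2 - 2 * |X|) := by
        gcongr
        · exact h _ (abs_nonneg X)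
        · nlinarith [sq_nonneg (|X| - 2), sq_abs X]
    _ = C * (Real.exp (1 * |X|) * Real.exp (2 - 2 * |X|)) := by ring
    _ = C * (Real.exp 2 * Real.exp (-|X|)) := by
        rw [← Real.exp_add, ← Real.exp_add]; congr 2; ring
    _ = _ := by ring

/-- The Gaussian with its first Edgeworth correction. -/
noncomputable def skewGauss (c X : ℝ) : ℝ := Real.exp (-X ^ 2 / 2) * (1 + c * (X ^ 3 + 3 * X))

lemma hasDerivAt_gauss (X : ℝ) :
    HasDerivAt (fun X : ℝ => Real.exp (-X ^ 2 / 2)) (-X * Real.exp (-X ^ 2 / 2)) X := by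
  have := (((hasDerivAt_pow 2 X).neg).div_const 2).exp
  refine this.congr_deriv ?_
  simp; ring

lemma skewGauss_expDecay (c₀ : ℝ) : ∃ D, ∀ c, |c| ≤ c₀ →
    ExpDecay (skewGauss c) (fun X => Real.exp (-X ^ 2 / 2) * (-X + c * (3 - X ^ 4)))
      (fun X => Real.exp (-X ^ 2 / 2) * (X ^ 2 - 1 + c * (X ^ 5 - 4 * X ^ 3 - 3 * X))) D := by
  choose C hC h using exists_pow_mul_gaussian_le
  have hC' := fun k => (hC k).le
  set S := C 0 + C 1 + C 2 + C 3 + C 4 + C 5 with hS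
  refine ⟨8 * (1 + |c₀|) * S, fun c hc => ?_⟩
  have hc0 : |c| ≤ |c₀| := hc.trans (le_abs_self _)
  have hp : ∀ k ≤ 5, ∀ X : ℝ, |X ^ k| * Real.exp (-X ^ 2 / 2) ≤ S * Real.exp (-|X|) := by
    intro k hk X
    rw [abs_pow]
    refine (h k X).trans ?_
    gcongr
    have := hC' 0; have := hC' 1; have := hC' 2; have := hC' 3; have := hC' 4; have := hC' 5
    interval_cases k <;> linarith
  have hS0 : 0 ≤ S := by
    have := hC' 0; have := hC' 1; have := hC' 2; have := hC' 3; have := hC' 4; have := hC' 5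
    linarith
  have key : ∀ (X a₀ a₁ a₂ a₃ a₄ a₅ : ℝ),
      |a₀| + |a₁| + |a₂| + |a₃| + |a₄| + |a₅| ≤ 8 * (1 + |c₀|) →
      |Real.exp (-X ^ 2 / 2) * (a₀ * X ^ 0 + a₁ * X ^ 1 + a₂ * X ^ 2 + a₃ * X ^ 3 + a₄ * X ^ 4 +
        a₅ * X ^ 5)| ≤ 8 * (1 + |c₀|) * S * Real.exp (-|X|) := by
    intro X a₀ a₁ a₂ a₃ a₄ a₅ ha
    rw [abs_mul, Real.abs_exp]
    set e := Real.exp (-X ^ 2 / 2) with he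
    have he0 : 0 < e := Real.exp_pos _
    have f : ∀ (a : ℝ) (k : ℕ), k ≤ 5 → e * |a * X ^ k| ≤ |a| * (S * Real.exp (-|X|)) := by
      intro a k hk
      rw [abs_mul]
      calc e * (|a| * |X ^ k|) = |a| * (|X ^ k| * e) := by ring
        _ ≤ _ := mul_le_mul_of_nonneg_left (hp k hk X) (abs_nonneg a)
    calc e * |a₀ * X ^ 0 + a₁ * X ^ 1 + a₂ * X ^ 2 + a₃ * X ^ 3 + a₄ * X ^ 4 + a₅ * X ^ 5| ≤
        e * (|a₀ * X ^ 0| + |a₁ * X ^ 1| + |a₂ * X ^ 2| + |a₃ * X ^ 3| + |a₄ * X ^ 4| +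
          |a₅ * X ^ 5|) := by
          refine mul_le_mul_of_nonneg_left ?_ he0.le
          iterate 4
            refine (abs_add_le _ _).trans (add_le_add ?_ le_rfl)
          exact abs_add_le _ _
      _ = e * |a₀ * X ^ 0| + e * |a₁ * X ^ 1| + e * |a₂ * X ^ 2| + e * |a₃ * X ^ 3| +
          e * |a₄ * X ^ 4| + e * |a₅ * X ^ 5| := by ring
      _ ≤ (|a₀| + |a₁| + |a₂| + |a₃| + |a₄| + |a₅|) * (S * Real.exp (-|X|)) := by
          linarith [f a₀ 0 (by norm_num), f a₁ 1 (by norm_num), f a₂ 2 (by norm_num),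
            f a₃ 3 (by norm_num), f a₄ 4 (by norm_num), f a₅ 5 (by norm_num)]
      _ ≤ (8 * (1 + |c₀|)) * (S * Real.exp (-|X|)) := by gcongr
      _ = _ := by ring
  have hc1 := abs_nonneg c
  refine ⟨fun X => ?_, fun X => ?_, fun X => ?_, fun X => ?_, fun X => ?_⟩
  · refine ((hasDerivAt_gauss X).mul ((((hasDerivAt_pow 3 X).add
      ((hasDerivAt_id X).const_mul 3)).const_mul c).const_add 1)).congr_deriv ?_
    simp; ring
  · refine ((hasDerivAt_gauss X).mul ((hasDerivAt_id X).neg.add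
      (((hasDerivAt_pow 4 X).const_sub 3).const_mul c))).congr_deriv ?_
    simp; ring
  · have := key X 1 (3 * c) 0 c 0 0 (by
      rw [abs_mul, abs_one, abs_zero, abs_of_pos (by norm_num : (0 : ℝ) < 3)]; linarith)
    convert this using 2
    rw [skewGauss]; ring
  · have := key X (3 * c) (-1) 0 0 (-c) 0 (by
      rw [abs_mul, abs_neg, abs_neg, abs_one, abs_zero, abs_of_pos (by norm_num : (0 : ℝ) < 3)]
      linarith)
    convert this using 2
    ring
  · have := key X (-1) (-(3 * c)) 1 (-(4 * c)) 0 c (by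
      rw [abs_neg, abs_neg, abs_neg, abs_mul, abs_mul, abs_one, abs_zero,
        abs_of_pos (by norm_num : (0 : ℝ) < 3), abs_of_pos (by norm_num : (0 : ℝ) < 4)]
      linarith)
    convert this using 2
    ring

/-- The correction has the elementary primitive `-(X² + 5) exp (-X² / 2)`, since differentiating it
returns `(X³ + 3X) exp (-X² / 2)`. -/
lemma integral_skewGauss (c x : ℝ) :
    ∫ X in Set.Ioi x, skewGauss c X =
      √(2 * π) * (CoulombGap.erfc (x / √2) / 2) + c * ((x ^ 2 + 5) * Real.exp (-x ^ 2 / 2)) := by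
  have hg : Integrable fun X : ℝ => Real.exp (-X ^ 2 / 2) := by
    have := integrable_exp_neg_mul_sq (b := 1 / 2) (by norm_num)
    refine this.congr (Eventually.of_forall fun X => ?_)
    simp only; congr 1; ring
  have hp : ∀ k : ℕ, Integrable fun X : ℝ => X ^ k * Real.exp (-X ^ 2 / 2) := fun k => by
    have := integrable_pow_mul_gaussian k 0 (b := 1 / 2) (by norm_num)
    refine this.congr (Eventually.of_forall fun X => ?_)
    simp only; congr 2; ring
  have h3 : ∫ X in Set.Ioi x, (X ^ 3 + 3 * X) * Real.exp (-X ^ 2 / 2) =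
      (x ^ 2 + 5) * Real.exp (-x ^ 2 / 2) := by
    have hd : ∀ X : ℝ, HasDerivAt (fun X : ℝ => -((X ^ 2 + 5) * Real.exp (-X ^ 2 / 2)))
        ((X ^ 3 + 3 * X) * Real.exp (-X ^ 2 / 2)) X := fun X => by
      refine (((hasDerivAt_pow 2 X).add_const 5).mul (hasDerivAt_gauss X)).neg.congr_deriv ?_
      simp; ring
    have hint : Integrable fun X : ℝ => (X ^ 3 + 3 * X) * Real.exp (-X ^ 2 / 2) := by
      refine ((hp 3).add ((hp 1).const_mul 3)).congr (Eventually.of_forall fun X => ?_)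
      simp; ring
    have hlim : Tendsto (fun X : ℝ => -((X ^ 2 + 5) * Real.exp (-X ^ 2 / 2))) atTop (𝓝 0) := by
      obtain ⟨C2, _, q2⟩ := exists_pow_mul_gaussian_le 2
      obtain ⟨C0, _, q0⟩ := exists_pow_mul_gaussian_le 0
      refine squeeze_zero_norm (a := fun X => (C2 + 5 * C0) * Real.exp (-|X|)) (fun X => ?_) ?_
      · have a2 := q2 X
        have a0 := q0 X
        rw [pow_zero, one_mul] at a0
        rw [sq_abs] at a2
        rw [norm_neg, Real.norm_of_nonneg (by positivity)]
        linarith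
      · have := (Real.tendsto_exp_neg_atTop_nhds_zero.comp tendsto_abs_atTop_atTop).const_mul
          (C2 + 5 * C0)
        simpa using this
    have := integral_Ioi_of_hasDerivAt_of_tendsto' (a := x) (fun X _ => hd X)
      hint.integrableOn hlim
    rw [this]; ring
  have h0 : ∫ X in Set.Ioi x, Real.exp (-X ^ 2 / 2) =
      √(2 * π) * (CoulombGap.erfc (x / √2) / 2) := by
    have := integral_comp_mul_left_Ioi (fun u : ℝ => Real.exp (-u ^ 2)) x
      (b := (√2)⁻¹) (by positivity)
    have e1 : ∀ X : ℝ, Real.exp (-((√2)⁻¹ * X) ^ 2) = Real.exp (-X ^ 2 / 2) := fun X => by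
      congr 1; rw [mul_pow, inv_pow, Real.sq_sqrt (by norm_num)]; ring
    simp only [e1] at this
    rw [this, CoulombGap.erfc, Real.sqrt_mul (by norm_num), inv_inv, smul_eq_mul, mul_comm _ x,
      ← div_eq_mul_inv]
    have : (0 : ℝ) < √π := Real.sqrt_pos.2 Real.pi_pos
    field_simp
  have e2 : ∀ X, skewGauss c X =
      Real.exp (-X ^ 2 / 2) + c * ((X ^ 3 + 3 * X) * Real.exp (-X ^ 2 / 2)) := fun X => by
    rw [skewGauss]; ring
  have hint : Integrable fun X : ℝ => (X ^ 3 + 3 * X) * Real.exp (-X ^ 2 / 2) := by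
    refine ((hp 3).add ((hp 1).const_mul 3)).congr (Eventually.of_forall fun X => ?_)
    simp; ring
  simp only [e2]
  rw [integral_add hg.integrableOn (hint.const_mul c).integrableOn, integral_const_mul, h0, h3]

/-- The Fermi sum alone drifts like `-ν`. Compared with a step at `⌈ν⌉` instead of 1 it is bounded,
so the combination with `ν` stays bounded as `n` grows. -/
lemma abs_tsum_fermiStep_add_le {L : ℝ} (hL : 0 < L) (ξ : ℝ) :
    ∃ C > 0, ∀ ν : ℝ, |(∑' k, fermiStep L (ν + ξ) k) + ν| ≤ C := by
  have hL1 : 0 < 1 - Real.exp (-(2 * L)) := by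
    have : Real.exp (-(2 * L)) < 1 := by rw [Real.exp_lt_one_iff]; linarith
    linarith
  refine ⟨Real.exp (L * (1 + 2 * |ξ|)) * (2 * Real.exp (2 * L / 2) / (1 - Real.exp (-(2 * L)))) + 1,
    by positivity, fun ν => ?_⟩
  have hsum := hasSum_fermiWeight_sub_step hL (ν + ξ) ⌈ν⌉
  have hlat := tsum_exp_neg_lattice (h := 2 * L) (by linarith) (-(2 * L * ν))
  have hb := tsum_of_norm_bounded (hlat.1.mul_left (Real.exp (L * (1 + 2 * |ξ|)))).hasSum
    (f := fun k : ℤ => fermiWeight L (ν + ξ) k - if ⌈ν⌉ ≤ k then (1 : ℝ) else 0) fun k => by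
      refine (abs_fermiWeight_sub_step_le hL ν ξ k).trans (le_of_eq ?_)
      rw [show -(2 * L * ν) + 2 * L * k = 2 * L * (k - ν) by ring, abs_mul,
        abs_of_pos (by linarith : 0 < 2 * L)]
  rw [hsum.tsum_eq, tsum_mul_left, Real.norm_eq_abs] at hb
  have hK1 : ν ≤ ⌈ν⌉ := Int.le_ceil ν
  have hK2 : (⌈ν⌉ : ℝ) < ν + 1 := Int.ceil_lt_add_one ν
  have h2 := hlat.2
  set F := ∑' k, fermiStep L (ν + ξ) k
  have h3 : |F + ν| ≤ |F + (⌈ν⌉ - 1)| + 1 := by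
    have : F + ν = (F + (⌈ν⌉ - 1)) + (ν - ⌈ν⌉ + 1) := by ring
    rw [this]
    refine (abs_add_le _ _).trans ?_
    gcongr
    rw [abs_le]; constructor <;> linarith
  refine h3.trans ?_
  gcongr
  refine hb.trans ?_
  gcongr

/-! ### Two-well potentials and bounds for their integrals -/

/-- A two-well potential `E` on the line, with wells at `x₁ < x₂`, and a bounded perturbation. -/
structure TwoWell (E μ : ℝ → ℝ) (x₁ x₂ β ρ M κ₀ : ℝ) : Prop where
  lt : x₁ < x₂
  β0 : 0 < β
  β1 : β < 1
  lsc : LowerSemicontinuous E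
  zero₁ : E x₁ = 0
  zero₂ : E x₂ = 0
  pos : ∀ x, x ≠ x₁ → x ≠ x₂ → 0 < E x
  top : Tendsto (fun x => E x - 2 * (1 - β) * x) atTop atTop
  bot : ∃ a, ∀ᶠ x in atBot, a ≤ E x + 2 * β * x
  meas : Measurable μ
  bdd : ∀ x, |μ x| ≤ M
  ρ0 : 0 < ρ
  M0 : 0 < M
  κ0 : 0 < κ₀
  sE₁ : SmoothNear E (deriv E) (deriv (deriv E)) (deriv (deriv (deriv E)))
      (deriv (deriv (deriv (deriv E)))) x₁ ρ M
  sE₂ : SmoothNear E (deriv E) (deriv (deriv E)) (deriv (deriv (deriv E)))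
      (deriv (deriv (deriv (deriv E)))) x₂ ρ M
  sμ₁ : SmoothNear μ (deriv μ) (deriv (deriv μ)) (deriv (deriv (deriv μ)))
      (deriv (deriv (deriv (deriv μ)))) x₁ ρ M
  sμ₂ : SmoothNear μ (deriv μ) (deriv (deriv μ)) (deriv (deriv (deriv μ)))
      (deriv (deriv (deriv (deriv μ)))) x₂ ρ M
  κ₁ : ∀ x, |x - x₁| ≤ ρ → κ₀ ≤ deriv (deriv E) x
  κ₂ : ∀ x, |x - x₂| ≤ ρ → κ₀ ≤ deriv (deriv E) x

/-- Lower bound for the integral of an exponential by its values on an interval. -/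
lemma le_integral_exp_of_le_on_Icc {f : ℝ → ℝ} (hf : Integrable fun x => Real.exp (f x)) {a r w : ℝ}
    (hr : 0 ≤ r) (h : ∀ x, a ≤ x → x ≤ a + r → w ≤ f x) :
    r * Real.exp w ≤ ∫ x, Real.exp (f x) := by
  have h1 : ∫ x in Set.Icc a (a + r), Real.exp w ≤ ∫ x in Set.Icc a (a + r), Real.exp (f x) := by
    refine setIntegral_mono_on (by simp) hf.integrableOn measurableSet_Icc fun x hx => ?_
    exact Real.exp_le_exp.2 (h x hx.1 hx.2)
  have h2 : ∫ x in Set.Icc a (a + r), Real.exp (f x) ≤ ∫ x, Real.exp (f x) :=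
    setIntegral_le_integral hf (Eventually.of_forall fun x => (Real.exp_pos _).le)
  refine le_trans (le_of_eq ?_) (h1.trans h2)
  simp [hr]

/-- A divergent integral has the value 0, and so has its inverse, so no integrability is assumed.
This matters for the largest degrees, where the growth of the field need not make the norm finite.
-/
lemma inv_integral_exp_le {f : ℝ → ℝ} {a r w : ℝ}
    (hr : 0 < r) (h : ∀ x, a ≤ x → x ≤ a + r → w ≤ f x) :
    (∫ x, Real.exp (f x))⁻¹ ≤ r⁻¹ * Real.exp (-w) := by
  by_cases hf : Integrable fun x => Real.exp (f x)
  · have h1 := le_integral_exp_of_le_on_Icc hf hr.le h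
    rw [Real.exp_neg, ← mul_inv]
    exact inv_anti₀ (by positivity) h1
  · rw [integral_undef hf, inv_zero]; positivity

namespace TwoWell

variable {E μ : ℝ → ℝ} {x₁ x₂ β ρ M κ₀ : ℝ} (W : TwoWell E μ x₁ x₂ β ρ M κ₀)
include W

lemma nonneg (x : ℝ) : 0 ≤ E x := by
  rcases eq_or_ne x x₁ with rfl | h1
  · exact W.zero₁.ge
  rcases eq_or_ne x x₂ with rfl | h2
  · exact W.zero₂.ge
  exact (W.pos x h1 h2).le

lemma deriv₁ : deriv E x₁ = 0 :=
  IsLocalMin.deriv_eq_zero (Eventually.of_forall fun x => by rw [W.zero₁]; exact W.nonneg x)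

lemma deriv₂ : deriv E x₂ = 0 :=
  IsLocalMin.deriv_eq_zero (Eventually.of_forall fun x => by rw [W.zero₂]; exact W.nonneg x)

lemma well_le₁ {y : ℝ} (hy : |y| ≤ ρ) : E (x₁ + y) ≤ M * y ^ 2 := by
  have := W.sE₁.taylor_one (x₀ := x₁) (η := ρ) (by simp) hy
  rw [W.zero₁, W.deriv₁, sq_abs] at this
  have := le_of_abs_le this
  linarith

lemma well_le₂ {y : ℝ} (hy : |y| ≤ ρ) : E (x₂ + y) ≤ M * y ^ 2 := by
  have := W.sE₂.taylor_one (x₀ := x₂) (η := ρ) (by simp) hy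
  rw [W.zero₂, W.deriv₂, sq_abs] at this
  have := le_of_abs_le this
  linarith

lemma perturb_sub_ge (x y : ℝ) : -(2 * M) ≤ μ x - μ y := by
  have h1 := neg_le_of_abs_le (W.bdd x)
  have h2 := le_of_abs_le (W.bdd y)
  linarith

lemma perturb_sub_le (x y : ℝ) : μ x - μ y ≤ 2 * M := by
  have := W.perturb_sub_ge y x
  linarith

/-- For `m ≤ 0` the left well makes the integral exponentially large. -/
lemma inv_integral_le_left : ∃ C > 0, ∀ n : ℝ, 1 ≤ n → ∀ x₀, |x₀ - x₂| ≤ (x₂ - x₁) / 2 →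
    ∀ m ≤ 0, (∫ x, laplaceIntegrand E μ n m x₀ x)⁻¹ ≤
      C * (√n * Real.exp (m * (x₂ - x₁))) := by
  have hρ := W.ρ0
  have hM := W.M0
  refine ⟨ρ⁻¹ * Real.exp (M * ρ ^ 2 + 2 * M), by positivity, fun n hn x₀ hx₀ m hm => ?_⟩
  have hn0 : 0 < n := by linarith
  have hs0 : 0 < √n := Real.sqrt_pos.2 hn0
  have hs1 : 1 ≤ √n := Real.one_le_sqrt.2 hn
  have hss : √n ^ 2 = n := Real.sq_sqrt hn0.le
  have hx₀' := (abs_le.1 hx₀).1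
  -- On the interval of length `ρ / √n` to the left of `x₁` the term `n E` stays bounded. There `x -
  -- x₀ ≤ -(x₂ - x₁) / 2`, so the tilt with `m ≤ 0` gains at least `-m (x₂ - x₁)`.
  have := inv_integral_exp_le (f := fun x => 2 * m * (x - x₀) - n * (E x - E x₀) + (μ x - μ x₀))
    (a := x₁ - ρ / √n) (r := ρ / √n) (w := -(m * (x₂ - x₁)) - M * ρ ^ 2 - 2 * M) (by positivity)
    fun x h1 h2 => by
      have hy1 : |x - x₁| ≤ ρ / √n := by rw [abs_le]; constructor <;> linarith
      have hy2 : |x - x₁| ≤ ρ := hy1.trans (div_le_self hρ.le hs1)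
      have hE := W.well_le₁ hy2
      rw [add_sub_cancel] at hE
      have hE2 : n * E x ≤ M * ρ ^ 2 := by
        have h3 : (x - x₁) ^ 2 ≤ (ρ / √n) ^ 2 := by
          rw [← sq_abs]; gcongr
        calc n * E x ≤ n * (M * (ρ / √n) ^ 2) := by
              gcongr; exact hE.trans (by gcongr)
          _ = M * ρ ^ 2 := by rw [div_pow, hss]; field_simp
      have h4 := W.perturb_sub_ge x x₀
      have h5 : 0 ≤ n * E x₀ := mul_nonneg hn0.le (W.nonneg x₀)
      have h6 : -(m * (x₂ - x₁)) ≤ 2 * m * (x - x₀) := by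
        have : 0 ≤ -m * (-(2 * (x - x₀)) - (x₂ - x₁)) := mul_nonneg (by linarith) (by linarith)
        linarith
      linarith
  unfold laplaceIntegrand
  refine this.trans (le_of_eq ?_)
  rw [inv_div, mul_mul_mul_comm, ← Real.exp_add, div_eq_mul_inv, mul_comm (√n)]
  congr 2; ring

/-- Crude Gaussian upper bound for the reciprocal of the integral. -/
lemma inv_integral_le_gauss : ∃ C > 0, ∃ c > 0, ∀ n : ℝ, 1 ≤ n → ∀ x₀, |x₀ - x₂| ≤ ρ / 2 →
    ∀ m, |m| ≤ n → (∫ x, laplaceIntegrand E μ n m x₀ x)⁻¹ ≤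
      C * (√n * Real.exp (-(c *
        saddleX (deriv E) (deriv (deriv E)) (deriv μ) n x₀ m ^ 2))) := by
  have hρ := W.ρ0
  have hM := W.M0
  have hκ := W.κ0
  -- The integral is bounded below near `x₀ + c₄ α / n`, a small fraction of the way to the saddle.
  -- The linear gain there is `c₄ α² / n`; the first constraint keeps the quadratic loss below a
  -- quarter of it, and the second keeps the point within the smooth range for every `|m| ≤ n`.
  set c₄ := min (1 / (16 * M)) (ρ / (4 * (2 + 2 * M))) with hc₄
  have hc₄0 : 0 < c₄ := by positivity
  have hc₄M : 16 * M * c₄ ≤ 1 := by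
    have : c₄ ≤ 1 / (16 * M) := min_le_left _ _
    rwa [le_div_iff₀ (by positivity), mul_comm] at this
  have hc₄ρ : c₄ * (2 + 2 * M) ≤ ρ / 4 := by
    have : c₄ ≤ ρ / (4 * (2 + 2 * M)) := min_le_right _ _
    rw [le_div_iff₀ (by positivity)] at this
    linarith
  set r := min 1 (ρ / 4) with hr
  have hr0 : 0 < r := by positivity
  have hr1 : r ≤ 1 := min_le_left _ _
  have hrρ : r ≤ ρ / 4 := min_le_right _ _
  refine ⟨r⁻¹ * Real.exp (1 / c₄ + 4 * M), by positivity, c₄ * κ₀ / 2, by positivity,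
    fun n hn x₀ hx₀ m hm => ?_⟩
  have hn0 : 0 < n := by linarith
  have hs0 : 0 < √n := Real.sqrt_pos.2 hn0
  have hs1 : 1 ≤ √n := Real.one_le_sqrt.2 hn
  have hss : √n ^ 2 = n := Real.sq_sqrt hn0.le
  set X := saddleX (deriv E) (deriv (deriv E)) (deriv μ) n x₀ m with hX
  set α := 2 * m - n * deriv E x₀ + deriv μ x₀ with hα
  set κ := deriv (deriv E) x₀ with hκdef
  have hx₀ρ : |x₀ - x₂| ≤ ρ := by linarith
  have hκ₀ : κ₀ ≤ κ := W.κ₂ x₀ hx₀ρ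
  have hκpos : 0 < κ := by linarith
  have hαX : α ^ 2 = n * κ * X ^ 2 := by
    rw [hX, saddleX, div_pow, Real.sq_sqrt (by positivity), mul_div_cancel₀ _ (by positivity)]
  have hαn : |α| ≤ n * (2 + 2 * M) := by
    have h1 := W.sE₂.b1 x₀ hx₀ρ
    have h2 := W.sμ₂.b1 x₀ hx₀ρ
    calc |α| ≤ |2 * m| + |n * deriv E x₀| + |deriv μ x₀| :=
          (abs_add_le _ _).trans (by gcongr; exact abs_sub _ _)
      _ = 2 * |m| + n * |deriv E x₀| + |deriv μ x₀| := by
          rw [abs_mul, abs_mul, abs_two, abs_of_pos hn0]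
      _ ≤ 2 * n + n * M + n * M := by
          gcongr
          exact h2.trans (le_mul_of_one_le_left hM.le hn)
      _ = _ := by ring
  have := inv_integral_exp_le (f := fun x => 2 * m * (x - x₀) - n * (E x - E x₀) + (μ x - μ x₀))
    (a := x₀ + c₄ * α / n) (r := r / √n)
    (w := c₄ * κ₀ / 2 * X ^ 2 - 1 / c₄ - 4 * M) (by positivity)
    fun x h1 h2 => by
      obtain ⟨u, rfl⟩ : ∃ u, x = x₀ + (c₄ * α / n + u) := ⟨x - x₀ - c₄ * α / n, by ring⟩
      have hu0 : 0 ≤ u := by linarith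
      have hu1 : u ≤ r / √n := by linarith
      have hu2 : u ≤ 1 / √n := hu1.trans (by gcongr)
      have hu3 : u ≤ ρ / 4 := hu1.trans ((div_le_self hr0.le hs1).trans hrρ)
      set y := c₄ * α / n + u with hy
      have hyρ : |y| ≤ ρ / 2 := by
        calc |y| ≤ |c₄ * α / n| + |u| := abs_add_le _ _
          _ ≤ ρ / 4 + ρ / 4 := by
            rw [abs_of_nonneg hu0]
            gcongr
            rw [abs_div, abs_mul, abs_of_pos hc₄0, abs_of_pos hn0, div_le_iff₀ hn0]
            calc c₄ * |α| ≤ c₄ * (n * (2 + 2 * M)) := by gcongr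
              _ = (c₄ * (2 + 2 * M)) * n := by ring
              _ ≤ _ := by gcongr
          _ = ρ / 2 := by ring
      have tE := le_of_abs_le
        (W.sE₂.taylor_one (x₀ := x₀) (η := ρ / 2) (by linarith) hyρ)
      have tμ := neg_le_of_abs_le
        (W.sμ₂.taylor_one (x₀ := x₀) (η := ρ / 2) (by linarith) hyρ)
      rw [sq_abs] at tE tμ
      rw [add_sub_cancel_left]
      have tE' : n * (E (x₀ + y) - E x₀ - deriv E x₀ * y) ≤ n * (M * y ^ 2) := by gcongr
      have tμ' : M * y ^ 2 ≤ n * (M * y ^ 2) := le_mul_of_one_le_left (by positivity) hn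
      have hmain : α * y - 2 * (n * (M * y ^ 2)) ≤
          2 * m * y - n * (E (x₀ + y) - E x₀) + (μ (x₀ + y) - μ x₀) := by
        rw [hα]; linarith
      refine le_trans ?_ hmain
      -- quadratic estimate
      have hy2 : y ^ 2 ≤ 2 * ((c₄ * α / n) ^ 2 + u ^ 2) := by
        rw [hy]; nlinarith [sq_nonneg (c₄ * α / n - u)]
      have hu4 : n * u ^ 2 ≤ 1 := by
        calc n * u ^ 2 ≤ n * (1 / √n) ^ 2 := by gcongr
          _ = 1 := by rw [div_pow, hss]; field_simp
      have hA : 0 ≤ α ^ 2 / n := by positivity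
      have e1 : n * (c₄ * α / n) ^ 2 = c₄ ^ 2 * (α ^ 2 / n) := by field_simp
      have h3 : 2 * (n * (M * y ^ 2)) ≤ 4 * M * (c₄ ^ 2 * (α ^ 2 / n)) + 4 * M := by
        calc 2 * (n * (M * y ^ 2)) ≤ 2 * (n * (M * (2 * ((c₄ * α / n) ^ 2 + u ^ 2)))) := by gcongr
          _ = 4 * M * (n * (c₄ * α / n) ^ 2) + 4 * M * (n * u ^ 2) := by ring
          _ ≤ 4 * M * (c₄ ^ 2 * (α ^ 2 / n)) + 4 * M * 1 := by rw [e1]; gcongr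
          _ = _ := by ring
      have h4 : 4 * M * (c₄ ^ 2 * (α ^ 2 / n)) ≤ c₄ / 4 * (α ^ 2 / n) := by
        have : 4 * M * (c₄ ^ 2 * (α ^ 2 / n)) = (16 * M * c₄) * (c₄ / 4 * (α ^ 2 / n)) := by ring
        rw [this]
        exact mul_le_of_le_one_left (by positivity) hc₄M
      have h5 : -(α * u) ≤ c₄ / 4 * (α ^ 2 / n) + 1 / c₄ := by
        have h6 : 0 ≤ (c₄ * α / 2 + n * u) ^ 2 / (c₄ * n) := by positivity
        have h7 : (c₄ * α / 2 + n * u) ^ 2 / (c₄ * n) =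
            c₄ / 4 * (α ^ 2 / n) + α * u + n * u ^ 2 / c₄ := by field_simp; ring
        have h8 : n * u ^ 2 / c₄ ≤ 1 / c₄ := by gcongr
        linarith
      have h9 : c₄ * κ₀ / 2 * X ^ 2 ≤ c₄ / 2 * (α ^ 2 / n) := by
        have : α ^ 2 / n = κ * X ^ 2 := by rw [hαX]; field_simp
        rw [this]
        calc c₄ * κ₀ / 2 * X ^ 2 ≤ c₄ * κ / 2 * X ^ 2 := by gcongr
          _ = _ := by ring
      have h10 : α * y = c₄ * (α ^ 2 / n) + α * u := by rw [hy]; ring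
      linarith
  unfold laplaceIntegrand
  refine this.trans (le_of_eq ?_)
  rw [inv_div, mul_mul_mul_comm, ← Real.exp_add, div_eq_mul_inv, mul_comm (√n)]
  congr 2; ring

/-- Away from the wells the potential grows at least linearly. -/
lemma exists_linear_growth {η : ℝ} (hη : 0 < η) :
    ∃ ε > 0, ∀ x, 2 * η < |x - x₁| → 2 * η < |x - x₂| → ε * (1 + |x - x₂|) ≤ E x := by
  have hβ0 := W.β0
  have hβ1 := W.β1
  obtain ⟨a, ha⟩ := W.bot
  have h1 : ∀ᶠ x in atTop, (1 - β) * (1 + |x - x₂|) ≤ E x := by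
    filter_upwards [W.top.eventually_ge_atTop 0, eventually_ge_atTop (max x₂ (1 - x₂))]
      with x hx hx2
    have h3 := (le_max_left _ _).trans hx2
    have h4 := (le_max_right _ _).trans hx2
    rw [abs_of_nonneg (by linarith)]
    have : 0 ≤ (1 - β) * (2 * x - (1 + (x - x₂))) := mul_nonneg (by linarith) (by linarith)
    linarith
  have h2 : ∀ᶠ x in atBot, β * (1 + |x - x₂|) ≤ E x := by
    filter_upwards [ha, eventually_le_atBot (min x₂ (a / β - 1 - x₂))] with x hx hx2
    have h3 := hx2.trans (min_le_left _ _)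
    have h4 := hx2.trans (min_le_right _ _)
    rw [abs_of_nonpos (by linarith)]
    have : 0 ≤ β * ((a / β - 1 - x₂) - x) := mul_nonneg hβ0.le (by linarith)
    have h5 : β * (a / β) = a := by field_simp
    linarith
  obtain ⟨R₁, hR₁⟩ := eventually_atTop.1 h1
  obtain ⟨R₂, hR₂⟩ := eventually_atBot.1 h2
  -- Beyond `R₁` and `R₂` growth at infinity applies. On the compact remainder the lower
  -- semicontinuous `E` attains its minimum, which is positive since both wells are excised.
  set K : Set ℝ := Set.Icc R₂ R₁ ∩ {x | 2 * η ≤ |x - x₁|} ∩ {x | 2 * η ≤ |x - x₂|} with hK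
  have hKc : IsCompact K :=
    (isCompact_Icc.inter_right (isClosed_le (by fun_prop) (by fun_prop))).inter_right
      (isClosed_le (by fun_prop) (by fun_prop))
  have hmin : ∃ d > 0, ∀ x ∈ K, d ≤ E x := by
    rcases K.eq_empty_or_nonempty with h | h
    · exact ⟨1, one_pos, by simp [h]⟩
    · obtain ⟨z, hz, hzm⟩ := (W.lsc.lowerSemicontinuousOn K).exists_isMinOn h hKc
      refine ⟨E z, W.pos z ?_ ?_, fun x hx => hzm hx⟩
      · rintro rfl
        have := hz.1.2
        simp at this; linarith
      · rintro rfl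
        have := hz.2
        simp at this; linarith
  obtain ⟨d, hd, hdK⟩ := hmin
  set D := 1 + |R₁ - x₂| + |R₂ - x₂| with hD
  have hD0 : 0 < D := by positivity
  refine ⟨min (min (1 - β) β) (d / D), by
    have : 0 < 1 - β := by linarith
    positivity, fun x hx1 hx2 => ?_⟩
  have hT : 0 ≤ 1 + |x - x₂| := by positivity
  rcases le_total R₁ x with h | h
  · refine le_trans ?_ (hR₁ x h)
    gcongr
    exact (min_le_left _ _).trans (min_le_left _ _)
  rcases le_total x R₂ with h' | h'
  · refine le_trans ?_ (hR₂ x h')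
    gcongr
    exact (min_le_left _ _).trans (min_le_right _ _)
  · refine le_trans ?_ (hdK x ⟨⟨⟨h', h⟩, hx1.le⟩, hx2.le⟩)
    have h6 : 1 + |x - x₂| ≤ D := by
      have : |x - x₂| ≤ |R₁ - x₂| + |R₂ - x₂| := by
        rcases abs_cases (x - x₂) with ⟨e, _⟩ | ⟨e, _⟩ <;> rw [e]
        · have := le_abs_self (R₁ - x₂); have := abs_nonneg (R₂ - x₂); linarith
        · have := neg_le_abs (R₂ - x₂); have := abs_nonneg (R₁ - x₂); linarith
      linarith
    calc min (min (1 - β) β) (d / D) * (1 + |x - x₂|) ≤ d / D * D := by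
          gcongr; exact min_le_right _ _
      _ = d := by field_simp

end TwoWell

lemma laplaceIntegrand_pos (E μ : ℝ → ℝ) (n m x₀ x : ℝ) : 0 < laplaceIntegrand E μ n m x₀ x :=
  Real.exp_pos _

/-- A change of base point multiplies the integrand by a constant, so relative weights of the wells
can be computed from any base point. -/
lemma laplaceIntegrand_cocycle (E μ : ℝ → ℝ) (n m x₀ y x : ℝ) :
    laplaceIntegrand E μ n m x₀ x =
      laplaceIntegrand E μ n m x₀ y * laplaceIntegrand E μ n m y x := by
  unfold laplaceIntegrand
  rw [← Real.exp_add]; congr 1; ring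

lemma integrable_exp_neg_mul_abs_sub {b : ℝ} (hb : 0 < b) (c : ℝ) :
    Integrable fun x : ℝ => Real.exp (-(b * |x - c|)) := by
  have h := (integrable_inv_one_add_sq.comp_sub_right c).const_mul (min 1 (b ^ 2 / 2))⁻¹
  refine h.mono' (by fun_prop) (Eventually.of_forall fun x => ?_)
  rw [Real.norm_of_nonneg (Real.exp_pos _).le, Real.exp_neg, ← mul_inv]
  have hT := abs_nonneg (x - c)
  refine inv_anti₀ (by positivity) ?_
  have h1 := Real.quadratic_le_exp_of_nonneg (x := b * |x - c|) (by positivity)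
  have h2 : 0 ≤ b * |x - c| := by positivity
  calc min 1 (b ^ 2 / 2) * (1 + (x - c) ^ 2) =
        min 1 (b ^ 2 / 2) * 1 + min 1 (b ^ 2 / 2) * (x - c) ^ 2 := by ring
    _ ≤ 1 * 1 + b ^ 2 / 2 * (x - c) ^ 2 := by
        gcongr
        · exact min_le_left _ _
        · exact min_le_right _ _
    _ ≤ Real.exp (b * |x - c|) := by rw [mul_pow, sq_abs] at h1; linarith

lemma volume_real_abs_sub_le {η : ℝ} (hη : 0 ≤ η) (c : ℝ) :
    volume.real {x : ℝ | |x - c| ≤ 2 * η} = 4 * η := by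
  have hset : {x : ℝ | |x - c| ≤ 2 * η} = Metric.closedBall c (2 * η) := by
    ext x; simp [Real.dist_eq]
  rw [hset, Measure.real, Real.volume_closedBall, ENNReal.toReal_ofReal (by positivity)]
  ring

lemma measurableSet_abs_sub_le (c η : ℝ) : MeasurableSet {x : ℝ | |x - c| ≤ 2 * η} :=
  measurableSet_le (by fun_prop) measurable_const

section Center

variable {E E₁ E₂ E₃ E₄ μ μ₁ μ₂ μ₃ μ₄ : ℝ → ℝ} {c ρ M κ₀ : ℝ}
  (hE : SmoothNear E E₁ E₂ E₃ E₄ c ρ M) (hμ : SmoothNear μ μ₁ μ₂ μ₃ μ₄ c ρ M)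
include hE hμ

set_option maxHeartbeats 800000 in
/-- Laplace's method at a critical point, for moderate frequencies. -/
lemma laplace_center (hρ : 0 < ρ) (hM : 0 < M) (hκ₀ : 0 < κ₀)
    (hκ : ∀ x, |x - c| ≤ ρ → κ₀ ≤ E₂ x) (hc : E₁ c = 0) (K : ℝ) :
    ∃ η₀ > 0, 4 * η₀ ≤ ρ ∧ ∀ η, 0 < η → η ≤ η₀ → ∃ C > 0, ∃ n₀ : ℝ, 1 ≤ n₀ ∧ ∀ n : ℝ, n₀ ≤ n →
      ∀ m : ℝ, |m| ≤ K * Real.log n →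
      |(∫ x in {x | |x - c| ≤ 2 * η}, laplaceIntegrand E μ n m c x) - √(2 * π / (n * E₂ c))| ≤
      C * (Real.log n ^ 2 / n) * √(2 * π / (n * E₂ c)) := by
  obtain ⟨η₀, hη₀, hηρ, hmain⟩ := laplace_integral hE hμ hρ hM hκ₀ hκ (θ := 1 / 2) (by norm_num)
  refine ⟨η₀, hη₀, hηρ, fun η hη hηle => ?_⟩
  obtain ⟨C, hC, hlap⟩ := hmain η hη hηle
  have hc0 : |c - c| ≤ ρ := by simp [hρ.le]
  set κ := E₂ c with hκdef
  have hκpos : 0 < κ := hκ₀.trans_le (hκ c hc0)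
  set D := (2 * |K| + M) / √κ with hD
  have hD0 : 0 < D := by positivity
  set D' := M / (6 * κ * √κ) with hD'
  have hD'0 : 0 < D' := by positivity
  have hlim : Tendsto (fun n : ℝ => D ^ 2 * (Real.log n ^ 2 / n)) atTop (𝓝 0) := by
    have := (Real.tendsto_pow_log_div_mul_add_atTop 1 0 2 one_ne_zero).const_mul (D ^ 2)
    simpa using this
  obtain ⟨n₁, hn₁⟩ := eventually_atTop.1 (hlim.eventually_le_const one_pos)
  refine ⟨4 * C + 8 * (D * D') + D ^ 2, by positivity, max n₁ (Real.exp 1),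
    (Real.one_le_exp zero_le_one).trans (le_max_right _ _), fun n hn m hm => ?_⟩
  have hnD := hn₁ n ((le_max_left _ _).trans hn)
  have hne : Real.exp 1 ≤ n := (le_max_right _ _).trans hn
  have hn1 : 1 ≤ n := (Real.one_le_exp zero_le_one).trans hne
  have hn0 : 0 < n := by linarith
  have hlog : 1 ≤ Real.log n := (Real.le_log_iff_exp_le hn0).2 hne
  have h1 := hlap n hn1 c (by simpa using hη.le) m
  set X := saddleX E₁ E₂ μ₁ n c m with hX
  set J₀ := √(2 * π / (n * κ)) with hJ₀
  have hJ₀0 : 0 ≤ J₀ := Real.sqrt_nonneg _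
  set l := Real.log n with hl
  have hsn : 0 < √n := Real.sqrt_pos.2 hn0
  -- At the bottom of the well `E₁` vanishes, so for `|m| ≤ K log n` the displacement is `O(log n /
  -- √n)`. Both `exp (X² / 2)` and the cubic correction are then `1 + O(log² n / n)`.
  have hXb : |X| ≤ D * (l / √n) := by
    rw [hX, saddleX, hc, mul_zero, sub_zero, abs_div, Real.sqrt_mul hn0.le, abs_of_pos
      (by positivity : 0 < √n * √(E₂ c)), hD, ← hκdef]
    have h2 : |2 * m + μ₁ c| ≤ (2 * |K| + M) * l := by
      calc |2 * m + μ₁ c| ≤ 2 * |m| + |μ₁ c| := by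
            refine (abs_add_le _ _).trans ?_
            rw [abs_mul, abs_two]
        _ ≤ 2 * (|K| * l) + M * l := by
            gcongr
            · exact hm.trans (by gcongr; exact le_abs_self K)
            · exact (hμ.b1 c hc0).trans (le_mul_of_one_le_right hM.le hlog)
        _ = _ := by ring
    calc |2 * m + μ₁ c| / (√n * √κ) ≤ (2 * |K| + M) * l / (√n * √κ) := by gcongr
      _ = _ := by field_simp
  have hX2 : X ^ 2 ≤ D ^ 2 * (l ^ 2 / n) := by
    rw [← sq_abs]
    calc |X| ^ 2 ≤ (D * (l / √n)) ^ 2 := by gcongr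
      _ = D ^ 2 * (l ^ 2 / n) := by rw [mul_pow, div_pow l, Real.sq_sqrt hn0.le]
  have hX1 : X ^ 2 ≤ 1 := hX2.trans hnD
  have hX1' : |X| ≤ 1 := by
    refine abs_le_of_sq_le_sq ?_ (by norm_num)
    linarith
  have hexp : Real.exp (X ^ 2 / 2) ≤ 1 + X ^ 2 := by
    have := Real.exp_bound_div_one_sub_of_interval (x := X ^ 2 / 2) (by positivity) (by linarith)
    refine this.trans ?_
    rw [div_le_iff₀ (by linarith)]
    have : 0 ≤ X ^ 2 * (1 - X ^ 2) := mul_nonneg (sq_nonneg X) (by linarith)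
    linarith
  have hexp1 : 1 ≤ Real.exp (X ^ 2 / 2) := Real.one_le_exp (by positivity)
  have hexp2 : Real.exp (1 / 2 * X ^ 2) ≤ 2 := by
    rw [show 1 / 2 * X ^ 2 = X ^ 2 / 2 by ring]; linarith
  set J := gaussWeight E₂ n c X with hJ
  have hJe : J = J₀ * Real.exp (X ^ 2 / 2) := rfl
  have hJ2 : J ≤ 2 * J₀ := by
    rw [hJe, mul_comm 2]; gcongr; linarith
  have hJ0 : 0 ≤ J := by rw [hJe]; positivity
  set p := phaseSkew E₂ E₃ n c * (X ^ 3 + 3 * X) with hp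
  have hpb : |p| ≤ 4 * (D * D') * (l ^ 2 / n) := by
    have hs : |phaseSkew E₂ E₃ n c| ≤ D' / √n := by
      rw [phaseSkew, abs_div, ← hκdef, abs_of_pos (by positivity : 0 < 6 * κ * √(n * κ)), hD',
        Real.sqrt_mul hn0.le]
      calc |E₃ c| / (6 * κ * (√n * √κ)) ≤ M / (6 * κ * (√n * √κ)) := by
            gcongr; exact hE.b3 c hc0
        _ = _ := by field_simp
    have hX3 : |X ^ 3 + 3 * X| ≤ 4 * |X| := by
      rw [show X ^ 3 + 3 * X = (X ^ 2 + 3) * X by ring, abs_mul, abs_of_nonneg (by positivity)]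
      gcongr; linarith
    rw [hp, abs_mul]
    calc |phaseSkew E₂ E₃ n c| * |X ^ 3 + 3 * X| ≤ D' / √n * (4 * (D * (l / √n))) := by
          gcongr; exact hX3.trans (by gcongr)
      _ = 4 * (D * D') * (l / √n ^ 2) := by field_simp
      _ ≤ 4 * (D * D') * (l ^ 2 / n) := by
          rw [Real.sq_sqrt hn0.le]
          gcongr
          exact le_self_pow₀ hlog two_ne_zero
  set H := ∫ x in {x | |x - c| ≤ 2 * η}, laplaceIntegrand E μ n m c x with hH
  have hCn : C / n ≤ C * (l ^ 2 / n) := by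
    rw [div_eq_mul_one_div]
    gcongr
    exact one_le_pow₀ hlog
  have b1 : |H - J * (1 - p)| ≤ 4 * C * (l ^ 2 / n) * J₀ := by
    refine h1.trans ?_
    calc C / n * (J * Real.exp (1 / 2 * X ^ 2)) ≤ C * (l ^ 2 / n) * (2 * J₀ * 2) := by gcongr
      _ = _ := by ring
  have b2 : |J * p| ≤ 8 * (D * D') * (l ^ 2 / n) * J₀ := by
    rw [abs_mul, abs_of_nonneg hJ0]
    calc J * |p| ≤ 2 * J₀ * (4 * (D * D') * (l ^ 2 / n)) := by gcongr
      _ = _ := by ring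
  have b3 : |J - J₀| ≤ D ^ 2 * (l ^ 2 / n) * J₀ := by
    rw [hJe, show J₀ * Real.exp (X ^ 2 / 2) - J₀ = (Real.exp (X ^ 2 / 2) - 1) * J₀ by ring,
      abs_mul, abs_of_nonneg hJ₀0, abs_of_nonneg (by linarith)]
    gcongr
    linarith
  calc |H - J₀| = |(H - J * (1 - p)) - J * p + (J - J₀)| := by congr 1; ring
    _ ≤ |H - J * (1 - p)| + |J * p| + |J - J₀| :=
        (abs_add_le _ _).trans (by gcongr; exact abs_sub _ _)
    _ ≤ _ := by linarith

end Center

namespace TwoWell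

variable {E μ : ℝ → ℝ} {x₁ x₂ β ρ M κ₀ : ℝ} (W : TwoWell E μ x₁ x₂ β ρ M κ₀)
include W

lemma measurable_integrand (n m x₀ : ℝ) : Measurable (laplaceIntegrand E μ n m x₀) := by
  have h1 := W.lsc.measurable
  have h2 := W.meas
  unfold laplaceIntegrand
  fun_prop

/-- The contribution away from the wells is exponentially small. -/
lemma tail {η ε : ℝ} (hε : 0 < ε)
    (hg : ∀ x, 2 * η < |x - x₁| → 2 * η < |x - x₂| → ε * (1 + |x - x₂|) ≤ E x) :
    ∃ C > 0, ∀ n : ℝ, 1 ≤ n → ∀ m, |m| ≤ n * ε / 4 →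
      IntegrableOn (laplaceIntegrand E μ n m x₂) {x | 2 * η < |x - x₁| ∧ 2 * η < |x - x₂|} ∧
      ∫ x in {x | 2 * η < |x - x₁| ∧ 2 * η < |x - x₂|}, laplaceIntegrand E μ n m x₂ x ≤
        C * Real.exp (-(n * ε / 2)) := by
  have hi := integrable_exp_neg_mul_abs_sub (b := ε / 2) (by linarith) x₂
  refine ⟨Real.exp (2 * M) * (∫ x : ℝ, Real.exp (-(ε / 2 * |x - x₂|))) + 1, by positivity,
    fun n hn m hm => ?_⟩
  set S : Set ℝ := {x | 2 * η < |x - x₁| ∧ 2 * η < |x - x₂|} with hS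
  have hSm : MeasurableSet S :=
    (measurableSet_lt (f := fun _ => 2 * η) (g := fun x : ℝ => |x - x₁|) measurable_const
      (by fun_prop)).inter
    (measurableSet_lt (f := fun _ => 2 * η) (g := fun x : ℝ => |x - x₂|) measurable_const
      (by fun_prop))
  have hpt : ∀ x ∈ S, laplaceIntegrand E μ n m x₂ x ≤
      Real.exp (2 * M) * Real.exp (-(n * ε / 2)) * Real.exp (-(ε / 2 * |x - x₂|)) := by
    intro x hx
    rw [laplaceIntegrand, ← Real.exp_add, ← Real.exp_add, W.zero₂, sub_zero]
    refine Real.exp_le_exp.2 ?_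
    have h1 := W.perturb_sub_le x x₂
    have hT := abs_nonneg (x - x₂)
    have h2 : n * (ε * (1 + |x - x₂|)) ≤ n * E x := by gcongr; exact hg x hx.1 hx.2
    have h3 : 2 * m * (x - x₂) ≤ n * ε / 2 * |x - x₂| := by
      calc 2 * m * (x - x₂) ≤ |2 * m * (x - x₂)| := le_abs_self _
        _ = 2 * |m| * |x - x₂| := by rw [abs_mul, abs_mul, abs_two]
        _ ≤ 2 * (n * ε / 4) * |x - x₂| := by gcongr
        _ = _ := by ring
    have h4 : ε / 2 * |x - x₂| ≤ n * (ε / 2 * |x - x₂|) :=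
      le_mul_of_one_le_left (by positivity) hn
    have h5 : 0 ≤ n * ε := by positivity
    linarith
  have hib := (hi.const_mul (Real.exp (2 * M) * Real.exp (-(n * ε / 2)))).integrableOn (s := S)
  have hint : IntegrableOn (laplaceIntegrand E μ n m x₂) S := by
    refine hib.mono' (W.measurable_integrand n m x₂).aestronglyMeasurable ?_
    filter_upwards [ae_restrict_mem hSm] with x hx
    rw [Real.norm_of_nonneg (laplaceIntegrand_pos _ _ _ _ _ _).le]
    exact hpt x hx
  refine ⟨hint, (setIntegral_mono_on hint hib hSm hpt).trans ?_⟩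
  rw [integral_const_mul]
  have h6 : ∫ x in S, Real.exp (-(ε / 2 * |x - x₂|)) ≤ ∫ x : ℝ, Real.exp (-(ε / 2 * |x - x₂|)) :=
    setIntegral_le_integral hi (Eventually.of_forall fun x => (Real.exp_pos _).le)
  calc Real.exp (2 * M) * Real.exp (-(n * ε / 2)) * ∫ x in S, Real.exp (-(ε / 2 * |x - x₂|)) ≤
      Real.exp (2 * M) * Real.exp (-(n * ε / 2)) * ∫ x : ℝ, Real.exp (-(ε / 2 * |x - x₂|)) := by
        gcongr
    _ = Real.exp (2 * M) * (∫ x : ℝ, Real.exp (-(ε / 2 * |x - x₂|))) * Real.exp (-(n * ε / 2)) := by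
        ring
    _ ≤ _ := by gcongr; linarith

/-- Lower bound for the contribution of the right well. -/
lemma right_lower {η : ℝ} (hη : 0 < η) (hηρ : 2 * η ≤ ρ) : ∃ c > 0, ∀ n : ℝ, 1 ≤ n → ∀ m, -√n ≤ m →
    c / √n ≤ ∫ x in {x | |x - x₂| ≤ 2 * η}, laplaceIntegrand E μ n m x₂ x := by
  have hM := W.M0
  set r := min 1 (2 * η) with hr
  have hr0 : 0 < r := by positivity
  have hr1 : r ≤ 1 := min_le_left _ _
  have hrη : r ≤ 2 * η := min_le_right _ _
  refine ⟨r * Real.exp (-2 - 3 * M), by positivity, fun n hn m hm => ?_⟩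
  have hn0 : 0 < n := by linarith
  have hs0 : 0 < √n := Real.sqrt_pos.2 hn0
  have hs1 : 1 ≤ √n := Real.one_le_sqrt.2 hn
  have hss : √n ^ 2 = n := Real.sq_sqrt hn0.le
  have hi := laplaceIntegrand_integrableOn W.sE₂ W.sμ₂ hηρ n m x₂
  have hrs : r / √n ≤ r := div_le_self hr0.le hs1
  have hsub : Set.Icc x₂ (x₂ + r / √n) ⊆ {x | |x - x₂| ≤ 2 * η} := fun x hx => by
    simp only [Set.mem_ofPred_eq]
    rw [abs_of_nonneg (by linarith [hx.1])]
    linarith [hx.2]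
  have h1 : ∫ x in Set.Icc x₂ (x₂ + r / √n), Real.exp (-2 - 3 * M) ≤
      ∫ x in Set.Icc x₂ (x₂ + r / √n), laplaceIntegrand E μ n m x₂ x := by
    refine setIntegral_mono_on (by simp) (hi.mono_set hsub) measurableSet_Icc fun x hx => ?_
    rw [laplaceIntegrand, W.zero₂, sub_zero]
    refine Real.exp_le_exp.2 ?_
    have hy0 : 0 ≤ x - x₂ := by linarith [hx.1]
    have hy1 : x - x₂ ≤ r / √n := by linarith [hx.2]
    have hy2 : x - x₂ ≤ 1 / √n := hy1.trans (by gcongr)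
    have hE := W.well_le₂ (y := x - x₂) (by rw [abs_of_nonneg hy0]; linarith)
    rw [add_sub_cancel] at hE
    have h3 : n * E x ≤ M := by
      calc n * E x ≤ n * (M * (1 / √n) ^ 2) := by
            gcongr; exact hE.trans (by gcongr)
        _ = M := by rw [div_pow, hss]; field_simp
    have h4 : -2 ≤ 2 * m * (x - x₂) := by
      have h5 : √n * (x - x₂) ≤ 1 := by
        rw [le_div_iff₀ hs0] at hy2; linarith
      have h6 : 0 ≤ (m + √n) * (x - x₂) := mul_nonneg (by linarith) hy0
      linarith
    have h7 := W.perturb_sub_ge x x₂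
    linarith
  have h2 : ∫ x in Set.Icc x₂ (x₂ + r / √n), laplaceIntegrand E μ n m x₂ x ≤
      ∫ x in {x | |x - x₂| ≤ 2 * η}, laplaceIntegrand E μ n m x₂ x :=
    setIntegral_mono_set hi (Eventually.of_forall fun x => (laplaceIntegrand_pos _ _ _ _ _ _).le)
      hsub.eventuallyLE
  refine le_trans (le_of_eq ?_) (h1.trans h2)
  simp only [setIntegral_const, smul_eq_mul, Measure.real, Real.volume_Icc]
  rw [add_sub_cancel_left, ENNReal.toReal_ofReal (by positivity)]
  ring

/-- Upper bound for the contribution of the left well. -/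
lemma left_upper {η : ℝ} (hη : 0 < η) (hηρ : 2 * η ≤ ρ) (hηL : 4 * η ≤ x₂ - x₁) {n m : ℝ}
    (hn : 0 ≤ n) (hm : 0 ≤ m) :
    ∫ x in {x | |x - x₁| ≤ 2 * η}, laplaceIntegrand E μ n m x₂ x ≤
      4 * η * (Real.exp (2 * M) * Real.exp (-(m * (x₂ - x₁)))) := by
  have hi := laplaceIntegrand_integrableOn W.sE₁ W.sμ₁ hηρ n m x₂
  have hset : {x : ℝ | |x - x₁| ≤ 2 * η} = Metric.closedBall x₁ (2 * η) := by
    ext x; simp [Real.dist_eq]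
  have h1 : ∫ x in {x | |x - x₁| ≤ 2 * η}, laplaceIntegrand E μ n m x₂ x ≤
      ∫ x in {x | |x - x₁| ≤ 2 * η}, Real.exp (2 * M) * Real.exp (-(m * (x₂ - x₁))) := by
    refine setIntegral_mono_on hi ?_ (measurableSet_abs_sub_le _ _) fun x hx => ?_
    · rw [hset]
      exact integrableOn_const measure_closedBall_lt_top.ne
    · rw [← Real.exp_add, laplaceIntegrand, W.zero₂, sub_zero]
      refine Real.exp_le_exp.2 ?_
      have hx1 : |x - x₁| ≤ 2 * η := hx
      have h2 := (abs_le.1 hx1).2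
      have h3 := mul_nonneg hn (W.nonneg x)
      have h4 := W.perturb_sub_le x x₂
      have h5 : 0 ≤ m * (-(x₂ - x₁) - 2 * (x - x₂)) := mul_nonneg hm (by linarith)
      linarith
  refine h1.trans (le_of_eq ?_)
  rw [setIntegral_const, smul_eq_mul, volume_real_abs_sub_le hη.le]

end TwoWell

/-! ### Relative weights of the wells and the individual terms -/

/-- The shift in the occupation weights of the two wells. -/
noncomputable def wellShift (E μ : ℝ → ℝ) (x₁ x₂ : ℝ) : ℝ :=
  (μ x₁ - μ x₂) / (2 * (x₂ - x₁)) +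
    Real.log (deriv (deriv E) x₂ / deriv (deriv E) x₁) / (4 * (x₂ - x₁)) - 1 / 2

/-- The relative weight of the left well. -/
noncomputable def wellRatio (E μ : ℝ → ℝ) (x₁ x₂ m : ℝ) : ℝ :=
  Real.exp (-2 * (x₂ - x₁) * (m - 1 / 2 - wellShift E μ x₁ x₂))

lemma tendsto_log_sq_div_atTop : Tendsto (fun n : ℝ => Real.log n ^ 2 / n) atTop (𝓝 0) := by
  simpa using Real.tendsto_pow_log_div_mul_add_atTop 1 0 2 one_ne_zero

lemma eventually_mul_log_le_sqrt (K : ℝ) : ∀ᶠ n : ℝ in atTop, K * Real.log n ≤ √n := by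
  have h := (tendsto_log_sq_div_atTop.const_mul (K ^ 2))
  rw [mul_zero] at h
  filter_upwards [h.eventually_le_const one_pos, eventually_gt_atTop 0] with n hn hn0
  refine Real.le_sqrt_of_sq_le ?_
  rw [← mul_div_assoc, div_le_one hn0] at hn
  rw [mul_pow]; exact hn

lemma eventually_sqrt_le_mul {ε : ℝ} (hε : 0 < ε) : ∀ᶠ n : ℝ in atTop, √n ≤ n * ε := by
  filter_upwards [eventually_ge_atTop (1 / ε ^ 2), eventually_gt_atTop 0] with n hn hn0
  refine Real.sqrt_le_iff.2 ⟨by positivity, ?_⟩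
  rw [div_le_iff₀ (by positivity)] at hn
  calc n = n * 1 := by ring
    _ ≤ n * (n * ε ^ 2) := by gcongr
    _ = (n * ε) ^ 2 := by ring

lemma abs_inv_one_add_sub_le {a b : ℝ} (ha : 0 ≤ a) (hb : 0 ≤ b) :
    |(1 + a)⁻¹ - (1 + b)⁻¹| ≤ |a - b| / (1 + b) := by
  have h1 : (1 + a)⁻¹ - (1 + b)⁻¹ = -(a - b) / ((1 + a) * (1 + b)) := by field_simp; ring
  rw [h1, abs_div, abs_neg, abs_of_pos (by positivity : 0 < (1 + a) * (1 + b))]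
  gcongr
  exact le_mul_of_one_le_left (by positivity) (by linarith)

namespace TwoWell

variable {E μ : ℝ → ℝ} {x₁ x₂ β ρ M κ₀ : ℝ} (W : TwoWell E μ x₁ x₂ β ρ M κ₀)
include W

lemma deriv2_pos₁ : 0 < deriv (deriv E) x₁ :=
  W.κ0.trans_le (W.κ₁ x₁ (by simp [W.ρ0.le]))

lemma deriv2_pos₂ : 0 < deriv (deriv E) x₂ :=
  W.κ0.trans_le (W.κ₂ x₂ (by simp [W.ρ0.le]))

/-- The ratio of two Gaussian prefactors times the ratio of the heights. The two halves in the
definitions cancel; they are there to match the half-integer lattice of `fermiWeight`. -/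
lemma wellRatio_eq (m : ℝ) : wellRatio E μ x₁ x₂ m =
    Real.exp (-2 * m * (x₂ - x₁) + (μ x₁ - μ x₂)) *
      √(deriv (deriv E) x₂ / deriv (deriv E) x₁) := by
  have h1 := W.deriv2_pos₁
  have h2 := W.deriv2_pos₂
  have hL : 0 < x₂ - x₁ := sub_pos.2 W.lt
  rw [wellRatio, wellShift, ← Real.exp_log (Real.sqrt_pos.2 (div_pos h2 h1)), ← Real.exp_add,
    Real.log_sqrt (div_pos h2 h1).le]
  congr 1
  field_simp
  ring

/-- Splitting off the right well. -/
lemma inv_integral_eq {η n m : ℝ} (hηρ : 2 * η ≤ ρ) (hηL : 4 * η < x₂ - x₁)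
    (htail : IntegrableOn (laplaceIntegrand E μ n m x₂)
      {x | 2 * η < |x - x₁| ∧ 2 * η < |x - x₂|}) (x₀ : ℝ)
    (hpos : 0 < ∫ x in {x | |x - x₂| ≤ 2 * η}, laplaceIntegrand E μ n m x₂ x) :
    (∫ x, laplaceIntegrand E μ n m x₀ x)⁻¹ =
      (∫ x in {x | |x - x₂| ≤ 2 * η}, laplaceIntegrand E μ n m x₀ x)⁻¹ *
      (1 + ((∫ x in {x | |x - x₁| ≤ 2 * η}, laplaceIntegrand E μ n m x₂ x) +
        ∫ x in {x | 2 * η < |x - x₁| ∧ 2 * η < |x - x₂|}, laplaceIntegrand E μ n m x₂ x) /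
        ∫ x in {x | |x - x₂| ≤ 2 * η}, laplaceIntegrand E μ n m x₂ x)⁻¹ := by
  set f := laplaceIntegrand E μ n m x₂ with hf
  set A₁ : Set ℝ := {x | |x - x₁| ≤ 2 * η} with hA₁
  set A₂ : Set ℝ := {x | |x - x₂| ≤ 2 * η} with hA₂
  set S : Set ℝ := {x | 2 * η < |x - x₁| ∧ 2 * η < |x - x₂|} with hS
  have i1 : IntegrableOn f A₁ := laplaceIntegrand_integrableOn W.sE₁ W.sμ₁ hηρ n m x₂
  have i2 : IntegrableOn f A₂ := laplaceIntegrand_integrableOn W.sE₂ W.sμ₂ hηρ n m x₂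
  have m1 : MeasurableSet A₁ := measurableSet_abs_sub_le _ _
  have m2 : MeasurableSet A₂ := measurableSet_abs_sub_le _ _
  have hSc : S = (A₁ ∪ A₂)ᶜ := by
    ext x; simp [hS, hA₁, hA₂]
  have hdisj : Disjoint A₁ A₂ := by
    rw [Set.disjoint_left]
    intro x h1 h2
    have h1' : |x - x₁| ≤ 2 * η := h1
    have h2' : |x - x₂| ≤ 2 * η := h2
    have := (abs_le.1 h1').2
    have := (abs_le.1 h2').1
    linarith
  have i12 : IntegrableOn f (A₁ ∪ A₂) := i1.union i2
  have hint : Integrable f := by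
    rw [← integrableOn_univ, ← Set.union_compl_self (A₁ ∪ A₂), ← hSc]
    exact i12.union htail
  have htot : ∫ x, f x = (∫ x in A₂, f x) + ((∫ x in A₁, f x) + ∫ x in S, f x) := by
    rw [← integral_add_compl (m1.union m2) hint, setIntegral_union hdisj m2 i1 i2, ← hSc]
    ring
  have e1 : ∫ x, laplaceIntegrand E μ n m x₀ x = laplaceIntegrand E μ n m x₀ x₂ * ∫ x, f x := by
    rw [← integral_const_mul]
    exact integral_congr_ae (Eventually.of_forall fun x => laplaceIntegrand_cocycle _ _ _ _ _ _ _)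
  have e2 : ∫ x in A₂, laplaceIntegrand E μ n m x₀ x =
      laplaceIntegrand E μ n m x₀ x₂ * ∫ x in A₂, f x := by
    rw [← integral_const_mul]
    exact integral_congr_ae (Eventually.of_forall fun x => laplaceIntegrand_cocycle _ _ _ _ _ _ _)
  rw [e1, e2, htot, ← mul_inv, mul_assoc]
  congr 2
  rw [mul_add, mul_one, mul_div_cancel₀ _ hpos.ne']

set_option maxHeartbeats 1000000 in
/-- The relative weight of the two wells at moderate frequencies. -/
lemma ratio_estimate (K : ℝ) : ∃ η₀ > 0, ∀ η, 0 < η → η ≤ η₀ → ∀ ε > 0,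
    (∀ x, 2 * η < |x - x₁| → 2 * η < |x - x₂| → ε * (1 + |x - x₂|) ≤ E x) →
    ∃ C > 0, ∀ᶠ n : ℝ in atTop, ∀ m, |m| ≤ K * Real.log n →
      |(1 + ((∫ x in {x | |x - x₁| ≤ 2 * η}, laplaceIntegrand E μ n m x₂ x) +
        ∫ x in {x | 2 * η < |x - x₁| ∧ 2 * η < |x - x₂|}, laplaceIntegrand E μ n m x₂ x) /
        ∫ x in {x | |x - x₂| ≤ 2 * η}, laplaceIntegrand E μ n m x₂ x)⁻¹ -
      (1 + wellRatio E μ x₁ x₂ m)⁻¹| ≤ C * (Real.log n ^ 2 / n) := by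
  obtain ⟨η₁, hη₁, hηρ₁, h1⟩ := laplace_center W.sE₁ W.sμ₁ W.ρ0 W.M0 W.κ0 W.κ₁ W.deriv₁ K
  obtain ⟨η₂, hη₂, hηρ₂, h2⟩ := laplace_center W.sE₂ W.sμ₂ W.ρ0 W.M0 W.κ0 W.κ₂ W.deriv₂ K
  refine ⟨min η₁ η₂, by positivity, fun η hη hηle ε hε hg => ?_⟩
  obtain ⟨C₁, hC₁, n₁, hn₁, h1⟩ := h1 η hη (hηle.trans (min_le_left _ _))
  obtain ⟨C₂, hC₂, n₂, hn₂, h2⟩ := h2 η hη (hηle.trans (min_le_right _ _))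
  have hηρ : 2 * η ≤ ρ := by
    have := hηle.trans (min_le_right _ _)
    linarith
  obtain ⟨Ct, hCt, ht⟩ := W.tail hε hg
  obtain ⟨c, hc, hlow⟩ := W.right_lower hη hηρ
  obtain ⟨Cp, hCp, hpoly⟩ := exists_poly_le_exp 2 (half_pos hε)
  set Cm := C₁ + C₂ with hCm
  refine ⟨4 * Cm + Ct * Cp / c, by positivity, ?_⟩
  have hlim := tendsto_log_sq_div_atTop.const_mul Cm
  rw [mul_zero] at hlim
  filter_upwards [eventually_ge_atTop n₁, eventually_ge_atTop n₂, eventually_mul_log_le_sqrt K,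
    eventually_sqrt_le_mul (ε := ε / 4) (by positivity), hlim.eventually_le_const one_half_pos,
    eventually_ge_atTop (Real.exp 1)]
    with n hnn₁ hnn₂ hKs hsε hδ hne m hm
  have hn1 : 1 ≤ n := hn₁.trans hnn₁
  have hn0 : 0 < n := by linarith
  have hs0 : 0 < √n := Real.sqrt_pos.2 hn0
  have hlog : 1 ≤ Real.log n := (Real.le_log_iff_exp_le hn0).2 hne
  have hκ1 := W.deriv2_pos₁
  have hκ2 := W.deriv2_pos₂
  have a1 := h1 n hnn₁ m hm
  have a2 := h2 n hnn₂ m hm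
  obtain ⟨-, a3⟩ := ht n hn1 m (by linarith)
  have a4 := hlow n hn1 m (by linarith [neg_le_of_abs_le hm])
  set J₁ := √(2 * π / (n * deriv (deriv E) x₁)) with hJ₁
  set J₂ := √(2 * π / (n * deriv (deriv E) x₂)) with hJ₂
  have hJ₁0 : 0 < J₁ := Real.sqrt_pos.2 (by positivity)
  have hJ₂0 : 0 < J₂ := Real.sqrt_pos.2 (by positivity)
  set H₁ := ∫ x in {x | |x - x₁| ≤ 2 * η}, laplaceIntegrand E μ n m x₁ x with hH₁
  set H₂ := ∫ x in {x | |x - x₂| ≤ 2 * η}, laplaceIntegrand E μ n m x₂ x with hH₂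
  set t := ∫ x in {x | 2 * η < |x - x₁| ∧ 2 * η < |x - x₂|}, laplaceIntegrand E μ n m x₂ x with ht'
  have ht0 : 0 ≤ t := integral_nonneg fun x => (laplaceIntegrand_pos _ _ _ _ _ _).le
  have hH₁0 : 0 ≤ H₁ := integral_nonneg fun x => (laplaceIntegrand_pos _ _ _ _ _ _).le
  set e₀ := Real.exp (-2 * m * (x₂ - x₁) + (μ x₁ - μ x₂)) with he₀
  have he₀0 : 0 < e₀ := Real.exp_pos _
  -- Rebasing at `x₁` reduces the left well to `laplace_center`; both wells have depth 0, so the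
  -- factor contains no `n`.
  have e1 : ∫ x in {x | |x - x₁| ≤ 2 * η}, laplaceIntegrand E μ n m x₂ x = e₀ * H₁ := by
    have : e₀ = laplaceIntegrand E μ n m x₂ x₁ := by
      rw [he₀, laplaceIntegrand, W.zero₁, W.zero₂]; congr 1; ring
    rw [this, hH₁, ← integral_const_mul]
    exact integral_congr_ae (Eventually.of_forall fun x => laplaceIntegrand_cocycle _ _ _ _ _ _ _)
  rw [e1]
  have hb : wellRatio E μ x₁ x₂ m = e₀ * (J₁ / J₂) := by
    rw [W.wellRatio_eq, ← he₀, hJ₁, hJ₂, ← Real.sqrt_div (by positivity)]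
    congr 2
    field_simp
  rw [hb]
  set b := e₀ * (J₁ / J₂) with hbdef
  have hb0 : 0 < b := by positivity
  set δ := Cm * (Real.log n ^ 2 / n) with hδdef
  have hq : 0 ≤ Real.log n ^ 2 / n := by positivity
  have d1 : |H₁ - J₁| ≤ δ * J₁ := a1.trans (by rw [hδdef, hCm]; gcongr; linarith)
  have d2 : |H₂ - J₂| ≤ δ * J₂ := a2.trans (by rw [hδdef, hCm]; gcongr; linarith)
  have hδ0 : 0 ≤ δ := by positivity
  have hH₂J : J₂ / 2 ≤ H₂ := by
    have := neg_le_of_abs_le d2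
    have h5 : δ * J₂ ≤ 1 / 2 * J₂ := by gcongr
    linarith
  have hH₂0 : 0 < H₂ := by linarith
  have hr : |H₁ / H₂ - J₁ / J₂| ≤ 4 * δ * (J₁ / J₂) := by
    have h5 : H₁ / H₂ - J₁ / J₂ = ((H₁ - J₁) * J₂ - J₁ * (H₂ - J₂)) / (H₂ * J₂) := by
      field_simp; ring
    rw [h5, abs_div, abs_of_pos (by positivity : 0 < H₂ * J₂), div_le_iff₀ (by positivity)]
    calc |(H₁ - J₁) * J₂ - J₁ * (H₂ - J₂)| ≤ |H₁ - J₁| * J₂ + J₁ * |H₂ - J₂| := by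
          refine (abs_sub _ _).trans (le_of_eq ?_)
          rw [abs_mul, abs_mul, abs_of_pos hJ₁0, abs_of_pos hJ₂0]
      _ ≤ δ * J₁ * J₂ + J₁ * (δ * J₂) := by gcongr
      _ = 4 * δ * (J₁ / J₂) * (J₂ / 2 * J₂) := by field_simp; ring
      _ ≤ _ := by gcongr
  have htH : t / H₂ ≤ Ct * Cp / c * (Real.log n ^ 2 / n) := by
    have h6 : n ^ 2 * Real.exp (-(n * ε / 2)) ≤ Cp := by
      have := hpoly n hn0.le
      rw [Real.exp_neg, ← div_eq_mul_inv, div_le_iff₀ (Real.exp_pos _)]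
      rwa [show n * ε / 2 = ε / 2 * n by ring]
    have h7 : √n ≤ n := Real.sqrt_le_iff.2 ⟨hn0.le, by nlinarith⟩
    rw [div_le_iff₀ hH₂0]
    calc t ≤ Ct * Real.exp (-(n * ε / 2)) := a3
      _ = Ct * (n ^ 2 * Real.exp (-(n * ε / 2))) / n ^ 2 := by field_simp
      _ ≤ Ct * Cp / n ^ 2 := by gcongr
      _ = Ct * Cp / c * (1 / n) * (c / n) := by field_simp
      _ ≤ Ct * Cp / c * (Real.log n ^ 2 / n) * (c / √n) := by
          gcongr
          exact one_le_pow₀ hlog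
      _ ≤ _ := by gcongr
  set a := (e₀ * H₁ + t) / H₂ with ha
  have ha0 : 0 ≤ a := by positivity
  have hab : |a - b| ≤ 4 * δ * b + t / H₂ := by
    have h8 : a - b = e₀ * (H₁ / H₂ - J₁ / J₂) + t / H₂ := by rw [ha, hbdef]; ring
    rw [h8]
    refine (abs_add_le _ _).trans ?_
    rw [abs_mul, abs_of_pos he₀0, abs_of_nonneg (by positivity : 0 ≤ t / H₂)]
    have h11 : e₀ * |H₁ / H₂ - J₁ / J₂| ≤ 4 * δ * b := by
      calc e₀ * |H₁ / H₂ - J₁ / J₂| ≤ e₀ * (4 * δ * (J₁ / J₂)) := by gcongr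
        _ = 4 * δ * b := by rw [hbdef]; ring
    linarith
  -- For negative `m` the ratio `b` can be as large as a power of `n`. Dividing by `1 + b` makes a
  -- relative error on `b` sufficient.
  refine (abs_inv_one_add_sub_le ha0 hb0.le).trans ?_
  rw [div_le_iff₀ (by positivity)]
  have h9 : 0 ≤ Ct * Cp / c * (Real.log n ^ 2 / n) * b := by positivity
  have h10 : (4 * Cm + Ct * Cp / c) * (Real.log n ^ 2 / n) * (1 + b) =
      4 * δ + 4 * δ * b + Ct * Cp / c * (Real.log n ^ 2 / n) +
      Ct * Cp / c * (Real.log n ^ 2 / n) * b := by rw [hδdef]; ring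
  rw [h10]
  linarith

end TwoWell

lemma abs_skewGauss_le (c₀ : ℝ) : ∃ C > 0, ∀ c, |c| ≤ c₀ → ∀ X,
    |skewGauss c X| ≤ C * Real.exp (-X ^ 2 / 4) := by
  obtain ⟨C, hC, h⟩ := exists_poly_le_exp 2 (θ := 1 / 4) (by norm_num)
  refine ⟨1 + |c₀| * ((C + 21)), by positivity, fun c hc X => ?_⟩
  have hc' : |c| ≤ |c₀| := hc.trans (le_abs_self _)
  have hsplit : Real.exp (-X ^ 2 / 2) = Real.exp (-X ^ 2 / 4) * Real.exp (-(X ^ 2 / 4)) := by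
    rw [← Real.exp_add]; congr 1; ring
  have he1 : Real.exp (-(X ^ 2 / 4)) ≤ 1 := Real.exp_le_one_iff.2 (by linarith [sq_nonneg X])
  have hX : |X ^ 3 + 3 * X| * Real.exp (-(X ^ 2 / 4)) ≤ (C + 21) := by
    have h1 : |X ^ 3 + 3 * X| ≤ (X ^ 2) ^ 2 + 5 + X ^ 2 * 4 := by
      rw [abs_le]; constructor <;>
      nlinarith [sq_nonneg (X ^ 2 - X), sq_nonneg (X ^ 2 + X), sq_nonneg (X - 1), sq_nonneg (X + 1)]
    have h2 := h (X ^ 2) (sq_nonneg X)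
    have h3 : X ^ 2 * 4 ≤ 16 * Real.exp (1 / 4 * X ^ 2) := by
      linarith [Real.add_one_le_exp (1 / 4 * X ^ 2)]
    have h4 : Real.exp (1 / 4 * X ^ 2) * Real.exp (-(X ^ 2 / 4)) = 1 := by
      rw [← Real.exp_add, show 1 / 4 * X ^ 2 + -(X ^ 2 / 4) = 0 by ring, Real.exp_zero]
    calc |X ^ 3 + 3 * X| * Real.exp (-(X ^ 2 / 4)) ≤
        (C * Real.exp (1 / 4 * X ^ 2) + 5 + 16 * Real.exp (1 / 4 * X ^ 2)) *
          Real.exp (-(X ^ 2 / 4)) := by gcongr; linarith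
      _ = (C + 16) * (Real.exp (1 / 4 * X ^ 2) * Real.exp (-(X ^ 2 / 4))) +
          5 * Real.exp (-(X ^ 2 / 4)) := by ring
      _ ≤ C + 21 := by rw [h4]; linarith
  rw [skewGauss, abs_mul, Real.abs_exp, hsplit, mul_assoc, mul_comm (1 + |c₀| * ((C + 21)))]
  refine mul_le_mul_of_nonneg_left ?_ (Real.exp_pos _).le
  calc Real.exp (-(X ^ 2 / 4)) * |1 + c * (X ^ 3 + 3 * X)| ≤
      Real.exp (-(X ^ 2 / 4)) * (1 + |c| * |X ^ 3 + 3 * X|) := by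
        gcongr
        refine (abs_add_le _ _).trans ?_
        rw [abs_one, abs_mul]
    _ = Real.exp (-(X ^ 2 / 4)) + |c| * (|X ^ 3 + 3 * X| * Real.exp (-(X ^ 2 / 4))) := by ring
    _ ≤ 1 + |c₀| * ((C + 21)) := by gcongr

lemma exp_neg_sq_div_four_le (X : ℝ) : Real.exp (-X ^ 2 / 4) ≤ 3 * Real.exp (-|X|) := by
  have h1 : -X ^ 2 / 4 ≤ 1 + -|X| := by nlinarith [sq_nonneg (|X| - 2), sq_abs X]
  have := Real.exp_one_lt_d9
  calc Real.exp (-X ^ 2 / 4) ≤ Real.exp (1 + -|X|) := Real.exp_le_exp.2 h1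
    _ = Real.exp 1 * Real.exp (-|X|) := Real.exp_add _ _
    _ ≤ _ := by gcongr; linarith

lemma inv_gaussWeight (E₂ : ℝ → ℝ) {n x₀ : ℝ} (X : ℝ) :
    (gaussWeight E₂ n x₀ X)⁻¹ = √(n * E₂ x₀ / (2 * π)) * Real.exp (-X ^ 2 / 2) := by
  rw [gaussWeight, mul_inv, ← Real.sqrt_inv, inv_div, ← Real.exp_neg]
  congr 2; ring

/-- `exp (-u)` is at most `n⁻²` once `u ≥ 2 log n`. -/
lemma exp_neg_le_inv_sq {n u : ℝ} (hn : 0 < n) (hu : 2 * Real.log n ≤ u) :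
    Real.exp (-u) ≤ 1 / n ^ 2 := by
  calc Real.exp (-u) ≤ Real.exp (-(2 * Real.log n)) := Real.exp_le_exp.2 (by linarith)
    _ = 1 / n ^ 2 := by
      rw [Real.exp_neg, mul_comm, Real.exp_mul, Real.exp_log hn, one_div]
      norm_cast

lemma sqrt_mul_inv_sq_le {n : ℝ} (hn : 1 ≤ n) : √n * (1 / n ^ 2) ≤ 1 / n := by
  have hn0 : 0 < n := by linarith
  have h7 : √n ≤ n := Real.sqrt_le_iff.2 ⟨hn0.le, by nlinarith⟩
  calc √n * (1 / n ^ 2) ≤ n * (1 / n ^ 2) := by gcongr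
    _ = 1 / n := by field_simp

namespace TwoWell

variable {E μ : ℝ → ℝ} {x₁ x₂ β ρ M κ₀ : ℝ} (W : TwoWell E μ x₁ x₂ β ρ M κ₀)
include W

lemma abs_deriv_le {x : ℝ} (hx : |x - x₂| ≤ ρ) : |deriv E x| ≤ M * |x - x₂| := by
  have := abs_le_pow_succ_of_hasDerivAt (h := fun y => deriv E (x₂ + y))
    (h' := fun y => deriv (deriv E) (x₂ + y)) (k := 0) (η := ρ) (C := M) (by simp [W.deriv₂])
    (fun y hy => SmoothNear.hasDerivAt_shift (W.sE₂.d1 _ (by simpa using hy)))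
    (fun y hy => by simpa using W.sE₂.b2 _ (by simpa using hy)) hx
  simpa using this

lemma abs_phaseSkew_le {n x : ℝ} (hn : 1 ≤ n) (hx : |x - x₂| ≤ ρ) :
    |phaseSkew (deriv (deriv E)) (deriv (deriv (deriv E))) n x| ≤
      M / (6 * κ₀ * √κ₀) / √n := by
  have hκ := W.κ₂ x hx
  have hκ0 := W.κ0
  have hM := W.M0
  have h0 : 0 < deriv (deriv E) x := hκ0.trans_le hκ
  have hn0 : 0 < n := by linarith
  rw [phaseSkew, abs_div, abs_of_pos (by positivity :
    0 < 6 * deriv (deriv E) x * √(n * deriv (deriv E) x)), Real.sqrt_mul hn0.le, div_div]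
  have h3 := W.sE₂.b3 x hx
  calc _ ≤ M / (6 * κ₀ * (√n * √κ₀)) := by gcongr
    _ = _ := by ring

set_option maxHeartbeats 1600000 in
/-- The asymptotics of each reciprocal integral. -/
lemma term_estimate : ∃ η' > 0, η' ≤ ρ ∧ ∃ C > 0, ∃ K > 0, ∀ᶠ n : ℝ in atTop, ∀ x₀, |x₀ - x₂| ≤ η' →
    ∀ m, |m| ≤ n →
    |(∫ x, laplaceIntegrand E μ n m x₀ x)⁻¹ - √(n * deriv (deriv E) x₀ / (2 * π)) *
      (skewGauss (phaseSkew (deriv (deriv E)) (deriv (deriv (deriv E))) n x₀)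
        (saddleX (deriv E) (deriv (deriv E)) (deriv μ) n x₀ m) *
        (1 + wellRatio E μ x₁ x₂ m)⁻¹)| ≤
    C * ((√n)⁻¹ * Real.exp (-|saddleX (deriv E) (deriv (deriv E)) (deriv μ) n x₀ m|) + 1 / n +
      if |m| ≤ K * Real.log n then Real.log n ^ 2 / √n else 0) := by
  have hL : 0 < x₂ - x₁ := sub_pos.2 W.lt
  have hρ := W.ρ0
  have hM := W.M0
  have hκ₀ := W.κ0
  obtain ⟨C₁, hC₁, c₁, hc₁, hcrude⟩ := W.inv_integral_le_gauss
  obtain ⟨C₂, hC₂, hleft⟩ := W.inv_integral_le_left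
  -- Once `X² > Kx log n`, both the crude bound `exp (-c₁X²)` and the Gaussian bound `exp (-X²/4)`
  -- are at most `n⁻²`. With `θ = 1 / (4 Kx)` the complementary range is exactly the one allowed in
  -- `laplace_reciprocal`.
  set Kx := max (2 / c₁) 8 with hKx
  have hKx0 : 0 < Kx := by positivity
  have hKx8 : 8 ≤ Kx := le_max_right _ _
  have hKxc : 2 ≤ c₁ * Kx := by
    have : 2 / c₁ ≤ Kx := le_max_left _ _
    rw [div_le_iff₀ hc₁] at this
    linarith
  set θ := 1 / (4 * Kx) with hθ
  have hθ0 : 0 < θ := by positivity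
  have hθ8 : θ ≤ 1 / 32 := by rw [hθ]; gcongr; linarith
  obtain ⟨ηa, hηa, hηaρ, hrec⟩ := laplace_reciprocal W.sE₂ W.sμ₂ hρ hM hκ₀ W.κ₂ hθ0 (by linarith)
  -- For `|m| > K log n` the factor `exp (-|m| (x₂ - x₁))` is at most `n⁻²`, so one well decides;
  -- only about `log n` indices see both.
  set K := 2 / (x₂ - x₁) with hK
  have hK0 : 0 < K := by positivity
  have hKL : K * (x₂ - x₁) = 2 := by rw [hK]; field_simp
  obtain ⟨ηb, hηb, hratio⟩ := W.ratio_estimate K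
  set η := min (min ηa ηb) (min (ρ / 4) ((x₂ - x₁) / 8)) with hη
  have hη0 : 0 < η := by positivity
  have hη1 : η ≤ ηa := (min_le_left _ _).trans (min_le_left _ _)
  have hη2 : η ≤ ηb := (min_le_left _ _).trans (min_le_right _ _)
  have hη3 : η ≤ ρ / 4 := (min_le_right _ _).trans (min_le_left _ _)
  have hη4 : η ≤ (x₂ - x₁) / 8 := (min_le_right _ _).trans (min_le_right _ _)
  obtain ⟨ε, hε, hg⟩ := W.exists_linear_growth hη0
  obtain ⟨C₃, hC₃, n₃, hn₃, hrec⟩ := hrec η hη0 hη1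
  obtain ⟨C₄, hC₄, hratio⟩ := hratio η hη0 hη2 ε hε hg
  obtain ⟨C₅, hC₅, htail⟩ := W.tail hε hg
  obtain ⟨c₆, hc₆, hlow⟩ := W.right_lower hη0 (by linarith)
  obtain ⟨C₇, hC₇, hpoly⟩ := exists_poly_le_exp 2 (half_pos hε)
  obtain ⟨C₈, hC₈, hskew⟩ := abs_skewGauss_le (M / (6 * κ₀ * √κ₀))
  set ωξ := Real.exp (2 * (x₂ - x₁) * (1 / 2 + wellShift E μ x₁ x₂)) with hω
  have hω0 : 0 < ωξ := Real.exp_pos _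
  -- The slope of `E` at `x₀` is at most `M η' ≤ ε / 16`, so a moderate displacement `X` implies
  -- `|m| ≤ n ε / 4`, the range of the tail estimate.
  set η' := min η (ε / (16 * M)) with hη'
  have hη'0 : 0 < η' := by positivity
  have hη'1 : η' ≤ η := min_le_left _ _
  have hη'2 : M * η' ≤ ε / 16 := by
    have : η' ≤ ε / (16 * M) := min_le_right _ _
    rw [le_div_iff₀ (by positivity)] at this
    linarith
  set D := (4 * η * Real.exp (2 * M) + C₅ * C₇) / c₆ + ωξ with hD
  have hD0 : 0 < D := by positivity
  set CC := C₁ + √M * C₈ + C₂ + √M * C₈ * ωξ⁻¹ + 3 * √M * C₃ + 2 * √M * C₄ + 2 * √M * D with hCC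
  have hsM : 0 < √M := Real.sqrt_pos.2 hM
  have p1 : 0 < √M * C₈ := by positivity
  have p2 : 0 < √M * C₈ * ωξ⁻¹ := by positivity
  have p3 : 0 < 3 * √M * C₃ := by positivity
  have p4 : 0 < 2 * √M * C₄ := by positivity
  have p5 : 0 < 2 * √M * D := by positivity
  have hCC0 : 0 < CC := by positivity
  have hη'ρ : η' ≤ ρ / 4 := hη'1.trans hη3
  refine ⟨η', hη'0, by linarith, CC, hCC0, K, hK0, ?_⟩
  filter_upwards [eventually_ge_atTop n₃, hratio, eventually_mul_log_le_sqrt K,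
    eventually_mul_log_le_sqrt (Kx * M), eventually_sqrt_le_mul (ε := ε ^ 2 / 256) (by positivity),
    eventually_ge_atTop (16 * M / ε)]
    with n hnn₃ hratio hKs hKxM hsε hMε x₀ hx₀ m hm
  clear_value Kx η η' K
  have hn1 : 1 ≤ n := hn₃.trans hnn₃
  have hn0 : 0 < n := by linarith
  have hs0 : 0 < √n := Real.sqrt_pos.2 hn0
  have hs1 : 1 ≤ √n := Real.one_le_sqrt.2 hn1
  have hss : √n * √n = n := Real.mul_self_sqrt hn0.le
  have hlog : 0 ≤ Real.log n := Real.log_nonneg hn1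
  have hsinv : √n * (1 / n ^ 2) ≤ 1 / n := sqrt_mul_inv_sq_le hn1
  have hx₀ρ : |x₀ - x₂| ≤ ρ := by linarith
  set X := saddleX (deriv E) (deriv (deriv E)) (deriv μ) n x₀ m with hX
  set sk := phaseSkew (deriv (deriv E)) (deriv (deriv (deriv E))) n x₀ with hsk
  set κ := deriv (deriv E) x₀ with hκdef
  have hκκ : κ₀ ≤ κ := W.κ₂ x₀ hx₀ρ
  have hκ0 : 0 < κ := hκ₀.trans_le hκκ
  have hκM : κ ≤ M := le_of_abs_le (W.sE₂.b2 x₀ hx₀ρ)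
  set G := skewGauss sk X with hG
  have hskb : |sk| ≤ M / (6 * κ₀ * √κ₀) :=
    (W.abs_phaseSkew_le hn1 hx₀ρ).trans (div_le_self (by positivity) hs1)
  have hGb : |G| ≤ C₈ * Real.exp (-(X ^ 2 / 4)) := by
    have := hskew sk hskb X
    rwa [show -X ^ 2 / 4 = -(X ^ 2 / 4) by ring] at this
  set s0 := √(n * κ / (2 * π)) with hs0def
  have hs00 : 0 ≤ s0 := Real.sqrt_nonneg _
  have hs0M : s0 ≤ √M * √n := by
    rw [hs0def, ← Real.sqrt_mul hM.le]
    refine Real.sqrt_le_sqrt ?_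
    rw [mul_comm M]
    calc n * κ / (2 * π) ≤ n * κ := div_le_self (by positivity) (by
          have := Real.pi_gt_three; linarith)
      _ ≤ n * M := by gcongr
  set b := wellRatio E μ x₁ x₂ m with hb
  have hbω : b = ωξ * Real.exp (-(2 * (m * (x₂ - x₁)))) := by
    rw [hb, wellRatio, hω, ← Real.exp_add]; congr 1; ring
  have hb0 : 0 < b := Real.exp_pos _
  set f := (1 + b)⁻¹ with hf
  have hf0 : 0 ≤ f := by positivity
  have hf1 : f ≤ 1 := inv_le_one_of_one_le₀ (by linarith)
  set T := (∫ x, laplaceIntegrand E μ n m x₀ x)⁻¹ with hT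
  have hT0 : 0 ≤ T := inv_nonneg.2 (integral_nonneg fun x => (laplaceIntegrand_pos _ _ _ _ _ _).le)
  set u := (√n)⁻¹ * Real.exp (-|X|) with hu
  set v := 1 / n with hv
  set w := (if |m| ≤ K * Real.log n then Real.log n ^ 2 / √n else 0) with hw
  have hu0 : 0 ≤ u := by positivity
  have hv0 : 0 ≤ v := by positivity
  have hw0 : 0 ≤ w := by rw [hw]; split_ifs <;> positivity
  have hfin : ∀ p q r : ℝ, p ≤ CC → q ≤ CC → r ≤ CC → p * u + q * v + r * w ≤ CC * (u + v + w) := by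
    intro p q r hp hq hr
    have h1 : p * u ≤ CC * u := by gcongr
    have h2 : q * v ≤ CC * v := by gcongr
    have h3 : r * w ≤ CC * w := by gcongr
    linarith
  have hGf : ∀ e₁ : ℝ, |G| * f ≤ e₁ → |s0 * (G * f)| ≤ √M * √n * e₁ := by
    intro e₁ he₁
    rw [abs_mul, abs_mul, abs_of_nonneg hs00, abs_of_nonneg hf0]
    have : 0 ≤ |G| * f := by positivity
    gcongr
  have hTG : |T - s0 * (G * f)| ≤ T + |s0 * (G * f)| := by
    refine (abs_sub _ _).trans ?_
    rw [abs_of_nonneg hT0]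
  rcases lt_or_ge (Kx * Real.log n) (X ^ 2) with hXbig | hXsmall
  · -- large saddle displacement
    have h1 : Real.exp (-(c₁ * X ^ 2)) ≤ 1 / n ^ 2 := exp_neg_le_inv_sq hn0 (by
      have h2 : c₁ * (Kx * Real.log n) ≤ c₁ * X ^ 2 := by gcongr
      have h3 : 2 * Real.log n ≤ c₁ * Kx * Real.log n := by gcongr
      linarith)
    have h2 : Real.exp (-(X ^ 2 / 4)) ≤ 1 / n ^ 2 := exp_neg_le_inv_sq hn0 (by
      have h3 : 8 * Real.log n ≤ Kx * Real.log n := by gcongr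
      linarith)
    have h3 : T ≤ C₁ * v := by
      refine (hcrude n hn1 x₀ (by linarith) m hm).trans ?_
      gcongr
      refine le_trans ?_ hsinv
      gcongr
    have h4 : |s0 * (G * f)| ≤ √M * C₈ * v := by
      calc |s0 * (G * f)| ≤ √M * √n * (C₈ * (1 / n ^ 2)) := hGf _ (by
            calc |G| * f ≤ |G| * 1 := by gcongr
              _ ≤ C₈ * (1 / n ^ 2) := by
                rw [mul_one]; exact hGb.trans (by gcongr))
        _ = √M * C₈ * (√n * (1 / n ^ 2)) := by ring
        _ ≤ _ := by gcongr
    have h5 := hfin 0 (C₁ + √M * C₈) 0 hCC0.le (by linarith) hCC0.le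
    linarith
  rcases lt_or_ge m (-(K * Real.log n)) with hmneg | hmge
  · -- the left well dominates
    have hmL : 2 * Real.log n ≤ -(m * (x₂ - x₁)) := by
      have h1 : K * Real.log n * (x₂ - x₁) ≤ -m * (x₂ - x₁) := by gcongr; linarith
      have h2 : K * Real.log n * (x₂ - x₁) = K * (x₂ - x₁) * Real.log n := by ring
      rw [h2, hKL] at h1
      linarith
    have h1 : Real.exp (m * (x₂ - x₁)) ≤ 1 / n ^ 2 := by
      have := exp_neg_le_inv_sq hn0 hmL
      rwa [neg_neg] at this
    have h3 : T ≤ C₂ * v := by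
      refine (hleft n hn1 x₀ (by linarith) m (by
        have : 0 ≤ K * Real.log n := by positivity
        linarith)).trans ?_
      gcongr
      refine le_trans ?_ hsinv
      gcongr
    have hfb : f ≤ ωξ⁻¹ * (1 / n ^ 2) := by
      calc f ≤ b⁻¹ := inv_anti₀ hb0 (by linarith)
        _ = ωξ⁻¹ * Real.exp (-(-(2 * (m * (x₂ - x₁))))) := by
          rw [hbω, mul_inv, Real.exp_neg (-(2 * (m * (x₂ - x₁))))]
        _ ≤ ωξ⁻¹ * (1 / n ^ 2) := by
          gcongr
          exact exp_neg_le_inv_sq hn0 (by linarith)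
    have hG1 : |G| ≤ C₈ := hGb.trans (mul_le_of_le_one_right hC₈.le
      (Real.exp_le_one_iff.2 (by linarith [sq_nonneg X])))
    have h4 : |s0 * (G * f)| ≤ √M * C₈ * ωξ⁻¹ * v := by
      calc |s0 * (G * f)| ≤ √M * √n * (C₈ * (ωξ⁻¹ * (1 / n ^ 2))) := hGf _ (by gcongr)
        _ = √M * C₈ * ωξ⁻¹ * (√n * (1 / n ^ 2)) := by ring
        _ ≤ _ := by gcongr
    have h5 := hfin 0 (C₂ + √M * C₈ * ωξ⁻¹) 0 hCC0.le (by linarith) hCC0.le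
    linarith
  -- the regime of Laplace's method at the right well
  obtain ⟨hJH, hrec⟩ := hrec n hnn₃ x₀ (hx₀.trans hη'1) m (by
    rw [← hX]
    have : 4 * θ = 1 / Kx := by rw [hθ]; field_simp
    rw [this, div_mul_eq_mul_div, one_mul, div_le_iff₀ hKx0]
    linarith)
  rw [← hX] at hJH hrec
  set H := ∫ x in {x | |x - x₂| ≤ 2 * η}, laplaceIntegrand E μ n m x₀ x with hH
  set J := gaussWeight (deriv (deriv E)) n x₀ X with hJ
  have hJ0 : 0 < J := by rw [hJ, gaussWeight]; positivity
  have hJinv : J⁻¹ = s0 * Real.exp (-X ^ 2 / 2) := inv_gaussWeight _ X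
  have hH0 : 0 < H := by linarith
  have hJs : J⁻¹ ≤ √M * √n := by
    rw [hJinv]
    exact (mul_le_of_le_one_right hs00 (Real.exp_le_one_iff.2 (by linarith [sq_nonneg X]))).trans
      hs0M
  have hHinv : H⁻¹ ≤ 2 * √M * √n := by
    calc H⁻¹ ≤ (J / 2)⁻¹ := inv_anti₀ (by positivity) hJH
      _ = 2 * J⁻¹ := by rw [inv_div]; ring
      _ ≤ 2 * √M * √n := by linarith
  have hHG : |H⁻¹ - s0 * G| ≤ 3 * √M * C₃ * u := by
    have h1 : J⁻¹ * (1 + sk * (X ^ 3 + 3 * X)) = s0 * G := by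
      rw [hJinv, hG, skewGauss]; ring
    rw [h1] at hrec
    refine hrec.trans ?_
    have h2 : J⁻¹ * Real.exp (2 * θ * X ^ 2) ≤ √M * √n * (3 * Real.exp (-|X|)) := by
      rw [hJinv, mul_assoc, ← Real.exp_add]
      have h3 : -X ^ 2 / 2 + 2 * θ * X ^ 2 ≤ -X ^ 2 / 4 := by
        have : 2 * θ * X ^ 2 ≤ 2 * (1 / 32) * X ^ 2 := by gcongr
        have := sq_nonneg X
        linarith
      gcongr
      exact (Real.exp_le_exp.2 h3).trans (exp_neg_sq_div_four_le X)
    calc C₃ / n * (J⁻¹ * Real.exp (2 * θ * X ^ 2)) ≤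
        C₃ / n * (√M * √n * (3 * Real.exp (-|X|))) := by gcongr
      _ = 3 * √M * C₃ * ((√n / n) * Real.exp (-|X|)) := by ring
      _ = 3 * √M * C₃ * u := by
        rw [hu]
        rw [Real.sqrt_div_self', one_div]
  -- `m` is small compared with `n`
  have hmε : |m| ≤ n * ε / 4 := by
    have hα : 2 * m = X * √(n * κ) + n * deriv E x₀ - deriv μ x₀ := by
      rw [hX, saddleX, div_mul_cancel₀ _ (Real.sqrt_pos.2 (by positivity)).ne']; ring
    have q1 : |X * √(n * κ)| ≤ n * (ε / 16) := by
      refine abs_le_of_sq_le_sq ?_ (by positivity)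
      rw [mul_pow, Real.sq_sqrt (by positivity)]
      calc X ^ 2 * (n * κ) ≤ Kx * Real.log n * (n * M) := by gcongr
        _ = n * (Kx * M * Real.log n) := by ring
        _ ≤ n * (n * (ε ^ 2 / 256)) := mul_le_mul_of_nonneg_left (hKxM.trans hsε) hn0.le
        _ = _ := by ring
    have q2 : |n * deriv E x₀| ≤ n * (ε / 16) := by
      rw [abs_mul, abs_of_pos hn0]
      gcongr
      refine (W.abs_deriv_le hx₀ρ).trans (le_trans ?_ hη'2)
      gcongr
    have q3 : |deriv μ x₀| ≤ n * (ε / 16) := by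
      refine (W.sμ₂.b1 x₀ hx₀ρ).trans ?_
      rw [div_le_iff₀ hε] at hMε
      linarith
    have q4 : |2 * m| ≤ n * (ε / 16) + n * (ε / 16) + n * (ε / 16) := by
      rw [hα]
      refine (abs_sub _ _).trans (add_le_add ((abs_add_le _ _).trans (add_le_add q1 q2)) q3)
    rw [abs_mul, abs_two] at q4
    have : 0 < n * ε := by positivity
    linarith
  obtain ⟨hti, htb⟩ := htail n hn1 m hmε
  have hm' : -√n ≤ m := by linarith
  have hlow' := hlow n hn1 m hm'
  have hH2 : 0 < ∫ x in {x | |x - x₂| ≤ 2 * η}, laplaceIntegrand E μ n m x₂ x :=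
    lt_of_lt_of_le (by positivity) hlow'
  have hTeq := W.inv_integral_eq (by linarith) (by linarith) hti x₀ hH2
  rw [← hT, ← hH] at hTeq
  set A := ∫ x in {x | |x - x₁| ≤ 2 * η}, laplaceIntegrand E μ n m x₂ x with hA
  set t := ∫ x in {x | 2 * η < |x - x₁| ∧ 2 * η < |x - x₂|}, laplaceIntegrand E μ n m x₂ x with ht
  set H₂ := ∫ x in {x | |x - x₂| ≤ 2 * η}, laplaceIntegrand E μ n m x₂ x with hH₂
  have hA0 : 0 ≤ A := integral_nonneg fun x => (laplaceIntegrand_pos _ _ _ _ _ _).le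
  have ht0 : 0 ≤ t := integral_nonneg fun x => (laplaceIntegrand_pos _ _ _ _ _ _).le
  set a := (A + t) / H₂ with ha
  have ha0 : 0 ≤ a := by positivity
  have hkey : ∀ d : ℝ, |(1 + a)⁻¹ - f| ≤ d →
      |T - s0 * (G * f)| ≤ 2 * √M * (√n * d) + 3 * √M * C₃ * u := by
    intro d hd
    -- The error splits into that of the Fermi factor, amplified by `H⁻¹ = O(√n)`, and that of
    -- Laplace's method at the right well, damped by `f ≤ 1`.
    have e1 : T - s0 * (G * f) = H⁻¹ * ((1 + a)⁻¹ - f) + (H⁻¹ - s0 * G) * f := by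
      rw [hTeq]; ring
    rw [e1]
    refine (abs_add_le _ _).trans ?_
    rw [abs_mul, abs_mul, abs_of_pos (inv_pos.2 hH0), abs_of_nonneg hf0]
    have h1 : H⁻¹ * |(1 + a)⁻¹ - f| ≤ 2 * √M * √n * d := by gcongr
    have h2 : |H⁻¹ - s0 * G| * f ≤ 3 * √M * C₃ * u :=
      (mul_le_of_le_one_right (abs_nonneg _) hf1).trans hHG
    linarith
  rcases le_or_gt m (K * Real.log n) with hmle | hmgt
  · have hmabs : |m| ≤ K * Real.log n := abs_le.2 ⟨hmge, hmle⟩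
    have hwe : w = Real.log n ^ 2 / √n := by rw [hw, if_pos hmabs]
    have h1 := hkey _ (hratio m hmabs)
    have h2 : √n * (C₄ * (Real.log n ^ 2 / n)) = C₄ * w := by
      rw [hwe]
      rw [show √n * (C₄ * (Real.log n ^ 2 / n)) = C₄ * (Real.log n ^ 2 * (√n / n)) by ring,
        Real.sqrt_div_self', ← div_eq_mul_one_div]
    rw [h2] at h1
    have h5 := hfin (3 * √M * C₃) 0 (2 * √M * C₄) (by linarith) hCC0.le (by linarith)
    linarith
  -- The right well dominates: the true ratio `a` and its model `b` are both `O(n^(-3/2))`, so both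
  -- Fermi factors are that close to 1.
  · have hm0 : 0 ≤ m := le_trans (by positivity) hmgt.le
    have hmL : 2 * Real.log n ≤ m * (x₂ - x₁) := by
      have h1 : K * Real.log n * (x₂ - x₁) ≤ m * (x₂ - x₁) := by gcongr
      have h2 : K * Real.log n * (x₂ - x₁) = K * (x₂ - x₁) * Real.log n := by ring
      rw [h2, hKL] at h1
      exact h1
    have hAb : A ≤ 4 * η * Real.exp (2 * M) * (1 / n ^ 2) := by
      refine (W.left_upper hη0 (by linarith) (by linarith) hn0.le hm0).trans ?_
      rw [mul_assoc (4 * η)]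
      gcongr
      exact exp_neg_le_inv_sq hn0 hmL
    have htb' : t ≤ C₅ * C₇ * (1 / n ^ 2) := by
      refine htb.trans ?_
      rw [mul_assoc]
      gcongr
      have := hpoly n hn0.le
      rw [Real.exp_neg, ← one_div, mul_one_div, div_le_div_iff₀ (Real.exp_pos _) (by positivity),
        one_mul, show n * ε / 2 = ε / 2 * n by ring]
      exact this
    have hab : a + b ≤ D * (√n * (1 / n ^ 2)) := by
      have h1 : a ≤ (4 * η * Real.exp (2 * M) + C₅ * C₇) / c₆ * (√n * (1 / n ^ 2)) := by
        calc a ≤ (4 * η * Real.exp (2 * M) * (1 / n ^ 2) + C₅ * C₇ * (1 / n ^ 2)) / (c₆ / √n) := by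
              rw [ha]; gcongr
          _ = _ := by field_simp
      have h2 : b ≤ ωξ * (√n * (1 / n ^ 2)) := by
        rw [hbω]
        gcongr
        calc Real.exp (-(2 * (m * (x₂ - x₁)))) ≤ 1 / n ^ 2 := exp_neg_le_inv_sq hn0 (by linarith)
          _ ≤ √n * (1 / n ^ 2) := le_mul_of_one_le_left (by positivity) hs1
      rw [hD, add_mul]
      linarith
    have h3 : |(1 + a)⁻¹ - f| ≤ D * (√n * (1 / n ^ 2)) := by
      refine (abs_inv_one_add_sub_le ha0 hb0.le).trans ((div_le_self (abs_nonneg _)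
        (by linarith)).trans (le_trans ?_ hab))
      refine (abs_sub _ _).trans ?_
      rw [abs_of_nonneg ha0, abs_of_pos hb0]
    have h1 := hkey _ h3
    have h4 : √n * (D * (√n * (1 / n ^ 2))) = D * v := by
      rw [show √n * (D * (√n * (1 / n ^ 2))) = D * (√n * √n) * (1 / n ^ 2) by ring, hss, hv]
      field_simp
    rw [h4] at h1
    have h5 := hfin (3 * √M * C₃) (2 * √M * D) 0 (by linarith) (by linarith) hCC0.le
    linarith

end TwoWell

/-! ### Summation over the degrees -/

/-- The main term in the asymptotics of the sum of reciprocal integrals. -/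
noncomputable def gapMain (E μ : ℝ → ℝ) (x₁ x₂ β n x₀ : ℝ) : ℝ :=
  n * deriv (deriv E) x₀ / 2 *
    (CoulombGap.erfc (saddleX (deriv E) (deriv (deriv E)) (deriv μ) n x₀ 0 / √2) / 2 +
      phaseSkew (deriv (deriv E)) (deriv (deriv (deriv E))) n x₀ *
        ((saddleX (deriv E) (deriv (deriv E)) (deriv μ) n x₀ 0 ^ 2 + 5) *
          Real.exp (-saddleX (deriv E) (deriv (deriv E)) (deriv μ) n x₀ 0 ^ 2 / 2)) / √(2 * π)) +
  √(n * deriv (deriv E) x₀ / (2 * π)) *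
    Real.exp (-saddleX (deriv E) (deriv (deriv E)) (deriv μ) n x₀ 0 ^ 2 / 2) *
    ((∑' k, fermiStep (x₂ - x₁) (n * β + wellShift E μ x₁ x₂) k) + n * β - 1 / 2)

lemma sum_exp_neg_le {h : ℝ} (hh : 0 < h) (hh1 : h ≤ 1) (b : ℝ) (n : ℕ) :
    ∑ j ∈ Finset.range n, Real.exp (-|b + h * ((j : ℝ) + 1)|) ≤ 8 / h := by
  have hs := (tsum_exp_neg_lattice hh b).1
  refine le_trans ?_ (tsum_exp_neg_lattice_le hh hh1 b)
  have hinj : Function.Injective fun j : ℕ => (j : ℤ) + 1 := fun i j hij => by simpa using hij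
  have h4 := (hs.comp_injective hinj).sum_le_tsum (Finset.range n)
    (fun i _ => (Real.exp_pos _).le)
  have h5 := tsum_comp_le_tsum_of_inj hs (fun i => (Real.exp_pos _).le) hinj
  refine le_trans ?_ h5
  simpa [Function.comp_def] using h4

/-- The indicator is at most `3 exp (-|j + 1 - ν| / R)`, which turns counting into a lattice sum
with spacing `1 / R`. -/
lemma sum_indicator_le {R : ℝ} (hR : 1 ≤ R) (ν : ℝ) (n : ℕ) :
    ∑ j ∈ Finset.range n, (if |(j : ℝ) + 1 - ν| ≤ R then (1 : ℝ) else 0) ≤ 24 * R := by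
  have hR0 : 0 < R := by linarith
  have h := sum_exp_neg_le (h := 1 / R) (by positivity) (by rw [div_le_one hR0]; exact hR)
    (-(ν / R)) n
  calc ∑ j ∈ Finset.range n, (if |(j : ℝ) + 1 - ν| ≤ R then (1 : ℝ) else 0) ≤
      ∑ j ∈ Finset.range n, 3 * Real.exp (-|-(ν / R) + 1 / R * ((j : ℝ) + 1)|) := by
        refine Finset.sum_le_sum fun j _ => ?_
        split_ifs with hj
        · have e1 : -(ν / R) + 1 / R * ((j : ℝ) + 1) = ((j : ℝ) + 1 - ν) / R := by ring
          rw [e1, abs_div, abs_of_pos hR0]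
          have h1 : |(j : ℝ) + 1 - ν| / R ≤ 1 := by rw [div_le_one hR0]; exact hj
          have h2 : Real.exp (-1) ≤ Real.exp (-(|(j : ℝ) + 1 - ν| / R)) :=
            Real.exp_le_exp.2 (by linarith)
          have h3 : (1 : ℝ) / 3 ≤ Real.exp (-1) := by
            have := Real.exp_one_lt_d9
            rw [Real.exp_neg, ← one_div]
            exact one_div_le_one_div_of_le (Real.exp_pos _) (by linarith)
          linarith
        · positivity
    _ ≤ 3 * (8 / (1 / R)) := by rw [← Finset.mul_sum]; gcongr
    _ = 24 * R := by field_simp; norm_num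

lemma abs_skewGauss_le_of_le (c₀ : ℝ) : ∃ C > 0, ∀ c, |c| ≤ c₀ → ∀ X R : ℝ, 0 ≤ R → R ≤ |X| →
    |skewGauss c X| ≤ C * Real.exp (-(R ^ 2 / 8)) * Real.exp (-|X|) := by
  obtain ⟨C, hC, h⟩ := abs_skewGauss_le c₀
  refine ⟨C * Real.exp 2, by positivity, fun c hc X R hR hX => (h c hc X).trans ?_⟩
  rw [mul_assoc, mul_assoc, ← Real.exp_add, ← Real.exp_add]
  gcongr
  have h1 : R ^ 2 ≤ |X| ^ 2 := by gcongr
  have h2 := sq_nonneg (|X| - 4)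
  rw [← sq_abs X]
  linarith

lemma ExpDecay.tsum_sub_sum_le {φ φ₁ φ₂ : ℝ → ℝ} {D : ℝ} (hφ : ExpDecay φ φ₁ φ₂ D) {h : ℝ}
    (hh : 0 < h) (hh1 : h ≤ 1) (x ν L y δ : ℝ) (n : ℕ) (hδ : 0 ≤ δ)
    (hb : ∀ k : ℤ, k ≤ 0 ∨ n < k → |φ (x + h * (k - ν)) * fermiWeight L y k| ≤
      δ * Real.exp (-|x + h * (k - ν)|)) :
    |(∑' k : ℤ, φ (x + h * (k - ν)) * fermiWeight L y k) -
      ∑ j ∈ Finset.range n, φ (x + h * (((j : ℝ) + 1) - ν)) * fermiWeight L y (j + 1)| ≤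
      δ * (8 / h) := by
  set g : ℤ → ℝ := fun k => φ (x + h * (k - ν)) * fermiWeight L y k with hg
  have hs : Summable g := hφ.summable_fermi hh x ν L y
  set S : Finset ℤ := Finset.Icc 1 (n : ℤ) with hS
  have h1 : HasSum (fun k => if k ∈ S then g k else 0) (∑ k ∈ S, g k) := by
    have : HasSum (fun k => if k ∈ S then g k else 0) (∑ k ∈ S, if k ∈ S then g k else 0) :=
      hasSum_sum_of_ne_finset_zero fun k hk => if_neg hk
    rwa [Finset.sum_congr rfl fun k hk => if_pos hk] at this
  have h2 : ∑ k ∈ S, g k =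
      ∑ j ∈ Finset.range n, φ (x + h * (((j : ℝ) + 1) - ν)) * fermiWeight L y (j + 1) := by
    symm
    refine Finset.sum_nbij' (fun j => (j : ℤ) + 1) (fun k => (k - 1).toNat) ?_ ?_ ?_ ?_ ?_
    · intro j hj; simp [hS] at hj ⊢; omega
    · intro k hk; simp [hS] at hk ⊢; omega
    · intro j hj; simp
    · intro k hk; simp [hS] at hk ⊢; omega
    · intro j hj; simp [hg]
  have hlat := tsum_exp_neg_lattice hh (x - h * ν)
  have h3 := tsum_of_norm_bounded (hlat.1.mul_left δ).hasSum
    (f := fun k => g k - if k ∈ S then g k else 0) fun k => by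
      have e1 : x - h * ν + h * k = x + h * (k - ν) := by ring
      rw [e1]
      split_ifs with hk
      · rw [sub_self, norm_zero]; positivity
      · rw [sub_zero]
        refine hb k ?_
        simp only [hS, Finset.mem_Icc, not_and_or, not_le] at hk
        omega
  rw [(hs.hasSum.sub h1).tsum_eq, h2, tsum_mul_left] at h3
  refine h3.trans ?_
  have := tsum_exp_neg_lattice_le hh hh1 (x - h * ν)
  gcongr

namespace TwoWell

variable {E μ : ℝ → ℝ} {x₁ x₂ β ρ M κ₀ : ℝ} (W : TwoWell E μ x₁ x₂ β ρ M κ₀)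
include W

set_option maxHeartbeats 1600000 in
/-- The lattice sum of the individual asymptotics. -/
lemma lattice_main : ∃ η' > 0, η' ≤ ρ ∧ ∃ C > 0, ∀ᶠ n : ℕ in atTop, ∀ x₀, |x₀ - x₂| ≤ η' →
    |√(n * deriv (deriv E) x₀ / (2 * π)) * (∑ j ∈ Finset.range n,
      skewGauss (phaseSkew (deriv (deriv E)) (deriv (deriv (deriv E))) n x₀)
        (saddleX (deriv E) (deriv (deriv E)) (deriv μ) n x₀ (j + 1 - n * β)) *
        (1 + wellRatio E μ x₁ x₂ (j + 1 - n * β))⁻¹) - gapMain E μ x₁ x₂ β n x₀| ≤ C := by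
  have hL : 0 < x₂ - x₁ := sub_pos.2 W.lt
  have hρ := W.ρ0
  have hM := W.M0
  have hκ₀ := W.κ0
  have hβ0 := W.β0
  have hβ1 : 0 < 1 - β := by linarith [W.β1]
  set L := x₂ - x₁ with hLdef
  set ξ := wellShift E μ x₁ x₂ with hξ
  set c₀ := M / (6 * κ₀ * √κ₀) with hc₀
  have hc₀0 : 0 < c₀ := by positivity
  obtain ⟨D, hD⟩ := skewGauss_expDecay c₀
  obtain ⟨Cl, hCl, hlat⟩ := ExpDecay.lattice_sum hL D ξ
  obtain ⟨Cf, hCf, hferm⟩ := abs_tsum_fermiStep_add_le hL ξ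
  obtain ⟨Cs, hCs, hskew⟩ := abs_skewGauss_le_of_le (max c₀ 1)
  obtain ⟨P₁, hP₁, hpoly₁⟩ := exists_poly_le_exp 1 (θ := (1 - β) ^ 2 / (8 * M)) (by positivity)
  obtain ⟨P₂, hP₂, hpoly₂⟩ := exists_poly_le_exp 1 (θ := 2 * L * β) (by positivity)
  set ω := Real.exp (-(2 * L * (1 / 2 + ξ))) with hω
  have hω0 : 0 < ω := Real.exp_pos _
  -- With `M η' ≤ (1 - β) / 2` the slope of `E` at `x₀` stays below `(1 - β) / 2`, so the Gaussian
  -- is centred well before `k = n` and cutting there costs little.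
  set η' := min ρ ((1 - β) / (2 * M)) with hη'
  have hη'0 : 0 < η' := by positivity
  have hη'ρ : η' ≤ ρ := min_le_left _ _
  have hη'M : M * η' ≤ (1 - β) / 2 := by
    have : η' ≤ (1 - β) / (2 * M) := min_le_right _ _
    rw [le_div_iff₀ (by positivity)] at this
    linarith
  set δc := Cs * P₁ + Cs * ω * P₂ with hδc
  have hδc0 : 0 < δc := by positivity
  refine ⟨η', hη'0, hη'ρ, 4 * M * δc + 2 * Cl + √M * c₀ * (2 * Cs) * (Cf + 1 / 2),
    by positivity, ?_⟩
  filter_upwards [eventually_ge_atTop 1, (tendsto_natCast_atTop_atTop (R := ℝ)).eventually_ge_atTop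
    (4 / κ₀), (tendsto_natCast_atTop_atTop (R := ℝ)).eventually_ge_atTop (2 * M / (1 - β))]
    with n hn hnκ hnM x₀ hx₀
  clear_value η' c₀
  have hn1 : (1 : ℝ) ≤ n := by exact_mod_cast hn
  have hn0 : (0 : ℝ) < n := by linarith
  have hs0 : 0 < √(n : ℝ) := Real.sqrt_pos.2 hn0
  have hss : √(n : ℝ) * √(n : ℝ) = n := Real.mul_self_sqrt hn0.le
  have hx₀ρ : |x₀ - x₂| ≤ ρ := hx₀.trans hη'ρ
  set sk := phaseSkew (deriv (deriv E)) (deriv (deriv (deriv E))) n x₀ with hsk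
  set κ := deriv (deriv E) x₀ with hκdef
  set X := saddleX (deriv E) (deriv (deriv E)) (deriv μ) n x₀ 0 with hX
  have hκκ : κ₀ ≤ κ := W.κ₂ x₀ hx₀ρ
  have hκ0 : 0 < κ := hκ₀.trans_le hκκ
  have hκM : κ ≤ M := le_of_abs_le (W.sE₂.b2 x₀ hx₀ρ)
  set s := √(n * κ) with hs
  have hnκ0 : 0 < n * κ := by positivity
  have hs0' : 0 < s := Real.sqrt_pos.2 hnκ0
  have hs2 : s * s = n * κ := Real.mul_self_sqrt hnκ0.le
  have hsM : s ≤ √M * √n := by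
    rw [hs, ← Real.sqrt_mul hM.le]
    refine Real.sqrt_le_sqrt ?_
    rw [mul_comm M]; gcongr
  set h := 2 / s with hh
  have hh0 : 0 < h := by positivity
  have hh1 : h ≤ 1 := by
    rw [hh, div_le_one hs0', hs]
    refine Real.le_sqrt_of_sq_le ?_
    rw [div_le_iff₀ hκ₀] at hnκ
    calc (2 : ℝ) ^ 2 = 4 := by norm_num
      _ ≤ n * κ₀ := hnκ
      _ ≤ n * κ := by gcongr
  have hskb' : |sk| ≤ c₀ / √n := by rw [hc₀]; exact W.abs_phaseSkew_le hn1 hx₀ρ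
  have hskb : |sk| ≤ c₀ := hskb'.trans (div_le_self hc₀0.le (Real.one_le_sqrt.2 hn1))
  have hskb1 : |sk| ≤ max c₀ 1 := hskb.trans (le_max_left _ _)
  have hφ := hD sk hskb
  set s0 := √(n * κ / (2 * π)) with hs0def
  have h2π : 0 < √(2 * π) := Real.sqrt_pos.2 (by positivity)
  have h2π1 : 1 ≤ √(2 * π) := Real.one_le_sqrt.2 (by have := Real.pi_gt_three; linarith)
  have hs0s : s0 = s / √(2 * π) := Real.sqrt_div hnκ0.le _
  have hs0le : s0 ≤ s := by rw [hs0s]; exact div_le_self hs0'.le h2π1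
  have hs00 : 0 ≤ s0 := Real.sqrt_nonneg _
  -- Because the expansion point `x₀` does not move with `j`, the displacements form an arithmetic
  -- progression of step `h`.
  have hsad : ∀ m : ℝ, saddleX (deriv E) (deriv (deriv E)) (deriv μ) n x₀ m = X + h * m := by
    intro m
    rw [hX, saddleX, saddleX, hh, ← hs]; ring
  set ν := (n : ℝ) * β with hν
  have hwt : ∀ k : ℤ, fermiWeight L (ν + ξ) k = (1 + wellRatio E μ x₁ x₂ (k - ν))⁻¹ := by
    intro k
    rw [fermiWeight, wellRatio, one_div, ← hLdef, ← hξ]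
    ring_nf
  have hsumeq : (∑ j ∈ Finset.range n,
      skewGauss sk (saddleX (deriv E) (deriv (deriv E)) (deriv μ) n x₀ (j + 1 - ν)) *
        (1 + wellRatio E μ x₁ x₂ (j + 1 - ν))⁻¹) =
      ∑ j ∈ Finset.range n, skewGauss sk (X + h * (((j : ℝ) + 1) - ν)) *
        fermiWeight L (ν + ξ) (j + 1) := by
    refine Finset.sum_congr rfl fun j _ => ?_
    rw [hwt, hsad]; push_cast; rfl
  rw [hsumeq]
  -- truncation of the lattice sum
  have htr : ∀ k : ℤ, k ≤ 0 ∨ n < k → |skewGauss sk (X + h * (k - ν)) * fermiWeight L (ν + ξ) k| ≤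
      δc / n * Real.exp (-|X + h * (k - ν)|) := by
    intro k hk
    rw [abs_mul, abs_of_nonneg (fermiWeight_nonneg _ _ _)]
    rcases hk with hk | hk
    -- The two ends are cut for different reasons: for `k ≤ 0` the Fermi weight is exponentially
    -- small in `n`, for `k > n` the Gaussian is.
    · have hk' : (k : ℝ) ≤ 0 := by exact_mod_cast hk
      have h1 := hskew sk hskb1 (X + h * (k - ν)) 0 le_rfl (abs_nonneg _)
      have h2 : fermiWeight L (ν + ξ) k ≤ ω * (P₂ / n) := by
        have h3 : Real.exp (-(2 * L * β * n)) ≤ P₂ / n := by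
          have := hpoly₂ n hn0.le
          rw [Real.exp_neg, ← one_div, div_le_div_iff₀ (Real.exp_pos _) hn0]
          linarith
        calc fermiWeight L (ν + ξ) k ≤ Real.exp (2 * L * ((k : ℝ) - 1 / 2 - (ν + ξ))) :=
              fermiWeight_le_exp _ _ _
          _ ≤ Real.exp (-(2 * L * (1 / 2 + ξ)) + -(2 * L * β * n)) := by
              refine Real.exp_le_exp.2 ?_
              have : L * k ≤ 0 := mul_nonpos_of_nonneg_of_nonpos hL.le hk'
              rw [hν]; linarith
          _ = ω * Real.exp (-(2 * L * β * n)) := Real.exp_add _ _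
          _ ≤ _ := by gcongr
      simp only [ne_eq, OfNat.ofNat_ne_zero, not_false_eq_true, zero_pow, zero_div, neg_zero,
        Real.exp_zero, mul_one] at h1
      calc |skewGauss sk (X + h * (k - ν))| * fermiWeight L (ν + ξ) k ≤
          Cs * Real.exp (-|X + h * (k - ν)|) * (ω * (P₂ / n)) :=
            mul_le_mul h1 h2 (fermiWeight_nonneg _ _ _) (by positivity)
        _ = Cs * ω * P₂ / n * Real.exp (-|X + h * (k - ν)|) := by ring
        _ ≤ _ := by
          have : Cs * ω * P₂ ≤ δc := by rw [hδc]; have : 0 < Cs * P₁ := by positivity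
                                        linarith
          gcongr
    · have hk' : (n : ℝ) < k := by exact_mod_cast hk
      have hXl : -(n * ((1 - β) / 2) + M) / s ≤ X := by
        rw [hX, saddleX, ← hs]
        have e1 := W.abs_deriv_le hx₀ρ
        have e2 : |deriv E x₀| ≤ (1 - β) / 2 := e1.trans (le_trans (by gcongr) hη'M)
        have e3 : n * deriv E x₀ ≤ n * ((1 - β) / 2) := by
          gcongr; exact le_of_abs_le e2
        have e4 := neg_le_of_abs_le (W.sμ₂.b1 x₀ hx₀ρ)
        gcongr
        linarith
      have hXk : n * (1 - β) / s ≤ X + h * (k - ν) := by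
        rw [div_le_iff₀ (by linarith)] at hnM
        have e1 : h * (n - ν) ≤ h * (k - ν) := by gcongr
        have e2 : h * (n - ν) = 2 * (n * (1 - β)) / s := by rw [hh, hν]; ring
        have e3 : n * (1 - β) / s ≤ -(n * ((1 - β) / 2) + M) / s + 2 * (n * (1 - β)) / s := by
          rw [← add_div]; gcongr; linarith
        linarith
      have hR : 0 ≤ n * (1 - β) / s := by positivity
      have h1 := hskew sk hskb1 (X + h * (k - ν)) _ hR (hXk.trans (le_abs_self _))
      have h2 : Real.exp (-((n * (1 - β) / s) ^ 2 / 8)) ≤ P₁ / n := by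
        have e1 : (1 - β) ^ 2 / (8 * M) * n ≤ (n * (1 - β) / s) ^ 2 / 8 := by
          have : (n * (1 - β) / s) ^ 2 / 8 = (1 - β) ^ 2 / (8 * κ) * n := by
            rw [div_pow, sq s, hs2]; field_simp
          rw [this]; gcongr
        have := hpoly₁ n hn0.le
        rw [pow_one] at this
        calc Real.exp (-((n * (1 - β) / s) ^ 2 / 8)) ≤
            Real.exp (-((1 - β) ^ 2 / (8 * M) * n)) := Real.exp_le_exp.2 (by linarith)
          _ ≤ P₁ / n := by
            rw [Real.exp_neg, ← one_div, div_le_div_iff₀ (Real.exp_pos _) hn0]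
            linarith
      calc |skewGauss sk (X + h * (k - ν))| * fermiWeight L (ν + ξ) k ≤
          |skewGauss sk (X + h * (k - ν))| :=
            mul_le_of_le_one_right (abs_nonneg _) (fermiWeight_le_one _ _ _)
        _ ≤ Cs * (P₁ / n) * Real.exp (-|X + h * (k - ν)|) := h1.trans (by gcongr)
        _ = Cs * P₁ / n * Real.exp (-|X + h * (k - ν)|) := by ring
        _ ≤ _ := by
          have : Cs * P₁ ≤ δc := by rw [hδc]; have : 0 < Cs * ω * P₂ := by positivity
                                    linarith
          gcongr
  have a1 := hφ.tsum_sub_sum_le hh0 hh1 X ν L (ν + ξ) (δc / n) n (by positivity) htr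
  have a2 := hlat _ _ _ hφ h hh0 hh1 X ν
  rw [integral_skewGauss] at a2
  have a3 := hferm ν
  set F := ∑' k, fermiStep L (ν + ξ) k with hF
  set G := ∑' k : ℤ, skewGauss sk (X + h * (k - ν)) * fermiWeight L (ν + ξ) k with hG
  set Sn := ∑ j ∈ Finset.range n, skewGauss sk (X + h * (((j : ℝ) + 1) - ν)) *
    fermiWeight L (ν + ξ) (j + 1) with hSn
  have b1 : |s0 * (G - Sn)| ≤ 4 * M * δc := by
    rw [abs_mul, abs_of_nonneg hs00]
    calc s0 * |G - Sn| ≤ s * (δc / n * (8 / h)) := by gcongr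
      _ = 4 * δc * (s * s) / n := by rw [hh]; field_simp; norm_num
      _ = 4 * κ * δc := by rw [hs2]; field_simp
      _ ≤ _ := by gcongr
  set V := √(2 * π) * (CoulombGap.erfc (X / √2) / 2) +
    sk * ((X ^ 2 + 5) * Real.exp (-X ^ 2 / 2)) with hV
  set Y := h * G - V - h * skewGauss sk X * (F + ν - 1 / 2) with hY
  have b2 : |s0 / h * Y| ≤ 2 * Cl := by
    rw [abs_mul, abs_of_nonneg (by positivity)]
    calc s0 / h * |Y| ≤ s / h * (Cl * h ^ 2) := by gcongr
      _ = 2 * Cl := by rw [hh]; field_simp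
  have b3 : |s0 * (sk * (skewGauss 1 X - skewGauss 0 X)) * (F + ν - 1 / 2)| ≤
      √M * c₀ * (2 * Cs) * (Cf + 1 / 2) := by
    have e1 : |skewGauss 1 X - skewGauss 0 X| ≤ 2 * Cs := by
      have f1 := hskew 1 (by simp) X 0 le_rfl (abs_nonneg _)
      have f0 := hskew 0 (by simp) X 0 le_rfl (abs_nonneg _)
      simp only [ne_eq, OfNat.ofNat_ne_zero, not_false_eq_true, zero_pow, zero_div, neg_zero,
        Real.exp_zero, mul_one] at f1 f0
      have f2 : Cs * Real.exp (-|X|) ≤ Cs :=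
        mul_le_of_le_one_right hCs.le (Real.exp_le_one_iff.2 (by simp))
      have := abs_sub (skewGauss 1 X) (skewGauss 0 X)
      linarith
    have e2 : |F + ν - 1 / 2| ≤ Cf + 1 / 2 := by
      refine (abs_sub _ _).trans (add_le_add a3 (by norm_num))
    rw [abs_mul, abs_mul, abs_mul, abs_of_nonneg hs00]
    calc s0 * (|sk| * |skewGauss 1 X - skewGauss 0 X|) * |F + ν - 1 / 2| ≤
        √M * √n * (c₀ / √n * (2 * Cs)) * (Cf + 1 / 2) := by
          gcongr
          exact hs0le.trans hsM
      _ = _ := by field_simp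
  have hmain : gapMain E μ x₁ x₂ β n x₀ =
      s0 / h * V + s0 * skewGauss 0 X * (F + ν - 1 / 2) := by
    rw [gapMain, ← hsk, ← hκdef, ← hX, ← hs0def, ← hν, ← hξ, ← hLdef, ← hF]
    have e1 : s0 / h = n * κ / 2 / √(2 * π) := by
      rw [hs0s, hh, ← hs2]; field_simp
    rw [e1, hV]
    have e2 : skewGauss 0 X = Real.exp (-X ^ 2 / 2) := by simp [skewGauss]
    rw [e2]
    field_simp
  rw [hmain]
  -- In the boundary term the cubic correction may be dropped: `skewGauss` is affine in its
  -- parameter and `sk = O(n^(-1/2))`, which compensates the factor `s0`.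
  have e4 : skewGauss sk X = skewGauss 0 X + sk * (skewGauss 1 X - skewGauss 0 X) := by
    simp only [skewGauss]; ring
  have e5 : s0 * Sn - (s0 / h * V + s0 * skewGauss 0 X * (F + ν - 1 / 2)) =
      -(s0 * (G - Sn)) + s0 / h * Y +
        s0 * (sk * (skewGauss 1 X - skewGauss 0 X)) * (F + ν - 1 / 2) := by
    rw [hY, e4]; field_simp; ring
  rw [e5]
  refine (abs_add_le _ _).trans (add_le_add ((abs_add_le _ _).trans (add_le_add ?_ b2)) b3)
  rw [abs_neg]; exact b1

/-- Asymptotics of the sum of the reciprocal integrals, uniformly near the right well. -/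
theorem sum_asymptotics : ∃ η' > 0, η' ≤ ρ ∧ ∃ C > 0, ∀ᶠ n : ℕ in atTop, ∀ x₀, |x₀ - x₂| ≤ η' →
    |(∑ j ∈ Finset.range n, (∫ x, laplaceIntegrand E μ n (j + 1 - n * β) x₀ x)⁻¹) -
      gapMain E μ x₁ x₂ β n x₀| ≤ C := by
  have hM := W.M0
  have hκ₀ := W.κ0
  obtain ⟨η₁, hη₁, hη₁ρ, C₁, hC₁, K, hK, h1⟩ := W.term_estimate
  obtain ⟨η₂, hη₂, -, C₂, hC₂, h2⟩ := W.lattice_main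
  refine ⟨min η₁ η₂, by positivity, (min_le_left _ _).trans hη₁ρ,
    C₁ * (4 * √M + 1 + 24) + C₂, by positivity, ?_⟩
  have hcast := tendsto_natCast_atTop_atTop (R := ℝ)
  have hlog3 : ∀ᶠ n : ℝ in atTop, K * Real.log n ^ 3 ≤ √n := by
    have h := (Real.tendsto_pow_log_div_mul_add_atTop 1 0 6 one_ne_zero).const_mul (K ^ 2)
    simp only [one_mul, add_zero, mul_zero] at h
    filter_upwards [h.eventually_le_const one_pos, eventually_gt_atTop 0] with n hn hn0
    refine Real.le_sqrt_of_sq_le ?_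
    rw [← mul_div_assoc, div_le_one hn0] at hn
    rw [mul_pow, ← pow_mul]; exact hn
  have hKlog : ∀ᶠ n : ℝ in atTop, 1 ≤ K * Real.log n :=
    (Real.tendsto_log_atTop.const_mul_atTop hK).eventually_ge_atTop 1
  filter_upwards [hcast.eventually h1, h2, hcast.eventually hlog3, hcast.eventually hKlog,
    eventually_ge_atTop 1, hcast.eventually_ge_atTop (4 / κ₀)]
    with n h1 h2 hlog3 hKlog hn hnκ x₀ hx₀
  have hn1 : (1 : ℝ) ≤ n := by exact_mod_cast hn
  have hn0 : (0 : ℝ) < n := by linarith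
  have hs0 : 0 < √(n : ℝ) := Real.sqrt_pos.2 hn0
  have hx₀1 : |x₀ - x₂| ≤ η₁ := hx₀.trans (min_le_left _ _)
  have hx₀ρ : |x₀ - x₂| ≤ ρ := hx₀1.trans hη₁ρ
  have a2 := h2 x₀ (hx₀.trans (min_le_right _ _))
  have hκκ : κ₀ ≤ deriv (deriv E) x₀ := W.κ₂ x₀ hx₀ρ
  have hκ0 : 0 < deriv (deriv E) x₀ := hκ₀.trans_le hκκ
  have hκM : deriv (deriv E) x₀ ≤ M := le_of_abs_le (W.sE₂.b2 x₀ hx₀ρ)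
  set s0 := √(n * deriv (deriv E) x₀ / (2 * π)) with hs0def
  set s := √(n * deriv (deriv E) x₀) with hs
  have hs0' : 0 < s := Real.sqrt_pos.2 (by positivity)
  have hsM : s ≤ √M * √n := by
    rw [hs, ← Real.sqrt_mul hM.le]
    refine Real.sqrt_le_sqrt ?_
    rw [mul_comm M]; gcongr
  have hh1 : 2 / s ≤ 1 := by
    rw [div_le_one hs0', hs]
    refine Real.le_sqrt_of_sq_le ?_
    rw [div_le_iff₀ hκ₀] at hnκ
    calc (2 : ℝ) ^ 2 = 4 := by norm_num
      _ ≤ n * κ₀ := hnκ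
      _ ≤ n * deriv (deriv E) x₀ := by gcongr
  set X := saddleX (deriv E) (deriv (deriv E)) (deriv μ) n x₀ with hX
  have hXlin : ∀ m : ℝ, X m = X 0 + 2 / s * m := by
    intro m
    simp only [hX, saddleX, ← hs]; ring
  set g : ℕ → ℝ := fun j => skewGauss (phaseSkew (deriv (deriv E)) (deriv (deriv (deriv E))) n x₀)
    (X (j + 1 - n * β)) * (1 + wellRatio E μ x₁ x₂ (j + 1 - n * β))⁻¹ with hg
  have hterm : ∀ j ∈ Finset.range n,
      |(∫ x, laplaceIntegrand E μ n (j + 1 - n * β) x₀ x)⁻¹ - s0 * g j| ≤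
      C₁ * ((√n)⁻¹ * Real.exp (-|X (j + 1 - n * β)|) + 1 / n +
      (Real.log n ^ 2 / √n) * if |(j : ℝ) + 1 - n * β| ≤ K * Real.log n then 1 else 0) := by
    intro j hj
    have hj' : (j : ℝ) + 1 ≤ n := by exact_mod_cast Finset.mem_range.1 hj
    have hj0 : (0 : ℝ) ≤ j := by positivity
    have hβ0 : 0 ≤ n * β := mul_nonneg hn0.le W.β0.le
    have hβ1 : n * β ≤ n * 1 := by have := W.β1; gcongr
    have := h1 x₀ hx₀1 (j + 1 - n * β) (by rw [abs_le]; constructor <;> linarith)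
    refine this.trans (le_of_eq ?_)
    congr 2
    split_ifs <;> simp
  have e1 : (∑ j ∈ Finset.range n, (∫ x, laplaceIntegrand E μ n (j + 1 - n * β) x₀ x)⁻¹) -
      gapMain E μ x₁ x₂ β n x₀ =
      (∑ j ∈ Finset.range n, ((∫ x, laplaceIntegrand E μ n (j + 1 - n * β) x₀ x)⁻¹ - s0 * g j)) +
      (s0 * (∑ j ∈ Finset.range n, g j) - gapMain E μ x₁ x₂ β n x₀) := by
    rw [Finset.sum_sub_distrib, ← Finset.mul_sum]; ring
  rw [e1]
  refine (abs_add_le _ _).trans (add_le_add ?_ a2)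
  refine (Finset.abs_sum_le_sum_abs _ _).trans ((Finset.sum_le_sum hterm).trans ?_)
  rw [← Finset.mul_sum, Finset.sum_add_distrib, Finset.sum_add_distrib, ← Finset.mul_sum,
    ← Finset.mul_sum]
  -- The three kinds of error each sum to `O(1)`: the exponential along a lattice of spacing `2 / s`
  -- sums to `O(√n)`, there are `n` terms `1 / n`, and `O(log n)` indices carry `log² n / √n`.
  have c1 : (√(n : ℝ))⁻¹ * ∑ j ∈ Finset.range n, Real.exp (-|X (j + 1 - n * β)|) ≤ 4 * √M := by
    have := sum_exp_neg_le (h := 2 / s) (by positivity) hh1 (X 0 - 2 / s * (n * β)) n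
    have e2 : ∀ j : ℕ, X 0 - 2 / s * (n * β) + 2 / s * ((j : ℝ) + 1) = X (j + 1 - n * β) := by
      intro j
      rw [hXlin (j + 1 - n * β)]; ring
    simp only [e2] at this
    calc _ ≤ (√(n : ℝ))⁻¹ * (8 / (2 / s)) := by gcongr
      _ = (√(n : ℝ))⁻¹ * (4 * s) := by field_simp; norm_num
      _ ≤ (√(n : ℝ))⁻¹ * (4 * (√M * √n)) := by gcongr
      _ = 4 * √M := by field_simp
  have c2 : ∑ j ∈ Finset.range n, 1 / (n : ℝ) = 1 := by
    rw [Finset.sum_const, Finset.card_range, nsmul_eq_mul]; field_simp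
  have c3 : Real.log n ^ 2 / √n * ∑ j ∈ Finset.range n,
      (if |(j : ℝ) + 1 - n * β| ≤ K * Real.log n then (1 : ℝ) else 0) ≤ 24 := by
    have := sum_indicator_le hKlog (n * β) n
    calc _ ≤ Real.log n ^ 2 / √n * (24 * (K * Real.log n)) := by gcongr
      _ = 24 * (K * Real.log n ^ 3) / √n := by ring
      _ ≤ 24 * √n / √n := by gcongr
      _ = 24 := by field_simp
  rw [c2]
  gcongr

end TwoWell

/-! ### Logarithmic coordinates -/

/-- Integrals of radial functions against `areaMeasure`, in logarithmic coordinates. -/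
lemma integral_radial_areaMeasure (f : ℝ → ℝ) :
    ∫ w : ℂ, f ‖w‖ ∂CoulombGap.areaMeasure = 2 * ∫ x : ℝ, Real.exp (2 * x) * f (Real.exp x) := by
  have h1 : ∫ w : ℂ, f ‖w‖ = 2 * π * ∫ r in Set.Ioi (0 : ℝ), r * f r := by
    rw [integral_fun_norm_addHaar (volume : Measure ℂ) f, Complex.finrank_real_complex]
    simp [Measure.real, Complex.volume_ball]
    ring
  have h2 : ∫ r in Set.Ioi (0 : ℝ), r * f r = ∫ x : ℝ, Real.exp (2 * x) * f (Real.exp x) := by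
    have := integral_image_eq_integral_abs_deriv_smul (s := Set.univ) (f := Real.exp)
      (f' := Real.exp) MeasurableSet.univ (fun x _ => (Real.hasDerivAt_exp x).hasDerivWithinAt)
      Real.exp_injective.injOn (fun r => r * f r)
    rw [Set.image_univ, Real.range_exp, setIntegral_univ] at this
    rw [this]
    refine integral_congr_ae (Eventually.of_forall fun x => ?_)
    simp only [abs_of_pos (Real.exp_pos x), smul_eq_mul]
    rw [two_mul, Real.exp_add]; ring
  rw [CoulombGap.areaMeasure, integral_smul_measure, h1, h2, ENNReal.toReal_ofReal (by positivity),
    smul_eq_mul]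
  field_simp

/-- Each summand of the 1-point function is a reciprocal Laplace integral. -/
lemma onePoint_term_eq (q l : ℝ → ℝ) (s A B : ℝ) {n : ℕ} (hn : n ≠ 0) (j : ℕ) (z : ℂ) (x₀ : ℝ)
    (hz : ‖z‖ = Real.exp x₀) :
    ‖CoulombGap.weightedMonomial (CoulombGap.perturbed (CoulombGap.radial q) (CoulombGap.radial l)
        s n) n j z‖ ^ 2 /
      ∫ w, ‖CoulombGap.weightedMonomial (CoulombGap.perturbed (CoulombGap.radial q)
        (CoulombGap.radial l) s n) n j w‖ ^ 2 ∂CoulombGap.areaMeasure =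
    (∫ x, laplaceIntegrand (fun x => q (Real.exp x) - A - B * x) (fun x => s * l (Real.exp x))
      n (j + 1 - n * (B / 2)) x₀ x)⁻¹ / (2 * Real.exp (2 * x₀)) := by
  have hn' : (n : ℝ) ≠ 0 := by exact_mod_cast hn
  set f : ℝ → ℝ := fun r => r ^ (2 * j) * Real.exp (-(n * q r) + s * l r) with hf
  have hnorm : ∀ w : ℂ, ‖CoulombGap.weightedMonomial (CoulombGap.perturbed (CoulombGap.radial q)
      (CoulombGap.radial l) s n) n j w‖ ^ 2 = f ‖w‖ := by
    intro w
    rw [CoulombGap.weightedMonomial, norm_mul, norm_pow, Complex.norm_real,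
      Real.norm_of_nonneg (Real.exp_pos _).le, mul_pow, ← pow_mul, ← Real.exp_nat_mul, hf]
    simp only [CoulombGap.perturbed, CoulombGap.radial]
    rw [mul_comm j 2]
    congr 2
    push_cast
    field_simp
    ring
  simp only [hnorm]
  rw [integral_radial_areaMeasure f, hz]
  have hf0 : f (Real.exp x₀) ≠ 0 := by simp only [hf]; positivity
  have key : ∀ x, Real.exp (2 * x) * f (Real.exp x) = (Real.exp (2 * x₀) * f (Real.exp x₀)) *
      laplaceIntegrand (fun x => q (Real.exp x) - A - B * x) (fun x => s * l (Real.exp x))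
      n (j + 1 - n * (B / 2)) x₀ x := by
    intro x
    simp only [hf, laplaceIntegrand, ← Real.exp_nat_mul, ← Real.exp_add]
    congr 1
    push_cast
    ring
  rw [funext key, integral_const_mul]
  set I := ∫ x, laplaceIntegrand (fun x => q (Real.exp x) - A - B * x)
    (fun x => s * l (Real.exp x)) n (j + 1 - n * (B / 2)) x₀ x
  -- The value 0 occurs when the integral diverges; both sides are then 0.
  rcases eq_or_ne I 0 with hI | hI
  · rw [hI]; simp
  · have := Real.exp_pos (2 * x₀)
    field_simp

lemma onePoint_eq_sum (q l : ℝ → ℝ) (s A B : ℝ) {n : ℕ} (hn : n ≠ 0) (z : ℂ) (x₀ : ℝ)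
    (hz : ‖z‖ = Real.exp x₀) :
    CoulombGap.onePoint (CoulombGap.perturbed (CoulombGap.radial q) (CoulombGap.radial l) s n) n z =
    (∑ j ∈ Finset.range n, (∫ x, laplaceIntegrand (fun x => q (Real.exp x) - A - B * x)
      (fun x => s * l (Real.exp x)) n (j + 1 - n * (B / 2)) x₀ x)⁻¹) / (2 * Real.exp (2 * x₀)) := by
  rw [CoulombGap.onePoint, Finset.sum_div]
  exact Finset.sum_congr rfl fun j _ => onePoint_term_eq q l s A B hn j z x₀ hz

/-- The profile of a radial function inherits its smoothness away from the origin. -/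
lemma contDiffAt_profile {q : ℝ → ℝ} {k : WithTop ℕ∞} {r : ℝ} (hr : 0 < r)
    (h : ContDiffAt ℝ k (CoulombGap.radial q) (r : ℂ)) : ContDiffAt ℝ k q r := by
  have h1 : ContDiffAt ℝ k (fun t : ℝ => CoulombGap.radial q (t : ℂ)) r :=
    h.comp r Complex.ofRealCLM.contDiff.contDiffAt
  refine h1.congr_of_eventuallyEq ?_
  filter_upwards [eventually_gt_nhds hr] with t ht
  simp [CoulombGap.radial, abs_of_pos ht]

/-- Second directional derivatives. -/
lemma iteratedFDeriv_two_diag {f : ℂ → ℝ} {z : ℂ} (hf : ContDiffAt ℝ 2 f z) (v : ℂ) {g₁ : ℝ → ℝ}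
    {d : ℝ} (h1 : ∀ᶠ t in 𝓝 (0 : ℝ), HasDerivAt (fun t : ℝ => f (z + t * v)) (g₁ t) t)
    (h2 : HasDerivAt g₁ d 0) : iteratedFDeriv ℝ 2 f z ![v, v] = d := by
  have hline : ∀ t : ℝ, HasDerivAt (fun t : ℝ => z + (t : ℂ) * v) v t := fun t => by
    simpa using ((Complex.ofRealCLM.hasDerivAt (x := t)).mul_const v).const_add z
  have hline0 : Tendsto (fun t : ℝ => z + t * v) (𝓝 0) (𝓝 z) := by
    have := (hline 0).continuousAt.tendsto
    simpa using this
  have hd : ∀ᶠ w in 𝓝 z, DifferentiableAt ℝ f w := by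
    filter_upwards [hf.eventually (by simp)] with w hw
    exact hw.differentiableAt (by norm_num)
  have e1 : ∀ᶠ t : ℝ in 𝓝 (0 : ℝ), fderiv ℝ f (z + t * v) v = g₁ t := by
    filter_upwards [h1, hline0.eventually hd] with t ht hdt
    exact (hdt.hasFDerivAt.comp_hasDerivAt t (hline t)).unique ht
  have hdd : DifferentiableAt ℝ (fderiv ℝ f) z :=
    (hf.fderiv_right (m := 1) (by norm_num)).differentiableAt (by norm_num)
  have e2 : HasDerivAt (fun t : ℝ => fderiv ℝ f (z + t * v) v) (fderiv ℝ (fderiv ℝ f) z v v) 0 := by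
    have hdd' : HasFDerivAt (fderiv ℝ f) (fderiv ℝ (fderiv ℝ f) z) (z + (0 : ℝ) * v) := by
      simpa using hdd.hasFDerivAt
    have := hdd'.comp_hasDerivAt (0 : ℝ) (hline 0)
    simpa using this.clm_apply (hasDerivAt_const (0 : ℝ) v)
  rw [iteratedFDeriv_two_apply]
  exact e2.unique (h2.congr_of_eventuallyEq e1)

/-- The Laplacian of a radial function. -/
lemma lap_radial {q : ℝ → ℝ} {r : ℝ} (hr : 0 < r)
    (h : ContDiffAt ℝ 2 (CoulombGap.radial q) (r : ℂ)) :
    CoulombGap.lap (CoulombGap.radial q) r = (deriv (deriv q) r + deriv q r / r) / 4 := by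
  have hq := contDiffAt_profile hr h
  have hqd : ∀ᶠ t in 𝓝 r, HasDerivAt q (deriv q t) t := by
    filter_upwards [hq.eventually (by simp)] with w hw
    exact (hw.differentiableAt (by norm_num)).hasDerivAt
  have hqdd : HasDerivAt (deriv q) (deriv (deriv q) r) r := by
    have : ContDiffAt ℝ 1 (deriv q) r := by
      have := (hq.fderiv_right (m := 1) (by norm_num)).clm_apply
        (contDiffAt_const (c := (1 : ℝ)))
      simpa only [fderiv_apply_one_eq_deriv] using this
    exact (this.differentiableAt (by norm_num)).hasDerivAt
  have hreal : iteratedFDeriv ℝ 2 (CoulombGap.radial q) (r : ℂ) ![1, 1] = deriv (deriv q) r := by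
    refine iteratedFDeriv_two_diag h 1 (g₁ := fun t => deriv q (r + t)) ?_ ?_
    · have ht : Tendsto (fun t : ℝ => r + t) (𝓝 0) (𝓝 r) := by
        have : ContinuousAt (fun t : ℝ => r + t) 0 := by fun_prop
        simpa using this.tendsto
      filter_upwards [ht.eventually hqd, ht.eventually (eventually_gt_nhds hr)] with t ht1 ht2
      have h3 := ht1.comp_const_add r t
      refine h3.congr_of_eventuallyEq ?_
      have hc : ContinuousAt (fun t : ℝ => r + t) t := by fun_prop
      filter_upwards [hc.tendsto.eventually (eventually_gt_nhds ht2)] with u hu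
      have : (r : ℂ) + u * 1 = ((r + u : ℝ) : ℂ) := by push_cast; ring
      rw [CoulombGap.radial, this, Complex.norm_real, Real.norm_of_nonneg hu.le]
    · have : HasDerivAt (deriv q) (deriv (deriv q) r) (r + 0) := by simpa using hqdd
      exact this.comp_const_add r 0
  have himag : iteratedFDeriv ℝ 2 (CoulombGap.radial q) (r : ℂ) ![Complex.I, Complex.I] =
      deriv q r / r := by
    -- Along the imaginary direction the modulus is `√(r² + t²)`, whose first derivative vanishes at
    -- 0, so only `q' ψ''` survives.
    set ψ : ℝ → ℝ := fun t => √(r ^ 2 + t ^ 2) with hψ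
    have hψ0 : ψ 0 = r := by simp [hψ, Real.sqrt_sq hr.le]
    have hψpos : ∀ t, 0 < ψ t := fun t => Real.sqrt_pos.2 (by positivity)
    have hψd : ∀ t, HasDerivAt ψ (t / ψ t) t := fun t => by
      have := ((hasDerivAt_pow 2 t).const_add (r ^ 2)).sqrt (by positivity)
      refine this.congr_deriv ?_
      simp only [hψ]
      field_simp
      simp
    have hψc : Tendsto ψ (𝓝 0) (𝓝 r) := by
      have := (hψd 0).continuousAt.tendsto
      rwa [hψ0] at this
    refine iteratedFDeriv_two_diag h Complex.I (g₁ := fun t => deriv q (ψ t) * (t / ψ t)) ?_ ?_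
    · filter_upwards [hψc.eventually hqd] with t ht
      have h3 := ht.comp t (hψd t)
      refine h3.congr_of_eventuallyEq (Eventually.of_forall fun u => ?_)
      simp only [CoulombGap.radial, Function.comp, hψ, Complex.norm_add_mul_I]
    · have hqdd' : HasDerivAt (deriv q) (deriv (deriv q) r) (ψ 0) := by rw [hψ0]; exact hqdd
      have h4 := (hqdd'.comp (0 : ℝ) (hψd 0)).mul
        ((hasDerivAt_id (0 : ℝ)).div (hψd 0) (hψpos 0).ne')
      refine h4.congr_deriv ?_
      simp [hψ0]
      field_simp
  rw [CoulombGap.lap, InnerProductSpace.laplacian_eq_iteratedFDeriv_complexPlane]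
  simp only
  rw [hreal, himag]; ring

lemma SmoothNear.mono {f f₁ f₂ f₃ f₄ : ℝ → ℝ} {c ρ ρ' M M' : ℝ}
    (h : SmoothNear f f₁ f₂ f₃ f₄ c ρ M) (hρ : ρ' ≤ ρ) (hM : M ≤ M') :
    SmoothNear f f₁ f₂ f₃ f₄ c ρ' M' where
  d0 x hx := h.d0 x (hx.trans hρ)
  d1 x hx := h.d1 x (hx.trans hρ)
  d2 x hx := h.d2 x (hx.trans hρ)
  d3 x hx := h.d3 x (hx.trans hρ)
  b1 x hx := (h.b1 x (hx.trans hρ)).trans hM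
  b2 x hx := (h.b2 x (hx.trans hρ)).trans hM
  b3 x hx := (h.b3 x (hx.trans hρ)).trans hM
  b4 x hx := (h.b4 x (hx.trans hρ)).trans hM

lemma SmoothNear.exists_convex {f f₁ f₂ f₃ f₄ : ℝ → ℝ} {c ρ M : ℝ}
    (h : SmoothNear f f₁ f₂ f₃ f₄ c ρ M) (hρ : 0 < ρ) (hc : 0 < f₂ c) :
    ∃ ρ' > 0, ∀ x, |x - c| ≤ ρ' → f₂ c / 2 ≤ f₂ x := by
  have hcont : ContinuousAt f₂ c := (h.d2 c (by simp [hρ.le])).continuousAt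
  obtain ⟨δ, hδ, hb⟩ := Metric.eventually_nhds_iff_ball.1
    (hcont.eventually (eventually_gt_nhds (half_lt_self hc)))
  refine ⟨δ / 2, by positivity, fun x hx => (hb x ?_).le⟩
  rw [Metric.mem_ball, Real.dist_eq]; linarith

section LogCoordinates

variable {q : ℝ → ℝ} (A B : ℝ)

lemma contDiffAt_log_coord {k : WithTop ℕ∞} {x : ℝ} (h : ContDiffAt ℝ k q (Real.exp x)) :
    ContDiffAt ℝ k (fun x => q (Real.exp x) - A - B * x) x :=
  ((h.comp x Real.contDiff_exp.contDiffAt).sub contDiffAt_const).sub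
    (contDiffAt_const.mul contDiffAt_id)

lemma hasDerivAt_log_coord {x : ℝ} (h : ContDiffAt ℝ 2 q (Real.exp x)) :
    HasDerivAt (fun x => q (Real.exp x) - A - B * x) (deriv q (Real.exp x) * Real.exp x - B) x := by
  have h1 := (h.differentiableAt (by norm_num)).hasDerivAt.comp x (Real.hasDerivAt_exp x)
  exact ((h1.sub_const A).sub ((hasDerivAt_id x).const_mul B)).congr_deriv (by simp)

lemma deriv2_log_coord {x : ℝ} (h : ContDiffAt ℝ 2 q (Real.exp x)) :
    deriv (deriv fun x => q (Real.exp x) - A - B * x) x =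
      deriv (deriv q) (Real.exp x) * Real.exp x ^ 2 + deriv q (Real.exp x) * Real.exp x := by
  have hev : ∀ᶠ y in 𝓝 x, ContDiffAt ℝ 2 q (Real.exp y) :=
    Real.continuous_exp.continuousAt.tendsto.eventually (h.eventually (by simp))
  have e1 : (deriv fun x => q (Real.exp x) - A - B * x) =ᶠ[𝓝 x]
      fun y => deriv q (Real.exp y) * Real.exp y - B := by
    filter_upwards [hev] with y hy
    exact (hasDerivAt_log_coord A B hy).deriv
  have hqdd : HasDerivAt (deriv q) (deriv (deriv q) (Real.exp x)) (Real.exp x) := by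
    have : ContDiffAt ℝ 1 (deriv q) (Real.exp x) := by
      have := (h.fderiv_right (m := 1) (by norm_num)).clm_apply
        (contDiffAt_const (c := (1 : ℝ)))
      simpa only [fderiv_apply_one_eq_deriv] using this
    exact (this.differentiableAt (by norm_num)).hasDerivAt
  have h2 := ((hqdd.comp x (Real.hasDerivAt_exp x)).mul (Real.hasDerivAt_exp x)).sub_const B
  rw [e1.deriv_eq]
  refine h2.deriv.trans ?_
  simp only [Function.comp]; ring

/-- The Laplacian of a radial function in logarithmic coordinates. -/
lemma lap_radial_eq_log_coord {r : ℝ} (hr : 0 < r)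
    (h : ContDiffAt ℝ 2 (CoulombGap.radial q) (r : ℂ)) :
    CoulombGap.lap (CoulombGap.radial q) r =
      deriv (deriv fun x => q (Real.exp x) - A - B * x) (Real.log r) / (4 * r ^ 2) := by
  have hq := contDiffAt_profile hr h
  have hq' : ContDiffAt ℝ 2 q (Real.exp (Real.log r)) := by rwa [Real.exp_log hr]
  rw [lap_radial hr h, deriv2_log_coord A B hq', Real.exp_log hr]
  field_simp

/-- `C⁶`-smoothness is an open condition, so `ΔQ = E''(log r) / (4 r²)` holds on a neighbourhood of
`r` and may be differentiated. -/
lemma deriv_lap_radial {r : ℝ} (hr : 0 < r)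
    (h : ContDiffAt ℝ 6 (CoulombGap.radial q) (r : ℂ)) :
    deriv (fun r : ℝ => CoulombGap.lap (CoulombGap.radial q) (r : ℂ)) r =
      deriv (deriv (deriv fun x => q (Real.exp x) - A - B * x)) (Real.log r) / (4 * r ^ 3) -
      deriv (deriv fun x => q (Real.exp x) - A - B * x) (Real.log r) / (2 * r ^ 3) := by
  set E := fun x => q (Real.exp x) - A - B * x with hE
  have hq := contDiffAt_profile hr h
  have hE6 : ContDiffAt ℝ 6 E (Real.log r) :=
    contDiffAt_log_coord A B (by rwa [Real.exp_log hr])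
  obtain ⟨ρ, hρ, M, -, hs⟩ := hE6.exists_smoothNear
  have hev : (fun r : ℝ => CoulombGap.lap (CoulombGap.radial q) (r : ℂ)) =ᶠ[𝓝 r]
      fun r => deriv (deriv E) (Real.log r) / (4 * r ^ 2) := by
    have h1 : ∀ᶠ t : ℝ in 𝓝 r, ContDiffAt ℝ 6 (CoulombGap.radial q) (t : ℂ) :=
      Complex.continuous_ofReal.continuousAt.tendsto.eventually (h.eventually (by simp))
    filter_upwards [h1, eventually_gt_nhds hr] with t ht ht0
    exact lap_radial_eq_log_coord A B ht0 (ht.of_le (by norm_num))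
  rw [hev.deriv_eq]
  have h2 := (hs.d2 (Real.log r) (by simp [hρ.le])).comp r (Real.hasDerivAt_log hr.ne')
  have h3 := h2.div (((hasDerivAt_pow 2 r).const_mul 4)) (by positivity)
  refine h3.deriv.trans ?_
  simp only [Function.comp]
  field_simp
  push_cast
  ring

end LogCoordinates

/-- In logarithmic coordinates, a droplet with a gap gives rise to a two-well potential. -/
theorem exists_twoWell
    (q : ℝ → ℝ) (σ : Measure ℂ)
    (hlsc : LowerSemicontinuous (CoulombGap.radial q))
    (hgrowth : Tendsto (fun z : ℂ => CoulombGap.radial q z - 2 * Real.log ‖z‖)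
      (cocompact ℂ) atTop)
    (hσ : CoulombGap.IsEquilibriumMeasure (CoulombGap.radial q) σ)
    (hC2 : ∀ z ∈ σ.support, ContDiffAt ℝ 2 (CoulombGap.radial q) z)
    (hpos : ∀ z ∈ frontier σ.support, 0 < CoulombGap.lap (CoulombGap.radial q) z)
    (hstrict : ∀ z ∉ σ.support,
      CoulombGap.obstacle (CoulombGap.radial q) σ z < CoulombGap.radial q z)
    (N : ℕ) (a b : ℕ → ℝ) (ha0 : 0 ≤ a 0) (hab : ∀ j ≤ N, a j < b j)
    (hba : ∀ j < N, b j < a (j + 1))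
    (hS : σ.support = ⋃ j ∈ Finset.range (N + 1), {z : ℂ | a j ≤ ‖z‖ ∧ ‖z‖ ≤ b j})
    (k : ℕ) (hk : k < N) (r₁ r₂ : ℝ) (hr₁ : r₁ = b k) (hr₂ : r₂ = a (k + 1))
    (hC6 : ∀ z : ℂ, ‖z‖ = r₁ ∨ ‖z‖ = r₂ → ContDiffAt ℝ 6 (CoulombGap.radial q) z)
    (l : ℝ → ℝ) (hl : ContDiff ℝ 6 (CoulombGap.radial l))
    (hl0 : ∀ z ∈ closure (σ.supportᶜ \ {w : ℂ | r₁ < ‖w‖ ∧ ‖w‖ < r₂}),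
      CoulombGap.radial l =ᶠ[𝓝 z] 0)
    (s : ℝ) :
    0 < r₁ ∧ r₁ < r₂ ∧ ∃ A B : ℝ,
      (∀ z : ℂ, r₁ ≤ ‖z‖ → ‖z‖ ≤ r₂ →
        CoulombGap.obstacle (CoulombGap.radial q) σ z = A + B * Real.log ‖z‖) ∧
      ∃ ρ M κ₀, TwoWell (fun x => q (Real.exp x) - A - B * x) (fun x => s * l (Real.exp x))
        (Real.log r₁) (Real.log r₂) (B / 2) ρ M κ₀ := by
  obtain ⟨A, B, hB0, hB2, hobs, hq1, hq2, hqpos⟩ := droplet_gap_structure hlsc hσ hC2 hstrict ha0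
    hab hba hS hk
  rw [← hr₁, ← hr₂] at hobs hqpos
  rw [← hr₁] at hq1
  rw [← hr₂] at hq2
  have hr1 : 0 < r₁ := by
    have h1 := (annuli_ordered hab hba (Nat.zero_le k) hk.le).2
    have h2 := hab k hk.le
    rw [hr₁]; linarith
  have hr12 : r₁ < r₂ := by rw [hr₁, hr₂]; exact hba k hk
  have hr2 : 0 < r₂ := hr1.trans hr12
  refine ⟨hr1, hr12, A, B, hobs, ?_⟩
  have hmem : ∀ z : ℂ, z ∈ σ.support ↔ ∃ j ≤ N, a j ≤ ‖z‖ ∧ ‖z‖ ≤ b j := by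
    intro z; rw [hS]; simp only [Finset.mem_range, Nat.lt_succ_iff, Set.mem_iUnion,
      Set.mem_ofPred_eq, exists_prop]
  have hgap : ∀ z : ℂ, r₁ < ‖z‖ → ‖z‖ < r₂ → z ∉ σ.support := by
    intro z h1 h2 hz
    obtain ⟨j, hj, hj1, hj2⟩ := (hmem z).1 hz
    rcases le_or_gt j k with hjk | hjk
    · have := (annuli_ordered hab hba hjk hk.le).1
      rw [hr₁] at h1; linarith
    · have := (annuli_ordered hab hba hjk hj).2
      rw [hr₂] at h2
      simp only [Nat.succ_eq_add_one] at this
      linarith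
  have hS1 : (r₁ : ℂ) ∈ σ.support := (hmem _).2 ⟨k, hk.le, by
    rw [Complex.norm_real, Real.norm_of_nonneg hr1.le, hr₁]; exact ⟨(hab k hk.le).le, le_rfl⟩⟩
  have hS2 : (r₂ : ℂ) ∈ σ.support := (hmem _).2 ⟨k + 1, hk, by
    rw [Complex.norm_real, Real.norm_of_nonneg hr2.le, hr₂]; exact ⟨le_rfl, (hab (k + 1) hk).le⟩⟩
  -- Radii slightly beyond `r₁` lie in the gap. Positivity of `ΔQ` is assumed on the boundary of the
  -- droplet only, and it is what makes the wells nondegenerate.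
  have hfr1 : (r₁ : ℂ) ∈ frontier σ.support := by
    refine ⟨subset_closure hS1, fun hint => ?_⟩
    have h1 : ∀ᶠ t : ℝ in 𝓝 r₁, (t : ℂ) ∈ σ.support :=
      Complex.continuous_ofReal.continuousAt.tendsto.eventually (mem_interior_iff_mem_nhds.1 hint)
    obtain ⟨t, ht, ht1, ht2⟩ := ((h1.filter_mono nhdsWithin_le_nhds).and
      (Ioo_mem_nhdsGT hr12)).exists
    refine hgap t ?_ ?_ ht <;> rwa [Complex.norm_real, Real.norm_of_nonneg (by linarith)]
  have hfr2 : (r₂ : ℂ) ∈ frontier σ.support := by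
    refine ⟨subset_closure hS2, fun hint => ?_⟩
    have h1 : ∀ᶠ t : ℝ in 𝓝 r₂, (t : ℂ) ∈ σ.support :=
      Complex.continuous_ofReal.continuousAt.tendsto.eventually (mem_interior_iff_mem_nhds.1 hint)
    obtain ⟨t, ht, ht1, ht2⟩ := ((h1.filter_mono nhdsWithin_le_nhds).and
      (Ioo_mem_nhdsLT hr12)).exists
    refine hgap t ?_ ?_ ht <;> rwa [Complex.norm_real, Real.norm_of_nonneg (by linarith)]
  have hC1' : ContDiffAt ℝ 6 (CoulombGap.radial q) (r₁ : ℂ) :=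
    hC6 _ (Or.inl (by rw [Complex.norm_real, Real.norm_of_nonneg hr1.le]))
  have hC2' : ContDiffAt ℝ 6 (CoulombGap.radial q) (r₂ : ℂ) :=
    hC6 _ (Or.inr (by rw [Complex.norm_real, Real.norm_of_nonneg hr2.le]))
  set E : ℝ → ℝ := fun x => q (Real.exp x) - A - B * x with hE
  set μ : ℝ → ℝ := fun x => s * l (Real.exp x) with hμ
  have hEd : ∀ r : ℝ, 0 < r → ContDiffAt ℝ 6 (CoulombGap.radial q) (r : ℂ) →
      ContDiffAt ℝ 6 E (Real.log r) := fun r hr h =>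
    contDiffAt_log_coord A B (by rw [Real.exp_log hr]; exact contDiffAt_profile hr h)
  have hμd : ∀ x, ContDiffAt ℝ 6 μ x := fun x =>
    contDiffAt_const.mul ((contDiffAt_profile (Real.exp_pos x) hl.contDiffAt).comp x
      Real.contDiff_exp.contDiffAt)
  have hE2pos : ∀ r : ℝ, 0 < r → ContDiffAt ℝ 6 (CoulombGap.radial q) (r : ℂ) →
      0 < CoulombGap.lap (CoulombGap.radial q) r → 0 < deriv (deriv E) (Real.log r) := by
    intro r hr h hp
    rw [lap_radial_eq_log_coord A B hr (h.of_le (by norm_num)), ← hE] at hp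
    exact (div_pos_iff_of_pos_right (by positivity)).1 hp
  obtain ⟨ρ₁, hρ₁, M₁, hM₁, s₁⟩ := (hEd r₁ hr1 hC1').exists_smoothNear
  obtain ⟨ρ₂, hρ₂, M₂, hM₂, s₂⟩ := (hEd r₂ hr2 hC2').exists_smoothNear
  obtain ⟨ρ₃, hρ₃, M₃, hM₃, s₃⟩ := (hμd (Real.log r₁)).exists_smoothNear
  obtain ⟨ρ₄, hρ₄, M₄, hM₄, s₄⟩ := (hμd (Real.log r₂)).exists_smoothNear
  have p1 := hE2pos r₁ hr1 hC1' (hpos _ hfr1)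
  have p2 := hE2pos r₂ hr2 hC2' (hpos _ hfr2)
  obtain ⟨ρ₅, hρ₅, k₁⟩ := s₁.exists_convex hρ₁ p1
  obtain ⟨ρ₆, hρ₆, k₂⟩ := s₂.exists_convex hρ₂ p2
  have hexp : Continuous fun x : ℝ => ((Real.exp x : ℝ) : ℂ) := by fun_prop
  have hμc : Continuous μ := continuous_iff_continuousAt.2 fun x => (hμd x).continuousAt
  -- the perturbation is bounded
  obtain ⟨Ml, hMl⟩ : ∃ Ml, ∀ x, |μ x| ≤ Ml := by
    obtain ⟨C, hC⟩ := (isCompact_closedBall (0 : ℂ) (b N)).exists_bound_of_continuousOn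
      hl.continuous.continuousOn
    refine ⟨|s| * |C|, fun x => ?_⟩
    rw [hμ]
    simp only
    rw [abs_mul]
    refine mul_le_mul_of_nonneg_left ?_ (abs_nonneg s)
    have hrad : l (Real.exp x) = CoulombGap.radial l ((Real.exp x : ℝ) : ℂ) := by
      rw [CoulombGap.radial, Complex.norm_real, Real.norm_of_nonneg (Real.exp_pos x).le]
    rw [hrad]
    have hnorm : ‖((Real.exp x : ℝ) : ℂ)‖ = Real.exp x := by
      rw [Complex.norm_real, Real.norm_of_nonneg (Real.exp_pos x).le]
    rcases le_or_gt (Real.exp x) (b N) with h | h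
    · exact (hC _ (by rw [mem_closedBall_zero_iff, hnorm]; exact h)).trans (le_abs_self C)
    -- Beyond the outermost annulus the point is outside both the droplet and the gap, where `hl0`
    -- makes `l` vanish; so no bound on `l` at infinity is needed.
    · have hz : ((Real.exp x : ℝ) : ℂ) ∈ closure (σ.supportᶜ \ {w : ℂ | r₁ < ‖w‖ ∧ ‖w‖ < r₂}) := by
        refine subset_closure ⟨fun hz => ?_, fun hz => ?_⟩
        · obtain ⟨j, hj, -, hj2⟩ := (hmem _).1 hz
          have := (annuli_ordered hab hba hj le_rfl).1
          rw [hnorm] at hj2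
          linarith
        · have h1 : ‖((Real.exp x : ℝ) : ℂ)‖ < r₂ := hz.2
          have h2 := (annuli_ordered hab hba (Nat.succ_le_of_lt hk) le_rfl).2
          have h3 := hab N le_rfl
          rw [hnorm, hr₂] at h1
          simp only [Nat.succ_eq_add_one] at h2
          linarith
      rw [(hl0 _ hz).eq_of_nhds]
      simp
  set ρ := min (min (min ρ₁ ρ₂) (min ρ₃ ρ₄)) (min ρ₅ ρ₆) with hρ
  set M := M₁ + M₂ + M₃ + M₄ + |Ml| with hM
  have hρ0 : 0 < ρ := by positivity
  have hρ1 : ρ ≤ ρ₁ := (min_le_left _ _).trans ((min_le_left _ _).trans (min_le_left _ _))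
  have hρ2 : ρ ≤ ρ₂ := (min_le_left _ _).trans ((min_le_left _ _).trans (min_le_right _ _))
  have hρ3 : ρ ≤ ρ₃ := (min_le_left _ _).trans ((min_le_right _ _).trans (min_le_left _ _))
  have hρ4 : ρ ≤ ρ₄ := (min_le_left _ _).trans ((min_le_right _ _).trans (min_le_right _ _))
  have hρ5 : ρ ≤ ρ₅ := (min_le_right _ _).trans (min_le_left _ _)
  have hρ6 : ρ ≤ ρ₆ := (min_le_right _ _).trans (min_le_right _ _)
  have hMl0 := abs_nonneg Ml
  have hlog1 : Real.log r₁ < Real.log r₂ := Real.log_lt_log hr1 hr12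
  have hEr : ∀ r > 0, E (Real.log r) = q r - A - B * Real.log r := fun r hr => by
    simp only [hE, Real.exp_log hr]
  have hqexp : ∀ x, q (Real.exp x) = CoulombGap.radial q ((Real.exp x : ℝ) : ℂ) := fun x => by
    rw [CoulombGap.radial, Complex.norm_real, Real.norm_of_nonneg (Real.exp_pos x).le]
  have hqlsc : LowerSemicontinuous fun x => q (Real.exp x) := by
    simp only [hqexp]
    exact LowerSemicontinuous.comp (f := CoulombGap.radial q) hlsc hexp
  refine ⟨ρ, M, min (deriv (deriv E) (Real.log r₁) / 2) (deriv (deriv E) (Real.log r₂) / 2), ?_⟩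
  refine
    { lt := hlog1
      β0 := by linarith
      β1 := by linarith
      lsc := ?_
      zero₁ := by rw [hEr r₁ hr1, hq1]; ring
      zero₂ := by rw [hEr r₂ hr2, hq2]; ring
      pos := fun x hx1 hx2 => ?_
      top := ?_
      bot := ?_
      meas := hμc.measurable
      bdd := fun x => (hMl x).trans ((le_abs_self _).trans (by linarith))
      ρ0 := hρ0
      M0 := by linarith
      κ0 := by positivity
      sE₁ := s₁.mono hρ1 (by linarith)
      sE₂ := s₂.mono hρ2 (by linarith)
      sμ₁ := s₃.mono hρ3 (by linarith)
      sμ₂ := s₄.mono hρ4 (by linarith)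
      κ₁ := fun x hx => (min_le_left _ _).trans (k₁ x (hx.trans hρ5))
      κ₂ := fun x hx => (min_le_right _ _).trans (k₂ x (hx.trans hρ6)) }
  · have h1 : E = fun x => q (Real.exp x) + (-A - B * x) := by funext x; simp only [hE]; ring
    rw [h1]
    exact hqlsc.add (Continuous.lowerSemicontinuous (by fun_prop))
  · have := hqpos (Real.exp x) (Real.exp_pos x)
      (fun h => hx1 (by rw [← h, Real.log_exp])) (fun h => hx2 (by rw [← h, Real.log_exp]))
    rw [Real.log_exp] at this
    simp only [hE]; linarith
  -- Since `2β = B`, the function `E x - 2(1 - β) x` is `q (exp x) - 2x - A`, and the growth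
  -- hypothesis on `Q` applies.
  · have ht : Tendsto (fun x : ℝ => ((Real.exp x : ℝ) : ℂ)) atTop (cocompact ℂ) := by
      rw [← Metric.cobounded_eq_cocompact, ← tendsto_norm_atTop_iff_cobounded]
      refine Real.tendsto_exp_atTop.congr fun x => ?_
      rw [Complex.norm_real, Real.norm_of_nonneg (Real.exp_pos x).le]
    have h1 := tendsto_atTop_add_const_right _ (-A) (hgrowth.comp ht)
    refine h1.congr fun x => ?_
    simp only [Function.comp, hE, ← hqexp]
    rw [Complex.norm_real, Real.norm_of_nonneg (Real.exp_pos x).le, Real.log_exp]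
    ring
  -- Here `E x + 2βx = q (exp x) - A`, and lower semicontinuity at the origin bounds `q` from below
  -- by `q 0 - 1`.
  · refine ⟨q 0 - 1 - A, ?_⟩
    have h0 : Tendsto (fun x : ℝ => ((Real.exp x : ℝ) : ℂ)) atBot (𝓝 0) := by
      exact (Complex.continuous_ofReal.tendsto' 0 0 (by simp)).comp Real.tendsto_exp_atBot
    have hq0 : CoulombGap.radial q 0 = q 0 := by simp [CoulombGap.radial]
    have h1 := hlsc 0 (q 0 - 1) (by change CoulombGap.radial q 0 > q 0 - 1; rw [hq0]; linarith)
    filter_upwards [h0.eventually h1] with x hx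
    rw [← hqexp] at hx
    simp only [hE]; linarith

/-! ### Uniform estimates for the Gaussian and `erfc` -/

lemma abs_sub_le_of_hasDerivAt {h h' : ℝ → ℝ} {C : ℝ} (hd : ∀ y, HasDerivAt h (h' y) y)
    (hb : ∀ y, |h' y| ≤ C) (x y : ℝ) : |h y - h x| ≤ C * |y - x| :=
  Convex.norm_image_sub_le_of_norm_hasDerivWithin_le (s := Set.univ)
    (fun z _ => (hd z).hasDerivWithinAt) (fun z _ => hb z) convex_univ trivial trivial

lemma abs_sub_sub_le_of_hasDerivAt {h h' h'' : ℝ → ℝ} {C : ℝ} (hd : ∀ y, HasDerivAt h (h' y) y)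
    (hd' : ∀ y, HasDerivAt h' (h'' y) y) (hb : ∀ y, |h'' y| ≤ C) (x y : ℝ) :
    |h y - h x - h' x * (y - x)| ≤ C * |y - x| ^ 2 := by
  have := abs_le_pow_succ_of_hasDerivAt (h := fun z => h (x + z) - h x - h' x * z)
    (h' := fun z => h' (x + z) - h' x) (C := C) (k := 1) (η := |y - x|) (by simp)
    (fun z _ => by
      have := ((hd (x + z)).comp_const_add x z).sub_const (h x)
      exact (this.sub ((hasDerivAt_id z).const_mul (h' x))).congr_deriv (by simp))
    (fun z _ => by simpa using abs_sub_le_of_hasDerivAt hd' hb x (x + z)) le_rfl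
  simpa using this

/-- The quadratic remainder of a `C²` function. -/
lemma ContDiffAt.isBigO_taylor_two {f : ℝ → ℝ} {a f' : ℝ} (hf : ContDiffAt ℝ 2 f a)
    (hf' : HasDerivAt f f' a) :
    (fun x => f x - f a - f' * (x - a)) =O[𝓝 a] fun x => (x - a) ^ 2 := by
  have h1 : ContDiffAt ℝ 1 (deriv f) a := by
    have := (hf.fderiv_right (m := 1) (by norm_num)).clm_apply (contDiffAt_const (c := (1 : ℝ)))
    simpa only [fderiv_apply_one_eq_deriv] using this
  have h2 := (h1.differentiableAt (by norm_num)).hasDerivAt.isBigO_sub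
  obtain ⟨C, hC⟩ := h2.bound
  have h3 : ∀ᶠ x in 𝓝 a, ContDiffAt ℝ 2 f x := hf.eventually (by simp)
  obtain ⟨η, hη, hb⟩ := Metric.eventually_nhds_iff_ball.1 (hC.and h3)
  refine Asymptotics.IsBigO.of_bound C ?_
  filter_upwards [Metric.closedBall_mem_nhds a (half_pos hη)] with x hx
  have hmem : ∀ z, |z| ≤ η / 2 → a + z ∈ Metric.ball a η := fun z hz => by
    rw [Metric.mem_ball, Real.dist_eq]; simp; linarith
  have := abs_le_pow_succ_of_hasDerivAt (h := fun z => f (a + z) - f a - f' * z)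
    (h' := fun z => deriv f (a + z) - deriv f a) (C := C) (k := 1) (η := η / 2) (by simp)
    (fun z hz => by
      have h4 := ((hb _ (hmem z hz)).2.differentiableAt (by norm_num)).hasDerivAt
      have := (h4.comp_const_add a z).sub_const (f a)
      exact (this.sub ((hasDerivAt_id z).const_mul f')).congr_deriv (by simp [hf'.deriv]))
    (fun z hz => by simpa using (hb _ (hmem z hz)).1) (y := x - a)
    (by rwa [Metric.mem_closedBall, Real.dist_eq] at hx)
  simpa using this

lemma exists_gauss_bound (k : ℕ) : ∃ C > 0, ∀ X : ℝ, |X ^ k * Real.exp (-X ^ 2 / 2)| ≤ C := by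
  obtain ⟨C, hC, h⟩ := exists_pow_mul_gaussian_le k
  refine ⟨C, hC, fun X => ?_⟩
  rw [abs_mul, abs_pow, Real.abs_exp]
  refine (h X).trans (mul_le_of_le_one_right hC.le (Real.exp_le_one_iff.2 (by simp)))

lemma gauss_lipschitz : ∃ C > 0, ∀ X Y : ℝ,
    |Real.exp (-Y ^ 2 / 2) - Real.exp (-X ^ 2 / 2)| ≤ C * |Y - X| := by
  obtain ⟨C, hC, h⟩ := exists_gauss_bound 1
  exact ⟨C, hC, abs_sub_le_of_hasDerivAt hasDerivAt_gauss fun X => by simpa using h X⟩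

lemma skew_primitive_lipschitz : ∃ C > 0, ∀ X Y : ℝ,
    |(Y ^ 2 + 5) * Real.exp (-Y ^ 2 / 2) - (X ^ 2 + 5) * Real.exp (-X ^ 2 / 2)| ≤ C * |Y - X| := by
  obtain ⟨C₁, h₁, b₁⟩ := exists_gauss_bound 1
  obtain ⟨C₃, h₃, b₃⟩ := exists_gauss_bound 3
  refine ⟨C₃ + 3 * C₁, by positivity, abs_sub_le_of_hasDerivAt
    (h' := fun X => -(X ^ 3 * Real.exp (-X ^ 2 / 2)) - 3 * (X ^ 1 * Real.exp (-X ^ 2 / 2)))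
    (fun X => ?_) fun X => ?_⟩
  · refine (((hasDerivAt_pow 2 X).add_const 5).mul (hasDerivAt_gauss X)).congr_deriv ?_
    simp; ring
  · refine (abs_sub _ _).trans ?_
    rw [abs_neg, abs_mul 3, abs_of_pos (by norm_num : (0 : ℝ) < 3)]
    linarith [b₁ X, b₃ X]

lemma integrable_gauss : Integrable fun X : ℝ => Real.exp (-X ^ 2 / 2) := by
  have := integrable_exp_neg_mul_sq (b := 1 / 2) (by norm_num)
  refine this.congr (Eventually.of_forall fun X => ?_)
  simp only; congr 1; ring

lemma erfc_div_sqrt_two (X : ℝ) :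
    CoulombGap.erfc (X / √2) / 2 = (∫ x in Set.Ioi X, Real.exp (-x ^ 2 / 2)) / √(2 * π) := by
  have h := integral_skewGauss 0 X
  simp only [skewGauss, zero_mul, add_zero, mul_one] at h
  rw [h, mul_div_cancel_left₀ _ (Real.sqrt_pos.2 (by positivity)).ne']

lemma hasDerivAt_erfc (X : ℝ) : HasDerivAt (fun X => CoulombGap.erfc (X / √2) / 2)
    (-(Real.exp (-X ^ 2 / 2) / √(2 * π))) X := by
  have e : (fun X => CoulombGap.erfc (X / √2) / 2) = fun X =>
      ((∫ x in Set.Ioi 0, Real.exp (-x ^ 2 / 2)) - ∫ x in (0 : ℝ)..X, Real.exp (-x ^ 2 / 2)) /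
        √(2 * π) := by
    funext X
    rw [erfc_div_sqrt_two, ← intervalIntegral.integral_Ioi_sub_Ioi'
      integrable_gauss.integrableOn integrable_gauss.integrableOn, sub_sub_cancel]
  rw [e]
  have hc : Continuous fun x : ℝ => Real.exp (-x ^ 2 / 2) := by fun_prop
  have := ((hc.integral_hasStrictDerivAt 0 X).hasDerivAt.const_sub
    (∫ x in Set.Ioi (0 : ℝ), Real.exp (-x ^ 2 / 2))).div_const (√(2 * π))
  exact this.congr_deriv (by ring)

lemma abs_erfc_le (X : ℝ) : |CoulombGap.erfc (X / √2) / 2| ≤ 1 := by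
  have hpos : 0 < √(2 * π) := Real.sqrt_pos.2 (by positivity)
  rw [erfc_div_sqrt_two, abs_of_nonneg (by positivity), div_le_one hpos]
  refine (setIntegral_le_integral integrable_gauss
    (Eventually.of_forall fun x => (Real.exp_pos _).le)).trans (le_of_eq ?_)
  have := integral_gaussian (1 / 2)
  rw [show π / (1 / 2) = 2 * π by ring] at this
  rw [← this]
  congr 1; funext x; congr 1; ring

/-- The second derivative is a multiple of `X exp (-X² / 2)`, which is bounded; so the remainder is
uniform in the base point, which ranges over a growing interval. -/
lemma erfc_taylor : ∃ C > 0, ∀ X Y : ℝ, |CoulombGap.erfc (Y / √2) / 2 - CoulombGap.erfc (X / √2) / 2 +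
    Real.exp (-X ^ 2 / 2) / √(2 * π) * (Y - X)| ≤ C * |Y - X| ^ 2 := by
  have hpos : 0 < √(2 * π) := Real.sqrt_pos.2 (by positivity)
  obtain ⟨C, hC, h⟩ := exists_gauss_bound 1
  refine ⟨C / √(2 * π), by positivity, fun X Y => ?_⟩
  have := abs_sub_sub_le_of_hasDerivAt hasDerivAt_erfc
    (fun y => ((hasDerivAt_gauss y).div_const (√(2 * π))).neg)
    (C := C / √(2 * π)) (fun y => by
      rw [abs_neg, abs_div, abs_of_pos hpos]
      have := h y
      gcongr
      simpa using this) X Y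
  rwa [neg_mul, sub_neg_eq_add] at this

/-! ### Calculus of errors in powers of `log n` and `n^(-1/2)` -/

/-- The filter `n → ∞` on pairs `(n, t)` with `|t| ≤ log n`. -/
noncomputable def edgeFilter : Filter (ℕ × ℝ) :=
  comap Prod.fst atTop ⊓ 𝓟 {p | |p.2| ≤ Real.log p.1}

/-- `f = O(log^i n / n^(j/2))` along `edgeFilter`. -/
def EdgeO (i j : ℕ) (f : ℕ × ℝ → ℝ) : Prop :=
  f =O[edgeFilter] fun p => Real.log p.1 ^ i * (√(p.1 : ℝ))⁻¹ ^ j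

lemma eventually_edgeFilter_of_atTop {P : ℕ → Prop} (h : ∀ᶠ n in atTop, P n) :
    ∀ᶠ p in edgeFilter, P p.1 :=
  Filter.Eventually.filter_mono inf_le_left (tendsto_comap.eventually h)

lemma eventually_edgeFilter_abs_le : ∀ᶠ p in edgeFilter, |p.2| ≤ Real.log p.1 :=
  Filter.Eventually.filter_mono inf_le_right (mem_principal_self _)

lemma eventually_edgeFilter_iff {P : ℕ × ℝ → Prop} : (∀ᶠ p in edgeFilter, P p) ↔
    ∃ n₀ : ℕ, ∀ n ≥ n₀, ∀ t : ℝ, |t| ≤ Real.log n → P (n, t) := by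
  rw [edgeFilter, eventually_inf_principal, eventually_comap, eventually_atTop]
  constructor
  · rintro ⟨n₀, h⟩
    exact ⟨n₀, fun n hn t ht => h n hn (n, t) rfl ht⟩
  · rintro ⟨n₀, h⟩
    exact ⟨n₀, fun n hn p hp hpt => by subst hp; exact h p.1 hn p.2 hpt⟩

lemma eventually_edgeFilter_large :
    ∀ᶠ p in edgeFilter, 0 < (p.1 : ℝ) ∧ 1 ≤ Real.log p.1 ∧ (√(p.1 : ℝ))⁻¹ ≤ 1 := by
  refine eventually_edgeFilter_of_atTop (P := fun n =>
    0 < (n : ℝ) ∧ 1 ≤ Real.log n ∧ (√(n : ℝ))⁻¹ ≤ 1) ?_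
  filter_upwards [eventually_ge_atTop 3] with n hn
  have h3 : (3 : ℝ) ≤ n := by exact_mod_cast hn
  refine ⟨by linarith, ?_, inv_le_one_of_one_le₀ (Real.one_le_sqrt.2 (by linarith))⟩
  rw [Real.le_log_iff_exp_le (by linarith)]
  linarith [Real.exp_one_lt_d9]

namespace EdgeO

variable {i j i' j' : ℕ} {f g : ℕ × ℝ → ℝ}

lemma mono (h : EdgeO i j f) (hi : i ≤ i') (hj : j' ≤ j) : EdgeO i' j' f := by
  refine Asymptotics.IsBigO.trans h (Asymptotics.IsBigO.of_bound 1 ?_)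
  filter_upwards [eventually_edgeFilter_large] with p ⟨h0, h1, h2⟩
  have h3 : 0 < (√(p.1 : ℝ))⁻¹ := by positivity
  have h4 : 0 ≤ Real.log p.1 := by linarith
  rw [one_mul, Real.norm_of_nonneg (by positivity), Real.norm_of_nonneg (by positivity)]
  exact mul_le_mul (pow_le_pow_right₀ h1 hi) (pow_le_pow_of_le_one h3.le h2 hj) (by positivity)
    (by positivity)

lemma add (hf : EdgeO i j f) (hg : EdgeO i j g) : EdgeO i j fun p => f p + g p :=
  Asymptotics.IsBigO.add hf hg

lemma sub (hf : EdgeO i j f) (hg : EdgeO i j g) : EdgeO i j fun p => f p - g p :=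
  Asymptotics.IsBigO.sub hf hg

lemma neg (hf : EdgeO i j f) : EdgeO i j fun p => -f p :=
  Asymptotics.IsBigO.neg_left hf

lemma mul (hf : EdgeO i j f) (hg : EdgeO i' j' g) : EdgeO (i + i') (j + j') fun p => f p * g p :=
  (Asymptotics.IsBigO.mul hf hg).congr_right fun p => by ring

lemma pow (hf : EdgeO i j f) (k : ℕ) : EdgeO (i * k) (j * k) fun p => f p ^ k :=
  (Asymptotics.IsBigO.pow hf k).congr_right fun p => by rw [mul_pow, pow_mul, pow_mul]

lemma of_bounded {C : ℝ} (h : ∀ᶠ p in edgeFilter, |f p| ≤ C) : EdgeO 0 0 f :=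
  Asymptotics.IsBigO.of_bound C (by simpa using h)

lemma const (c : ℝ) : EdgeO 0 0 fun _ => c :=
  of_bounded (C := |c|) (Eventually.of_forall fun _ => le_rfl)

lemma const_mul (hf : EdgeO i j f) (c : ℝ) : EdgeO i j fun p => c * f p :=
  Asymptotics.IsBigO.const_mul_left hf c

lemma congr (hf : EdgeO i j f) (h : f =ᶠ[edgeFilter] g) : EdgeO i j g :=
  Asymptotics.IsBigO.congr' hf h EventuallyEq.rfl

lemma trans_le (hg : EdgeO i j g) {C : ℝ} (h : ∀ᶠ p in edgeFilter, |f p| ≤ C * |g p|) :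
    EdgeO i j f :=
  (Asymptotics.IsBigO.of_bound C h).trans hg

lemma snd : EdgeO 1 0 fun p => p.2 := by
  refine Asymptotics.IsBigO.of_bound 1 ?_
  filter_upwards [eventually_edgeFilter_abs_le] with p hp
  have h0 := (abs_nonneg _).trans hp
  simpa [abs_of_nonneg h0] using hp

lemma inv_sqrt : EdgeO 0 1 fun p => (√(p.1 : ℝ))⁻¹ :=
  (Asymptotics.isBigO_refl _ _).congr_right fun p => by simp

lemma sqrt_mul (hf : EdgeO i (j + 1) f) : EdgeO i j fun p => √(p.1 : ℝ) * f p := by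
  have h := (Asymptotics.isBigO_refl (fun p : ℕ × ℝ => √(p.1 : ℝ)) edgeFilter).mul hf
  refine Asymptotics.IsBigO.congr' h EventuallyEq.rfl ?_
  filter_upwards [eventually_edgeFilter_large] with p ⟨h0, _⟩
  have : √(p.1 : ℝ) ≠ 0 := by positivity
  linear_combination (Real.log p.1 ^ i * (√(p.1 : ℝ))⁻¹ ^ j) * mul_inv_cancel₀ this

lemma natCast_mul (hf : EdgeO i (j + 2) f) : EdgeO i j fun p => (p.1 : ℝ) * f p := by
  refine hf.sqrt_mul.sqrt_mul.congr (Eventually.of_forall fun p => ?_)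
  simp only
  rw [← mul_assoc, Real.mul_self_sqrt (by positivity)]

lemma tendsto_zero (hf : EdgeO 1 1 f) : Tendsto f edgeFilter (𝓝 0) := by
  refine Asymptotics.IsBigO.trans_tendsto hf ?_
  have h1 : Tendsto (fun n : ℝ => Real.log n ^ 1 * (√n)⁻¹ ^ 1) atTop (𝓝 0) := by
    have h := isLittleO_log_rpow_atTop (r := 1 / 2) (by norm_num)
    have := h.tendsto_div_nhds_zero
    refine this.congr fun n => ?_
    rw [pow_one, pow_one, Real.sqrt_eq_rpow, div_eq_mul_inv]
  have h2 : Tendsto (fun n : ℕ => Real.log n ^ 1 * (√(n : ℝ))⁻¹ ^ 1) atTop (𝓝 0) :=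
    h1.comp tendsto_natCast_atTop_atTop
  exact h2.comp (tendsto_comap.mono_left inf_le_left)

lemma taylor_two {F : ℝ → ℝ} {a F' : ℝ} (hF : ContDiffAt ℝ 2 F a) (hF' : HasDerivAt F F' a)
    (hf : EdgeO 1 1 fun p => f p - a) : EdgeO 2 2 fun p => F (f p) - F a - F' * (f p - a) := by
  have ht : Tendsto f edgeFilter (𝓝 a) := tendsto_sub_nhds_zero_iff.1 hf.tendsto_zero
  exact ((hF.isBigO_taylor_two hF').comp_tendsto ht).trans (hf.pow 2)

end EdgeO

namespace EdgeO

variable {i j : ℕ} {f : ℕ × ℝ → ℝ}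

/-- Since `log n / √n` is bounded, one logarithm may be dropped together with one factor `n^(-1/2)`.
-/
lemma trade (hf : EdgeO (i + 1) (j + 1) f) : EdgeO i j f := by
  have h1 : EdgeO 1 1 fun p => Real.log p.1 * (√(p.1 : ℝ))⁻¹ :=
    (Asymptotics.isBigO_refl _ _).congr_right fun p => by simp
  have h2 : (fun p : ℕ × ℝ => Real.log p.1 * (√(p.1 : ℝ))⁻¹) =O[edgeFilter] fun _ => (1 : ℝ) :=
    h1.tendsto_zero.isBigO_one ℝ
  have h3 := (Asymptotics.isBigO_refl
    (fun p : ℕ × ℝ => Real.log p.1 ^ i * (√(p.1 : ℝ))⁻¹ ^ j) edgeFilter).mul h2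
  refine Asymptotics.IsBigO.trans hf ?_
  refine h3.congr (fun p => ?_) (fun p => ?_) <;> ring

end EdgeO

/-! ### Expansion of the main term at the edge -/

/-- The displacement `u` with `|z| = r₂ (1 + u)`. -/
noncomputable def edgeShift (κ : ℝ) (p : ℕ × ℝ) : ℝ := √2 * p.2 / √(p.1 * κ)

section EdgeExpansion

lemma edgeShift_eq (κ : ℝ) (p : ℕ × ℝ) :
    edgeShift κ p = √2 / √κ * (p.2 * (√(p.1 : ℝ))⁻¹) := by
  rw [edgeShift, Real.sqrt_mul (Nat.cast_nonneg _), div_eq_mul_inv, mul_inv, div_eq_mul_inv]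
  ring

lemma edgeShift_edgeO (κ : ℝ) : EdgeO 1 1 (edgeShift κ) :=
  ((EdgeO.snd.mul EdgeO.inv_sqrt).const_mul (√2 / √κ)).congr
    (Eventually.of_forall fun p => (edgeShift_eq _ p).symm)

lemma log_one_add_edgeO {u : ℕ × ℝ → ℝ} (hu : EdgeO 1 1 u) :
    EdgeO 3 3 fun p => Real.log (1 + u p) - (u p - u p ^ 2 / 2) := by
  refine (hu.pow 3).trans_le (C := 2) ?_
  have h0 : ∀ᶠ p in edgeFilter, |u p| < 1 / 2 := by
    have := hu.tendsto_zero.abs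
    rw [abs_zero] at this
    exact this.eventually_lt_const (by norm_num)
  filter_upwards [h0] with p hp
  have h := Real.abs_log_sub_add_sum_range_le (x := -u p) (by rw [abs_neg]; linarith) 2
  simp only [Finset.sum_range_succ, Finset.sum_range_zero, abs_neg] at h
  have e : Real.log (1 + u p) - (u p - u p ^ 2 / 2) =
      0 + (-u p) ^ (0 + 1) / ((0 : ℕ) + 1) + (-u p) ^ (1 + 1) / ((1 : ℕ) + 1) +
        Real.log (1 - -u p) := by
    rw [sub_neg_eq_add]; push_cast; ring
  rw [e]
  refine h.trans ?_
  rw [abs_pow, div_le_iff₀ (by linarith)]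
  have : 0 ≤ |u p| ^ 3 * (1 - 2 * |u p|) := mul_nonneg (by positivity) (by linarith)
  rw [show 2 + 1 = 3 from rfl]
  linarith

lemma log_one_add_edgeO_one {u : ℕ × ℝ → ℝ} (hu : EdgeO 1 1 u) :
    EdgeO 1 1 fun p => Real.log (1 + u p) := by
  have h := ((log_one_add_edgeO hu).trade.trade.add hu).sub ((hu.pow 2).trade.const_mul (1 / 2))
  exact h.congr (Eventually.of_forall fun p => by simp only; ring)

variable {f f₁ f₂ f₃ f₄ : ℝ → ℝ} {c ρ M : ℝ} (h : SmoothNear f f₁ f₂ f₃ f₄ c ρ M) (hρ : 0 < ρ)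
  {δ : ℕ × ℝ → ℝ} (hδ : EdgeO 1 1 δ)
include h hρ hδ

omit h in
lemma eventually_abs_le_edge : ∀ᶠ p in edgeFilter, |δ p| ≤ ρ := by
  have := hδ.tendsto_zero.abs
  rw [abs_zero] at this
  exact this.eventually_le_const hρ

lemma SmoothNear.edgeO_f₁ :
    EdgeO 3 3 fun p => f₁ (c + δ p) - f₁ c - f₂ c * δ p - f₃ c * δ p ^ 2 / 2 := by
  refine (hδ.pow 3).trans_le (C := M) ?_
  filter_upwards [eventually_abs_le_edge hρ hδ] with p hp
  rw [abs_pow]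
  exact h.taylor_f₁ (η := ρ) (by simp) hp

lemma SmoothNear.edgeO_f₂ : EdgeO 2 2 fun p => f₂ (c + δ p) - f₂ c - f₃ c * δ p := by
  refine (hδ.pow 2).trans_le (C := M) ?_
  filter_upwards [eventually_abs_le_edge hρ hδ] with p hp
  rw [abs_pow]
  exact h.taylor_f₂ (η := ρ) (by simp) hp

lemma SmoothNear.edgeO_f₃ : EdgeO 1 1 fun p => f₃ (c + δ p) - f₃ c := by
  refine (hδ.pow 1).trans_le (C := M) ?_
  filter_upwards [eventually_abs_le_edge hρ hδ] with p hp
  rw [abs_pow]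
  exact h.taylor_f₃ (η := ρ) (by simp) hp

lemma SmoothNear.edgeO_f₁_one : EdgeO 1 1 fun p => f₁ (c + δ p) - f₁ c := by
  have h1 := ((h.edgeO_f₁ hρ hδ).trade.trade.add (hδ.const_mul (f₂ c))).add
    ((hδ.pow 2).trade.const_mul (f₃ c / 2))
  exact h1.congr (Eventually.of_forall fun p => by simp only; ring)

end EdgeExpansion

section SaddleExpansion

variable {E E₁ E₂ E₃ E₄ μ μ₁ μ₂ μ₃ μ₄ : ℝ → ℝ} {c ρ M : ℝ}
  (hE : SmoothNear E E₁ E₂ E₃ E₄ c ρ M) (hμ : SmoothNear μ μ₁ μ₂ μ₃ μ₄ c ρ M)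
  (hρ : 0 < ρ) (h0 : E₁ c = 0) (hκ : 0 < E₂ c)

/-- The logarithm of the modulus of the evaluation point. -/
noncomputable def edgePoint (E₂ : ℝ → ℝ) (c : ℝ) (p : ℕ × ℝ) : ℝ :=
  c + Real.log (1 + edgeShift (E₂ c) p)

include hE hρ hκ

omit hκ in
-- The distance to the well is `log (1 + u) = u - u²/2 + O(u³)`; its quadratic part turns the Taylor
-- coefficient `E₃` into `E₃ - E₂`.
lemma edgeO_deriv_one (h0 : E₁ c = 0) : EdgeO 3 3 fun p => E₁ (edgePoint E₂ c p) -
    (E₂ c * edgeShift (E₂ c) p + (E₃ c - E₂ c) * edgeShift (E₂ c) p ^ 2 / 2) := by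
  have hu := edgeShift_edgeO (E₂ c)
  have hδ := log_one_add_edgeO_one hu
  have h1 := hE.edgeO_f₁ hρ hδ
  have h2 := log_one_add_edgeO hu
  have h3 : EdgeO 2 2 fun p => Real.log (1 + edgeShift (E₂ c) p) - edgeShift (E₂ c) p :=
    (h2.trade.sub ((hu.pow 2).const_mul (1 / 2))).congr
      (Eventually.of_forall fun p => by simp only; ring)
  have h4 := (h1.add (h2.const_mul (E₂ c))).add ((h3.mul (hδ.add hu)).const_mul (E₃ c / 2))
  refine h4.congr (Eventually.of_forall fun p => ?_)
  simp only [edgePoint]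
  rw [h0]; ring

omit hκ in
lemma edgeO_deriv_two : EdgeO 2 2 fun p => E₂ (edgePoint E₂ c p) -
    (E₂ c + E₃ c * edgeShift (E₂ c) p) := by
  have hu := edgeShift_edgeO (E₂ c)
  have hδ := log_one_add_edgeO_one hu
  have h1 := hE.edgeO_f₂ hρ hδ
  have h2 := log_one_add_edgeO hu
  have h3 := (h1.add (h2.trade.const_mul (E₃ c))).sub ((hu.pow 2).const_mul (E₃ c / 2))
  refine h3.congr (Eventually.of_forall fun p => ?_)
  simp only [edgePoint]
  ring

omit hκ in
lemma edgeO_deriv_two_one : EdgeO 1 1 fun p => E₂ (edgePoint E₂ c p) - E₂ c := by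
  have hu := edgeShift_edgeO (E₂ c)
  refine ((edgeO_deriv_two hE hρ).trade.add (hu.const_mul (E₃ c))).congr
    (Eventually.of_forall fun p => by simp only; ring)

lemma eventually_edge_deriv_two_pos : ∀ᶠ p in edgeFilter, 0 < E₂ (edgePoint E₂ c p) :=
  (tendsto_sub_nhds_zero_iff.1 (edgeO_deriv_two_one hE hρ).tendsto_zero).eventually_const_lt hκ

lemma edgeO_inv_sqrt : EdgeO 2 2 fun p => (√(E₂ (edgePoint E₂ c p)))⁻¹ -
    ((√(E₂ c))⁻¹ - E₃ c / (2 * √(E₂ c) ^ 3) * edgeShift (E₂ c) p) := by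
  have hK : √(E₂ c) ≠ 0 := (Real.sqrt_pos.2 hκ).ne'
  have hF : ContDiffAt ℝ 2 (fun y => (√y)⁻¹) (E₂ c) := (Real.contDiffAt_sqrt hκ.ne').inv hK
  have hF' := (Real.hasDerivAt_sqrt hκ.ne').fun_inv hK
  have h1 := EdgeO.taylor_two hF hF' (edgeO_deriv_two_one hE hρ)
  have h2 := (edgeO_deriv_two hE hρ).const_mul (-(1 / (2 * √(E₂ c))) / √(E₂ c) ^ 2)
  refine (h1.add h2).congr (Eventually.of_forall fun p => ?_)
  simp only
  field_simp
  ring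

lemma edgeO_inv_sqrt_one : EdgeO 1 1 fun p => (√(E₂ (edgePoint E₂ c p)))⁻¹ - (√(E₂ c))⁻¹ := by
  have hu := edgeShift_edgeO (E₂ c)
  refine ((edgeO_inv_sqrt hE hρ hκ).trade.sub
    (hu.const_mul (E₃ c / (2 * √(E₂ c) ^ 3)))).congr (Eventually.of_forall fun p => ?_)
  simp only; ring

lemma edgeO_inv_sqrt_zero : EdgeO 0 0 fun p => (√(E₂ (edgePoint E₂ c p)))⁻¹ :=
  ((edgeO_inv_sqrt_one hE hρ hκ).trade.add (EdgeO.const (√(E₂ c))⁻¹)).congr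
    (Eventually.of_forall fun p => by simp only; ring)

include hμ in
/-- The saddle to first order. -/
lemma edgeO_saddleX (h0 : E₁ c = 0) : EdgeO 3 2 fun p => saddleX E₁ E₂ μ₁ p.1 (edgePoint E₂ c p) 0 -
    (-√2 * p.2 + (p.2 ^ 2 + μ₁ c) / √(E₂ c) * (√(p.1 : ℝ))⁻¹) := by
  have hu := edgeShift_edgeO (E₂ c)
  have hδ := log_one_add_edgeO_one hu
  set K := √(E₂ c) with hKdef
  have hK : K ≠ 0 := (Real.sqrt_pos.2 hκ).ne'
  have hKK : E₂ c = K ^ 2 := (Real.sq_sqrt hκ.le).symm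
  have ha := edgeO_inv_sqrt hE hρ hκ
  have ha1 := edgeO_inv_sqrt_one hE hρ hκ
  have ha0 := edgeO_inv_sqrt_zero hE hρ hκ
  have h1 := edgeO_deriv_one hE hρ h0
  have hμ1 := hμ.edgeO_f₁_one hρ hδ
  rw [← hKdef] at ha ha1
  have hm1 : EdgeO 1 1 fun p => E₂ c * edgeShift (E₂ c) p +
      (E₃ c - E₂ c) * edgeShift (E₂ c) p ^ 2 / 2 :=
    ((hu.const_mul (E₂ c)).add ((hu.pow 2).trade.const_mul ((E₃ c - E₂ c) / 2))).congr
      (Eventually.of_forall fun p => by simp only; ring)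
  -- The third derivative cancels to this order: `E₂ u + (E₃ - E₂) u²/2` times `E₂^(-1/2) (1 - E₃ u
  -- / (2 E₂))` is `√E₂ (u - u²/2)`.
  have hR1 : EdgeO 3 3 fun p => E₁ (edgePoint E₂ c p) * (√(E₂ (edgePoint E₂ c p)))⁻¹ -
      K * (edgeShift (E₂ c) p - edgeShift (E₂ c) p ^ 2 / 2) := by
    refine (((h1.mul ha0).add (hm1.mul ha)).sub ((hu.pow 3).const_mul
      ((E₃ c - K ^ 2) * E₃ c / (4 * K ^ 3)))).congr (Eventually.of_forall fun p => ?_)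
    simp only
    rw [hKK]
    field_simp
    ring
  have hR2 : EdgeO 1 1 fun p => μ₁ (edgePoint E₂ c p) * (√(E₂ (edgePoint E₂ c p)))⁻¹ - μ₁ c * K⁻¹ :=
    ((hμ1.mul ha0).add (ha1.const_mul (μ₁ c))).congr
      (Eventually.of_forall fun p => by simp only [edgePoint]; ring)
  have hR := (hR1.sqrt_mul.neg).add ((EdgeO.inv_sqrt.mul hR2).mono (i' := 3) (j' := 2)
    (by norm_num) (by norm_num))
  refine hR.congr ?_
  filter_upwards [eventually_edgeFilter_large] with p ⟨hp, _⟩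
  have hs : √(p.1 : ℝ) ≠ 0 := by positivity
  have hss : (p.1 : ℝ) = √(p.1 : ℝ) ^ 2 := (Real.sq_sqrt hp.le).symm
  have h22 : √2 ^ 2 = (2 : ℝ) := Real.sq_sqrt (by norm_num)
  have e1 : √(p.1 : ℝ) * (K * (edgeShift (E₂ c) p - edgeShift (E₂ c) p ^ 2 / 2)) =
      √2 * p.2 - p.2 ^ 2 / K * (√(p.1 : ℝ))⁻¹ := by
    rw [edgeShift_eq _, ← hKdef]
    field_simp
    linear_combination (-p.2 ^ 2) * h22
  have e2 : saddleX E₁ E₂ μ₁ p.1 (edgePoint E₂ c p) 0 =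
      -(√(p.1 : ℝ) * (E₁ (edgePoint E₂ c p) * (√(E₂ (edgePoint E₂ c p)))⁻¹)) +
      (√(p.1 : ℝ))⁻¹ * (μ₁ (edgePoint E₂ c p) * (√(E₂ (edgePoint E₂ c p)))⁻¹) := by
    rw [saddleX, Real.sqrt_mul hp.le, div_eq_mul_inv, mul_inv]
    have e3 : (p.1 : ℝ) * (√(p.1 : ℝ))⁻¹ = √(p.1 : ℝ) := by
      nth_rewrite 1 [hss]; field_simp
    linear_combination (-(E₁ (edgePoint E₂ c p) * (√(E₂ (edgePoint E₂ c p)))⁻¹)) * e3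
  rw [e2]
  linear_combination e1

include hμ in
lemma edgeO_saddleX_sub (h0 : E₁ c = 0) : EdgeO 2 1 fun p =>
    saddleX E₁ E₂ μ₁ p.1 (edgePoint E₂ c p) 0 - -√2 * p.2 := by
  have h1 := (edgeO_saddleX hE hμ hρ hκ h0).trade
  have h2 : EdgeO 2 1 fun p => (p.2 ^ 2 + μ₁ c) * (√(p.1 : ℝ))⁻¹ :=
    ((EdgeO.snd.pow 2).add ((EdgeO.const (μ₁ c)).mono (by norm_num) le_rfl)).mul EdgeO.inv_sqrt
  refine (h1.add (h2.const_mul (√(E₂ c))⁻¹)).congr (Eventually.of_forall fun p => ?_)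
  simp only; ring

lemma edgeO_phaseSkew : EdgeO 1 2 fun p => phaseSkew E₂ E₃ p.1 (edgePoint E₂ c p) -
    E₃ c / (6 * √(E₂ c) ^ 3) * (√(p.1 : ℝ))⁻¹ := by
  have hu := edgeShift_edgeO (E₂ c)
  have hδ := log_one_add_edgeO_one hu
  have hK : √(E₂ c) ≠ 0 := (Real.sqrt_pos.2 hκ).ne'
  have ha1 := edgeO_inv_sqrt_one hE hρ hκ
  have ha0 := edgeO_inv_sqrt_zero hE hρ hκ
  have h3 := hE.edgeO_f₃ hρ hδ
  have h4 : EdgeO 1 1 fun p => (√(E₂ (edgePoint E₂ c p)))⁻¹ ^ 3 - (√(E₂ c))⁻¹ ^ 3 :=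
    (ha1.mul (((ha0.pow 2).add (ha0.const_mul (√(E₂ c))⁻¹)).add
      (EdgeO.const ((√(E₂ c))⁻¹ ^ 2)))).congr
      (Eventually.of_forall fun p => by simp only; ring)
  have h5 : EdgeO 1 1 fun p => E₃ (edgePoint E₂ c p) * (√(E₂ (edgePoint E₂ c p)))⁻¹ ^ 3 -
      E₃ c * (√(E₂ c))⁻¹ ^ 3 :=
    ((h3.mul (ha0.pow 3)).add (h4.const_mul (E₃ c))).congr
      (Eventually.of_forall fun p => by simp only [edgePoint]; ring)
  refine ((h5.mul EdgeO.inv_sqrt).const_mul (1 / 6)).congr ?_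
  filter_upwards [eventually_edgeFilter_large, eventually_edge_deriv_two_pos hE hρ hκ] with
    p ⟨hp, _⟩ hp2
  have hs : √(p.1 : ℝ) ≠ 0 := by positivity
  have hs2 : √(E₂ (edgePoint E₂ c p)) ≠ 0 := (Real.sqrt_pos.2 hp2).ne'
  have hss : E₂ (edgePoint E₂ c p) = √(E₂ (edgePoint E₂ c p)) ^ 2 := (Real.sq_sqrt hp2.le).symm
  rw [phaseSkew, Real.sqrt_mul hp.le]
  have e1 : 6 * E₂ (edgePoint E₂ c p) * (√(p.1 : ℝ) * √(E₂ (edgePoint E₂ c p))) =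
      6 * √(E₂ (edgePoint E₂ c p)) ^ 3 * √(p.1 : ℝ) := by
    nth_rewrite 1 [hss]; ring
  rw [e1]
  field_simp

end SaddleExpansion

section EdgeExpansion

variable {E E₁ E₂ E₃ E₄ μ μ₁ μ₂ μ₃ μ₄ : ℝ → ℝ} {c ρ M : ℝ}
  (hE : SmoothNear E E₁ E₂ E₃ E₄ c ρ M) (hμ : SmoothNear μ μ₁ μ₂ μ₃ μ₄ c ρ M)
  (hρ : 0 < ρ) (hκ : 0 < E₂ c) (h0 : E₁ c = 0)

lemma edgeO_one_add_inv_sq {u : ℕ × ℝ → ℝ} (hu : EdgeO 1 1 u) :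
    EdgeO 2 2 fun p => ((1 + u p) ^ 2)⁻¹ - (1 - 2 * u p) := by
  have hF : ContDiffAt ℝ 2 (fun y : ℝ => (y ^ 2)⁻¹) 1 :=
    (contDiffAt_id.pow 2).inv (by simp)
  have hF' := (hasDerivAt_pow 2 (1 : ℝ)).fun_inv (by simp)
  have h1 := EdgeO.taylor_two hF hF' (f := fun p => 1 + u p)
    (hu.congr (Eventually.of_forall fun p => by simp))
  refine h1.congr (Eventually.of_forall fun p => ?_)
  norm_num
  ring

lemma edgeO_one_add_inv_sq_one {u : ℕ × ℝ → ℝ} (hu : EdgeO 1 1 u) :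
    EdgeO 1 1 fun p => ((1 + u p) ^ 2)⁻¹ - 1 :=
  ((edgeO_one_add_inv_sq hu).trade.sub (hu.const_mul 2)).congr
    (Eventually.of_forall fun p => by simp only; ring)

lemma edgeO_gauss (X : ℕ × ℝ → ℝ) : EdgeO 0 0 fun p => Real.exp (-X p ^ 2 / 2) := by
  obtain ⟨C, -, hC⟩ := exists_gauss_bound 0
  exact EdgeO.of_bounded (C := C) (Eventually.of_forall fun p => by simpa using hC (X p))

lemma edgeO_skew_primitive (X : ℕ × ℝ → ℝ) :
    EdgeO 0 0 fun p => (X p ^ 2 + 5) * Real.exp (-X p ^ 2 / 2) := by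
  obtain ⟨C₀, -, h₀⟩ := exists_gauss_bound 0
  obtain ⟨C₂, -, h₂⟩ := exists_gauss_bound 2
  refine EdgeO.of_bounded (C := C₂ + 5 * C₀) (Eventually.of_forall fun p => ?_)
  have a := h₀ (X p)
  have b := h₂ (X p)
  rw [abs_of_nonneg (by positivity)] at a b ⊢
  simp only [pow_zero, one_mul] at a
  linarith

include hE hμ hρ hκ h0

/-- The bulk of the main term near the edge. -/
lemma edgeO_bracket : EdgeO 4 2 fun p =>
    CoulombGap.erfc (saddleX E₁ E₂ μ₁ p.1 (edgePoint E₂ c p) 0 / √2) / 2 +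
      phaseSkew E₂ E₃ p.1 (edgePoint E₂ c p) *
        ((saddleX E₁ E₂ μ₁ p.1 (edgePoint E₂ c p) 0 ^ 2 + 5) *
          Real.exp (-saddleX E₁ E₂ μ₁ p.1 (edgePoint E₂ c p) 0 ^ 2 / 2)) / √(2 * π) -
    (CoulombGap.erfc (-√2 * p.2 / √2) / 2 + Real.exp (-(-√2 * p.2) ^ 2 / 2) / √(2 * π) *
      (√(p.1 : ℝ))⁻¹ * (-(p.2 ^ 2 + μ₁ c) / √(E₂ c) +
        E₃ c / (6 * √(E₂ c) ^ 3) * ((-√2 * p.2) ^ 2 + 5))) := by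
  have hD := edgeO_saddleX hE hμ hρ hκ h0
  have hD1 := edgeO_saddleX_sub hE hμ hρ hκ h0
  have hps := edgeO_phaseSkew hE hρ hκ
  set Y : ℕ × ℝ → ℝ := fun p => saddleX E₁ E₂ μ₁ p.1 (edgePoint E₂ c p) 0 with hY
  set w : ℕ × ℝ → ℝ := fun p => -√2 * p.2 with hw
  obtain ⟨C, -, hC⟩ := erfc_taylor
  obtain ⟨C', -, hC'⟩ := skew_primitive_lipschitz
  -- The square of the displacement error `log² n / √n`; after multiplication by `n` this is one of
  -- the terms responsible for `log⁴ n`.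
  have h1 : EdgeO 4 2 fun p => CoulombGap.erfc (Y p / √2) / 2 - CoulombGap.erfc (w p / √2) / 2 +
      Real.exp (-w p ^ 2 / 2) / √(2 * π) * (Y p - w p) :=
    (hD1.pow 2).trans_le (C := C) (Eventually.of_forall fun p => by
      rw [abs_pow]; exact hC (w p) (Y p))
  have h2 : EdgeO 2 1 fun p => (Y p ^ 2 + 5) * Real.exp (-Y p ^ 2 / 2) -
      (w p ^ 2 + 5) * Real.exp (-w p ^ 2 / 2) :=
    hD1.trans_le (C := C') (Eventually.of_forall fun p => hC' (w p) (Y p))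
  have h3 := ((hD.mul (edgeO_gauss w)).const_mul (-(1 / √(2 * π)))).mono (i' := 4) (by norm_num) le_rfl
  have h4 := ((hps.mul (edgeO_skew_primitive Y)).const_mul (1 / √(2 * π))).mono (i' := 4)
    (j' := 2) (by norm_num) (by norm_num)
  have h5 := ((EdgeO.inv_sqrt.mul h2).const_mul (E₃ c / (6 * √(E₂ c) ^ 3) * (1 / √(2 * π)))).mono
    (i' := 4) (j' := 2) (by norm_num) (by norm_num)
  refine (((h1.add h3).add h4).add h5).congr (Eventually.of_forall fun p => ?_)
  simp only [hY, hw]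
  ring

/-- Expansion of the main term at the outer edge of the gap. -/
theorem edgeO_main {T : ℕ → ℝ} {C : ℝ} (hT : ∀ n, |T n| ≤ C) : EdgeO 4 0 fun p =>
    (p.1 * E₂ (edgePoint E₂ c p) / 2 *
      (CoulombGap.erfc (saddleX E₁ E₂ μ₁ p.1 (edgePoint E₂ c p) 0 / √2) / 2 +
        phaseSkew E₂ E₃ p.1 (edgePoint E₂ c p) *
          ((saddleX E₁ E₂ μ₁ p.1 (edgePoint E₂ c p) 0 ^ 2 + 5) *
            Real.exp (-saddleX E₁ E₂ μ₁ p.1 (edgePoint E₂ c p) 0 ^ 2 / 2)) / √(2 * π)) +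
      √(p.1 * E₂ (edgePoint E₂ c p) / (2 * π)) *
        Real.exp (-saddleX E₁ E₂ μ₁ p.1 (edgePoint E₂ c p) 0 ^ 2 / 2) * T p.1) *
      ((1 + edgeShift (E₂ c) p) ^ 2)⁻¹ -
    (p.1 * (E₂ c / 2 * (CoulombGap.erfc (-√2 * p.2 / √2) / 2 *
        (1 + (E₃ c / E₂ c - 2) * edgeShift (E₂ c) p) +
        Real.exp (-(-√2 * p.2) ^ 2 / 2) / √(2 * π) *
        (√(p.1 : ℝ))⁻¹ * (-(p.2 ^ 2 + μ₁ c) / √(E₂ c) +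
        E₃ c / (6 * √(E₂ c) ^ 3) * ((-√2 * p.2) ^ 2 + 5)))) +
      √(p.1 : ℝ) * (√(E₂ c) / √(2 * π) * (Real.exp (-(-√2 * p.2) ^ 2 / 2) * T p.1))) := by
  have hB := edgeO_bracket hE hμ hρ hκ h0
  have hu := edgeShift_edgeO (E₂ c)
  have hv := edgeO_one_add_inv_sq hu
  have hv1 := edgeO_one_add_inv_sq_one hu
  have hE2 := edgeO_deriv_two hE hρ
  have hE21 := edgeO_deriv_two_one hE hρ
  have ha1 := edgeO_inv_sqrt_one hE hρ hκ
  have ha0 := edgeO_inv_sqrt_zero hE hρ hκ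
  have hD1 := edgeO_saddleX_sub hE hμ hρ hκ h0
  have hK : √(E₂ c) ≠ 0 := (Real.sqrt_pos.2 hκ).ne'
  have hKK : E₂ c = √(E₂ c) ^ 2 := (Real.sq_sqrt hκ.le).symm
  have hTo : EdgeO 0 0 fun p => T p.1 := EdgeO.of_bounded (Eventually.of_forall fun p => hT p.1)
  have hΦ : EdgeO 0 0 fun p : ℕ × ℝ => CoulombGap.erfc (-√2 * p.2 / √2) / 2 :=
    EdgeO.of_bounded (Eventually.of_forall fun p => abs_erfc_le _)
  set B₁ : ℕ × ℝ → ℝ := fun p => Real.exp (-(-√2 * p.2) ^ 2 / 2) / √(2 * π) *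
      (√(p.1 : ℝ))⁻¹ * (-(p.2 ^ 2 + μ₁ c) / √(E₂ c) +
        E₃ c / (6 * √(E₂ c) ^ 3) * ((-√2 * p.2) ^ 2 + 5)) with hB₁
  set Bk : ℕ × ℝ → ℝ := fun p =>
    CoulombGap.erfc (saddleX E₁ E₂ μ₁ p.1 (edgePoint E₂ c p) 0 / √2) / 2 +
      phaseSkew E₂ E₃ p.1 (edgePoint E₂ c p) *
        ((saddleX E₁ E₂ μ₁ p.1 (edgePoint E₂ c p) 0 ^ 2 + 5) *
          Real.exp (-saddleX E₁ E₂ μ₁ p.1 (edgePoint E₂ c p) 0 ^ 2 / 2)) / √(2 * π) with hBk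
  have hB₁o : EdgeO 2 1 B₁ := by
    have e1 : EdgeO 2 0 fun p : ℕ × ℝ => -(p.2 ^ 2 + μ₁ c) / √(E₂ c) +
        E₃ c / (6 * √(E₂ c) ^ 3) * ((-√2 * p.2) ^ 2 + 5) :=
      (((EdgeO.snd.pow 2).const_mul
        (-1 / √(E₂ c) + E₃ c / (6 * √(E₂ c) ^ 3) * √2 ^ 2)).add
        ((EdgeO.const (-μ₁ c / √(E₂ c) + E₃ c / (6 * √(E₂ c) ^ 3) * 5)).mono
          (by norm_num) le_rfl)).congr (Eventually.of_forall fun p => by simp only; ring)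
    refine ((((edgeO_gauss fun p => -√2 * p.2).mul EdgeO.inv_sqrt).mul e1).const_mul
      (1 / √(2 * π))).congr (Eventually.of_forall fun p => ?_)
    simp only [hB₁]; ring
  have hBo : EdgeO 4 2 fun p => Bk p - (CoulombGap.erfc (-√2 * p.2 / √2) / 2 + B₁ p) := hB
  have hBk0 : EdgeO 2 0 Bk := by
    refine (((hBo.trade.trade.mono le_rfl (by norm_num)).add (hB₁o.mono le_rfl (by norm_num))).add
      (hΦ.mono (i' := 2) (by norm_num) le_rfl)).congr (Eventually.of_forall fun p => ?_)
    simp only; ring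
  -- The product is proportional to `ΔQ` at `|z|`: the quotient `E₃ / E₂` comes from moving along
  -- `E''` and the `-2` from the factor `|z|⁻²`.
  have hP : EdgeO 2 2 fun p => E₂ (edgePoint E₂ c p) * ((1 + edgeShift (E₂ c) p) ^ 2)⁻¹ -
      E₂ c * (1 + (E₃ c / E₂ c - 2) * edgeShift (E₂ c) p) := by
    have e1 : EdgeO 1 1 fun p => E₂ (edgePoint E₂ c p) - E₂ c := hE21
    refine (((hE2.add (hv.const_mul (E₂ c))).add (e1.mul hv1))).congr
      (Eventually.of_forall fun p => ?_)
    simp only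
    field_simp
    ring
  -- This part is multiplied by `n` and therefore needs precision `log⁴ n / n`. The theta part below
  -- carries only `√n`, so leading order is enough for it.
  have hfirst := (((hP.mul hBk0).mono (i' := 4) (j' := 2) (by norm_num) (by norm_num)).add
    (((hBo.add (EdgeO.trade (i := 4) (j := 2) ((hu.mul hBo).const_mul (E₃ c / E₂ c - 2)))).add
      (((hu.mul hB₁o).const_mul (E₃ c / E₂ c - 2)).mono (i' := 4) (j' := 2) (by norm_num)
        (by norm_num))).const_mul (E₂ c))).const_mul (1 / 2)
  have hg1 : EdgeO 2 1 fun p => Real.exp (-saddleX E₁ E₂ μ₁ p.1 (edgePoint E₂ c p) 0 ^ 2 / 2) -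
      Real.exp (-(-√2 * p.2) ^ 2 / 2) := by
    obtain ⟨C', -, hC'⟩ := gauss_lipschitz
    exact hD1.trans_le (C := C') (Eventually.of_forall fun p => hC' _ _)
  have hA1 : EdgeO 1 1 fun p => E₂ (edgePoint E₂ c p) * (√(E₂ (edgePoint E₂ c p)))⁻¹ *
      ((1 + edgeShift (E₂ c) p) ^ 2)⁻¹ - √(E₂ c) := by
    have hv0 : EdgeO 0 0 fun p => ((1 + edgeShift (E₂ c) p) ^ 2)⁻¹ :=
      (hv1.trade.add (EdgeO.const 1)).congr (Eventually.of_forall fun p => by simp only; ring)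
    refine ((((hE21.mul ha0).mul hv0).add ((ha1.const_mul (E₂ c)).mul hv0)).add
      (hv1.const_mul √(E₂ c))).congr (Eventually.of_forall fun p => ?_)
    simp only
    generalize (√(E₂ (edgePoint E₂ c p)))⁻¹ = a
    generalize ((1 + edgeShift (E₂ c) p) ^ 2)⁻¹ = v
    have : E₂ c * (√(E₂ c))⁻¹ = √(E₂ c) := by nth_rewrite 1 [hKK]; field_simp
    linear_combination (-v) * this
  have hA0 : EdgeO 0 0 fun p => E₂ (edgePoint E₂ c p) * (√(E₂ (edgePoint E₂ c p)))⁻¹ *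
      ((1 + edgeShift (E₂ c) p) ^ 2)⁻¹ :=
    (hA1.trade.add (EdgeO.const √(E₂ c))).congr (Eventually.of_forall fun p => by simp only; ring)
  have hsecond := ((((hA0.mul hg1).mono (i' := 4) (by norm_num) le_rfl).add
    ((hA1.mul (edgeO_gauss fun p => -√2 * p.2)).mono (i' := 4) (j' := 1) (by norm_num)
      le_rfl)).mul hTo).const_mul (1 / √(2 * π))
  refine (hfirst.natCast_mul.add (hsecond.sqrt_mul)).congr ?_
  filter_upwards [eventually_edgeFilter_large, eventually_edge_deriv_two_pos hE hρ hκ] with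
    p ⟨hp, _⟩ hp2
  have e1 : √(p.1 * E₂ (edgePoint E₂ c p) / (2 * π)) = √(p.1 : ℝ) *
      (E₂ (edgePoint E₂ c p) * (√(E₂ (edgePoint E₂ c p)))⁻¹) / √(2 * π) := by
    rw [Real.sqrt_div (by positivity), Real.sqrt_mul hp.le]
    congr 2
    have hs2 : √(E₂ (edgePoint E₂ c p)) ≠ 0 := (Real.sqrt_pos.2 hp2).ne'
    rw [eq_mul_inv_iff_mul_eq₀ hs2, Real.mul_self_sqrt hp2.le]
  rw [e1]
  change _ = (p.1 * E₂ (edgePoint E₂ c p) / 2 * Bk p + _) * _ - (p.1 * (E₂ c / 2 * (_ + B₁ p)) + _)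
  ring

end EdgeExpansion

/-! ### Assembly -/

/-- Rewriting the expansion in logarithmic coordinates in terms of the Laplacian. -/
lemma edge_main_identity {S K r c t e w T P q μ' s' l' dl L lg θ : ℝ} (hS : 0 < S) (hK : 0 < K)
    (hr : 0 < r) (hw : 0 < w) (hP : 0 < P) (hq : 0 < q) (hq2 : q ^ 2 = 2) (hL : 0 < L)
    (hμ : μ' = s' * r * l') (hT : T = -(1 / 2) - s' * dl / (2 * L) - lg / (4 * L) - θ / (2 * L)) :
    1 / (2 * r ^ 2) * (S ^ 2 * (K ^ 2 / 2 * (e / 2 * (1 + (c / K ^ 2 - 2) * (q / K * (t * S⁻¹))) +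
      w / (q * P) * S⁻¹ * (-(t ^ 2 + μ') / K + c / (6 * K ^ 3) * (2 * t ^ 2 + 5)))) +
      S * (K / (q * P) * (w * T))) =
    S ^ 2 * (K ^ 2 / (4 * r ^ 2)) * (e / 2) + S * K / (2 * r) / (q * P * r) * w *
      (-(s' / 2) * (r * l' + dl / L) + 1 / 6 * (2 - t ^ 2) +
        r * ((c / (4 * r ^ 3) - K ^ 2 / (2 * r ^ 3)) / (K ^ 2 / (4 * r ^ 2))) *
          (1 / 2 * P * t * e * w⁻¹ + 1 / 12 * (2 * t ^ 2 + 5)) - lg / (4 * L) -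
        1 / (2 * L) * θ) := by
  -- Here `S = √n`, `K = √κ`, `P = √π`, `q = √2`, `w = exp (-t²)`, `e = erfc (-t)` and `c` is the
  -- third derivative of `E` at the well. This line is `r ∂ᵣΔQ / ΔQ = E'''/E'' - 2`.
  have e1 : r * ((c / (4 * r ^ 3) - K ^ 2 / (2 * r ^ 3)) / (K ^ 2 / (4 * r ^ 2))) =
      c / K ^ 2 - 2 := by field_simp; ring
  have e2 : q / K = 2 / (q * K) := by field_simp; exact hq2
  rw [e1, e2, hT, hμ]
  field_simp
  ring

theorem theorem1p10
    -- the radially symmetric potential `Q(z) = q(|z|)` and its equilibrium measure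
    (q : ℝ → ℝ) (σ : Measure ℂ)
    (hlsc : LowerSemicontinuous (CoulombGap.radial q))
    (hgrowth : Tendsto (fun z : ℂ => CoulombGap.radial q z - 2 * Real.log ‖z‖)
      (cocompact ℂ) atTop)
    (hσ : CoulombGap.IsEquilibriumMeasure (CoulombGap.radial q) σ)
    (hC2 : ∀ z ∈ σ.support, ContDiffAt ℝ 2 (CoulombGap.radial q) z)
    (hpos : ∀ z ∈ frontier σ.support, 0 < CoulombGap.lap (CoulombGap.radial q) z)
    (hstrict : ∀ z ∉ σ.support,
      CoulombGap.obstacle (CoulombGap.radial q) σ z < CoulombGap.radial q z)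
    -- the droplet is a finite union of concentric annuli
    (N : ℕ) (a b : ℕ → ℝ) (ha0 : 0 ≤ a 0) (hab : ∀ j ≤ N, a j < b j)
    (hba : ∀ j < N, b j < a (j + 1))
    (hS : σ.support = ⋃ j ∈ Finset.range (N + 1), {z : ℂ | a j ≤ ‖z‖ ∧ ‖z‖ ≤ b j})
    -- the gap `r₁ < |z| < r₂`
    (k : ℕ) (hk : k < N) (r₁ r₂ : ℝ) (hr₁ : r₁ = b k) (hr₂ : r₂ = a (k + 1))
    (hC6 : ∀ z : ℂ, ‖z‖ = r₁ ∨ ‖z‖ = r₂ → ContDiffAt ℝ 6 (CoulombGap.radial q) z)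
    -- the perturbation `λ(z) = l(|z|)`, which vanishes near all other components of the complement
    (l : ℝ → ℝ) (hl : ContDiff ℝ 6 (CoulombGap.radial l))
    (hl0 : ∀ z ∈ closure (σ.supportᶜ \ {w : ℂ | r₁ < ‖w‖ ∧ ‖w‖ < r₂}),
      CoulombGap.radial l =ᶠ[𝓝 z] 0)
    (s : ℝ) :
    ∃ A B : ℝ,
      (∀ z : ℂ, r₁ ≤ ‖z‖ → ‖z‖ ≤ r₂ →
        CoulombGap.obstacle (CoulombGap.radial q) σ z = A + B * Real.log ‖z‖) ∧
      ∀ α ∈ Set.Ico 0 (2 * π), ∃ (C : ℝ) (n₀ : ℕ), ∀ n ≥ n₀, ∀ t : ℝ, |t| ≤ Real.log n →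
        |CoulombGap.onePoint
            (CoulombGap.perturbed (CoulombGap.radial q) (CoulombGap.radial l) s n) n
            (Complex.exp (α * Complex.I) *
              ((r₂ + t / √(2 * n * CoulombGap.lap (CoulombGap.radial q) r₂) : ℝ) : ℂ))
          - (n * CoulombGap.lap (CoulombGap.radial q) r₂ * (CoulombGap.erfc (-t) / 2)
            + √(n * CoulombGap.lap (CoulombGap.radial q) r₂) / (√(2 * π) * r₂)
              * Real.exp (-t ^ 2)
              * (-(s / 2) * (r₂ * deriv l r₂ + (l r₁ - l r₂) / Real.log (r₂ / r₁))
                + 1 / 6 * (2 - t ^ 2)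
                + r₂ * (deriv (fun r : ℝ => CoulombGap.lap (CoulombGap.radial q) (r : ℂ)) r₂
                      / CoulombGap.lap (CoulombGap.radial q) r₂)
                    * (1 / 2 * √π * t * CoulombGap.erfc (-t) * Real.exp (t ^ 2)
                      + 1 / 12 * (2 * t ^ 2 + 5))
                - Real.log (CoulombGap.lap (CoulombGap.radial q) r₂
                      / CoulombGap.lap (CoulombGap.radial q) r₁)
                    / (4 * Real.log (r₂ / r₁))
                - 1 / (2 * Real.log (r₂ / r₁))
                    * CoulombGap.thetaLogDeriv
                      (B / 2 * n
                        + Real.log (CoulombGap.lap (CoulombGap.radial q) r₂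
                            / CoulombGap.lap (CoulombGap.radial q) r₁)
                          / (4 * Real.log (r₂ / r₁))
                        + s * (l r₁ - l r₂) / (2 * Real.log (r₂ / r₁)))
                      (π / Real.log (r₂ / r₁))))|
          ≤ C * Real.log n ^ 4 := by
  obtain ⟨hr1, hr12, A, B, hobs, ρ, M, κ₀, W⟩ := exists_twoWell q σ hlsc hgrowth hσ hC2 hpos
    hstrict N a b ha0 hab hba hS k hk r₁ r₂ hr₁ hr₂ hC6 l hl hl0 s
  refine ⟨A, B, hobs, fun α _ => ?_⟩
  have hr2 : 0 < r₂ := hr1.trans hr12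
  set E : ℝ → ℝ := fun x => q (Real.exp x) - A - B * x with hE
  set μ : ℝ → ℝ := fun x => s * l (Real.exp x) with hμ
  have hc₁ : ContDiffAt ℝ 6 (CoulombGap.radial q) (r₁ : ℂ) :=
    hC6 _ (Or.inl (by rw [Complex.norm_real, Real.norm_of_nonneg hr1.le]))
  have hc₂ : ContDiffAt ℝ 6 (CoulombGap.radial q) (r₂ : ℂ) :=
    hC6 _ (Or.inr (by rw [Complex.norm_real, Real.norm_of_nonneg hr2.le]))
  have hL : Real.log (r₂ / r₁) = Real.log r₂ - Real.log r₁ := Real.log_div hr2.ne' hr1.ne'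
  have hL0 : 0 < Real.log (r₂ / r₁) := by rw [hL]; exact sub_pos.2 W.lt
  have hκ₁ := W.deriv2_pos₁
  have hκ₂ := W.deriv2_pos₂
  have hlap₁ := lap_radial_eq_log_coord A B hr1 (hc₁.of_le (by norm_num))
  have hlap₂ := lap_radial_eq_log_coord A B hr2 (hc₂.of_le (by norm_num))
  have hlap₃ := deriv_lap_radial A B hr2 hc₂
  rw [← hE] at hlap₁ hlap₂ hlap₃
  have hμ₂ : deriv μ (Real.log r₂) = s * r₂ * deriv l r₂ := by
    have h1 : HasDerivAt l (deriv l r₂) (Real.exp (Real.log r₂)) := by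
      rw [Real.exp_log hr2]
      exact ((contDiffAt_profile hr2 hl.contDiffAt).differentiableAt (by norm_num)).hasDerivAt
    have h2 := ((h1.comp _ (Real.hasDerivAt_exp (Real.log r₂))).const_mul s).deriv
    rw [Real.exp_log hr2] at h2
    exact h2.trans (by ring)
  -- The second derivatives are `4 r² ΔQ`, so their logarithmic ratio contains an extra `2 log (r₂ /
  -- r₁)`. Divided by `4 log (r₂ / r₁)` this is `1 / 2`, which cancels the `-1 / 2` in `wellShift`.
  have hshift : wellShift E μ (Real.log r₁) (Real.log r₂) =
      Real.log (CoulombGap.lap (CoulombGap.radial q) r₂ / CoulombGap.lap (CoulombGap.radial q) r₁) /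
        (4 * Real.log (r₂ / r₁)) + s * (l r₁ - l r₂) / (2 * Real.log (r₂ / r₁)) := by
    have h1 : deriv (deriv E) (Real.log r₂) / deriv (deriv E) (Real.log r₁) =
        CoulombGap.lap (CoulombGap.radial q) r₂ / CoulombGap.lap (CoulombGap.radial q) r₁ *
          (r₂ / r₁) ^ 2 := by
      rw [hlap₁, hlap₂]; field_simp
    have hd : 0 < CoulombGap.lap (CoulombGap.radial q) r₂ /
        CoulombGap.lap (CoulombGap.radial q) r₁ := by
      rw [hlap₁, hlap₂]; positivity
    rw [wellShift, h1, Real.log_mul hd.ne' (by positivity), Real.log_pow, ← hL]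
    simp only [hμ, Real.exp_log hr1, Real.exp_log hr2]
    field_simp
    push_cast
    ring
  set κ := deriv (deriv E) (Real.log r₂) with hκ
  set T : ℕ → ℝ := fun n => (∑' k, fermiStep (Real.log r₂ - Real.log r₁)
    (n * (B / 2) + wellShift E μ (Real.log r₁) (Real.log r₂)) k) + n * (B / 2) - 1 / 2 with hTdef
  obtain ⟨CT, -, hCT⟩ := abs_tsum_fermiStep_add_le (sub_pos.2 W.lt)
    (wellShift E μ (Real.log r₁) (Real.log r₂))
  have hT : ∀ n, |T n| ≤ CT + 1 / 2 := fun n => by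
    have h1 := abs_sub (∑' k, fermiStep (Real.log r₂ - Real.log r₁)
      (n * (B / 2) + wellShift E μ (Real.log r₁) (Real.log r₂)) k + n * (B / 2)) (1 / 2)
    have h2 := hCT (n * (B / 2))
    rw [abs_of_pos (by norm_num : (0 : ℝ) < 1 / 2)] at h1
    exact h1.trans (by linarith)
  have hmain := edgeO_main W.sE₂ W.sμ₂ W.ρ0 hκ₂ W.deriv₂ hT
  rw [← hκ] at hmain
  obtain ⟨η, hη, -, C, -, hsum⟩ := W.sum_asymptotics
  have hu := edgeShift_edgeO κ
  have hclose : ∀ᶠ p in edgeFilter,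
      |edgePoint (deriv (deriv E)) (Real.log r₂) p - Real.log r₂| ≤ η := by
    filter_upwards [eventually_abs_le_edge hη (log_one_add_edgeO_one hu)] with p hp
    simpa [edgePoint] using hp
  have hsumO : EdgeO 0 0 fun p => (∑ j ∈ Finset.range p.1, (∫ x, laplaceIntegrand E μ p.1
      (j + 1 - p.1 * (B / 2)) (edgePoint (deriv (deriv E)) (Real.log r₂) p) x)⁻¹) -
      gapMain E μ (Real.log r₁) (Real.log r₂) (B / 2) p.1
        (edgePoint (deriv (deriv E)) (Real.log r₂) p) := by
    refine EdgeO.of_bounded (C := C) ?_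
    filter_upwards [eventually_edgeFilter_of_atTop hsum, hclose] with p h1 h2
    exact h1 _ h2
  have hv0 : EdgeO 0 0 fun p => ((1 + edgeShift κ p) ^ 2)⁻¹ :=
    ((edgeO_one_add_inv_sq_one hu).trade.add (EdgeO.const 1)).congr
      (Eventually.of_forall fun p => by simp only; ring)
  -- The `O(1)` error of the summation and the `O(log⁴ n)` error of the edge expansion, both divided
  -- by `2 |z|² = 2 r₂² (1 + u)²`.
  have htotal := (((hsumO.mul hv0).mono (i' := 4) (j' := 0) (by norm_num) le_rfl).add
    hmain).const_mul (1 / (2 * r₂ ^ 2))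
  obtain ⟨C', hC'⟩ := Asymptotics.IsBigO.bound htotal
  have hupos : ∀ᶠ p in edgeFilter, 0 < 1 + edgeShift κ p := by
    filter_upwards [eventually_abs_le_edge (by norm_num : (0 : ℝ) < 1 / 2) hu] with p hp
    linarith [neg_abs_le (edgeShift κ p)]
  obtain ⟨n₀, hn₀⟩ := eventually_edgeFilter_iff.1 ((hC'.and hupos).and eventually_edgeFilter_large)
  refine ⟨C', n₀, fun n hn t ht => ?_⟩
  obtain ⟨⟨hbound, hpos1⟩, hnpos, hlog, -⟩ := hn₀ n hn t ht
  dsimp only at hbound hnpos hlog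
  have hS0 : 0 < √(n : ℝ) := Real.sqrt_pos.2 hnpos
  have hK0 : 0 < √κ := Real.sqrt_pos.2 hκ₂
  have hx₀ : Real.exp (edgePoint (deriv (deriv E)) (Real.log r₂) (n, t)) =
      r₂ * (1 + edgeShift κ (n, t)) := by
    rw [edgePoint, Real.exp_add, Real.exp_log hr2, Real.exp_log hpos1]
  have hmod : r₂ + t / √(2 * n * CoulombGap.lap (CoulombGap.radial q) r₂) =
      r₂ * (1 + edgeShift κ (n, t)) := by
    have h1 : 2 * n * CoulombGap.lap (CoulombGap.radial q) r₂ = n * κ / (2 * r₂ ^ 2) := by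
      rw [hlap₂]; field_simp; ring
    rw [h1, Real.sqrt_div (by positivity), Real.sqrt_mul hnpos.le,
      Real.sqrt_mul (by norm_num : (0 : ℝ) ≤ 2), Real.sqrt_sq hr2.le,
      edgeShift, Real.sqrt_mul hnpos.le]
    field_simp
  have hnorm : ‖Complex.exp (α * Complex.I) *
      ((r₂ + t / √(2 * n * CoulombGap.lap (CoulombGap.radial q) r₂) : ℝ) : ℂ)‖ =
      Real.exp (edgePoint (deriv (deriv E)) (Real.log r₂) (n, t)) := by
    rw [norm_mul, Complex.norm_exp_ofReal_mul_I, one_mul, Complex.norm_real, hx₀, hmod,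
      Real.norm_of_nonneg (by positivity)]
  rw [onePoint_eq_sum q l s A B (by exact_mod_cast hnpos.ne') _ _ hnorm, ← hE, ← hμ]
  -- `thetaLogDeriv_eq` with `L = log (r₂ / r₁)` trades the Fermi sum for theta. The `n B / 2` in
  -- the theta argument cancels the drift of the Fermi sum, leaving the shift and the `-1 / 2` of
  -- the trapezoidal rule.
  have hTn : T n = -(1 / 2) - s * (l r₁ - l r₂) / (2 * Real.log (r₂ / r₁)) -
      Real.log (CoulombGap.lap (CoulombGap.radial q) r₂ / CoulombGap.lap (CoulombGap.radial q) r₁) /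
        (4 * Real.log (r₂ / r₁)) -
      CoulombGap.thetaLogDeriv (B / 2 * n + Real.log (CoulombGap.lap (CoulombGap.radial q) r₂ /
          CoulombGap.lap (CoulombGap.radial q) r₁) / (4 * Real.log (r₂ / r₁)) +
        s * (l r₁ - l r₂) / (2 * Real.log (r₂ / r₁))) (π / Real.log (r₂ / r₁)) /
        (2 * Real.log (r₂ / r₁)) := by
    rw [thetaLogDeriv_eq hL0]
    simp only [hTdef]
    rw [hshift, ← hL, mul_comm (n : ℝ) (B / 2), add_assoc]
    field_simp
    ring_nf
  have hsq2 : √2 ^ 2 = (2 : ℝ) := Real.sq_sqrt (by norm_num)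
  have hid := edge_main_identity (c := deriv (deriv (deriv E)) (Real.log r₂)) (t := t)
    (e := CoulombGap.erfc (-t)) hS0 hK0 hr2 (Real.exp_pos (-t ^ 2)) (Real.sqrt_pos.2 Real.pi_pos)
    (by positivity : 0 < √2) hsq2 hL0 hμ₂ hTn
  rw [Real.sq_sqrt hnpos.le, Real.sq_sqrt hκ₂.le, ← hlap₂, ← hlap₃] at hid
  have hsqrt : √(n * CoulombGap.lap (CoulombGap.radial q) r₂) = √(n : ℝ) * √κ / (2 * r₂) := by
    rw [hlap₂, ← mul_div_assoc, Real.sqrt_div (by positivity), Real.sqrt_mul hnpos.le,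
      show 4 * r₂ ^ 2 = (2 * r₂) ^ 2 by ring, Real.sqrt_sq (by positivity)]
  have hinv : (Real.exp (-t ^ 2))⁻¹ = Real.exp (t ^ 2) := by rw [← Real.exp_neg, neg_neg]
  rw [hsqrt, Real.sqrt_mul (by norm_num : (0 : ℝ) ≤ 2) π, ← hinv, ← hid]
  rw [pow_zero, mul_one, Real.norm_eq_abs, Real.norm_of_nonneg (by positivity)] at hbound
  refine le_trans (le_of_eq ?_) hbound
  congr 1
  have hw1 : -√2 * t / √2 = -t := by field_simp
  have hw2 : (-√2 * t) ^ 2 = 2 * t ^ 2 := by rw [neg_mul, neg_sq, mul_pow, hsq2]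
  have hw3 : -(2 * t ^ 2) / 2 = -t ^ 2 := by ring
  have hexp2 : Real.exp (2 * edgePoint (deriv (deriv E)) (Real.log r₂) (n, t)) =
      r₂ ^ 2 * (1 + edgeShift κ (n, t)) ^ 2 := by
    rw [two_mul, Real.exp_add, hx₀]; ring
  have hpi2 : √(2 * π) = √2 * √π := Real.sqrt_mul (by norm_num) π
  simp only [gapMain]
  rw [hexp2]
  have hdiv : ∀ x y : ℝ, x / (2 * (r₂ ^ 2 * y)) = 1 / (2 * r₂ ^ 2) * (x * y⁻¹) := fun x y => by
    rw [div_eq_mul_inv, mul_inv, mul_inv, one_div, mul_inv]; ring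
  have hu' : √2 / √κ * (t * (√(n : ℝ))⁻¹) = edgeShift κ (n, t) := (edgeShift_eq κ (n, t)).symm
  rw [hdiv, hu']
  simp only [hw1, hw2, hw3, hpi2, hTdef]
  ring
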